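/- Let $n\ge 0$ and write $T^*\mathbb R^n=\mathbb R^n\times(\mathbb R^n)^*$, with symplectic form $\omega_0[(q_1,p_1),(q_2,p_2)]=p_1[q_2]-p_2[q_1]$; identify $T^*\mathbb R^n\times T^*\mathbb R^n$ with $T^*\mathbb R^{2n}$. Let $H:[0,1]\times T^*\mathbb R^n\to\mathbb R$ be a smooth Hamiltonian with $D_{pp}H(t,q,p)>0$ everywhere and $H(t,q,p)/|p|\to+\infty$ as $|p|\to\infty$ for every $(t,q)$, and let $L(t,q,v)=\max_{p}(\langle p,v\rangle-H(t,q,p))$ be its Fenchel dual Lagrangian. Let $X_H$ be the vector field with $\omega_0(X_H(t,x),\zeta)=-D_xH(t,x)[\zeta]$ and let $\phi^H_t$ be its (possibly only locally defined) flow from time $0$ to time $t$. Let $Q\subset\mathbb R^n\times\mathbb R^n$ be a smooth submanifold without boundary. Let $\gamma:[0,1]\to\mathbb R^n$ be a $C^1$ curve which solves the Euler–Lagrange equation $$\frac{d}{dt}D_vL(t,\gamma,\gamma')=D_qL(t,\gamma,\gamma')$$ with the boundary conditions $(\gamma(0),\gamma(1))\in Q$ and $$D_vL(0,\gamma(0),\gamma'(0))[\xi_0]=D_vL(1,\gamma(1),\gamma'(1))[\xi_1]\qquad\forall(\xi_0,\xi_1)\in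 W:=T_{(\gamma(0),\gamma(1))}Q .$$ Let $x(t)=(\gamma(t),D_vL(t,\gamma(t),\gamma'(t)))$ be the corresponding orbit of $X_H$. On $W^{1,2}_W:=\{u\in W^{1,2}([0,1],\mathbb R^n): (u(0),u(1))\in W\}$ consider the second variation of the action, $$d^2\mathbb S_L(\gamma)[u,v]=\int_0^1\bigl(D_{vv}L[u',v']+D_{qv}L[u',v]+D_{vq}L[u,v']+D_{qq}L[u,v]\bigr)\,dt ,$$ with the derivatives of $L$ taken at $(t,\gamma(t),\gamma'(t))$. Let $i^Q(\gamma)$ be the maximal dimension of a subspace of $W^{1,2}_W$ on which $d^2\mathbb S_L(\gamma)$ is negative definite, and let $\nu^Q(\gamma)$ be the dimension of the kernel $\{u\in W^{1,2}_W: d^2\mathbb S_L(\gamma)[u,v]=0\ \forall v\in W^{1,2}_W\}$. Let $C(q,p)=(q,-p)$, let $$\lambda(t)=\operatorname{graph}\bigl(D\phi^H_t(x(0))\,C\bigr)\subset T^*\mathbb R^{2n},\qquad t\in[0,1],$$ and let $N^*W=\{(z,\zeta)\in\mathbb R^{2n}\times(\mathbb R^{2n})^*: z\in W,\ \zeta|_W=0\}$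 be the conormal space of $W$. Then $\lambda$ is a $C^1$ path of Lagrangian subspaces of $T^*\mathbb R^{2n}$, the numbers $i^Q(\gamma)$ and $\nu^Q(\gamma)$ are finite, and $$\nu^Q(\gamma)=\dim\lambda(1)\cap N^*W,$$ $$i^Q(\gamma)=\mu(\lambda,N^*W)+\tfrac12(\dim Q-n)-\tfrac12\nu^Q(\gamma).$$ Here $\mu$ is the Robbin–Salamon relative Maslov index. Explicitly, for a $C^1$ Lagrangian path $\lambda$ on $[0,1]$ and a Lagrangian subspace $\lambda_0$, the crossing form $\Gamma(\lambda,\lambda_0,t)$ is the quadratic form $\xi\mapsto\frac{d}{ds}\big|_{s=t}\omega_0(\xi,\eta(s))$ on $\lambda(t)\cap\lambda_0$, where $\eta(s)$ lies in a fixed Lagrangian complement of $\lambda(t)$ and $\xi+\eta(s)\in\lambda(s)$. If all crossing forms are non-degenerate, then $\mu(\lambda,\lambda_0)=\frac12\operatorname{sgn}\Gamma(\lambda,\lambda_0,0)+\sum_{0<t<1}\operatorname{sgn}\Gamma(\lambda,\lambda_0,t)+\frac12\operatorname{sgn}\Gamma(\lambda,\lambda_0,1)$. For a general continuous Lagrangian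 path, $\mu(\lambda,\lambda_0)$ is the index of any path with non-degenerate crossing forms that is homotopic to $\lambda$ with fixed end-points through Lagrangian paths. -/

import Mathlib

open Set Filter Topology MeasureTheory
open scoped ContDiff

noncomputable section

namespace ConormalIndex

section Symplectic

variable {V : Type*} [NormedAddCommGroup V] [NormedSpace ℝ V]

/-- The cotangent space `T*V = V × V*` of a finite-dimensional real vector space. -/
abbrev Cot (V : Type*) [NormedAddCommGroup V] [NormedSpace ℝ V] : Type _ := V × (V →L[ℝ] ℝ)

/-- The standard symplectic form `dp ∧ dq` on `T*V`. -/
def symp (ξ η : Cot V) : ℝ := ξ.2 η.1 - η.2 ξ.1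

/-- Lagrangian subspaces of `T*V`. -/
def IsLagrangian (Λ : Submodule ℝ (Cot V)) : Prop :=
  Module.finrank ℝ Λ = Module.finrank ℝ V ∧ ∀ ξ ∈ Λ, ∀ η ∈ Λ, symp ξ η = 0

/-- The conormal space `N*W = W × W^⊥` of a linear subspace `W` of `V`. -/
def conormal (W : Submodule ℝ V) : Submodule ℝ (Cot V) where
  carrier := {ξ | ξ.1 ∈ W ∧ ∀ u ∈ W, ξ.2 u = 0}
  add_mem' := by
    rintro ξ η ⟨h1, h2⟩ ⟨h3, h4⟩
    exact ⟨W.add_mem h1 h3, fun u hu => by simp [h2 u hu, h4 u hu]⟩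
  zero_mem' := ⟨W.zero_mem, fun u _ => by simp⟩
  smul_mem' := by
    rintro c ξ ⟨h1, h2⟩
    exact ⟨W.smul_mem c h1, fun u hu => by simp [h2 u hu]⟩

/-- A map `Λ` from a subset `s` of a normed space into the Lagrangian Grassmannian of `T*V` is of
class `C^k` (continuous for `k = 0`): near every point of `s` it is spanned by a frame of
class `C^k`. -/
def IsLagrangianFamilyOn {Y : Type*} [NormedAddCommGroup Y] [NormedSpace ℝ Y]
    (k : ℕ) (Λ : Y → Submodule ℝ (Cot V)) (s : Set Y) : Prop :=
  (∀ y ∈ s, IsLagrangian (Λ y)) ∧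
  ∀ y ∈ s, ∃ u ∈ 𝓝 y, ∃ F : Y → Fin (Module.finrank ℝ V) → Cot V,
    ContDiffOn ℝ k F (s ∩ u) ∧
    ∀ z ∈ s ∩ u, LinearIndependent ℝ (F z) ∧ Submodule.span ℝ (range (F z)) = Λ z

/-- `Γ` is the crossing form at time `t` of the path `Λ` on `[0,1]` with respect to `Λ₀`: for a
Lagrangian complement `ν` of `Λ t` and `ξ ∈ Λ t ∩ Λ₀`, if `η s ∈ ν` is such that
`ξ + η s ∈ Λ s` for `s` near `t`, then `Γ ξ` is the derivative of `ω(ξ, η s)` at `s = t`. -/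
def IsCrossingForm (Λ : ℝ → Submodule ℝ (Cot V)) (Λ₀ : Submodule ℝ (Cot V)) (t : ℝ)
    (Γ : QuadraticForm ℝ ↥(Λ t ⊓ Λ₀)) : Prop :=
  ∃ ν : Submodule ℝ (Cot V), IsLagrangian ν ∧ IsCompl (Λ t) ν ∧
    ∀ ξ : ↥(Λ t ⊓ Λ₀), ∃ η : ℝ → Cot V,
      (∀ᶠ s in 𝓝[Icc 0 1] t, η s ∈ ν ∧ (ξ : Cot V) + η s ∈ Λ s) ∧
      HasDerivWithinAt (fun s => symp (ξ : Cot V) (η s)) (Γ ξ) (Icc 0 1) t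

/-- The signature of a real quadratic form on a (finite-dimensional) subspace of `T*V`. -/
def sgn {U : Submodule ℝ (Cot V)} (Γ : QuadraticForm ℝ U) : ℤ :=
  (sigPos (R := ℝ) (M := U) Γ : ℤ) - (sigNeg (R := ℝ) (M := U) Γ : ℤ)

/-- Non-degeneracy of a real quadratic form on a subspace of `T*V`. -/
def IsNondeg {U : Submodule ℝ (Cot V)} (Γ : QuadraticForm ℝ U) : Prop :=
  ∀ ξ : U, (∀ ζ : U, QuadraticMap.polar Γ ξ ζ = 0) → ξ = 0

/-- `Λ` is a `C^1` Lagrangian path on `[0,1]` all of whose crossings with `Λ₀` are regular, and `m`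
is its relative Maslov index with respect to `Λ₀`, computed by the crossing forms. (At a time
which is not a crossing the form lives on the zero space, is non-degenerate and has
signature `0`.) -/
def IsRegularMaslovIndex (Λ : ℝ → Submodule ℝ (Cot V)) (Λ₀ : Submodule ℝ (Cot V)) (m : ℝ) : Prop :=
  IsLagrangianFamilyOn 1 Λ (Icc (0 : ℝ) 1) ∧
  ∃ Γ : ∀ t : ℝ, QuadraticForm ℝ ↥(Λ t ⊓ Λ₀),
    (∀ t ∈ Icc (0 : ℝ) 1, IsCrossingForm Λ Λ₀ t (Γ t) ∧ IsNondeg (Γ t)) ∧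
    m = (sgn (Γ 0) : ℝ) / 2 + ∑ᶠ t ∈ Ioo (0 : ℝ) 1, (sgn (Γ t) : ℝ) + (sgn (Γ 1) : ℝ) / 2

/-- The Lagrangian paths `Λ` and `Λ'` on `[0,1]` are homotopic with fixed end-points. -/
def LagrangianHomotopic (Λ Λ' : ℝ → Submodule ℝ (Cot V)) : Prop :=
  ∃ h : ℝ × ℝ → Submodule ℝ (Cot V),
    IsLagrangianFamilyOn 0 h (Icc (0 : ℝ) 1 ×ˢ Icc (0 : ℝ) 1) ∧
    (∀ t ∈ Icc (0 : ℝ) 1, h (0, t) = Λ t ∧ h (1, t) = Λ' t) ∧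
    ∀ s ∈ Icc (0 : ℝ) 1, h (s, 0) = Λ 0 ∧ h (s, 1) = Λ 1

/-- `m` is the relative Maslov index of the continuous Lagrangian path `Λ` on `[0,1]` with respect
to the constant `Λ₀`, in the sense of Robbin and Salamon: it is the index of a path with regular
crossings which is homotopic to `Λ` with fixed end-points. -/
def IsMaslovIndex (Λ : ℝ → Submodule ℝ (Cot V)) (Λ₀ : Submodule ℝ (Cot V)) (m : ℝ) : Prop :=
  ∃ Λ' : ℝ → Submodule ℝ (Cot V), LagrangianHomotopic Λ Λ' ∧ IsRegularMaslovIndex Λ' Λ₀ m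

open Classical in
/-- The Robbin–Salamon relative Maslov index `μ(Λ, Λ₀)`. -/
def maslovIndex (Λ : ℝ → Submodule ℝ (Cot V)) (Λ₀ : Submodule ℝ (Cot V)) : ℝ :=
  if h : ∃ m, IsMaslovIndex Λ Λ₀ m then h.choose else 0

/-- The anti-symplectic involution `C(q,p) = (q,-p)`. -/
def involC (V : Type*) [NormedAddCommGroup V] [NormedSpace ℝ V] : Cot V →ₗ[ℝ] Cot V :=
  LinearMap.prodMap LinearMap.id (-LinearMap.id)

/-- The identification `T*V × T*V = T*(V × V)`. -/
def cotProd (V : Type*) [NormedAddCommGroup V] [NormedSpace ℝ V] :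
    (Cot V × Cot V) →ₗ[ℝ] Cot (V × V) where
  toFun z := ((z.1.1, z.2.1), z.1.2.coprod z.2.2)
  map_add' z w := by
    ext <;> simp
  map_smul' c z := by
    ext <;> simp

/-- The graph of a linear endomorphism of `T*V`, as a subspace of `T*(V × V)`. -/
def graphCot (A : Cot V →ₗ[ℝ] Cot V) : Submodule ℝ (Cot (V × V)) :=
  A.graph.map (cotProd V)

end Symplectic

section Submanifold

variable {X : Type*} [NormedAddCommGroup X] [NormedSpace ℝ X]

/-- `Q` is a smooth (embedded, boundaryless) `d`-dimensional submanifold of the vector space `X`. -/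
def IsSubmanifold (d : ℕ) (Q : Set X) : Prop :=
  ∀ z ∈ Q, ∃ Φ : OpenPartialHomeomorph X X, ∃ S : Submodule ℝ X,
    z ∈ Φ.source ∧ ContDiffOn ℝ ∞ Φ Φ.source ∧ ContDiffOn ℝ ∞ Φ.symm Φ.target ∧
    Module.finrank ℝ S = d ∧ Φ '' (Q ∩ Φ.source) = (S : Set X) ∩ Φ.target

/-- The tangent space `T_z Q`: velocities at `z` of smooth curves in `Q`. (For a submanifold these
velocities already form a linear subspace.) -/
def tangentAt (Q : Set X) (z : X) : Submodule ℝ X :=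
  Submodule.span ℝ {v | ∃ c : ℝ → X, ContDiffAt ℝ ∞ c 0 ∧ c 0 = z ∧ (∀ᶠ s in 𝓝 0, c s ∈ Q) ∧
    HasDerivAt c v 0}

end Submanifold

/-- The space `ℝ^n`. -/
abbrev E (n : ℕ) : Type := EuclideanSpace ℝ (Fin n)

section Dynamics

variable {n : ℕ}

/-- `H` is a smooth Tonelli Hamiltonian on `[0,1] × T*ℝ^n`: fibrewise `C^2`-strictly convex and
superlinear. -/
structure IsTonelli (H : ℝ → Cot (E n) → ℝ) : Prop where
  smooth : ContDiffOn ℝ ∞ (fun z : ℝ × Cot (E n) => H z.1 z.2) (Icc (0 : ℝ) 1 ×ˢ univ)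
  convex : ∀ t ∈ Icc (0 : ℝ) 1, ∀ (q : E n) (p η : E n →L[ℝ] ℝ), η ≠ 0 →
    0 < fderiv ℝ (fderiv ℝ fun p' : E n →L[ℝ] ℝ => H t (q, p')) p η η
  superlinear : ∀ t ∈ Icc (0 : ℝ) 1, ∀ q : E n,
    Tendsto (fun p : E n →L[ℝ] ℝ => H t (q, p) / ‖p‖) (Bornology.cobounded _) atTop

/-- `x` is an orbit on `[0,T]` of the Hamiltonian vector field `X_H`, where
`ω(X_H(t,x), ζ) = -D_x H(t,x)[ζ]` for all `ζ`. -/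
def IsHamiltonianOrbit (H : ℝ → Cot (E n) → ℝ) (T : ℝ) (x : ℝ → Cot (E n)) : Prop :=
  ∀ t ∈ Icc (0 : ℝ) T, ∃ X : Cot (E n), (∀ ζ, symp X ζ = -(fderiv ℝ (H t) (x t) ζ)) ∧
    HasDerivWithinAt x X (Icc (0 : ℝ) T) t

open Classical in
/-- The Hamiltonian flow `φ_t^H(y)`: the value at time `t` of the orbit on `[0,t]` starting from `y`
(with the value `0` if that orbit does not exist up to time `t`). -/
def hamFlow (H : ℝ → Cot (E n) → ℝ) (t : ℝ) (y : Cot (E n)) : Cot (E n) :=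
  if h : ∃ x, IsHamiltonianOrbit H t x ∧ x 0 = y then h.choose t else 0

/-- The Fenchel dual Lagrangian `L(t,q,v) = max_p (⟨p,v⟩ - H(t,q,p))` on `Tℝ^n = ℝ^n × ℝ^n`. -/
def lagr (H : ℝ → Cot (E n) → ℝ) (t : ℝ) (z : E n × E n) : ℝ :=
  ⨆ p : E n →L[ℝ] ℝ, (p z.2 - H t (z.1, p))

/-- The partial derivative `D_q L(t,q,v)`. -/
def lagrQ (H : ℝ → Cot (E n) → ℝ) (t : ℝ) (q v : E n) : E n →L[ℝ] ℝ :=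
  fderiv ℝ (fun q' => lagr H t (q', v)) q

/-- The partial derivative `D_v L(t,q,v)`. -/
def lagrV (H : ℝ → Cot (E n) → ℝ) (t : ℝ) (q v : E n) : E n →L[ℝ] ℝ :=
  fderiv ℝ (fun v' => lagr H t (q, v')) v

/-- The velocity `γ'` of a curve on `[0,1]`. -/
def vel (γ : ℝ → E n) (t : ℝ) : E n := derivWithin γ (Icc (0 : ℝ) 1) t

/-- `γ` solves on `[0,1]` the Euler–Lagrange equation with the non-local boundary conditions given
by `Q`. -/
structure IsExtremal (H : ℝ → Cot (E n) → ℝ) (Q : Set (E n × E n)) (γ : ℝ → E n) : Prop where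
  contDiff : ContDiffOn ℝ 1 γ (Icc (0 : ℝ) 1)
  euler : ∀ t ∈ Icc (0 : ℝ) 1,
    HasDerivWithinAt (fun s => lagrV H s (γ s) (vel γ s)) (lagrQ H t (γ t) (vel γ t)) (Icc 0 1) t
  mem : (γ 0, γ 1) ∈ Q
  natural : ∀ ξ ∈ tangentAt Q (γ 0, γ 1),
    lagrV H 0 (γ 0) (vel γ 0) ξ.1 = lagrV H 1 (γ 1) (vel γ 1) ξ.2

/-- The Hamiltonian orbit `x(t) = (γ(t), D_v L(t, γ(t), γ'(t)))` corresponding to `γ`. -/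
def hamOrbit (H : ℝ → Cot (E n) → ℝ) (γ : ℝ → E n) (t : ℝ) : Cot (E n) :=
  (γ t, lagrV H t (γ t) (vel γ t))

/-- The path `λ(t) = graph (Dφ_t^H(x(0)) C)` of subspaces of `T*(ℝ^n × ℝ^n)`. -/
def lamPath (H : ℝ → Cot (E n) → ℝ) (γ : ℝ → E n) (t : ℝ) : Submodule ℝ (Cot (E n × E n)) :=
  graphCot ((fderiv ℝ (hamFlow H t) (hamOrbit H γ 0) : Cot (E n) →ₗ[ℝ] Cot (E n)) ∘ₗ involC (E n))

end Dynamics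

section Variation

/-- The Sobolev space `W^{1,2}([0,1],ℝ^n)`: the primitives on `[0,1]` of square-integrable maps. -/
def W12 (n : ℕ) : Submodule ℝ (Icc (0 : ℝ) 1 → E n) where
  carrier := {u | ∃ g : ℝ → E n, MemLp g 2 (volume.restrict (Icc (0 : ℝ) 1)) ∧
    ∀ t : Icc (0 : ℝ) 1, u t = u 0 + ∫ s in (0 : ℝ)..t, g s}
  add_mem' := by
    rintro u v ⟨g, hg, hu⟩ ⟨k, hk, hv⟩
    refine ⟨g + k, hg.add hk, fun t => ?_⟩
    have hi : ∀ f : ℝ → E n, MemLp f 2 (volume.restrict (Icc (0 : ℝ) 1)) →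
        IntervalIntegrable f volume 0 (t : ℝ) := fun f hf => by
      rw [intervalIntegrable_iff_integrableOn_Icc_of_le t.2.1]
      exact IntegrableOn.mono_set (hf.integrable (by norm_num)) (Icc_subset_Icc_right t.2.2)
    simp only [Pi.add_apply]
    rw [intervalIntegral.integral_add (hi g hg) (hi k hk), hu t, hv t]
    abel
  zero_mem' := ⟨0, MemLp.zero, fun t => by simp⟩
  smul_mem' := by
    rintro c u ⟨g, hg, hu⟩
    refine ⟨c • g, hg.const_smul c, fun t => ?_⟩
    simp only [Pi.smul_apply]
    rw [intervalIntegral.integral_smul, hu t, smul_add]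

variable {n : ℕ}

/-- The value `u(t)`, `t ∈ [0,1]`. -/
def w12Val (u : W12 n) (t : ℝ) : E n := IccExtend zero_le_one (u : Icc (0 : ℝ) 1 → E n) t

/-- The weak derivative `u'` (unique up to a null set). -/
def w12Deriv (u : W12 n) : ℝ → E n := u.2.choose

/-- The space `W^{1,2}_W([0,1],ℝ^n)` of those `u` with `(u(0),u(1)) ∈ W`. -/
def W12W (W : Submodule ℝ (E n × E n)) : Submodule ℝ (W12 n) where
  carrier := {u | ((u : Icc (0 : ℝ) 1 → E n) 0, (u : Icc (0 : ℝ) 1 → E n) 1) ∈ W}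
  add_mem' := fun hu hv => W.add_mem hu hv
  zero_mem' := W.zero_mem
  smul_mem' := fun c _ hu => W.smul_mem c hu

/-- The second variation `d²S_L(γ)[u,v]`, the integral of the full second derivative in `(q,v)` of
`L(t,·)` at `(γ(t),γ'(t))`, evaluated on `(u,u')` and `(v,v')`. -/
def secondVar (H : ℝ → Cot (E n) → ℝ) (γ : ℝ → E n) (u v : W12 n) : ℝ :=
  ∫ t in (0 : ℝ)..1, fderiv ℝ (fderiv ℝ (lagr H t)) (γ t, vel γ t)
    (w12Val u t, w12Deriv u t) (w12Val v t, w12Deriv v t)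

/-- The Morse index: the maximal dimension of a subspace of `W^{1,2}_W`, `W = T_{(γ(0),γ(1))} Q`, on
which the second variation is negative definite. -/
def morseIndex (H : ℝ → Cot (E n) → ℝ) (Q : Set (E n × E n)) (γ : ℝ → E n) : ℕ∞ :=
  ⨆ (S : Submodule ℝ (W12 n)) (_ : S ≤ W12W (tangentAt Q (γ 0, γ 1)) ∧
    ∀ u ∈ S, u ≠ 0 → secondVar H γ u u < 0), Cardinal.toENat (Module.rank ℝ S)

/-- The nullity: the dimension of the kernel of the second variation on `W^{1,2}_W`. (The kernel is
a linear subspace as soon as the second variation is bilinear, so the span adds nothing.) -/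
def nullity (H : ℝ → Cot (E n) → ℝ) (Q : Set (E n × E n)) (γ : ℝ → E n) : ℕ∞ :=
  Cardinal.toENat (Module.rank ℝ (Submodule.span ℝ
    {u : W12 n | u ∈ W12W (tangentAt Q (γ 0, γ 1)) ∧
      ∀ v ∈ W12W (tangentAt Q (γ 0, γ 1)), secondVar H γ u v = 0}))

end Variation

end ConormalIndex

end

noncomputable section

set_option linter.unusedSectionVars false

namespace ConormalIndex

section Signature

variable {M : Type*} [AddCommGroup M] [Module ℝ M]

/-- The signature of a real quadratic form. -/
def signature (Q : QuadraticForm ℝ M) : ℤ := (sigPos Q : ℤ) - (sigNeg Q : ℤ)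

theorem signature_congr {M' : Type*} [AddCommGroup M'] [Module ℝ M'] {Q : QuadraticForm ℝ M}
    {Q' : QuadraticForm ℝ M'} (e : M ≃ₗ[ℝ] M') (h : ∀ x, Q' (e x) = Q x) :
    signature Q = signature Q' := by
  have he : QuadraticMap.Equivalent Q Q' := ⟨⟨e, h⟩⟩
  rw [signature, signature, he.sigPos_eq, he.sigNeg_eq]

theorem two_mul_quadratic_eq_sum {κ : Type*} [Fintype κ] (b : Module.Basis κ ℝ M)
    (Q : QuadraticForm ℝ M) (x : κ → ℝ) :
    2 * Q (∑ j, x j • b j) = ∑ j, ∑ l, x j * x l * QuadraticMap.polar Q (b j) (b l) := by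
  have h : Q.polarBilin (∑ j, x j • b j) (∑ j, x j • b j) = 2 * Q (∑ j, x j • b j) := by
    rw [QuadraticMap.polarBilin_apply_apply, QuadraticMap.polar_self]
    simp
  rw [← h, LinearMap.map_sum₂]
  refine Finset.sum_congr rfl fun j _ => ?_
  rw [map_sum]
  refine Finset.sum_congr rfl fun l _ => ?_
  simp only [map_smul, LinearMap.smul_apply, smul_eq_mul, QuadraticMap.polarBilin_apply_apply]
  ring

theorem tendsto_polar {ι : Type*} {l : Filter ι} {Q : ι → QuadraticForm ℝ M}
    {Q₀ : QuadraticForm ℝ M} (h : ∀ x, Tendsto (fun i => Q i x) l (𝓝 (Q₀ x))) (x y : M) :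
    Tendsto (fun i => QuadraticMap.polar (Q i) x y) l (𝓝 (QuadraticMap.polar Q₀ x y)) :=
  ((h (x + y)).sub (h x)).sub (h y)

/-- Positive definiteness is an open condition on a finite-dimensional space. -/
theorem eventually_posDef [FiniteDimensional ℝ M] {ι : Type*} {l : Filter ι}
    {Q : ι → QuadraticForm ℝ M} {Q₀ : QuadraticForm ℝ M}
    (h : ∀ x, Tendsto (fun i => Q i x) l (𝓝 (Q₀ x))) (h₀ : Q₀.PosDef) :
    ∀ᶠ i in l, (Q i).PosDef := by
  set b := Module.finBasis ℝ M with hb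
  set k := Module.finrank ℝ M
  let N : ι → ℝ := fun i => ∑ j : Fin k, ∑ m : Fin k,
    |QuadraticMap.polar (Q i) (b j) (b m) - QuadraticMap.polar Q₀ (b j) (b m)|
  have hN : Tendsto N l (𝓝 0) := by
    have : Tendsto N l (𝓝 (∑ j : Fin k, ∑ m : Fin k,
        |QuadraticMap.polar Q₀ (b j) (b m) - QuadraticMap.polar Q₀ (b j) (b m)|)) :=
      tendsto_finsetSum _ fun j _ => tendsto_finsetSum _ fun m _ =>
        ((tendsto_polar h _ _).sub_const _).abs
    simpa using this
  have hcont : Continuous fun x : Fin k → ℝ => 2 * Q₀ (∑ j, x j • b j) := by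
    simp only [two_mul_quadratic_eq_sum]
    fun_prop
  have hne : ∀ x : Fin k → ℝ, x ≠ 0 → ∑ j, x j • b j ≠ 0 := by
    intro x hx h0
    exact hx (funext fun j => Fintype.linearIndependent_iff.1 b.linearIndependent x h0 j)
  obtain ⟨c, hc, hcx⟩ : ∃ c > 0, ∀ x : Fin k → ℝ, ‖x‖ = 1 → c ≤ 2 * Q₀ (∑ j, x j • b j) := by
    rcases (Metric.sphere (0 : Fin k → ℝ) 1).eq_empty_or_nonempty with he | hne'
    · refine ⟨1, one_pos, fun x hx => ?_⟩
      have : x ∈ Metric.sphere (0 : Fin k → ℝ) 1 := by simpa using hx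
      simp [he] at this
    · obtain ⟨x₀, hx₀, hmin⟩ := (isCompact_sphere (0 : Fin k → ℝ) 1).exists_isMinOn hne'
        hcont.continuousOn
      have hx₀' : x₀ ≠ 0 := by
        rintro rfl
        simp at hx₀
      exact ⟨_, mul_pos two_pos (h₀ _ (hne _ hx₀')), fun x hx => hmin (by simpa using hx)⟩
  filter_upwards [hN.eventually (gt_mem_nhds hc)] with i hi
  intro y hy
  obtain ⟨x, rfl⟩ : ∃ x : Fin k → ℝ, y = ∑ j, x j • b j := ⟨b.repr y, (b.sum_repr y).symm⟩
  have hx : x ≠ 0 := by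
    rintro rfl
    simp at hy
  have hxn : 0 < ‖x‖ := norm_pos_iff.2 hx
  have h1 : c * ‖x‖ ^ 2 ≤ 2 * Q₀ (∑ j, x j • b j) := by
    have h2 := hcx (‖x‖⁻¹ • x) (by rw [norm_smul, norm_inv, norm_norm, inv_mul_cancel₀ hxn.ne'])
    have h3 : ∑ j, (‖x‖⁻¹ • x) j • b j = ‖x‖⁻¹ • ∑ j, x j • b j := by
      simp [Finset.smul_sum, smul_smul]
    rw [h3, QuadraticMap.map_smul, smul_eq_mul] at h2
    have h4 : 2 * (‖x‖⁻¹ * ‖x‖⁻¹ * Q₀ (∑ j, x j • b j)) * ‖x‖ ^ 2 = 2 * Q₀ (∑ j, x j • b j) := by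
      field_simp
    rw [← h4]
    gcongr
  have h2 : |2 * Q i (∑ j, x j • b j) - 2 * Q₀ (∑ j, x j • b j)| ≤ N i * ‖x‖ ^ 2 := by
    rw [two_mul_quadratic_eq_sum, two_mul_quadratic_eq_sum, ← Finset.sum_sub_distrib,
      Finset.sum_mul]
    refine (Finset.abs_sum_le_sum_abs _ _).trans (Finset.sum_le_sum fun j _ => ?_)
    rw [← Finset.sum_sub_distrib, Finset.sum_mul]
    refine (Finset.abs_sum_le_sum_abs _ _).trans (Finset.sum_le_sum fun m _ => ?_)
    rw [← mul_sub, abs_mul, mul_comm, abs_mul, sq]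
    have h5 := norm_le_pi_norm x j
    have h6 := norm_le_pi_norm x m
    rw [Real.norm_eq_abs] at h5 h6
    gcongr
  have h3 : N i * ‖x‖ ^ 2 < c * ‖x‖ ^ 2 := by gcongr
  have := (abs_le.1 h2).1
  linarith

theorem finrank_le_sigPos_of_comp [FiniteDimensional ℝ M] {Z : Type*} [AddCommGroup Z]
    [Module ℝ Z] (Q : QuadraticForm ℝ M) (f : Z →ₗ[ℝ] M) (h : (Q.comp f).PosDef) :
    Module.finrank ℝ Z ≤ sigPos Q := by
  have hf : Function.Injective f := by
    rw [injective_iff_map_eq_zero]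
    intro z hz
    by_contra hne
    have := h z hne
    simp [hz] at this
  rw [← LinearMap.finrank_range_of_inj hf]
  refine le_sigPos_of_posDef Q ?_
  rintro ⟨_, z, rfl⟩ hz
  refine h z ?_
  rintro rfl
  exact hz (by simp)

/-- Lower semicontinuity of the positive index of inertia. -/
theorem eventually_sigPos_le [FiniteDimensional ℝ M] {ι : Type*} {l : Filter ι}
    {Q : ι → QuadraticForm ℝ M} {Q₀ : QuadraticForm ℝ M}
    (h : ∀ x, Tendsto (fun i => Q i x) l (𝓝 (Q₀ x))) : ∀ᶠ i in l, sigPos Q₀ ≤ sigPos (Q i) := by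
  obtain ⟨V, hV, hpos⟩ := exists_finrank_eq_sigPos_and_posDef Q₀
  filter_upwards [eventually_posDef (Q := fun i => (Q i).restrict V) (Q₀ := Q₀.restrict V) (fun x => h x) hpos] with i hi
  rw [← hV]
  exact le_sigPos_of_posDef _ hi

theorem eventually_sigNeg_le [FiniteDimensional ℝ M] {ι : Type*} {l : Filter ι}
    {Q : ι → QuadraticForm ℝ M} {Q₀ : QuadraticForm ℝ M}
    (h : ∀ x, Tendsto (fun i => Q i x) l (𝓝 (Q₀ x))) : ∀ᶠ i in l, sigNeg Q₀ ≤ sigNeg (Q i) := by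
  simpa using eventually_sigPos_le (Q := fun i => -Q i) (Q₀ := -Q₀) fun x => (h x).neg

theorem mem_radical_iff_polar (Q : QuadraticForm ℝ M) (x : M) :
    x ∈ Q.radical ↔ ∀ y, QuadraticMap.polar Q x y = 0 := by
  rw [QuadraticMap.radical_eq_ker_polarBilin, LinearMap.mem_ker, LinearMap.ext_iff]
  rfl

theorem radical_neg (Q : QuadraticForm ℝ M) : (-Q).radical = Q.radical := by
  ext x
  simp [mem_radical_iff_polar, QuadraticMap.polar_neg]

theorem radical_eq_bot_iff_polar (Q : QuadraticForm ℝ M) :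
    Q.radical = ⊥ ↔ ∀ x, (∀ y, QuadraticMap.polar Q x y = 0) → x = 0 := by
  rw [Submodule.eq_bot_iff]
  simp only [mem_radical_iff_polar]

/-- Near a nondegenerate form the signature is constant and the forms are nondegenerate. -/
theorem eventually_signature_eq [FiniteDimensional ℝ M] {ι : Type*} {l : Filter ι}
    {Q : ι → QuadraticForm ℝ M} {Q₀ : QuadraticForm ℝ M}
    (h : ∀ x, Tendsto (fun i => Q i x) l (𝓝 (Q₀ x))) (h₀ : Q₀.radical = ⊥) :
    ∀ᶠ i in l, signature (Q i) = signature Q₀ ∧ (Q i).radical = ⊥ := by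
  filter_upwards [eventually_sigPos_le h, eventually_sigNeg_le h] with i h1 h2
  have h3 := QuadraticForm.sigPos_add_sigNeg_add_radical (Q := Q₀)
  have h4 := QuadraticForm.sigPos_add_sigNeg_add_radical (Q := Q i)
  rw [h₀, finrank_bot] at h3
  refine ⟨by unfold signature; omega, ?_⟩
  rw [← Submodule.finrank_eq_zero (R := ℝ)]
  omega

theorem exists_nonpos_subspace [FiniteDimensional ℝ M] (Q : QuadraticForm ℝ M) :
    ∃ V : Submodule ℝ M, Module.finrank ℝ V = sigNeg Q + Module.finrank ℝ Q.radical ∧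
      ∀ x ∈ V, Q x ≤ 0 := by
  obtain ⟨V, hV, hneg⟩ := exists_finrank_eq_sigNeg_and_negDef Q
  have hV' : ∀ x ∈ V, x ≠ 0 → Q x < 0 := by
    intro x hx hx0
    have := hneg ⟨x, hx⟩ (by simpa using hx0)
    simpa using this
  have hdisj : Disjoint V Q.radical := by
    rw [Submodule.disjoint_def]
    intro x hx hr
    by_contra hx0
    have h1 := hV' x hx hx0
    have h2 := (mem_radical_iff_polar Q x).1 hr x
    rw [QuadraticMap.polar_self] at h2
    simp at h2
    linarith
  refine ⟨V ⊔ Q.radical, ?_, ?_⟩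
  · have := Submodule.finrank_sup_add_finrank_inf_eq V Q.radical
    rw [hdisj.eq_bot, finrank_bot] at this
    omega
  · intro x hx
    obtain ⟨v, hv, r, hr, rfl⟩ := Submodule.mem_sup.1 hx
    have h2 := (mem_radical_iff_polar Q r).1 hr
    have h3 := h2 r
    rw [QuadraticMap.polar_self] at h3
    have h4 := h2 v
    rw [QuadraticMap.polar_comm, QuadraticMap.polar] at h4
    simp at h3
    rcases eq_or_ne v 0 with rfl | hv0
    · simp [h3]
    · have := hV' v hv hv0
      linarith

section Split

variable {Z Y Y' : Type*} [AddCommGroup Z] [Module ℝ Z] [AddCommGroup Y] [Module ℝ Y]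
  [AddCommGroup Y'] [Module ℝ Y'] [FiniteDimensional ℝ Z]

theorem sigPos_comp_bound (Q : QuadraticForm ℝ Z) (i : Y →ₗ[ℝ] Z) (j : Y' →ₗ[ℝ] Z)
    (hi : Function.Injective i) (hj : Function.Injective j)
    (horth : ∀ y y', QuadraticMap.polar Q (i y) (j y') = 0) :
    sigPos Q + (sigNeg (Q.comp i) + Module.finrank ℝ (Q.comp i).radical + sigNeg (Q.comp j)) ≤
      Module.finrank ℝ Z := by
  have := FiniteDimensional.of_injective i hi
  have := FiniteDimensional.of_injective j hj
  obtain ⟨V, hV, hVn⟩ := exists_nonpos_subspace (Q.comp i)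
  obtain ⟨V', hV', hVn'⟩ := exists_finrank_eq_sigNeg_and_negDef (Q.comp j)
  have hneg : ∀ x ∈ V', x ≠ 0 → Q (j x) < 0 := by
    intro x hx hx0
    have := hVn' ⟨x, hx⟩ (by simpa using hx0)
    simpa using this
  have hdisj : Disjoint (V.map i) (V'.map j) := by
    rw [Submodule.disjoint_def]
    rintro x ⟨y, hy, rfl⟩ ⟨y', hy', hyy⟩
    by_contra h0
    have hy0 : y' ≠ 0 := by
      rintro rfl
      exact h0 (by rw [← hyy, map_zero])
    have h1 := hneg y' hy' hy0
    have h2 := horth y y'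
    rw [← hyy, QuadraticMap.polar_self] at h2
    simp at h2
    linarith
  have h1 : ∀ x ∈ V.map i ⊔ V'.map j, Q x ≤ 0 := by
    intro x hx
    obtain ⟨_, ⟨y, hy, rfl⟩, _, ⟨y', hy', rfl⟩, rfl⟩ := Submodule.mem_sup.1 hx
    have h2 := horth y y'
    have h3 := hVn y hy
    rw [QuadraticMap.polar] at h2
    rw [QuadraticMap.comp_apply] at h3
    rcases eq_or_ne y' 0 with rfl | h0
    · simpa using h3
    · have := hneg y' hy' h0
      linarith
  have h2 := QuadraticForm.sigPos_add_finrank_le_of_nonpos h1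
  have h3 := Submodule.finrank_sup_add_finrank_inf_eq (V.map i) (V'.map j)
  rw [hdisj.eq_bot, finrank_bot, (Submodule.equivMapOfInjective i hi V).symm.finrank_eq,
    (Submodule.equivMapOfInjective j hj V').symm.finrank_eq] at h3
  omega

/-- The signature of a nondegenerate form is the sum of the signatures of its restrictions to two
orthogonal subspaces of complementary dimensions (which may intersect). -/
theorem signature_eq_add (Q : QuadraticForm ℝ Z) (hQ : Q.radical = ⊥) (i : Y →ₗ[ℝ] Z)
    (j : Y' →ₗ[ℝ] Z) (hi : Function.Injective i) (hj : Function.Injective j)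
    (hdim : Module.finrank ℝ Y + Module.finrank ℝ Y' = Module.finrank ℝ Z)
    (horth : ∀ y y', QuadraticMap.polar Q (i y) (j y') = 0) :
    signature Q = signature (Q.comp i) + signature (Q.comp j) := by
  have := FiniteDimensional.of_injective i hi
  have := FiniteDimensional.of_injective j hj
  have horth' : ∀ y' y, QuadraticMap.polar Q (j y') (i y) = 0 := fun y' y => by
    rw [QuadraticMap.polar_comm, horth]
  have hn : ∀ x y, QuadraticMap.polar Q x y = 0 → QuadraticMap.polar (-Q) x y = 0 := by
    intro x y h
    rw [FunLike.coe_neg, QuadraticMap.polar_neg, h, neg_zero]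
  have e1 := sigPos_comp_bound Q i j hi hj horth
  have e2 := sigPos_comp_bound Q j i hj hi horth'
  have e3 := sigPos_comp_bound (-Q) i j hi hj fun y y' => hn _ _ (horth y y')
  have e4 := sigPos_comp_bound (-Q) j i hj hi fun y y' => hn _ _ (horth' y y')
  have hci : (-Q).comp i = -(Q.comp i) := rfl
  have hcj : (-Q).comp j = -(Q.comp j) := rfl
  rw [hci, hcj, radical_neg, sigNeg_neg, sigNeg_neg, sigPos_neg] at e3 e4
  have t1 := QuadraticForm.sigPos_add_sigNeg_add_radical (Q := Q)
  have t2 := QuadraticForm.sigPos_add_sigNeg_add_radical (Q := Q.comp i)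
  have t3 := QuadraticForm.sigPos_add_sigNeg_add_radical (Q := Q.comp j)
  rw [hQ, finrank_bot] at t1
  unfold signature
  omega

end Split

section Jump

variable [FiniteDimensional ℝ M] {U : Type*} [AddCommGroup U] [Module ℝ U]

theorem eventually_sigPos_add_le {ι : Type*} {l : Filter ι} {Q : ι → QuadraticForm ℝ M}
    {Q₀ : QuadraticForm ℝ M} {τ : ι → ℝ} (hτ : Tendsto τ l (𝓝[>] 0)) {D : M → ℝ}
    (hD : ∀ x, Tendsto (fun i => (Q i x - Q₀ x) / τ i) l (𝓝 (D x)))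
    (j : U →ₗ[ℝ] M) (hjr : ∀ u x, QuadraticMap.polar Q₀ (j u) x = 0)
    [FiniteDimensional ℝ U] (Γ : QuadraticForm ℝ U) (hΓ : ∀ u, Γ u = D (j u)) :
    ∀ᶠ i in l, sigPos Q₀ + sigPos Γ ≤ sigPos (Q i) := by
  obtain ⟨P, hP, hPpos⟩ := exists_finrank_eq_sigPos_and_posDef Q₀
  obtain ⟨N, hN, hNpos⟩ := exists_finrank_eq_sigPos_and_posDef Γ
  have hτ0 : ∀ᶠ i in l, 0 < τ i := hτ.eventually self_mem_nhdsWithin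
  have hτ1 : Tendsto τ l (𝓝 0) := hτ.mono_right nhdsWithin_le_nhds
  have hQ : ∀ x, Tendsto (fun i => Q i x) l (𝓝 (Q₀ x)) := by
    intro x
    have h1 : Tendsto (fun i => Q₀ x + (Q i x - Q₀ x) / τ i * τ i) l (𝓝 (Q₀ x + D x * 0)) :=
      tendsto_const_nhds.add ((hD x).mul hτ1)
    rw [mul_zero, add_zero] at h1
    refine h1.congr' ?_
    filter_upwards [hτ0] with i hi
    field_simp
    ring
  have hj0 : ∀ u, Q₀ (j u) = 0 := fun u => by
    have := hjr u (j u)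
    rw [QuadraticMap.polar_self] at this
    simpa using this
  let f : ι → (P × N) →ₗ[ℝ] M := fun i =>
    P.subtype.coprod ((Real.sqrt (τ i))⁻¹ • (j ∘ₗ N.subtype))
  let R₀ : QuadraticForm ℝ (P × N) := (Q₀.restrict P).prod (Γ.restrict N)
  have hR₀ : R₀.PosDef := by
    rintro ⟨p, u⟩ hne
    have h1 : 0 ≤ Q₀.restrict P p := by
      rcases eq_or_ne p 0 with rfl | h
      · simp
      · exact (hPpos p h).le
    have h2 : 0 ≤ Γ.restrict N u := by
      rcases eq_or_ne u 0 with rfl | h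
      · simp
      · exact (hNpos u h).le
    change 0 < Q₀.restrict P p + Γ.restrict N u
    rcases eq_or_ne p 0 with rfl | h
    · have : u ≠ 0 := by
        rintro rfl
        exact hne rfl
      have := hNpos u this
      linarith
    · have := hPpos p h
      linarith
  have key : ∀ᶠ i in l, ((Q i).comp (f i)).PosDef := by
    refine eventually_posDef (Q₀ := R₀) ?_ hR₀
    rintro ⟨p, u⟩
    have h1 : Tendsto (fun i => Q i p + (Real.sqrt (τ i) *
        ((Q i (p + j u) - Q₀ (p + j u)) / τ i - (Q i p - Q₀ p) / τ i -
          (Q i (j u) - Q₀ (j u)) / τ i) + (Q i (j u) - Q₀ (j u)) / τ i)) l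
        (𝓝 (Q₀ p + (0 * (D (p + j u) - D p - D (j u)) + D (j u)))) := by
      have hs : Tendsto (fun i => Real.sqrt (τ i)) l (𝓝 0) := by
        have := (Real.continuous_sqrt.tendsto 0).comp hτ1
        rwa [Real.sqrt_zero] at this
      exact (hQ _).add ((hs.mul (((hD _).sub (hD _)).sub (hD _))).add (hD _))
    have h2 : R₀ (p, u) = Q₀ p + (0 * (D (p + j u) - D p - D (j u)) + D (j u)) := by
      rw [zero_mul, zero_add, ← hΓ]
      rfl
    rw [h2]
    refine h1.congr' ?_
    filter_upwards [hτ0] with i hi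
    have h3 : (Q i).comp (f i) (p, u) =
        Q i p + Q i ((Real.sqrt (τ i))⁻¹ • j u) +
          QuadraticMap.polar (Q i) p ((Real.sqrt (τ i))⁻¹ • j u) := by
      rw [QuadraticMap.comp_apply]
      have : f i (p, u) = p + (Real.sqrt (τ i))⁻¹ • j u := by simp [f]
      rw [this, QuadraticMap.polar]
      ring
    have h4 : Q₀ (p + j u) = Q₀ p := by
      have := hjr u p
      rw [QuadraticMap.polar_comm, QuadraticMap.polar, hj0] at this
      linarith
    rw [h3, QuadraticMap.polar_smul_right, QuadraticMap.map_smul, hj0, h4, QuadraticMap.polar]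
    have hs := Real.sqrt_pos.2 hi
    have hss := Real.mul_self_sqrt hi.le
    generalize hr : Real.sqrt (τ i) = r at *
    rw [← hss]
    simp only [smul_eq_mul]
    field_simp
    ring
  filter_upwards [key] with i hi
  have := finrank_le_sigPos_of_comp _ _ hi
  rw [Module.finrank_prod] at this
  omega

/-- Jump of the inertia indices at a degenerate form whose derivative is nondegenerate on the
radical. -/
theorem eventually_signature_jump {ι : Type*} {l : Filter ι} {Q : ι → QuadraticForm ℝ M}
    {Q₀ : QuadraticForm ℝ M} {τ : ι → ℝ} (hτ : Tendsto τ l (𝓝[>] 0)) {D : M → ℝ}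
    (hD : ∀ x, Tendsto (fun i => (Q i x - Q₀ x) / τ i) l (𝓝 (D x)))
    (j : U →ₗ[ℝ] M) (hj : Function.Injective j) (hjr : LinearMap.range j = Q₀.radical)
    (Γ : QuadraticForm ℝ U) (hΓ : ∀ u, Γ u = D (j u)) (hΓr : Γ.radical = ⊥) :
    ∀ᶠ i in l, signature (Q i) = signature Q₀ + signature Γ ∧ (Q i).radical = ⊥ := by
  have := FiniteDimensional.of_injective j hj
  have hjr' : ∀ u x, QuadraticMap.polar Q₀ (j u) x = 0 := fun u x =>
    (mem_radical_iff_polar Q₀ _).1 (hjr ▸ LinearMap.mem_range_self j u) x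
  have h1 := eventually_sigPos_add_le hτ hD j hjr' Γ hΓ
  have h2 := eventually_sigPos_add_le (Q := fun i => -Q i) (Q₀ := -Q₀) (D := fun x => -D x) hτ
    (fun x => by
      refine (hD x).neg.congr fun i => ?_
      simp only [neg_apply]
      ring) j (fun u x => by
      rw [FunLike.coe_neg, QuadraticMap.polar_neg, hjr', neg_zero]) (-Γ)
      (fun u => by rw [neg_apply, hΓ])
  filter_upwards [h1, h2] with i h1 h2
  have t1 := QuadraticForm.sigPos_add_sigNeg_add_radical (Q := Q₀)
  have t2 := QuadraticForm.sigPos_add_sigNeg_add_radical (Q := Q i)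
  have t3 := QuadraticForm.sigPos_add_sigNeg_add_radical (Q := Γ)
  rw [hΓr, finrank_bot] at t3
  rw [← hjr, LinearMap.finrank_range_of_inj hj] at t1
  simp only [sigPos_neg] at h2
  refine ⟨by unfold signature; omega, ?_⟩
  rw [← Submodule.finrank_eq_zero (R := ℝ)]
  omega

end Jump

end Signature

/-- A symplectic form on a finite-dimensional space which is compatible with some complex
structure. -/
structure IsSymplecticForm {X : Type*} [AddCommGroup X] [Module ℝ X]
    (Ω : LinearMap.BilinForm ℝ X) : Prop where
  alt : ∀ x, Ω x x = 0
  nondeg : ∀ x, (∀ y, Ω x y = 0) → x = 0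
  exists_complex : ∃ J : X →ₗ[ℝ] X, (∀ x y, Ω (J x) (J y) = Ω x y) ∧
    (∀ x y, Ω x (J y) = Ω y (J x)) ∧ ∀ x, x ≠ 0 → 0 < Ω x (J x)

/-- Lagrangian subspaces with respect to a bilinear form. -/
def IsLag {X : Type*} [AddCommGroup X] [Module ℝ X] (Ω : LinearMap.BilinForm ℝ X)
    (Λ : Submodule ℝ X) : Prop :=
  Module.finrank ℝ Λ + Module.finrank ℝ Λ = Module.finrank ℝ X ∧ ∀ ξ ∈ Λ, ∀ η ∈ Λ, Ω ξ η = 0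

section LagrangianAlgebra

variable {X : Type*} [NormedAddCommGroup X] [NormedSpace ℝ X] {Ω : LinearMap.BilinForm ℝ X}

theorem IsSymplecticForm.swap (hΩ : IsSymplecticForm Ω) (x y : X) : Ω x y = -Ω y x := by
  have h := hΩ.alt (x + y)
  rw [LinearMap.BilinForm.add_left, LinearMap.BilinForm.add_right, LinearMap.BilinForm.add_right,
    hΩ.alt, hΩ.alt] at h
  linarith

theorem IsSymplecticForm.ker_eq_bot (hΩ : IsSymplecticForm Ω) : LinearMap.ker Ω = ⊥ := by
  rw [Submodule.eq_bot_iff]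
  intro ξ hξ
  exact hΩ.nondeg ξ fun η => by rw [LinearMap.mem_ker.1 hξ]; rfl

variable [FiniteDimensional ℝ X]

/-- A Lagrangian subspace is its own symplectic orthogonal. -/
theorem IsLag.mem_of_orthogonal (hΩ : IsSymplecticForm Ω) {Λ : Submodule ℝ X} (hΛ : IsLag Ω Λ)
    {ξ : X} (h : ∀ η ∈ Λ, Ω η ξ = 0) : ξ ∈ Λ := by
  have h1 : Λ ≤ Ω.orthogonal Λ := fun η hη ζ hζ => hΛ.2 ζ hζ η hη
  have h2 := LinearMap.BilinForm.finrank_add_finrank_orthogonal' (B := Ω) Λ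
  rw [hΩ.ker_eq_bot, inf_bot_eq, finrank_bot, add_zero, ← hΛ.1] at h2
  have h3 : Λ = Ω.orthogonal Λ := Submodule.eq_of_le_of_finrank_eq h1 (by omega)
  rw [h3]
  exact h

theorem IsLag.isCompl {Λ ν : Submodule ℝ X} (hΛ : IsLag Ω Λ) (hν : IsLag Ω ν)
    (h : Disjoint Λ ν) : IsCompl Λ ν := by
  refine (Submodule.isCompl_iff_disjoint _ _ ?_).2 h
  have := hΛ.1
  have := hν.1
  omega

theorem IsLag.finrank_eq {Λ ν : Submodule ℝ X} (hΛ : IsLag Ω Λ) (hν : IsLag Ω ν) :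
    Module.finrank ℝ Λ = Module.finrank ℝ ν := by
  have := hΛ.1
  have := hν.1
  omega

/-- Two Lagrangian subspaces have a common Lagrangian complement. -/
theorem exists_common_complement (hΩ : IsSymplecticForm Ω) {Λ Λ₀ : Submodule ℝ X} (hΛ : IsLag Ω Λ)
    (hΛ₀ : IsLag Ω Λ₀) : ∃ ν, IsLag Ω ν ∧ IsCompl Λ₀ ν ∧ IsCompl Λ ν := by
  obtain ⟨J, hJ, hJs, hJp⟩ := hΩ.exists_complex
  let f : ℝ → X →ₗ[ℝ] X := fun c => J + c • LinearMap.id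
  have hf : ∀ c x, f c x = J x + c • x := fun c x => rfl
  have h0 : ∀ c, ∀ a ∈ Λ₀, f c a ∈ Λ₀ → a = 0 := by
    intro c a ha hfa
    by_contra hne
    have h1 := hJp a hne
    have h2 := hΛ₀.2 a ha _ hfa
    rw [hf, LinearMap.BilinForm.add_right, LinearMap.BilinForm.smul_right, hΩ.alt] at h2
    linarith
  have hlag : ∀ c, IsLag Ω (Λ₀.map (f c)) := by
    intro c
    constructor
    · have hinj : Function.Injective ((f c).domRestrict Λ₀) := by
        rw [injective_iff_map_eq_zero]
        rintro ⟨a, ha⟩ h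
        simp only [LinearMap.domRestrict_apply] at h
        have := h0 c a ha (h ▸ Λ₀.zero_mem)
        simpa using this
      rw [← hΛ₀.1, ← LinearMap.finrank_range_of_inj hinj, LinearMap.range_domRestrict]
    · rintro _ ⟨a, ha, rfl⟩ _ ⟨a', ha', rfl⟩
      simp only [hf, LinearMap.BilinForm.add_left, LinearMap.BilinForm.add_right, LinearMap.BilinForm.smul_left, LinearMap.BilinForm.smul_right, hJ,
        hΛ₀.2 a ha a' ha']
      rw [hΩ.swap (J a), hJs a']
      ring
  have hc0 : ∀ c, IsCompl Λ₀ (Λ₀.map (f c)) := by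
    intro c
    refine hΛ₀.isCompl (hlag c) ?_
    rw [Submodule.disjoint_def]
    rintro _ hx ⟨a, ha, rfl⟩
    rw [h0 c a ha hx, map_zero]
  by_contra! hcon
  have hex : ∀ c : Fin (Module.finrank ℝ Λ₀ + 1), ∃ a : Λ₀, a ≠ 0 ∧ f (c : ℕ) a ∈ Λ := by
    intro c
    by_contra! hno
    refine hcon _ (hlag (c : ℕ)) (hc0 _) (hΛ.isCompl (hlag _) ?_)
    rw [Submodule.disjoint_def]
    rintro _ hx ⟨a, ha, rfl⟩
    by_contra hne
    refine hno ⟨a, ha⟩ ?_ hx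
    intro h
    have : a = 0 := by simpa using h
    exact hne (by rw [this, map_zero])
  choose a ha haΛ using hex
  let g : LinearMap.BilinForm ℝ Λ₀ :=
    (Ω.compl₂ J).compl₁₂ Λ₀.subtype Λ₀.subtype
  have hg : ∀ x y : Λ₀, g x y = Ω (x : X) (J y) := fun x y => rfl
  have hli : LinearIndependent ℝ a := by
    refine LinearMap.BilinForm.linearIndependent_of_iIsOrtho (B := g) ?_ ?_
    · rw [LinearMap.BilinForm.iIsOrtho_def]
      intro c c' hcc
      rw [hg]
      have h1 := hΛ.2 _ (haΛ c) _ (haΛ c')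
      simp only [hf, LinearMap.BilinForm.add_left, LinearMap.BilinForm.add_right, LinearMap.BilinForm.smul_left, LinearMap.BilinForm.smul_right, hJ,
        hΛ₀.2 _ (a c).2 _ (a c').2] at h1
      rw [hΩ.swap (J _), hJs (a c' : X)] at h1
      have h2 : ((c : ℕ) : ℝ) - ((c' : ℕ) : ℝ) ≠ 0 := by
        rw [sub_ne_zero]
        exact fun h => hcc (Fin.ext (by exact_mod_cast h))
      have h3 : (((c : ℕ) : ℝ) - ((c' : ℕ) : ℝ)) * Ω (a c : X) (J (a c')) = 0 := by
        linarith
      exact (mul_eq_zero.1 h3).resolve_left h2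
    · intro c
      rw [hg]
      exact (hJp _ (by simpa using ha c)).ne'
  have := hli.fintype_card_le_finrank
  rw [Fintype.card_fin] at this
  omega

/-- The quadratic form `ξ ↦ Ω(π ξ, ξ)`, where `π` is the projection onto `Λ₀` along `ν`. -/
def chartForm (Ω : LinearMap.BilinForm ℝ X) {Λ₀ ν : Submodule ℝ X} (h : IsCompl Λ₀ ν) :
    QuadraticForm ℝ X :=
  LinearMap.BilinMap.toQuadraticMap (Ω ∘ₗ Λ₀.projection ν h)

theorem chartForm_apply {Λ₀ ν : Submodule ℝ X} (h : IsCompl Λ₀ ν) (ξ : X) :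
    chartForm Ω h ξ = Ω (Λ₀.projection ν h ξ) ξ := rfl

/-- The signature of the chart form on a subspace. -/
def chartSig (Ω : LinearMap.BilinForm ℝ X) {Λ₀ ν : Submodule ℝ X} (h : IsCompl Λ₀ ν) (Λ : Submodule ℝ X) : ℤ :=
  signature ((chartForm Ω h).restrict Λ)

theorem form_projection_symm (hΩ : IsSymplecticForm Ω) {Λ₀ ν : Submodule ℝ X} (h : IsCompl Λ₀ ν)
    (hΛ₀ : IsLag Ω Λ₀) (hν : IsLag Ω ν) {ξ η : X} (hξη : Ω ξ η = 0) :
    Ω (Λ₀.projection ν h ξ) η = Ω (Λ₀.projection ν h η) ξ := by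
  set a := Λ₀.projection ν h ξ with ha
  set b := Λ₀.projection ν h η with hb
  have haΛ : a ∈ Λ₀ := Submodule.projection_apply_mem _ _
  have hbΛ : b ∈ Λ₀ := Submodule.projection_apply_mem _ _
  have haν : ξ - a ∈ ν := Submodule.sub_projection_mem h ξ
  have hbν : η - b ∈ ν := Submodule.sub_projection_mem h η
  have h1 := hν.2 _ haν _ hbν
  have h2 := hΛ₀.2 _ haΛ _ hbΛ
  rw [LinearMap.BilinForm.sub_left, LinearMap.BilinForm.sub_right, LinearMap.BilinForm.sub_right, hξη, h2, hΩ.swap ξ b] at h1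
  linarith

/-- A frame of `Λ` identifies `Λ` with the coordinate space. -/
def frameEquiv {ι : Type*} [Fintype ι] {F : ι → X} {Λ : Submodule ℝ X}
    (hF : LinearIndependent ℝ F) (hs : Submodule.span ℝ (range F) = Λ) : (ι → ℝ) ≃ₗ[ℝ] Λ :=
  (Module.Basis.span hF).equivFun.symm.trans (LinearEquiv.ofEq _ _ hs)

theorem frameEquiv_apply {ι : Type*} [Fintype ι] {F : ι → X} {Λ : Submodule ℝ X}
    (hF : LinearIndependent ℝ F) (hs : Submodule.span ℝ (range F) = Λ) (c : ι → ℝ) :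
    (frameEquiv hF hs c : X) = Fintype.linearCombination ℝ F c := by
  simp [frameEquiv, Fintype.linearCombination_apply, Module.Basis.equivFun_symm_apply,
    Module.Basis.span_apply]

theorem chartSig_eq_frame {Λ₀ ν : Submodule ℝ X} (h : IsCompl Λ₀ ν) {ι : Type*} [Fintype ι]
    {F : ι → X} {Λ : Submodule ℝ X}
    (hF : LinearIndependent ℝ F) (hs : Submodule.span ℝ (range F) = Λ) :
    chartSig Ω h Λ = signature ((chartForm Ω h).comp (Fintype.linearCombination ℝ F)) := by
  refine (signature_congr (frameEquiv hF hs) fun c => ?_).symm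
  rw [QuadraticMap.restrict_apply, frameEquiv_apply, QuadraticMap.comp_apply]

section Transition

variable {Λ₀ ν ν' : Submodule ℝ X} {ι : Type*} [Fintype ι]

/-- The form `(ξ, β) ↦ Ω(π ξ, ξ) + 2 Ω(π ξ, β) + Ω(π β, β)` on `Λ × ν'`, with `Λ` given by a
frame. -/
def transitionForm (Ω : LinearMap.BilinForm ℝ X) (h : IsCompl Λ₀ ν) (ν' : Submodule ℝ X) (F : ι → X) :
    QuadraticForm ℝ ((ι → ℝ) × ν') :=
  let p := Λ₀.projection ν h
  let f : ((ι → ℝ) × ν') →ₗ[ℝ] X := Fintype.linearCombination ℝ F ∘ₗ LinearMap.fst ℝ _ _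
  let g : ((ι → ℝ) × ν') →ₗ[ℝ] X := ν'.subtype ∘ₗ LinearMap.snd ℝ _ _
  LinearMap.BilinMap.toQuadraticMap (Ω.compl₁₂ (p ∘ₗ f) f + (2 : ℝ) • Ω.compl₁₂ (p ∘ₗ f) g +
    Ω.compl₁₂ (p ∘ₗ g) g)

theorem transitionForm_apply (h : IsCompl Λ₀ ν) (ν' : Submodule ℝ X) (F : ι → X)
    (c : ι → ℝ) (β : ν') : transitionForm Ω h ν' F (c, β) =
      Ω (Λ₀.projection ν h (Fintype.linearCombination ℝ F c)) (Fintype.linearCombination ℝ F c) +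
      2 * Ω (Λ₀.projection ν h (Fintype.linearCombination ℝ F c)) β +
      Ω (Λ₀.projection ν h β) β := rfl

theorem transitionForm_polar (hΩ : IsSymplecticForm Ω) (h : IsCompl Λ₀ ν) (hΛ₀ : IsLag Ω Λ₀) (hν : IsLag Ω ν)
    (hν' : IsLag Ω ν') {F : ι → X} {Λ : Submodule ℝ X} (hΛ : IsLag Ω Λ)
    (hs : Submodule.span ℝ (range F) = Λ) (c c' : ι → ℝ) (β β' : ν') :
    QuadraticMap.polar (transitionForm Ω h ν' F) (c, β) (c', β') =
      2 * (Ω (Λ₀.projection ν h (Fintype.linearCombination ℝ F c'))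
          (Fintype.linearCombination ℝ F c + β) +
        Ω (Λ₀.projection ν h (Fintype.linearCombination ℝ F c + β)) β') := by
  have hmem : ∀ c, Fintype.linearCombination ℝ F c ∈ Λ := fun c => by
    rw [← hs, ← Fintype.range_linearCombination ℝ F]
    exact LinearMap.mem_range_self _ c
  have h1 := form_projection_symm hΩ h hΛ₀ hν (hΛ.2 _ (hmem c) _ (hmem c'))
  have h2 := form_projection_symm hΩ h hΛ₀ hν (hν'.2 _ β.2 _ β'.2)
  rw [QuadraticMap.polar, Prod.mk_add_mk, transitionForm_apply, transitionForm_apply,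
    transitionForm_apply]
  simp only [map_add, LinearMap.add_apply, Submodule.coe_add]
  rw [h1, h2]
  ring

theorem transitionForm_radical (hΩ : IsSymplecticForm Ω) (h : IsCompl Λ₀ ν) (h' : IsCompl Λ₀ ν') (hΛ₀ : IsLag Ω Λ₀)
    (hν : IsLag Ω ν) (hν' : IsLag Ω ν') {F : ι → X} {Λ : Submodule ℝ X}
    (hΛ : IsLag Ω Λ) (hF : LinearIndependent ℝ F)
    (hs : Submodule.span ℝ (range F) = Λ) (hΛν : IsCompl Λ ν) (hΛν' : IsCompl Λ ν') :
    (transitionForm Ω h ν' F).radical = ⊥ := by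
  rw [radical_eq_bot_iff_polar]
  rintro ⟨c, β⟩ hpol
  have hmem : ∀ c, Fintype.linearCombination ℝ F c ∈ Λ := fun c => by
    rw [← hs, ← Fintype.range_linearCombination ℝ F]
    exact LinearMap.mem_range_self _ c
  set ξ := Fintype.linearCombination ℝ F c with hξ
  have hP : ∀ c' β', Ω (Λ₀.projection ν h (Fintype.linearCombination ℝ F c')) (ξ + β) +
      Ω (Λ₀.projection ν h (ξ + β)) (β' : ν') = 0 := by
    intro c' β'
    have := hpol (c', β')
    rw [transitionForm_polar hΩ h hΛ₀ hν hν' hΛ hs] at this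
    linarith
  have h1 : Λ₀.projection ν h (ξ + β) = 0 := by
    have h2 : Λ₀.projection ν h (ξ + β) ∈ ν' := hν'.mem_of_orthogonal hΩ fun η hη => by
      have := hP 0 ⟨η, hη⟩
      rw [map_zero, map_zero, LinearMap.BilinForm.zero_left, zero_add] at this
      rw [hΩ.swap, this, neg_zero]
    exact (Submodule.disjoint_def.1 h'.disjoint) _ (Submodule.projection_apply_mem _ _) h2
  have h3 : ξ + β ∈ ν := by rwa [← Submodule.projection_apply_eq_zero_iff h]
  have h4 : ξ + β ∈ Λ₀ := hΛ₀.mem_of_orthogonal hΩ fun η hη => by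
    have hdec := Submodule.projection_add_projection_eq_self hΛν η
    set l := Λ.projection ν hΛν η with hl
    have hlm : l ∈ Λ := Submodule.projection_apply_mem _ _
    have hnm : ν.projection Λ hΛν.symm η ∈ ν := Submodule.projection_apply_mem _ _
    obtain ⟨c', hc'⟩ : ∃ c', Fintype.linearCombination ℝ F c' = l := by
      have : l ∈ LinearMap.range (Fintype.linearCombination ℝ F) := by
        rw [Fintype.range_linearCombination, hs]
        exact hlm
      exact this
    have h5 := hP c' 0
    rw [Submodule.coe_zero, LinearMap.BilinForm.zero_right, add_zero, hc'] at h5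
    have h6 : Λ₀.projection ν h l = η := by
      have h7 : l = η - ν.projection Λ hΛν.symm η := eq_sub_of_add_eq hdec
      rw [h7, map_sub, (Submodule.projection_eq_self_iff h η).2 hη,
        (Submodule.projection_apply_eq_zero_iff h).2 hnm, sub_zero]
    rwa [h6] at h5
  have h5 : ξ + β = 0 := (Submodule.disjoint_def.1 h.disjoint) _ h4 h3
  have h6 : ξ = 0 := by
    refine (Submodule.disjoint_def.1 hΛν'.disjoint) _ (hmem c) ?_
    rw [eq_neg_of_add_eq_zero_left h5]
    exact ν'.neg_mem β.2
  have h7 : c = 0 := by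
    refine funext (Fintype.linearIndependent_iff.1 hF c ?_)
    rw [← Fintype.linearCombination_apply]
    exact h6
  rw [h6, zero_add] at h5
  exact Prod.ext h7 (Subtype.ext h5)

/-- The difference of the signatures of two chart forms is the signature of the transition form. -/
theorem chartSig_sub_chartSig (hΩ : IsSymplecticForm Ω) (h : IsCompl Λ₀ ν) (h' : IsCompl Λ₀ ν') (hΛ₀ : IsLag Ω Λ₀)
    (hν : IsLag Ω ν) (hν' : IsLag Ω ν') {F : ι → X} {Λ : Submodule ℝ X}
    (hΛ : IsLag Ω Λ) (hF : LinearIndependent ℝ F)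
    (hs : Submodule.span ℝ (range F) = Λ) (hrad : (transitionForm Ω h ν' F).radical = ⊥) :
    chartSig Ω h Λ - chartSig Ω h' Λ = signature (transitionForm Ω h ν' F) := by
  have hcard : Fintype.card ι = Module.finrank ℝ ν' := by
    rw [← hΛ.finrank_eq hν', ← (frameEquiv hF hs).finrank_eq, Module.finrank_fintype_fun_eq_card]
  let φ := Fintype.linearCombination ℝ F
  let p' := Λ₀.projection ν' h'
  have hq : ∀ x, x - p' x ∈ ν' := fun x => Submodule.sub_projection_mem h' x
  let r : (ι → ℝ) →ₗ[ℝ] ν' := LinearMap.codRestrict ν' (p' ∘ₗ φ - φ) fun c => by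
    have := ν'.neg_mem (hq (φ c))
    rwa [neg_sub] at this
  have hr : ∀ c, (r c : X) = p' (φ c) - φ c := fun c => rfl
  let i : (ι → ℝ) →ₗ[ℝ] (ι → ℝ) × ν' := LinearMap.inl ℝ _ _
  let j : (ι → ℝ) →ₗ[ℝ] (ι → ℝ) × ν' := LinearMap.id.prod r
  have hj : Function.Injective j := fun x y hxy => (Prod.ext_iff.1 hxy).1
  have hmem : ∀ x, p' x ∈ Λ₀ := fun x => Submodule.projection_apply_mem _ _
  have hmem' : ∀ x, Λ₀.projection ν h x ∈ Λ₀ := fun x => Submodule.projection_apply_mem _ _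
  have hsum : ∀ c, φ c + (r c : X) = p' (φ c) := fun c => by rw [hr]; abel
  have key := signature_eq_add (transitionForm Ω h ν' F) hrad i j LinearMap.inl_injective hj
    (by rw [Module.finrank_prod, Module.finrank_fintype_fun_eq_card, hcard]) (by
      intro c c'
      rw [QuadraticMap.polar_comm]
      change QuadraticMap.polar (transitionForm Ω h ν' F) (c', r c') (c, 0) = 0
      rw [transitionForm_polar hΩ h hΛ₀ hν hν' hΛ hs]
      change 2 * (Ω (Λ₀.projection ν h (φ c)) (φ c' + (r c' : X)) + _) = 0
      rw [hsum, hΛ₀.2 _ (hmem' _) _ (hmem _), Submodule.coe_zero, LinearMap.BilinForm.zero_right]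
      simp)
  have e1 : (transitionForm Ω h ν' F).comp i = (chartForm Ω h).comp φ := by
    ext c
    change transitionForm Ω h ν' F (c, 0) = _
    rw [transitionForm_apply, QuadraticMap.comp_apply, chartForm_apply, Submodule.coe_zero,
      LinearMap.BilinForm.zero_right, LinearMap.BilinForm.zero_right, mul_zero, add_zero, add_zero]
  have e2 : (transitionForm Ω h ν' F).comp j = -((chartForm Ω h').comp φ) := by
    ext c
    change transitionForm Ω h ν' F (c, r c) = -(chartForm Ω h' (φ c))
    rw [transitionForm_apply, chartForm_apply]
    change Ω (Λ₀.projection ν h (φ c)) (φ c) + 2 * Ω (Λ₀.projection ν h (φ c)) (r c) +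
      Ω (Λ₀.projection ν h (r c)) (r c) = -Ω (p' (φ c)) (φ c)
    have t1 : Ω (Λ₀.projection ν h (φ c)) (φ c) + Ω (Λ₀.projection ν h (φ c)) (r c) = 0 := by
      rw [← LinearMap.BilinForm.add_right, hsum]
      exact hΛ₀.2 _ (hmem' _) _ (hmem _)
    have t2 : Ω (Λ₀.projection ν h (φ c)) (r c) + Ω (Λ₀.projection ν h (r c)) (r c) =
        Ω (p' (φ c)) (r c) := by
      rw [← LinearMap.BilinForm.add_left, ← map_add, hsum, (Submodule.projection_eq_self_iff h _).2 (hmem _)]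
    have t3 : Ω (p' (φ c)) (r c) = -Ω (p' (φ c)) (φ c) := by
      rw [hr, LinearMap.BilinForm.sub_right, hΩ.alt]
      ring
    linarith
  have e3 : signature (-((chartForm Ω h').comp φ)) = -signature ((chartForm Ω h').comp φ) := by
    unfold signature
    rw [sigPos_neg, sigNeg_neg]
    ring
  rw [key, e1, e2, e3, chartSig_eq_frame h hF hs, chartSig_eq_frame h' hF hs]
  ring

end Transition

section Family

theorem continuous_bilin (Ω : LinearMap.BilinForm ℝ X) : Continuous fun z : X × X => Ω z.1 z.2 := by
  let f : X →ₗ[ℝ] (X →L[ℝ] ℝ) := (LinearMap.toContinuousLinearMap (𝕜 := ℝ) (E := X)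
    (F' := ℝ)).toLinearMap ∘ₗ Ω
  have hf : Continuous f := LinearMap.continuous_of_finiteDimensional f
  exact (hf.comp continuous_fst).clm_apply continuous_snd

variable {Y : Type*} [NormedAddCommGroup Y] [NormedSpace ℝ Y] {Λ₀ ν ν' : Submodule ℝ X}

/-- `Λ` is a family of Lagrangian subspaces which near `y`, within `s`, is spanned by a frame of
class `C^k` at `y`. -/
def HasFrameAt (Ω : LinearMap.BilinForm ℝ X) (k : ℕ) (Λ : Y → Submodule ℝ X) (s : Set Y)
    (y : Y) : Prop :=
  ∃ (m : ℕ) (F : Y → Fin m → X), ContDiffWithinAt ℝ k F s y ∧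
    ∀ᶠ z in 𝓝[s] y, IsLag Ω (Λ z) ∧ LinearIndependent ℝ (F z) ∧
      Submodule.span ℝ (range (F z)) = Λ z

theorem disjoint_iff_linearIndependent_sumElim {ι κ : Type*} {F : ι → X} {G : κ → X}
    (hF : LinearIndependent ℝ F) (hG : LinearIndependent ℝ G) :
    LinearIndependent ℝ (Sum.elim F G) ↔
      Disjoint (Submodule.span ℝ (range F)) (Submodule.span ℝ (range G)) :=
  ⟨fun h => (linearIndependent_sum.1 h).2.2, fun h => hF.sum_type hG h⟩

/-- Transversality to a fixed Lagrangian subspace is an open condition. -/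
theorem HasFrameAt.eventually_isCompl {k : ℕ} {Λ : Y → Submodule ℝ X} {s : Set Y}
    {y : Y} (h : HasFrameAt Ω k Λ s y) (hy : y ∈ s) (hν : IsLag Ω ν)
    (hc : IsCompl (Λ y) ν) : ∀ᶠ z in 𝓝[s] y, IsCompl (Λ z) ν := by
  obtain ⟨m, F, hFd, hF⟩ := h
  have hFc := hFd.continuousWithinAt
  let b := Module.finBasis ℝ ν
  let G : Fin (Module.finrank ℝ ν) → X := fun i => b i
  have hG : LinearIndependent ℝ G := b.linearIndependent.map' ν.subtype (Submodule.ker_subtype _)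
  have hGs : Submodule.span ℝ (range G) = ν := by
    have h1 : range G = ν.subtype '' range b := by
      rw [← range_comp]
      rfl
    rw [h1, ← Submodule.map_span, b.span_eq, Submodule.map_top, Submodule.range_subtype]
  have hFy := hF.self_of_nhdsWithin hy
  have h1 : LinearIndependent ℝ (Sum.elim (F y) G) := by
    rw [disjoint_iff_linearIndependent_sumElim hFy.2.1 hG, hFy.2.2, hGs]
    exact hc.disjoint
  have h2 : ContinuousWithinAt (fun z => Sum.elim (F z) G) s y := by
    rw [continuousWithinAt_pi]
    rintro (i | i)
    · exact (continuousWithinAt_pi.1 hFc) i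
    · exact continuousWithinAt_const
  have h3 := h2.eventually (isOpen_setOfPred_linearIndependent.mem_nhds h1)
  filter_upwards [h3, hF] with z hz hFz
  refine hFz.1.isCompl hν ?_
  rw [← hFz.2.2, ← hGs, ← disjoint_iff_linearIndependent_sumElim hFz.2.1 hG]
  exact hz

/-- The difference of the signatures in two charts is locally constant. -/
theorem HasFrameAt.eventually_chartSig_sub (hΩ : IsSymplecticForm Ω) {k : ℕ}
    {Λ : Y → Submodule ℝ X} {s : Set Y} {y : Y} (hfam : HasFrameAt Ω k Λ s y) (hy : y ∈ s) (hΛ₀ : IsLag Ω Λ₀)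
    (hν : IsLag Ω ν) (hν' : IsLag Ω ν') (h : IsCompl Λ₀ ν) (h' : IsCompl Λ₀ ν')
    (hc : IsCompl (Λ y) ν) (hc' : IsCompl (Λ y) ν') :
    ∀ᶠ z in 𝓝[s] y, chartSig Ω h (Λ z) - chartSig Ω h' (Λ z) =
      chartSig Ω h (Λ y) - chartSig Ω h' (Λ y) := by
  obtain ⟨m, F, hFd, hF⟩ := hfam
  have hFc := hFd.continuousWithinAt
  have hFy := hF.self_of_nhdsWithin hy
  have hrad := transitionForm_radical hΩ h h' hΛ₀ hν hν' hFy.1 hFy.2.1 hFy.2.2 hc hc'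
  have hlim : ∀ x, Tendsto (fun z => transitionForm Ω h ν' (F z) x) (𝓝[s] y)
      (𝓝 (transitionForm Ω h ν' (F y) x)) := by
    rintro ⟨c, β⟩
    have h1 : ContinuousWithinAt (fun z => Fintype.linearCombination ℝ (F z) c) s y := by
      simp only [Fintype.linearCombination_apply]
      exact tendsto_finsetSum _ fun i _ => ((continuousWithinAt_pi.1 hFc) i).const_smul (c i)
    have h2 : ContinuousWithinAt (fun z => Λ₀.projection ν h
        (Fintype.linearCombination ℝ (F z) c)) s y :=
      (LinearMap.continuous_of_finiteDimensional
        (Λ₀.projection ν h)).continuousAt.comp_continuousWithinAt h1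
    have hcΩ : Continuous fun z : X × X => Ω z.1 z.2 :=
      continuous_bilin Ω
    simp only [transitionForm_apply]
    exact ((hcΩ.continuousAt.comp_continuousWithinAt (h2.prodMk h1)).add
      ((hcΩ.continuousAt.comp_continuousWithinAt
        (h2.prodMk continuousWithinAt_const)).const_mul 2)).add tendsto_const_nhds
  filter_upwards [eventually_signature_eq hlim hrad, hF] with z hz hFz
  rw [chartSig_sub_chartSig hΩ h h' hΛ₀ hν hν' hFy.1 hFy.2.1 hFy.2.2 hrad,
    chartSig_sub_chartSig hΩ h h' hΛ₀ hν hν' hFz.1 hFz.2.1 hFz.2.2 hz.2, hz.1]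

end Family

end LagrangianAlgebra

section HomotopyInvariance

variable {X : Type*} [NormedAddCommGroup X] [NormedSpace ℝ X] {Ω : LinearMap.BilinForm ℝ X}
  {Λ₀ : Submodule ℝ X}

/-- The local properties of a continuous family of Lagrangian subspaces on which the homotopy
invariance of the relative Maslov index rests. -/
def IsLagCont (Ω : LinearMap.BilinForm ℝ X) (Λ₀ : Submodule ℝ X) {Y : Type*} [TopologicalSpace Y]
    (h : Y → Submodule ℝ X) (s : Set Y) : Prop :=
  ∀ y ∈ s, IsLag Ω (h y) ∧
    (∀ ν, IsLag Ω ν → IsCompl (h y) ν → ∀ᶠ z in 𝓝[s] y, IsCompl (h z) ν) ∧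
    ∀ ν ν', IsLag Ω ν → IsLag Ω ν' → ∀ (hc : IsCompl Λ₀ ν) (hc' : IsCompl Λ₀ ν'),
      IsCompl (h y) ν → IsCompl (h y) ν' → ∀ᶠ z in 𝓝[s] y,
        chartSig Ω hc (h z) - chartSig Ω hc' (h z) = chartSig Ω hc (h y) - chartSig Ω hc' (h y)

/-- `D` jumps along the path `Λ` exactly as the signatures of the chart forms do. -/
def IsPrim (Ω : LinearMap.BilinForm ℝ X) (Λ₀ : Submodule ℝ X) (Λ : ℝ → Submodule ℝ X)
    (D : ℝ → ℤ) : Prop :=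
  ∀ ν, IsLag Ω ν → ∀ hc : IsCompl Λ₀ ν, ∀ t ∈ Icc (0 : ℝ) 1, IsCompl (Λ t) ν →
    ∀ᶠ s in 𝓝[Icc (0 : ℝ) 1] t, chartSig Ω hc (Λ s) - D s = chartSig Ω hc (Λ t) - D t

theorem eq_of_eventually_const {Y : Type*} [TopologicalSpace Y] {A : Set Y}
    (hA : IsPreconnected A) {f : Y → ℤ} (hf : ∀ y ∈ A, ∀ᶠ z in 𝓝[A] y, f z = f y) {x y : Y}
    (hx : x ∈ A) (hy : y ∈ A) : f x = f y := by
  refine hA.constant (fun z hz => ?_) hx hy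
  exact tendsto_nhds_of_eventually_eq (hf z hz)

section Glue

variable {Y Z : Type*} [TopologicalSpace Y] [TopologicalSpace Z]

theorem IsLagCont.union {h : Y → Submodule ℝ X} {A B : Set Y} (hA : IsClosed A) (hB : IsClosed B)
    (h1 : IsLagCont Ω Λ₀ h A) (h2 : IsLagCont Ω Λ₀ h B) : IsLagCont Ω Λ₀ h (A ∪ B) := by
  have key : ∀ y ∈ A ∪ B, ∀ p : Y → Prop, (y ∈ A → ∀ᶠ z in 𝓝[A] y, p z) →
      (y ∈ B → ∀ᶠ z in 𝓝[B] y, p z) → ∀ᶠ z in 𝓝[A ∪ B] y, p z := by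
    intro y _ p hpA hpB
    have aux : ∀ C : Set Y, IsClosed C → (y ∈ C → ∀ᶠ z in 𝓝[C] y, p z) → ∀ᶠ z in 𝓝[C] y, p z := by
      intro C hC hp
      by_cases hy : y ∈ C
      · exact hp hy
      · have : 𝓝[C] y = ⊥ := by
          rw [← notMem_closure_iff_nhdsWithin_eq_bot, hC.closure_eq]
          exact hy
        simp [this]
    rw [nhdsWithin_union]
    exact eventually_sup.2 ⟨aux A hA hpA, aux B hB hpB⟩
  intro y hy
  refine ⟨?_, fun ν hν hc => key y hy _ ?_ ?_, fun ν ν' hν hν' hc hc' hy1 hy2 => key y hy _ ?_ ?_⟩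
  · rcases hy with hy | hy
    · exact (h1 y hy).1
    · exact (h2 y hy).1
  · exact fun hy => (h1 y hy).2.1 ν hν hc
  · exact fun hy => (h2 y hy).2.1 ν hν hc
  · exact fun hy => (h1 y hy).2.2 ν ν' hν hν' hc hc' hy1 hy2
  · exact fun hy => (h2 y hy).2.2 ν ν' hν hν' hc hc' hy1 hy2

theorem IsLagCont.comp {h : Y → Submodule ℝ X} {B : Set Y} (hh : IsLagCont Ω Λ₀ h B)
    {φ : Z → Y} (hφ : Continuous φ) {A : Set Z} (hAB : MapsTo φ A B) :
    IsLagCont Ω Λ₀ (h ∘ φ) A := by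
  intro y hy
  have ht : Tendsto φ (𝓝[A] y) (𝓝[B] (φ y)) :=
    hφ.continuousWithinAt.tendsto_nhdsWithin hAB
  obtain ⟨h1, h2, h3⟩ := hh (φ y) (hAB hy)
  exact ⟨h1, fun ν hν hc => ht.eventually (h2 ν hν hc),
    fun ν ν' hν hν' hc hc' hy1 hy2 => ht.eventually (h3 ν ν' hν hν' hc hc' hy1 hy2)⟩

theorem IsLagCont.congr {h h' : Y → Submodule ℝ X} {A : Set Y} (hh : IsLagCont Ω Λ₀ h A)
    (heq : ∀ y ∈ A, h' y = h y) : IsLagCont Ω Λ₀ h' A := by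
  intro y hy
  obtain ⟨h1, h2, h3⟩ := hh y hy
  rw [heq y hy]
  refine ⟨h1, fun ν hν hc => ?_, fun ν ν' hν hν' hc hc' hy1 hy2 => ?_⟩
  · filter_upwards [h2 ν hν hc, self_mem_nhdsWithin] with z hz hzA
    rwa [heq z hzA]
  · filter_upwards [h3 ν ν' hν hν' hc hc' hy1 hy2, self_mem_nhdsWithin] with z hz hzA
    rwa [heq z hzA]

theorem IsLagCont.chartSig_sub_eq {h : Y → Submodule ℝ X} {A : Set Y} (hh : IsLagCont Ω Λ₀ h A)
    {B : Set Y} (hBA : B ⊆ A) (hB : IsPreconnected B) {ν ν' : Submodule ℝ X} (hν : IsLag Ω ν)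
    (hν' : IsLag Ω ν') (hc : IsCompl Λ₀ ν) (hc' : IsCompl Λ₀ ν')
    (h1 : ∀ y ∈ B, IsCompl (h y) ν) (h2 : ∀ y ∈ B, IsCompl (h y) ν') {x y : Y} (hx : x ∈ B)
    (hy : y ∈ B) : chartSig Ω hc (h x) - chartSig Ω hc' (h x) =
      chartSig Ω hc (h y) - chartSig Ω hc' (h y) := by
  refine eq_of_eventually_const (f := fun x => chartSig Ω hc (h x) - chartSig Ω hc' (h x)) hB
    (fun z hz => ?_) hx hy
  exact nhdsWithin_mono z hBA ((hh z (hBA hz)).2.2 ν ν' hν hν' hc hc' (h1 z hz) (h2 z hz))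

end Glue

theorem IsPrim.sub_eq {Λ : ℝ → Submodule ℝ X} {D : ℝ → ℤ} (hD : IsPrim Ω Λ₀ Λ D) {a b : ℝ}
    (ha : 0 ≤ a) (hab : a ≤ b) (hb : b ≤ 1) {ν : Submodule ℝ X} (hν : IsLag Ω ν)
    (hc : IsCompl Λ₀ ν) (h : ∀ t ∈ Icc a b, IsCompl (Λ t) ν) :
    chartSig Ω hc (Λ b) - chartSig Ω hc (Λ a) = D b - D a := by
  have hsub : Icc a b ⊆ Icc 0 1 := Icc_subset_Icc ha hb
  have := eq_of_eventually_const (f := fun t => chartSig Ω hc (Λ t) - D t)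
    (isPreconnected_Icc (a := a) (b := b)) (fun t ht =>
      nhdsWithin_mono t hsub (hD ν hν hc t (hsub ht) (h t ht)))
    (right_mem_Icc.2 hab) (left_mem_Icc.2 hab)
  linarith

variable [FiniteDimensional ℝ X]

/-- Homotopy invariance over a rectangle. -/
theorem IsPrim.homotopy (hΩ : IsSymplecticForm Ω) (hΛ₀ : IsLag Ω Λ₀)
    {h : ℝ × ℝ → Submodule ℝ X} (hh : IsLagCont Ω Λ₀ h (Icc (-1) 1 ×ˢ Icc 0 1))
    (h0 : ∀ s ∈ Icc (-1 : ℝ) 1, h (s, 0) = h (-1, 0))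
    (h1 : ∀ s ∈ Icc (-1 : ℝ) 1, h (s, 1) = h (-1, 1)) {D D' : ℝ → ℤ}
    (hD : IsPrim Ω Λ₀ (fun t => h (-1, t)) D) (hD' : IsPrim Ω Λ₀ (fun t => h (1, t)) D') :
    D 1 - D 0 = D' 1 - D' 0 := by
  set R : Set (ℝ × ℝ) := Icc (-1) 1 ×ˢ Icc 0 1 with hR
  have hRc : IsCompact R := isCompact_Icc.prod isCompact_Icc
  have hloc : ∀ y : R, ∃ ν, IsLag Ω ν ∧ IsCompl Λ₀ ν ∧ ∃ U : Set (ℝ × ℝ), IsOpen U ∧ (y : ℝ × ℝ) ∈ U ∧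
      ∀ z ∈ U ∩ R, IsCompl (h z) ν := by
    rintro ⟨y, hy⟩
    obtain ⟨ν, hν, hc0, hc⟩ := exists_common_complement hΩ (hh y hy).1 hΛ₀
    have := (hh y hy).2.1 ν hν hc
    rw [eventually_nhdsWithin_iff, eventually_nhds_iff] at this
    obtain ⟨U, hU, hUo, hyU⟩ := this
    exact ⟨ν, hν, hc0, U, hUo, hyU, fun z hz => hU z hz.1 hz.2⟩
  choose ν₀ hν₀ hν₀c U hUo hyU hU using hloc
  obtain ⟨δ, hδ, hball⟩ := lebesgue_number_lemma_of_metric hRc hUo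
    (fun y hy => mem_iUnion.2 ⟨⟨y, hy⟩, hyU ⟨y, hy⟩⟩)
  obtain ⟨N, hN⟩ := exists_nat_gt (2 / δ)
  have hNpos : (0 : ℝ) < N := lt_trans (by positivity) hN
  have hN0 : 0 < N := by exact_mod_cast hNpos
  have hNδ : 2 / (N : ℝ) < δ := by
    rw [div_lt_iff₀ hNpos]
    rw [div_lt_iff₀ hδ] at hN
    linarith
  let σ : ℕ → ℝ := fun i => -1 + 2 * (i / N)
  let τ : ℕ → ℝ := fun j => j / N
  have hσ0 : σ 0 = -1 := by simp [σ]
  have hσN : σ N = 1 := by simp [σ, hNpos.ne']; norm_num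
  have hτ0 : τ 0 = 0 := by simp [τ]
  have hτN : τ N = 1 := by simp [τ, hNpos.ne']
  have hσs : ∀ i, σ (i + 1) = σ i + 2 / N := fun i => by simp only [σ]; push_cast; ring
  have hτs : ∀ j, τ (j + 1) = τ j + 1 / N := fun j => by simp only [τ]; push_cast; ring
  have hσm : Monotone σ := monotone_nat_of_le_succ fun i => by
    rw [hσs]; linarith [div_pos two_pos hNpos]
  have hτm : Monotone τ := monotone_nat_of_le_succ fun i => by
    rw [hτs]; linarith [div_pos one_pos hNpos]
  have hσI : ∀ i ≤ N, σ i ∈ Icc (-1 : ℝ) 1 := fun i hi =>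
    ⟨hσ0 ▸ hσm (Nat.zero_le i), hσN ▸ hσm hi⟩
  have hτI : ∀ j ≤ N, τ j ∈ Icc (0 : ℝ) 1 := fun j hj =>
    ⟨hτ0 ▸ hτm (Nat.zero_le j), hτN ▸ hτm hj⟩
  have hchart : ∀ i j, ∃ ν, IsLag Ω ν ∧ IsCompl Λ₀ ν ∧ (i < N → j < N →
      ∀ s ∈ Icc (σ i) (σ (i + 1)), ∀ t ∈ Icc (τ j) (τ (j + 1)), IsCompl (h (s, t)) ν) := by
    intro i j
    by_cases hij : i < N ∧ j < N
    · obtain ⟨y, hy⟩ := hball (σ i, τ j) ⟨hσI i hij.1.le, hτI j hij.2.le⟩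
      refine ⟨ν₀ y, hν₀ y, hν₀c y, fun _ _ s hs t ht => hU y _ ⟨hy ?_, ?_⟩⟩
      · rw [Metric.mem_ball, Prod.dist_eq, max_lt_iff, Real.dist_eq, Real.dist_eq, abs_lt, abs_lt]
        have h3 : 1 / (N : ℝ) ≤ 2 / N := by gcongr; norm_num
        have := hs.1; have := hs.2; have := ht.1; have := ht.2
        rw [hσs, hτs] at *
        refine ⟨⟨?_, ?_⟩, ?_, ?_⟩ <;> simp only <;> linarith
      · exact ⟨⟨(hσI i hij.1.le).1.trans hs.1, hs.2.trans (hσI (i + 1) hij.1).2⟩,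
          ⟨(hτI j hij.2.le).1.trans ht.1, ht.2.trans (hτI (j + 1) hij.2).2⟩⟩
    · obtain ⟨ν, hν, hc, -⟩ := exists_common_complement hΩ hΛ₀ hΛ₀
      exact ⟨ν, hν, hc, fun h1 h2 => absurd ⟨h1, h2⟩ hij⟩
  choose ν hν hc htr using hchart
  let S : ℕ → ℕ → ℝ × ℝ → ℤ := fun i j y => chartSig Ω (hc i j) (h y)
  have hRmem : ∀ {i j}, i < N → j < N → ∀ s ∈ Icc (σ i) (σ (i + 1)),
      ∀ t ∈ Icc (τ j) (τ (j + 1)), (s, t) ∈ R := fun hi hj s hs t ht =>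
    ⟨⟨(hσI _ hi.le).1.trans hs.1, hs.2.trans (hσI _ hi).2⟩,
      ⟨(hτI _ hj.le).1.trans ht.1, ht.2.trans (hτI _ hj).2⟩⟩
  have hlσ : ∀ i, σ i ∈ Icc (σ i) (σ (i + 1)) := fun i => ⟨le_rfl, hσm i.le_succ⟩
  have hrσ : ∀ i, σ (i + 1) ∈ Icc (σ i) (σ (i + 1)) := fun i => ⟨hσm i.le_succ, le_rfl⟩
  have hlτ : ∀ j, τ j ∈ Icc (τ j) (τ (j + 1)) := fun j => ⟨le_rfl, hτm j.le_succ⟩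
  have hrτ : ∀ j, τ (j + 1) ∈ Icc (τ j) (τ (j + 1)) := fun j => ⟨hτm j.le_succ, le_rfl⟩
  let a : ℕ → ℕ → ℤ := fun i j => S i j (σ i, τ (j + 1)) - S i j (σ i, τ j)
  let b : ℕ → ℕ → ℤ := fun i j => S i j (σ (i + 1), τ (j + 1)) - S i j (σ (i + 1), τ j)
  have hrow : ∀ i < N, ∑ j ∈ Finset.range N, a i j = ∑ j ∈ Finset.range N, b i j := by
    intro i hi
    let r : ℕ → ℤ := fun j => if j < N then S i j (σ (i + 1), τ j) - S i j (σ i, τ j) else 0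
    have hr : ∀ j ∈ Finset.range N, b i j - a i j = r (j + 1) - r j := by
      intro j hj
      rw [Finset.mem_range] at hj
      have e1 : r j = S i j (σ (i + 1), τ j) - S i j (σ i, τ j) := if_pos hj
      have e2 : r (j + 1) = S i j (σ (i + 1), τ (j + 1)) - S i j (σ i, τ (j + 1)) := by
        by_cases hj1 : j + 1 < N
        · have e3 : r (j + 1) = S i (j + 1) (σ (i + 1), τ (j + 1)) -
              S i (j + 1) (σ i, τ (j + 1)) := if_pos hj1
          rw [e3]
          have := hh.chartSig_sub_eq (B := Icc (σ i) (σ (i + 1)) ×ˢ {τ (j + 1)})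
            (by
              rintro ⟨s, t⟩ ⟨hs, rfl⟩
              exact hRmem hi hj s hs _ (hrτ j))
            (isPreconnected_Icc.prod isPreconnected_singleton) (hν i j) (hν i (j + 1))
            (hc i j) (hc i (j + 1))
            (by
              rintro ⟨s, t⟩ ⟨hs, rfl⟩
              exact htr i j hi hj s hs _ (hrτ j))
            (by
              rintro ⟨s, t⟩ ⟨hs, rfl⟩
              exact htr i (j + 1) hi hj1 s hs _ (hlτ (j + 1)))
            (x := (σ i, τ (j + 1))) (y := (σ (i + 1), τ (j + 1))) ⟨hlσ i, rfl⟩ ⟨hrσ i, rfl⟩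
          simp only [S]
          linarith
        · have e3 : r (j + 1) = 0 := if_neg hj1
          have e4 : j + 1 = N := by omega
          rw [e3]
          simp only [S]
          rw [e4, hτN, h1 _ (hσI i hi.le), h1 _ (hσI (i + 1) hi), sub_self]
      rw [e1, e2]
      simp only [a, b]
      ring
    have hsum : ∑ j ∈ Finset.range N, (b i j - a i j) = 0 := by
      rw [Finset.sum_congr rfl hr, Finset.sum_range_sub]
      have e1 : r N = 0 := if_neg (lt_irrefl N)
      have e2 : r 0 = 0 := by
        simp only [r, if_pos hN0, S]
        rw [hτ0, h0 _ (hσI i hi.le), h0 _ (hσI (i + 1) hi), sub_self]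
      rw [e1, e2, sub_self]
    rw [Finset.sum_sub_distrib] at hsum
    linarith
  have hnext : ∀ i, i + 1 < N → ∀ j < N, b i j = a (i + 1) j := by
    intro i hi j hj
    have hi' : i < N := Nat.lt_of_succ_lt hi
    have := hh.chartSig_sub_eq (B := {σ (i + 1)} ×ˢ Icc (τ j) (τ (j + 1)))
      (by
        rintro ⟨s, t⟩ ⟨rfl, ht⟩
        exact hRmem hi' hj _ (hrσ i) t ht)
      (isPreconnected_singleton.prod isPreconnected_Icc) (hν i j) (hν (i + 1) j)
      (hc i j) (hc (i + 1) j)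
      (by
        rintro ⟨s, t⟩ ⟨rfl, ht⟩
        exact htr i j hi' hj _ (hrσ i) t ht)
      (by
        rintro ⟨s, t⟩ ⟨rfl, ht⟩
        exact htr (i + 1) j hi hj _ (hlσ (i + 1)) t ht)
      (x := (σ (i + 1), τ j)) (y := (σ (i + 1), τ (j + 1))) ⟨rfl, hlτ j⟩ ⟨rfl, hrτ j⟩
    simp only [a, b, S]
    linarith
  have hchain : ∀ i < N, ∑ j ∈ Finset.range N, a 0 j = ∑ j ∈ Finset.range N, a i j := by
    intro i
    induction i with
    | zero => exact fun _ => rfl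
    | succ i ih =>
      intro hi
      rw [ih (Nat.lt_of_succ_lt hi), hrow i (Nat.lt_of_succ_lt hi)]
      exact Finset.sum_congr rfl fun j hj => hnext i hi j (Finset.mem_range.1 hj)
  have hfirst : ∑ j ∈ Finset.range N, a 0 j = D 1 - D 0 := by
    have e : ∀ j ∈ Finset.range N, a 0 j = D (τ (j + 1)) - D (τ j) := by
      intro j hj
      rw [Finset.mem_range] at hj
      have := hD.sub_eq (hτI j hj.le).1 (hτm j.le_succ) (hτI (j + 1) hj).2 (hν 0 j) (hc 0 j)
        (fun t ht => htr 0 j hN0 hj _ (by rw [← hσ0]; exact hlσ 0) t ht)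
      simp only [a, S, hσ0]
      exact this
    rw [Finset.sum_congr rfl e, Finset.sum_range_sub (fun j => D (τ j)), hτ0, hτN]
  have hlast : ∑ j ∈ Finset.range N, b (N - 1) j = D' 1 - D' 0 := by
    have hN1 : N - 1 + 1 = N := Nat.sub_add_cancel hN0
    have hlt : N - 1 < N := Nat.sub_lt hN0 one_pos
    have e : ∀ j ∈ Finset.range N, b (N - 1) j = D' (τ (j + 1)) - D' (τ j) := by
      intro j hj
      rw [Finset.mem_range] at hj
      have := hD'.sub_eq (hτI j hj.le).1 (hτm j.le_succ) (hτI (j + 1) hj).2 (hν (N - 1) j)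
        (hc (N - 1) j) (fun t ht => htr (N - 1) j hlt hj _
          (by rw [← hσN]; exact ⟨hσm hlt.le, by rw [hN1]⟩) t ht)
      simp only [b, S, hN1, hσN]
      exact this
    rw [Finset.sum_congr rfl e, Finset.sum_range_sub (fun j => D' (τ j)), hτ0, hτN]
  have hlt : N - 1 < N := Nat.sub_lt hN0 one_pos
  rw [← hfirst, hchain (N - 1) hlt, hrow (N - 1) hlt, hlast]

/-- Two paths which are homotopic with fixed end-points to the same path have the same total
jump. -/
theorem IsPrim.eq_of_homotopic (hΩ : IsSymplecticForm Ω) (hΛ₀ : IsLag Ω Λ₀)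
    {h h' : ℝ × ℝ → Submodule ℝ X} (hh : IsLagCont Ω Λ₀ h (Icc 0 1 ×ˢ Icc 0 1))
    (hh' : IsLagCont Ω Λ₀ h' (Icc 0 1 ×ˢ Icc 0 1))
    (heq : ∀ t ∈ Icc (0 : ℝ) 1, h (0, t) = h' (0, t))
    (h0 : ∀ s ∈ Icc (0 : ℝ) 1, h (s, 0) = h (0, 0)) (h1 : ∀ s ∈ Icc (0 : ℝ) 1, h (s, 1) = h (0, 1))
    (h0' : ∀ s ∈ Icc (0 : ℝ) 1, h' (s, 0) = h' (0, 0))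
    (h1' : ∀ s ∈ Icc (0 : ℝ) 1, h' (s, 1) = h' (0, 1)) {D D' : ℝ → ℤ}
    (hD : IsPrim Ω Λ₀ (fun t => h (1, t)) D) (hD' : IsPrim Ω Λ₀ (fun t => h' (1, t)) D') :
    D 1 - D 0 = D' 1 - D' 0 := by
  let k : ℝ × ℝ → Submodule ℝ X := fun y => if y.1 ≤ 0 then h (-y.1, y.2) else h' y
  have hneg : ∀ s ≤ (0 : ℝ), ∀ t, k (s, t) = h (-s, t) := fun s hs t => if_pos hs
  have hpos : ∀ s, (0 : ℝ) ≤ s → ∀ t ∈ Icc (0 : ℝ) 1, k (s, t) = h' (s, t) := by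
    intro s hs t ht
    rcases hs.eq_or_lt with rfl | hs
    · rw [hneg 0 le_rfl, neg_zero, heq t ht]
    · exact if_neg (not_le.2 hs)
  have hk : IsLagCont Ω Λ₀ k (Icc (-1) 1 ×ˢ Icc 0 1) := by
    have hU : (Icc (-1 : ℝ) 1 ×ˢ Icc (0 : ℝ) 1) =
        (Icc (-1 : ℝ) 0 ×ˢ Icc (0 : ℝ) 1) ∪ (Icc (0 : ℝ) 1 ×ˢ Icc (0 : ℝ) 1) := by
      rw [← union_prod, Icc_union_Icc_eq_Icc (by norm_num) (by norm_num)]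
    rw [hU]
    refine IsLagCont.union (isClosed_Icc.prod isClosed_Icc) (isClosed_Icc.prod isClosed_Icc) ?_ ?_
    · refine (hh.comp (φ := fun y : ℝ × ℝ => (-y.1, y.2)) (by fun_prop) ?_).congr ?_
      · rintro ⟨s, t⟩ ⟨hs, ht⟩
        exact ⟨⟨by linarith [hs.2], by linarith [hs.1]⟩, ht⟩
      · rintro ⟨s, t⟩ ⟨hs, ht⟩
        exact hneg s hs.2 t
    · refine hh'.congr ?_
      rintro ⟨s, t⟩ ⟨hs, ht⟩
      exact hpos s hs.1 t ht
  have side : ∀ t ∈ ({0, 1} : Set ℝ), (∀ s ∈ Icc (0 : ℝ) 1, h (s, t) = h (0, t)) →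
      (∀ s ∈ Icc (0 : ℝ) 1, h' (s, t) = h' (0, t)) →
      ∀ s ∈ Icc (-1 : ℝ) 1, k (s, t) = k (-1, t) := by
    intro t ht e e' s hs
    have htI : t ∈ Icc (0 : ℝ) 1 := by
      rcases ht with rfl | rfl <;> simp
    rw [hneg (-1) (by norm_num), e (- -1) (by norm_num)]
    rcases le_total s 0 with hs0 | hs0
    · rw [hneg s hs0, e _ ⟨by linarith, by linarith [hs.1]⟩]
    · rw [hpos s hs0 t htI, e' s ⟨hs0, hs.2⟩, heq t htI]
  refine IsPrim.homotopy hΩ hΛ₀ hk (side 0 (by simp) h0 h0') (side 1 (by simp) h1 h1') ?_ ?_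
  · have : (fun t => k (-1, t)) = fun t => h (1, t) := by
      ext1 t
      rw [hneg (-1) (by norm_num), neg_neg]
    rwa [this]
  · have : (fun t => k (1, t)) = fun t => h' (1, t) := by
      ext1 t
      exact if_neg (by norm_num)
    rwa [this]

theorem IsLagCont.of_hasFrameAt (hΩ : IsSymplecticForm Ω) (hΛ₀ : IsLag Ω Λ₀) {Y : Type*}
    [NormedAddCommGroup Y] [NormedSpace ℝ Y] {k : ℕ} {h : Y → Submodule ℝ X} {s : Set Y}
    (hh : ∀ y ∈ s, HasFrameAt Ω k h s y) : IsLagCont Ω Λ₀ h s := by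
  intro y hy
  obtain ⟨m, F, hF, hev⟩ := id (hh y hy)
  exact ⟨(hev.self_of_nhdsWithin hy).1, fun ν hν hc => (hh y hy).eventually_isCompl hy hν hc,
    fun ν ν' hν hν' hc hc' h1 h2 =>
      (hh y hy).eventually_chartSig_sub hΩ hy hΛ₀ hν hν' hc hc' h1 h2⟩

end HomotopyInvariance

section RegularCrossing

variable {X : Type*} [NormedAddCommGroup X] [NormedSpace ℝ X] {Ω : LinearMap.BilinForm ℝ X}
  {Λ₀ : Submodule ℝ X}

theorem signature_neg {M : Type*} [AddCommGroup M] [Module ℝ M] (Q : QuadraticForm ℝ M) :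
    signature (-Q) = -signature Q := by
  have h1 : sigNeg (-Q) = sigPos Q := by
    change sigPos (- -Q) = sigPos Q
    rw [neg_neg]
  have h2 : sigPos (-Q) = sigNeg Q := rfl
  simp only [signature, h1, h2]
  ring

variable [FiniteDimensional ℝ X]

/-- The path `Λ` is moved near `t` by the differentiable family `T` of endomorphisms, with
derivative `T'` at `t`. -/
structure IsMovedBy (Ω : LinearMap.BilinForm ℝ X) (Λ : ℝ → Submodule ℝ X) (t : ℝ)
    (T : ℝ → X →L[ℝ] X) (T' : X →L[ℝ] X) : Prop where
  hasDeriv : HasDerivWithinAt T T' (Icc 0 1) t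
  one : T t = 1
  map_eq : ∀ᶠ s in 𝓝[Icc 0 1] t, IsLag Ω (Λ s) ∧ (Λ t).map (T s : X →ₗ[ℝ] X) = Λ s

theorem HasFrameAt.exists_isMovedBy {Λ : ℝ → Submodule ℝ X} {t : ℝ} (ht : t ∈ Icc (0 : ℝ) 1)
    (h : HasFrameAt Ω 1 Λ (Icc 0 1) t) : ∃ T T', IsMovedBy Ω Λ t T T' := by
  obtain ⟨m, F, hF, hev⟩ := h
  obtain ⟨-, hli, hspan⟩ := hev.self_of_nhdsWithin ht
  have hinj : LinearMap.ker (Fintype.linearCombination ℝ (F t)) = ⊥ := by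
    rw [LinearMap.ker_eq_bot]
    exact hli.fintypeLinearCombination_injective
  obtain ⟨g, hg⟩ := LinearMap.exists_leftInverse_of_injective _ hinj
  let Ψ₀ : (Fin m → X) →ₗ[ℝ] (X →L[ℝ] X) :=
    { toFun := fun G => LinearMap.toContinuousLinearMap (Fintype.linearCombination ℝ G ∘ₗ g)
      map_add' := fun G G' => by
        ext x
        simp [Fintype.linearCombination_apply, smul_add, Finset.sum_add_distrib]
      map_smul' := fun c G => by
        ext x
        simp [Fintype.linearCombination_apply, Finset.smul_sum, smul_comm c] }
  let Ψ : (Fin m → X) →L[ℝ] (X →L[ℝ] X) := LinearMap.toContinuousLinearMap Ψ₀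
  have hΨ : ∀ G x, Ψ G x = Fintype.linearCombination ℝ G (g x) := fun G x => rfl
  have hd := (hF.differentiableWithinAt (by norm_num)).hasDerivWithinAt
  refine ⟨fun s => 1 + (Ψ (F s) - Ψ (F t)), Ψ (derivWithin F (Icc 0 1) t), ?_, by simp, ?_⟩
  · exact ((Ψ.hasFDerivAt.comp_hasDerivWithinAt t hd).sub_const _).const_add _
  · filter_upwards [hev] with s hs
    refine ⟨hs.1, ?_⟩
    rw [← hs.2.2, ← hspan, ← Fintype.range_linearCombination ℝ, ← Fintype.range_linearCombination ℝ,
      ← LinearMap.range_comp]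
    congr 1
    refine LinearMap.ext fun c => ?_
    have h1 : g (Fintype.linearCombination ℝ (F t) c) = c := LinearMap.congr_fun hg c
    simp [hΨ, h1]

namespace IsMovedBy

variable {Λ : ℝ → Submodule ℝ X} {t : ℝ} {T : ℝ → X →L[ℝ] X} {T' : X →L[ℝ] X}

theorem isLag (h : IsMovedBy Ω Λ t T T') (ht : t ∈ Icc (0 : ℝ) 1) : IsLag Ω (Λ t) :=
  (h.map_eq.self_of_nhdsWithin ht).1

theorem eventually_isUnit (h : IsMovedBy Ω Λ t T T') : ∀ᶠ s in 𝓝[Icc 0 1] t, IsUnit (T s) := by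
  have h1 : ∀ᶠ A in 𝓝 (T t), IsUnit A := by
    have : IsUnit (T t) := by rw [h.one]; exact isUnit_one
    exact Units.isOpen.mem_nhds this
  exact h.hasDeriv.continuousWithinAt.tendsto.eventually h1

/-- The vectors defining the crossing form exist and yield `Ω(ξ, T'ξ)`. -/
theorem exists_crossing (hΩ : IsSymplecticForm Ω) (h : IsMovedBy Ω Λ t T T')
    (ht : t ∈ Icc (0 : ℝ) 1) {ν : Submodule ℝ X} (hc : IsCompl (Λ t) ν) {ξ : X} (hξ : ξ ∈ Λ t) :
    ∃ η : ℝ → X, (∀ᶠ s in 𝓝[Icc 0 1] t, η s ∈ ν ∧ ξ + η s ∈ Λ s) ∧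
      HasDerivWithinAt (fun s => Ω ξ (η s)) (Ω ξ (T' ξ)) (Icc 0 1) t := by
  let P : X →L[ℝ] X := LinearMap.toContinuousLinearMap ((Λ t).projection ν hc)
  have hPmem : ∀ x, P x ∈ Λ t := fun x => Submodule.projection_apply_mem hc x
  have hPid : ∀ x ∈ Λ t, P x = x := fun x hx => (Submodule.projection_eq_self_iff hc x).2 hx
  have hPker : ∀ x, x - P x ∈ ν := fun x => by
    rw [← Submodule.projection_apply_eq_zero_iff hc]
    have := hPid _ (hPmem x)
    change P (x - P x) = 0
    rw [map_sub, this, sub_self]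
  let S : ℝ → X →L[ℝ] X := fun s => P * T s * P + (1 - P)
  have hS : HasDerivWithinAt S (P * T' * P) (Icc 0 1) t :=
    ((h.hasDeriv.const_mul P).mul_const P).add_const _
  have hPP : P * P = P := by
    ext x
    exact hPid _ (hPmem x)
  have hSt : S t = 1 := by
    simp only [S, h.one, mul_one, hPP]
    abel
  have hinv : HasFDerivAt Ring.inverse (-ContinuousLinearMap.mulLeftRight ℝ (X →L[ℝ] X) 1 1) (S t) := by
    have := hasFDerivAt_ringInverse (𝕜 := ℝ) (1 : (X →L[ℝ] X)ˣ)
    rw [hSt]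
    simpa using this
  have hw := hinv.comp_hasDerivWithinAt t hS
  let w : ℝ → X := fun s => Ring.inverse (S s) ξ
  obtain ⟨w', hw'⟩ : ∃ w', HasDerivWithinAt w w' (Icc 0 1) t :=
    ⟨_, hw.clm_apply (hasDerivWithinAt_const t (Icc (0 : ℝ) 1) ξ)⟩
  have hwt : w t = ξ := by simp [w, hSt]
  have hunit : ∀ᶠ s in 𝓝[Icc 0 1] t, IsUnit (S s) := by
    have h1 : ∀ᶠ A in 𝓝 (S t), IsUnit A :=
      Units.isOpen.mem_nhds (by rw [hSt]; exact isUnit_one)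
    exact hS.continuousWithinAt.tendsto.eventually h1
  have hSw : ∀ᶠ s in 𝓝[Icc 0 1] t, w s ∈ Λ t ∧ P (T s (w s)) = ξ := by
    filter_upwards [hunit] with s hs
    have h1 : S s (w s) = ξ := by
      have := Ring.mul_inverse_cancel _ hs
      exact congrArg (fun A : X →L[ℝ] X => A ξ) this
    have h2 : P (T s (P (w s))) + (w s - P (w s)) = ξ := h1
    have h3 : w s - P (w s) = 0 := by
      have h4 := congrArg (fun x => x - P x) h2
      simp only [map_add, hPid _ (hPmem _), hPid ξ hξ, map_sub, sub_self, add_zero] at h4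
      rw [← h4]
      abel
    have h5 : P (w s) = w s := (sub_eq_zero.1 h3).symm
    rw [h3, add_zero, h5] at h2
    exact ⟨h5 ▸ hPmem (w s), h2⟩
  refine ⟨fun s => T s (w s) - ξ, ?_, ?_⟩
  · filter_upwards [hSw, h.map_eq] with s hs hm
    refine ⟨?_, ?_⟩
    · have := hPker (T s (w s))
      rwa [hs.2] at this
    · rw [add_sub_cancel, ← hm.2]
      exact ⟨w s, hs.1, rfl⟩
  · have hder : HasDerivWithinAt (fun s => T s (w s) - w s) (T' ξ) (Icc 0 1) t := by
      have := (h.hasDeriv.clm_apply hw').sub hw'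
      simp only [hwt, h.one, one_apply_eq_self, add_sub_cancel_right] at this
      exact this
    have h2 : HasDerivWithinAt (fun s => Ω ξ (T s (w s) - w s)) (Ω ξ (T' ξ)) (Icc 0 1) t :=
      (LinearMap.toContinuousLinearMap (Ω ξ)).hasFDerivAt.comp_hasDerivWithinAt t hder
    refine h2.congr_of_eventuallyEq_of_mem ?_ ht
    filter_upwards [hSw] with s hs
    rw [map_sub, map_sub, hΩ.alt, (h.isLag ht).2 ξ hξ (w s) hs.1]

theorem crossing_unique (hΩ : IsSymplecticForm Ω) (h : IsMovedBy Ω Λ t T T')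
    (ht : t ∈ Icc (0 : ℝ) 1) {ν : Submodule ℝ X} (hc : IsCompl (Λ t) ν)
    (hcs : ∀ᶠ s in 𝓝[Icc 0 1] t, IsCompl (Λ s) ν) {ξ : X}
    (hξ : ξ ∈ Λ t) {η : ℝ → X} {r : ℝ} (hη : ∀ᶠ s in 𝓝[Icc 0 1] t, η s ∈ ν ∧ ξ + η s ∈ Λ s)
    (hr : HasDerivWithinAt (fun s => Ω ξ (η s)) r (Icc 0 1) t) : r = Ω ξ (T' ξ) := by
  obtain ⟨η', h1, h2⟩ := h.exists_crossing hΩ ht hc hξ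
  have heq : (fun s => Ω ξ (η s)) =ᶠ[𝓝[Icc 0 1] t] fun s => Ω ξ (η' s) := by
    filter_upwards [hcs, hη, h1] with s hs h3 h4
    have h5 : η s - η' s ∈ Λ s ⊓ ν :=
      ⟨by have := (Λ s).sub_mem h3.2 h4.2; rwa [add_sub_add_left_eq_sub] at this,
        ν.sub_mem h3.1 h4.1⟩
    rw [hs.inf_eq_bot, Submodule.mem_bot, sub_eq_zero] at h5
    rw [h5]
  have h3 := h2.congr_of_eventuallyEq_of_mem heq ht
  exact (uniqueDiffOn_Icc zero_lt_one t ht).eq_deriv _ hr h3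

theorem radical_chartForm (hΩ : IsSymplecticForm Ω) (hΛ₀ : IsLag Ω Λ₀) {ν L : Submodule ℝ X}
    (hν : IsLag Ω ν) (hc : IsCompl Λ₀ ν) (hL : IsLag Ω L) {ξ : L} :
    ξ ∈ ((chartForm Ω hc).restrict L).radical ↔ Λ₀.projection ν hc ξ ∈ L := by
  rw [mem_radical_iff_polar]
  have hpol : ∀ η : L, QuadraticMap.polar ((chartForm Ω hc).restrict L) ξ η =
      2 * Ω (Λ₀.projection ν hc ξ) η := by
    intro η
    have h1 := form_projection_symm hΩ hc hΛ₀ hν (hL.2 ξ ξ.2 η η.2)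
    have h2 : QuadraticMap.polar ((chartForm Ω hc).restrict L) ξ η =
      Ω (Λ₀.projection ν hc (ξ + η)) (ξ + η) - Ω (Λ₀.projection ν hc ξ) ξ -
        Ω (Λ₀.projection ν hc η) η := rfl
    rw [h2]
    simp only [map_add, LinearMap.add_apply]
    linarith
  constructor
  · intro h
    refine hL.mem_of_orthogonal hΩ fun η hη => ?_
    have := h ⟨η, hη⟩
    rw [hpol] at this
    rw [hΩ.swap]
    simp only at this
    linarith
  · intro h η
    rw [hpol, hL.2 _ h η η.2, mul_zero]

/-- The signature of the chart forms jumps at a regular crossing by the signature of the crossing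
form, and regular crossings are isolated. -/
theorem eventually_chartSig (hΩ : IsSymplecticForm Ω) (hΛ₀ : IsLag Ω Λ₀)
    (h : IsMovedBy Ω Λ t T T') (ht : t ∈ Icc (0 : ℝ) 1) {Γ : QuadraticForm ℝ ↥(Λ t ⊓ Λ₀)}
    (hΓ : ∀ ξ, Γ ξ = Ω ξ (T' ξ)) (hΓr : Γ.radical = ⊥) {ν : Submodule ℝ X} (hν : IsLag Ω ν)
    (hc₀ : IsCompl Λ₀ ν) (hc : IsCompl (Λ t) ν) :
    ∀ᶠ s in 𝓝[Icc 0 1] t,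
      chartSig Ω hc₀ (Λ s) = chartSig Ω hc₀ (Λ t) + (SignType.sign (s - t) : ℤ) * signature Γ ∧
      (s ≠ t → Λ s ⊓ Λ₀ = ⊥) := by
  let π : X →L[ℝ] X := LinearMap.toContinuousLinearMap (Λ₀.projection ν hc₀)
  let Ωc : X →L[ℝ] X →L[ℝ] ℝ := LinearMap.toContinuousBilinearMap Ω
  have hπ : ∀ x, π x = Λ₀.projection ν hc₀ x := fun x => rfl
  let Q : ℝ → QuadraticForm ℝ (Λ t) := fun s =>
    (chartForm Ω hc₀).comp ((T s : X →ₗ[ℝ] X) ∘ₗ (Λ t).subtype)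
  have hQ : ∀ s x, Q s x = Ω (π (T s x)) (T s x) := fun s x => rfl
  have hLt := h.isLag ht
  have hQt : Q t = (chartForm Ω hc₀).restrict (Λ t) := by
    ext x
    rw [hQ, h.one]
    rfl
  let D : Λ t → ℝ := fun x => Ω (π (T' x)) x + Ω (π x) (T' x)
  have hder : ∀ x : Λ t, HasDerivWithinAt (fun s => Q s x) (D x) (Icc 0 1) t := by
    intro x
    have h1 : HasDerivWithinAt (fun s => T s (x : X)) (T' x) (Icc 0 1) t := by
      simpa using h.hasDeriv.clm_apply (hasDerivWithinAt_const t (Icc (0 : ℝ) 1) (x : X))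
    have h2 : HasDerivWithinAt (fun s => Ωc (π (T s (x : X)))) (Ωc (π (T' x))) (Icc 0 1) t :=
      (Ωc.comp π).hasFDerivAt.comp_hasDerivWithinAt t h1
    have h3 := h2.clm_apply h1
    rw [h.one] at h3
    exact h3
  have hslope : ∀ x : Λ t, Tendsto (fun s => (Q s x - Q t x) / (s - t)) (𝓝[Icc 0 1 \ {t}] t)
      (𝓝 (D x)) := by
    intro x
    have := hasDerivWithinAt_iff_tendsto_slope.1 (hder x)
    refine this.congr fun s => ?_
    rw [slope_def_field]
  let j : ↥(Λ t ⊓ Λ₀) →ₗ[ℝ] Λ t := Submodule.inclusion inf_le_left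
  have hj : Function.Injective j := Submodule.inclusion_injective _
  have hjr : LinearMap.range j = (Q t).radical := by
    rw [hQt]
    ext x
    rw [radical_chartForm hΩ hΛ₀ hν hc₀ hLt]
    constructor
    · rintro ⟨y, rfl⟩
      have : Λ₀.projection ν hc₀ (y : X) = y := (Submodule.projection_eq_self_iff hc₀ _).2 y.2.2
      change Λ₀.projection ν hc₀ (y : X) ∈ Λ t
      rw [this]
      exact y.2.1
    · intro hx
      have h1 : (x : X) - Λ₀.projection ν hc₀ x ∈ Λ t ⊓ ν := by
        refine ⟨(Λ t).sub_mem x.2 hx, ?_⟩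
        refine (Submodule.projection_apply_eq_zero_iff hc₀).1 ?_
        rw [map_sub, sub_eq_zero]
        exact ((Submodule.projection_eq_self_iff hc₀ _).2 (Submodule.projection_apply_mem hc₀ _)).symm
      rw [hc.inf_eq_bot, Submodule.mem_bot, sub_eq_zero] at h1
      have h2 : (x : X) ∈ Λ₀ := by
        rw [h1]
        exact Submodule.projection_apply_mem hc₀ _
      exact ⟨⟨x, x.2, h2⟩, rfl⟩
  have hΓD : ∀ u, Γ u = D (j u) := by
    intro u
    have h1 : π (u : X) = u := (Submodule.projection_eq_self_iff hc₀ _).2 u.2.2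
    have h2 : Ω (π (T' u)) u = 0 := hΛ₀.2 _ (Submodule.projection_apply_mem hc₀ _) _ u.2.2
    change Γ u = Ω (π (T' u)) u + Ω (π u) (T' u)
    rw [h2, h1, zero_add, hΓ]
  have hright : ∀ᶠ s in 𝓝[Icc 0 1 ∩ Ioi t] t,
      signature (Q s) = signature (Q t) + signature Γ ∧ (Q s).radical = ⊥ := by
    refine eventually_signature_jump (τ := fun s => s - t) (D := D) ?_ ?_ j hj hjr Γ hΓD hΓr
    · refine tendsto_nhdsWithin_iff.2 ⟨?_, ?_⟩
      · have : Tendsto (fun s => s - t) (𝓝 t) (𝓝 (t - t)) := (continuous_id.sub continuous_const).tendsto t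
        rw [sub_self] at this
        exact this.mono_left nhdsWithin_le_nhds
      · filter_upwards [self_mem_nhdsWithin] with s hs
        exact sub_pos.2 (mem_Ioi.1 hs.2)
    · intro x
      exact (hslope x).mono_left (nhdsWithin_mono t fun s hs => ⟨hs.1, ne_of_gt hs.2⟩)
  have hleft : ∀ᶠ s in 𝓝[Icc 0 1 ∩ Iio t] t,
      signature (Q s) = signature (Q t) + signature (-Γ) ∧ (Q s).radical = ⊥ := by
    refine eventually_signature_jump (τ := fun s => t - s) (D := fun x => -D x) ?_ ?_ j hj hjr (-Γ) ?_ ?_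
    · refine tendsto_nhdsWithin_iff.2 ⟨?_, ?_⟩
      · have : Tendsto (fun s => t - s) (𝓝 t) (𝓝 (t - t)) := (continuous_const.sub continuous_id).tendsto t
        rw [sub_self] at this
        exact this.mono_left nhdsWithin_le_nhds
      · filter_upwards [self_mem_nhdsWithin] with s hs
        exact sub_pos.2 (mem_Iio.1 hs.2)
    · intro x
      refine ((hslope x).mono_left (nhdsWithin_mono t fun s hs => ⟨hs.1, ne_of_lt hs.2⟩)).neg.congr
        fun s => ?_
      rw [← div_neg, neg_sub]
    · intro u
      change -Γ u = -D (j u)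
      rw [hΓD]
    · rw [radical_neg, hΓr]
  have hconv : ∀ᶠ s in 𝓝[Icc 0 1] t, chartSig Ω hc₀ (Λ s) = signature (Q s) ∧
      ((Q s).radical = ⊥ → Λ s ⊓ Λ₀ = ⊥) := by
    filter_upwards [h.map_eq, h.eventually_isUnit] with s hs hu
    have hinj : Function.Injective (T s) := by
      obtain ⟨u, hu⟩ := hu
      intro x y hxy
      have e : ∀ z, (↑u⁻¹ : X →L[ℝ] X) (T s z) = z := fun z => by
        rw [← hu]
        exact congrArg (fun A : X →L[ℝ] X => A z) u.inv_mul
      rw [← e x, hxy, e y]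
    let e : Λ t ≃ₗ[ℝ] Λ s :=
      (Submodule.equivMapOfInjective (T s : X →ₗ[ℝ] X) hinj (Λ t)).trans (LinearEquiv.ofEq _ _ hs.2)
    have he : ∀ x, (e x : X) = T s x := fun x => rfl
    refine ⟨(signature_congr e fun x => rfl).symm, fun hr => ?_⟩
    rw [Submodule.eq_bot_iff]
    rintro ξ ⟨h1, h2⟩
    have h3 : (⟨ξ, h1⟩ : Λ s) ∈ ((chartForm Ω hc₀).restrict (Λ s)).radical := by
      rw [radical_chartForm hΩ hΛ₀ hν hc₀ hs.1]
      have : Λ₀.projection ν hc₀ ξ = ξ := (Submodule.projection_eq_self_iff hc₀ _).2 h2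
      change Λ₀.projection ν hc₀ ξ ∈ Λ s
      rwa [this]
    have h4 : e.symm ⟨ξ, h1⟩ ∈ (Q s).radical := by
      rw [mem_radical_iff_polar] at h3 ⊢
      intro y
      have h5 := h3 (e y)
      have h6 : QuadraticMap.polar (Q s) (e.symm ⟨ξ, h1⟩) y =
          QuadraticMap.polar ((chartForm Ω hc₀).restrict (Λ s)) (e (e.symm ⟨ξ, h1⟩)) (e y) := by
        simp only [QuadraticMap.polar]
        rw [← map_add]
        rfl
      rw [h6, e.apply_symm_apply, h5]
    rw [hr, Submodule.mem_bot, LinearEquiv.map_eq_zero_iff] at h4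
    exact congrArg Subtype.val h4
  have hsplit : 𝓝[Icc (0 : ℝ) 1] t ≤ 𝓝[Icc 0 1 ∩ Iio t] t ⊔ (𝓝[Icc 0 1 ∩ Ioi t] t ⊔ 𝓝[{t}] t) := by
    rw [← nhdsWithin_union, ← nhdsWithin_union]
    refine nhdsWithin_mono t fun s hs => ?_
    rcases lt_trichotomy s t with h1 | h1 | h1
    · exact Or.inl ⟨hs, h1⟩
    · exact Or.inr (Or.inr h1)
    · exact Or.inr (Or.inl ⟨hs, h1⟩)
  have h0 : chartSig Ω hc₀ (Λ t) = signature (Q t) := by rw [hQt]; rfl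
  refine hsplit (eventually_sup.2 ⟨?_, eventually_sup.2 ⟨?_, ?_⟩⟩)
  · filter_upwards [hleft, self_mem_nhdsWithin, nhdsWithin_mono t inter_subset_left hconv]
      with s h1 h2 h3
    refine ⟨?_, fun _ => h3.2 h1.2⟩
    rw [h3.1, h1.1, h0, signature_neg, sign_neg (sub_neg.2 h2.2)]
    simp
  · filter_upwards [hright, self_mem_nhdsWithin, nhdsWithin_mono t inter_subset_left hconv]
      with s h1 h2 h3
    refine ⟨?_, fun _ => h3.2 h1.2⟩
    rw [h3.1, h1.1, h0, sign_pos (sub_pos.2 h2.2)]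
    simp
  · rw [nhdsWithin_singleton]
    refine eventually_pure.2 ⟨?_, fun hne => absurd rfl hne⟩
    simp

end IsMovedBy

/-- A path whose chart signatures jump by `g` has a primitive, whose total increment is twice the
half-weighted sum of the jumps. -/
theorem exists_isPrim {Λ : ℝ → Submodule ℝ X} (g : ℝ → ℤ)
    (hg : ∀ t ∈ Icc (0 : ℝ) 1, ∀ ν, IsLag Ω ν → ∀ hc : IsCompl Λ₀ ν, IsCompl (Λ t) ν →
      ∀ᶠ s in 𝓝[Icc 0 1] t,
        chartSig Ω hc (Λ s) = chartSig Ω hc (Λ t) + (SignType.sign (s - t) : ℤ) * g t)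
    (hiso : ∀ t ∈ Icc (0 : ℝ) 1, ∀ᶠ s in 𝓝[Icc 0 1] t, s ≠ t → g s = 0) :
    ∃ D, IsPrim Ω Λ₀ Λ D ∧
      ((D 1 - D 0 : ℤ) : ℝ) / 2 = (g 0 : ℝ) / 2 + ∑ᶠ t ∈ Ioo (0 : ℝ) 1, (g t : ℝ) + (g 1 : ℝ) / 2 := by
  let Z : Set ℝ := {t | t ∈ Icc (0 : ℝ) 1 ∧ g t ≠ 0}
  have hZfin : Z.Finite := by
    have key : (Icc (0 : ℝ) 1 ∩ Z).Finite := by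
      refine isCompact_Icc.induction_on (p := fun A => (A ∩ Z).Finite) (by simp)
        (fun A B hAB hB => hB.subset (inter_subset_inter_left _ hAB))
        (fun A B hA hB => by rw [union_inter_distrib_right]; exact hA.union hB) ?_
      intro t ht
      refine ⟨{s | s ∈ Icc (0 : ℝ) 1 ∧ (s ≠ t → g s = 0)}, ?_, ?_⟩
      · filter_upwards [hiso t ht, self_mem_nhdsWithin] with s h1 h2
        exact ⟨h2, h1⟩
      · refine (finite_singleton t).subset ?_
        rintro s ⟨h1, h2⟩
        by_contra hne
        exact h2.2 (h1.2 hne)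
    exact key.subset fun t ht => ⟨ht.1, ht⟩
  let D : ℝ → ℤ := fun t => ∑ x ∈ hZfin.toFinset, g x * (SignType.sign (t - x) : ℤ)
  refine ⟨D, ?_, ?_⟩
  · intro ν hν hc t ht htr
    have hterm : ∀ x ∈ hZfin.toFinset, ∀ᶠ s in 𝓝[Icc (0 : ℝ) 1] t,
        g x * (SignType.sign (s - x) : ℤ) - g x * (SignType.sign (t - x) : ℤ) =
          if x = t then (SignType.sign (s - t) : ℤ) * g t else 0 := by
      intro x _
      by_cases hx : x = t
      · subst hx
        refine Eventually.of_forall fun s => ?_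
        simp [mul_comm]
      · simp only [if_neg hx]
        refine nhdsWithin_le_nhds ?_
        rcases lt_or_gt_of_ne hx with h1 | h1
        · filter_upwards [eventually_gt_nhds h1] with s hs
          rw [sign_pos (sub_pos.2 hs), sign_pos (sub_pos.2 h1), sub_self]
        · filter_upwards [eventually_lt_nhds h1] with s hs
          rw [sign_neg (sub_neg.2 hs), sign_neg (sub_neg.2 h1), sub_self]
    filter_upwards [hg t ht ν hν hc htr, (Filter.eventually_all_finset _).2 hterm] with s h1 h2
    have h3 : D s - D t = (SignType.sign (s - t) : ℤ) * g t := by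
      simp only [D]
      rw [← Finset.sum_sub_distrib, Finset.sum_congr rfl h2, Finset.sum_ite_eq']
      split_ifs with h4
      · rfl
      · have : g t = 0 := by
          by_contra hne
          exact h4 (hZfin.mem_toFinset.2 ⟨ht, hne⟩)
        simp [this]
    linarith
  · have hfs : ∑ᶠ t ∈ Ioo (0 : ℝ) 1, (g t : ℝ) =
        ∑ x ∈ hZfin.toFinset, if x ∈ Ioo (0 : ℝ) 1 then (g x : ℝ) else 0 := by
      rw [← finsum_mem_coe_finset, finsum_mem_def, finsum_mem_def]
      refine finsum_congr fun x => ?_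
      simp only [indicator]
      by_cases hx : x ∈ Ioo (0 : ℝ) 1
      · by_cases hg0 : g x = 0
        · simp [hg0]
        · have : x ∈ (hZfin.toFinset : Set ℝ) := by
            rw [hZfin.coe_toFinset]
            exact ⟨Ioo_subset_Icc_self hx, hg0⟩
          rw [if_pos hx, if_pos this]
      · simp [hx]
    have hpt : ∀ a : ℝ, a ∈ Icc (0 : ℝ) 1 → (g a : ℝ) =
        ∑ x ∈ hZfin.toFinset, if x = a then (g x : ℝ) else 0 := by
      intro a ha
      rw [Finset.sum_ite_eq']
      split_ifs with h4
      · rfl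
      · have : g a = 0 := by
          by_contra hne
          exact h4 (hZfin.mem_toFinset.2 ⟨ha, hne⟩)
        simp [this]
    rw [hfs, hpt 0 (by simp), hpt 1 (by simp), Finset.sum_div, Finset.sum_div,
      ← Finset.sum_add_distrib, ← Finset.sum_add_distrib]
    simp only [D]
    rw [← Finset.sum_sub_distrib]
    push_cast
    rw [Finset.sum_div]
    refine Finset.sum_congr rfl fun x hx => ?_
    have hxI : x ∈ Icc (0 : ℝ) 1 := (hZfin.mem_toFinset.1 hx).1
    rcases hxI.1.eq_or_lt with rfl | h0
    · simp
    · rcases hxI.2.eq_or_lt with rfl | h1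
      · simp
      · rw [if_neg h0.ne', if_neg h1.ne, if_pos ⟨h0, h1⟩, sign_pos (sub_pos.2 h1),
          sign_neg (sub_neg.2 h0)]
        push_cast
        simp

theorem signature_eq_zero {M : Type*} [AddCommGroup M] [Module ℝ M] [FiniteDimensional ℝ M]
    (h : Module.finrank ℝ M = 0) (Q : QuadraticForm ℝ M) : signature Q = 0 := by
  have : Subsingleton M := Module.finrank_zero_iff.1 h
  have h1 : Q = -Q := by
    ext x
    rw [Subsingleton.elim x 0]
    simp
  have h2 := signature_neg Q
  rw [← h1] at h2
  omega

/-- A path of Lagrangian subspaces with regular crossings has a primitive which computes the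
half-weighted sum of the signatures of its crossing forms. -/
theorem exists_isPrim_of_crossing (hΩ : IsSymplecticForm Ω) (hΛ₀ : IsLag Ω Λ₀)
    {Λ : ℝ → Submodule ℝ X} (hΛ : ∀ t ∈ Icc (0 : ℝ) 1, HasFrameAt Ω 1 Λ (Icc 0 1) t)
    (Γ : ∀ t, QuadraticForm ℝ ↥(Λ t ⊓ Λ₀))
    (hΓ : ∀ t ∈ Icc (0 : ℝ) 1, (∃ ν, IsLag Ω ν ∧ IsCompl (Λ t) ν ∧ ∀ ξ : ↥(Λ t ⊓ Λ₀), ∃ η : ℝ → X,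
      (∀ᶠ s in 𝓝[Icc 0 1] t, η s ∈ ν ∧ (ξ : X) + η s ∈ Λ s) ∧
      HasDerivWithinAt (fun s => Ω ξ (η s)) (Γ t ξ) (Icc 0 1) t) ∧
      ∀ ξ : ↥(Λ t ⊓ Λ₀), (∀ ζ, QuadraticMap.polar (Γ t) ξ ζ = 0) → ξ = 0) :
    ∃ D, IsPrim Ω Λ₀ Λ D ∧ ((D 1 - D 0 : ℤ) : ℝ) / 2 = (signature (Γ 0) : ℝ) / 2 +
      ∑ᶠ t ∈ Ioo (0 : ℝ) 1, (signature (Γ t) : ℝ) + (signature (Γ 1) : ℝ) / 2 := by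
  have key : ∀ t ∈ Icc (0 : ℝ) 1, ∀ ν, IsLag Ω ν → ∀ hc : IsCompl Λ₀ ν, IsCompl (Λ t) ν →
      ∀ᶠ s in 𝓝[Icc 0 1] t, chartSig Ω hc (Λ s) =
        chartSig Ω hc (Λ t) + (SignType.sign (s - t) : ℤ) * signature (Γ t) ∧
        (s ≠ t → Λ s ⊓ Λ₀ = ⊥) := by
    intro t ht ν hν hc hct
    obtain ⟨T, T', hT⟩ := (hΛ t ht).exists_isMovedBy ht
    obtain ⟨⟨ν₁, hν₁, hc₁, hη⟩, hnd⟩ := hΓ t ht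
    refine hT.eventually_chartSig hΩ hΛ₀ ht (fun ξ => ?_)
      ((radical_eq_bot_iff_polar (Γ t)).2 hnd) hν hc hct
    obtain ⟨η, h1, h2⟩ := hη ξ
    exact hT.crossing_unique hΩ ht hc₁ ((hΛ t ht).eventually_isCompl ht hν₁ hc₁) ξ.2.1 h1 h2
  refine exists_isPrim (fun t => signature (Γ t)) (fun t ht ν hν hc hct => ?_) fun t ht => ?_
  · exact (key t ht ν hν hc hct).mono fun s hs => hs.1
  · obtain ⟨T, T', hT⟩ := (hΛ t ht).exists_isMovedBy ht
    obtain ⟨ν, hν, hc, hct⟩ := exists_common_complement hΩ (hT.isLag ht) hΛ₀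
    refine (key t ht ν hν hc hct).mono fun s hs hne => signature_eq_zero ?_ _
    rw [hs.2 hne, finrank_bot]

end RegularCrossing

section MaslovUniqueness

variable {V : Type*} [NormedAddCommGroup V] [NormedSpace ℝ V]

theorem symp_add_left (ξ ξ' η : Cot V) : symp (ξ + ξ') η = symp ξ η + symp ξ' η := by
  simp [symp]; ring

theorem symp_add_right (ξ η η' : Cot V) : symp ξ (η + η') = symp ξ η + symp ξ η' := by
  simp [symp]; ring

theorem symp_smul_left (c : ℝ) (ξ η : Cot V) : symp (c • ξ) η = c * symp ξ η := by
  simp [symp]; ring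

theorem symp_smul_right (c : ℝ) (ξ η : Cot V) : symp ξ (c • η) = c * symp ξ η := by
  simp [symp]; ring

theorem symp_swap (ξ η : Cot V) : symp ξ η = -symp η ξ := by
  simp [symp]

theorem symp_self (ξ : Cot V) : symp ξ ξ = 0 := by
  simp [symp]

/-- The symplectic form as a bilinear form. -/
def sympB (V : Type*) [NormedAddCommGroup V] [NormedSpace ℝ V] :
    LinearMap.BilinForm ℝ (Cot V) :=
  LinearMap.mk₂ ℝ symp symp_add_left symp_smul_left symp_add_right symp_smul_right

theorem symp_zero_left (η : Cot V) : symp 0 η = 0 := by simp [symp]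

theorem symp_zero_right (η : Cot V) : symp η 0 = 0 := by simp [symp]

theorem symp_neg_left (ξ η : Cot V) : symp (-ξ) η = -symp ξ η := by
  simp [symp]; ring

theorem symp_sub_left (ξ ξ' η : Cot V) : symp (ξ - ξ') η = symp ξ η - symp ξ' η := by
  simp [symp]; ring

theorem symp_nondegenerate {ξ : Cot V} (h : ∀ η, symp ξ η = 0) : ξ = 0 := by
  have h2 : ξ.2 = 0 := by
    ext q
    simpa [symp] using h (q, 0)
  have h1 : ξ.1 = 0 := by
    refine SeparatingDual.eq_zero_of_forall_dual_eq_zero (R := ℝ) fun p => ?_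
    simpa [symp] using h (0, p)
  exact Prod.ext h1 h2

variable [FiniteDimensional ℝ V]

theorem finrank_dual_eq : Module.finrank ℝ (V →L[ℝ] ℝ) = Module.finrank ℝ V := by
  rw [(LinearMap.toContinuousLinearMap (𝕜 := ℝ) (E := V) (F' := ℝ)).symm.finrank_eq]
  exact Subspace.dual_finrank_eq

theorem finrank_cot : Module.finrank ℝ (Cot V) = Module.finrank ℝ V + Module.finrank ℝ V := by
  rw [Module.finrank_prod, finrank_dual_eq]

/-- A complex structure compatible with the symplectic form. -/
theorem exists_compatible_complex_structure (V : Type*) [NormedAddCommGroup V] [NormedSpace ℝ V]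
    [FiniteDimensional ℝ V] : ∃ J : Cot V →ₗ[ℝ] Cot V, (∀ x y, symp (J x) (J y) = symp x y) ∧
      (∀ x y, symp x (J y) = symp y (J x)) ∧ ∀ x, x ≠ 0 → 0 < symp x (J x) := by
  let b := Module.finBasis ℝ V
  let β : V →ₗ[ℝ] V →ₗ[ℝ] ℝ := ∑ i, (b.coord i).smulRight (b.coord i)
  have hβ : ∀ x y, β x y = ∑ i, b.repr x i * b.repr y i := by
    intro x y
    simp [β, LinearMap.sum_apply]
  have hβs : ∀ x y, β x y = β y x := fun x y => by
    rw [hβ, hβ]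
    exact Finset.sum_congr rfl fun i _ => mul_comm _ _
  have hβp : ∀ x, x ≠ 0 → 0 < β x x := by
    intro x hx
    rw [hβ]
    obtain ⟨i, hi⟩ : ∃ i, b.repr x i ≠ 0 := by
      by_contra! hcon
      exact hx (b.repr.map_eq_zero_iff.1 (Finsupp.ext hcon))
    exact Finset.sum_pos' (fun j _ => mul_self_nonneg _) ⟨i, Finset.mem_univ _, mul_self_pos.2 hi⟩
  let φ₀ : V →ₗ[ℝ] (V →L[ℝ] ℝ) :=
    (LinearMap.toContinuousLinearMap (𝕜 := ℝ) (E := V) (F' := ℝ)).toLinearMap ∘ₗ β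
  have hφ₀ : ∀ x y, φ₀ x y = β x y := fun x y => rfl
  have hinj : Function.Injective φ₀ := by
    rw [injective_iff_map_eq_zero]
    intro x hx
    by_contra hne
    have := hβp x hne
    rw [← hφ₀, hx] at this
    simp at this
  let φ : V ≃ₗ[ℝ] (V →L[ℝ] ℝ) :=
    LinearEquiv.ofInjectiveOfFinrankEq φ₀ hinj finrank_dual_eq.symm
  have hφ : ∀ x y, φ x y = β x y := fun x y => rfl
  let J : Cot V →ₗ[ℝ] Cot V :=
    (φ.symm.toLinearMap ∘ₗ LinearMap.snd ℝ _ _).prod (-(φ.toLinearMap ∘ₗ LinearMap.fst ℝ _ _))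
  have hJ : ∀ x : Cot V, J x = (φ.symm x.2, -φ x.1) := fun x => rfl
  have hs : ∀ x y : V, φ x y = φ y x := fun x y => by rw [hφ, hφ, hβs]
  have hJs : ∀ x y, symp x (J y) = φ (φ.symm x.2) (φ.symm y.2) + φ y.1 x.1 := by
    intro x y
    simp [hJ, symp]
  refine ⟨J, ?_, ?_, ?_⟩
  · intro x y
    obtain ⟨p, hp⟩ := φ.surjective x.2
    obtain ⟨p', hp'⟩ := φ.surjective y.2
    simp only [hJ, symp, ← hp, ← hp', LinearEquiv.symm_apply_apply]
    simp only [neg_apply]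
    rw [hs x.1, hs y.1]
    ring
  · intro x y
    rw [hJs, hJs, hs (φ.symm x.2), hs y.1]
  · intro x hx
    rw [hJs, hφ, hφ]
    have h1 : ∀ y, 0 ≤ β y y := fun y => by
      rcases eq_or_ne y 0 with rfl | h
      · simp
      · exact (hβp y h).le
    by_cases h : x.1 = 0
    · have h2 : φ.symm x.2 ≠ 0 := by
        intro h0
        exact hx (Prod.ext h (φ.symm.map_eq_zero_iff.1 h0))
      have := hβp _ h2
      have := h1 x.1
      linarith
    · have := hβp _ h
      have := h1 (φ.symm x.2)
      linarith

theorem isSymplecticForm_sympB : IsSymplecticForm (sympB V) where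
  alt := symp_self
  nondeg := fun _ h => symp_nondegenerate h
  exists_complex := exists_compatible_complex_structure V

theorem isLagrangian_iff {Λ : Submodule ℝ (Cot V)} : IsLagrangian Λ ↔ IsLag (sympB V) Λ := by
  unfold IsLagrangian IsLag
  rw [finrank_cot]
  refine and_congr ⟨fun h => by rw [h], fun h => by omega⟩ Iff.rfl

theorem IsLagrangianFamilyOn.hasFrameAt {Y : Type*} [NormedAddCommGroup Y] [NormedSpace ℝ Y]
    {k : ℕ} {Λ : Y → Submodule ℝ (Cot V)} {s : Set Y} (h : IsLagrangianFamilyOn k Λ s) {y : Y}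
    (hy : y ∈ s) : HasFrameAt (sympB V) k Λ s y := by
  obtain ⟨u, hu, F, hF, hspan⟩ := h.2 y hy
  have hmem : s ∩ u ∈ 𝓝[s] y := inter_mem self_mem_nhdsWithin (mem_nhdsWithin_of_mem_nhds hu)
  refine ⟨_, F, (hF y ⟨hy, mem_of_mem_nhds hu⟩).mono_of_mem_nhdsWithin hmem, ?_⟩
  filter_upwards [hmem] with z hz
  exact ⟨isLagrangian_iff.1 (h.1 z hz.1), hspan z hz⟩

theorem IsRegularMaslovIndex.exists_isPrim {Λ : ℝ → Submodule ℝ (Cot V)}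
    {Λ₀ : Submodule ℝ (Cot V)} (hΛ₀ : IsLagrangian Λ₀) {m : ℝ}
    (h : IsRegularMaslovIndex Λ Λ₀ m) :
    ∃ D, IsPrim (sympB V) Λ₀ Λ D ∧ ((D 1 - D 0 : ℤ) : ℝ) / 2 = m := by
  obtain ⟨hfam, Γ, hΓ, rfl⟩ := h
  refine exists_isPrim_of_crossing (X := Cot V) (Ω := sympB V) isSymplecticForm_sympB
    (isLagrangian_iff.1 hΛ₀) (fun t ht => hfam.hasFrameAt ht) Γ fun t ht => ?_
  obtain ⟨⟨ν, hν, hc, hη⟩, hnd⟩ := hΓ t ht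
  exact ⟨⟨ν, isLagrangian_iff.1 hν, hc, hη⟩, hnd⟩

theorem IsMaslovIndex.unique {Λ : ℝ → Submodule ℝ (Cot V)} {Λ₀ : Submodule ℝ (Cot V)}
    (hΛ₀ : IsLagrangian Λ₀) {m m' : ℝ} (h : IsMaslovIndex Λ Λ₀ m) (h' : IsMaslovIndex Λ Λ₀ m') :
    m = m' := by
  obtain ⟨Λ₁, ⟨k, hk, hk01, hkend⟩, hreg⟩ := h
  obtain ⟨Λ₂, ⟨k', hk', hk01', hkend'⟩, hreg'⟩ := h'
  obtain ⟨D, hD, rfl⟩ := hreg.exists_isPrim hΛ₀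
  obtain ⟨D', hD', rfl⟩ := hreg'.exists_isPrim hΛ₀
  have hΩ := isSymplecticForm_sympB (V := V)
  have hL := isLagrangian_iff.1 hΛ₀
  have hprim : ∀ {Λ Λ' : ℝ → Submodule ℝ (Cot V)} {D : ℝ → ℤ}, IsPrim (sympB V) Λ₀ Λ D →
      (∀ t ∈ Icc (0 : ℝ) 1, Λ' t = Λ t) → IsPrim (sympB V) Λ₀ Λ' D := by
    intro Λ Λ' D h heq ν hν hc t ht hct
    rw [heq t ht] at hct ⊢
    filter_upwards [h ν hν hc t ht hct, self_mem_nhdsWithin] with s hs hsI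
    rw [heq s hsI, hs]
  have z0 : (0 : ℝ) ∈ Icc (0 : ℝ) 1 := by simp
  have z1 : (1 : ℝ) ∈ Icc (0 : ℝ) 1 := by simp
  have := IsPrim.eq_of_homotopic (D := D) (D' := D') hΩ hL
    (IsLagCont.of_hasFrameAt hΩ hL fun y hy => hk.hasFrameAt hy)
    (IsLagCont.of_hasFrameAt hΩ hL fun y hy => hk'.hasFrameAt hy)
    (fun t ht => by rw [(hk01 t ht).1, (hk01' t ht).1])
    (fun s hs => by rw [(hkend s hs).1, (hkend 0 z0).1])
    (fun s hs => by rw [(hkend s hs).2, (hkend 0 z0).2])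
    (fun s hs => by rw [(hkend' s hs).1, (hkend' 0 z0).1])
    (fun s hs => by rw [(hkend' s hs).2, (hkend' 0 z0).2])
    (hprim hD fun t ht => (hk01 t ht).2) (hprim hD' fun t ht => (hk01' t ht).2)
  rw [this]

theorem IsMaslovIndex.maslovIndex_eq {Λ : ℝ → Submodule ℝ (Cot V)} {Λ₀ : Submodule ℝ (Cot V)}
    (hΛ₀ : IsLagrangian Λ₀) {m : ℝ} (h : IsMaslovIndex Λ Λ₀ m) : maslovIndex Λ Λ₀ = m := by
  have hex : ∃ m, IsMaslovIndex Λ Λ₀ m := ⟨m, h⟩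
  rw [maslovIndex, dif_pos hex]
  exact hex.choose_spec.unique hΛ₀ h

theorem IsMovedBy.isCrossingForm {Λ : ℝ → Submodule ℝ (Cot V)} {Λ₀ : Submodule ℝ (Cot V)} {t : ℝ}
    {T : ℝ → Cot V →L[ℝ] Cot V} {T' : Cot V →L[ℝ] Cot V} (h : IsMovedBy (sympB V) Λ t T T')
    (ht : t ∈ Icc (0 : ℝ) 1) {Γ : QuadraticForm ℝ ↥(Λ t ⊓ Λ₀)}
    (hΓ : ∀ ξ, Γ ξ = symp (ξ : Cot V) (T' ξ)) : IsCrossingForm Λ Λ₀ t Γ := by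
  obtain ⟨ν, hν, hc, -⟩ := exists_common_complement isSymplecticForm_sympB (h.isLag ht) (h.isLag ht)
  refine ⟨ν, isLagrangian_iff.2 hν, hc, fun ξ => ?_⟩
  rw [hΓ]
  exact h.exists_crossing isSymplecticForm_sympB ht hc ξ.2.1

end MaslovUniqueness

section Volterra

variable {X : Type*} [NormedAddCommGroup X] [NormedSpace ℝ X]

/-- The extension of a continuous map on `[0,1]` to the real line, constant outside `[0,1]`. -/
def ext {Y : Type*} (w : Icc (0 : ℝ) 1 → Y) : ℝ → Y := IccExtend zero_le_one w

theorem ext_apply {Y : Type*} (w : Icc (0 : ℝ) 1 → Y) {t : ℝ} (ht : t ∈ Icc (0 : ℝ) 1) :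
    ext w t = w ⟨t, ht⟩ := IccExtend_of_mem _ _ ht

@[simp] theorem ext_coe {Y : Type*} (w : Icc (0 : ℝ) 1 → Y) (t : Icc (0 : ℝ) 1) :
    ext w t = w t := ext_apply w t.2

theorem continuous_ext (w : C(Icc (0 : ℝ) 1, X)) : Continuous (ext w) :=
  w.continuous.Icc_extend'

theorem norm_ext_le (w : C(Icc (0 : ℝ) 1, X)) (t : ℝ) : ‖ext w t‖ ≤ ‖w‖ :=
  w.norm_coe_le_norm _

theorem integrableOn_ext (w : C(Icc (0 : ℝ) 1, X)) : IntegrableOn (ext w) (Icc 0 1) :=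
  (continuous_ext w).continuousOn.integrableOn_compact isCompact_Icc

theorem intervalIntegrable_of_integrableOn {f : ℝ → X} (hf : IntegrableOn f (Icc (0 : ℝ) 1)) {a b : ℝ}
    (ha : a ∈ Icc (0 : ℝ) 1) (hb : b ∈ Icc (0 : ℝ) 1) : IntervalIntegrable f volume a b :=
  (hf.mono_set (uIcc_subset_Icc ha hb)).intervalIntegrable

/-- The primitive of an integrable map, as a continuous map on `[0,1]`. -/
def primOf (f : ℝ → X) (hf : IntegrableOn f (Icc (0 : ℝ) 1)) : C(Icc (0 : ℝ) 1, X) where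
  toFun t := ∫ s in (0 : ℝ)..t, f s
  continuous_toFun := by
    have h : ContinuousOn (fun t => ∫ s in (0 : ℝ)..t, f s) (Icc 0 1) := by
      have := intervalIntegral.continuousOn_primitive_interval (μ := volume) (f := f) (a := 0) (b := 1)
        (by rwa [uIcc_of_le zero_le_one])
      rwa [uIcc_of_le zero_le_one] at this
    exact continuousOn_iff_continuous_domRestrict.1 h

theorem primOf_apply (f : ℝ → X) (hf : IntegrableOn f (Icc (0 : ℝ) 1)) (t : Icc (0 : ℝ) 1) :
    primOf f hf t = ∫ s in (0 : ℝ)..t, f s := rfl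

/-- The primitive operator on `C([0,1], X)`. -/
def prim (X : Type*) [NormedAddCommGroup X] [NormedSpace ℝ X] :
    C(Icc (0 : ℝ) 1, X) →L[ℝ] C(Icc (0 : ℝ) 1, X) :=
  LinearMap.mkContinuous
    { toFun := fun w => primOf (ext w) (integrableOn_ext w)
      map_add' := fun w w' => by
        ext t
        change ∫ s in (0 : ℝ)..t, (ext w s + ext w' s) = _
        rw [intervalIntegral.integral_add ((continuous_ext w).intervalIntegrable _ _)
          ((continuous_ext w').intervalIntegrable _ _)]
        rfl
      map_smul' := fun c w => by
        ext t
        change ∫ s in (0 : ℝ)..t, (c • ext w s) = _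
        rw [intervalIntegral.integral_smul]
        rfl } 1 fun w => by
    rw [one_mul, ContinuousMap.norm_le _ (norm_nonneg _)]
    intro t
    change ‖∫ s in (0 : ℝ)..t, ext w s‖ ≤ _
    refine (intervalIntegral.norm_integral_le_of_norm_le_const (C := ‖w‖)
      fun s _ => norm_ext_le w s).trans ?_
    rw [sub_zero, abs_of_nonneg t.2.1]
    exact mul_le_of_le_one_right (norm_nonneg _) t.2.2

theorem prim_apply (w : C(Icc (0 : ℝ) 1, X)) (t : Icc (0 : ℝ) 1) :
    prim X w t = ∫ s in (0 : ℝ)..t, ext w s := rfl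

theorem hasDerivWithinAt_prim [CompleteSpace X] (w : C(Icc (0 : ℝ) 1, X)) {t : ℝ}
    (ht : t ∈ Icc (0 : ℝ) 1) : HasDerivWithinAt (ext (prim X w)) (ext w t) (Icc 0 1) t := by
  have h1 : HasDerivAt (fun t => ∫ s in (0 : ℝ)..t, ext w s) (ext w t) t :=
    intervalIntegral.integral_hasDerivAt_right ((continuous_ext w).intervalIntegrable _ _)
      ((continuous_ext w).stronglyMeasurableAtFilter _ _) (continuous_ext w).continuousAt
  refine h1.hasDerivWithinAt.congr (fun s hs => ?_) ?_
  · rw [ext_apply _ hs, prim_apply]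
  · rw [ext_apply _ ht, prim_apply]

/-- The pointwise action of a continuous family of operators on `C([0,1], X)`. -/
def mulOp {Y : Type*} [NormedAddCommGroup Y] [NormedSpace ℝ Y] (A : C(Icc (0 : ℝ) 1, X →L[ℝ] Y)) :
    C(Icc (0 : ℝ) 1, X) →L[ℝ] C(Icc (0 : ℝ) 1, Y) :=
  LinearMap.mkContinuous
    { toFun := fun w => ⟨fun t => A t (w t), A.continuous.clm_apply w.continuous⟩
      map_add' := fun w w' => by ext t; simp
      map_smul' := fun c w => by ext t; simp } ‖A‖ fun w => by
    rw [ContinuousMap.norm_le _ (by positivity)]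
    intro t
    refine ((A t).le_opNorm _).trans ?_
    gcongr
    · exact A.norm_coe_le_norm t
    · exact w.norm_coe_le_norm t

@[simp] theorem mulOp_apply {Y : Type*} [NormedAddCommGroup Y] [NormedSpace ℝ Y]
    (A : C(Icc (0 : ℝ) 1, X →L[ℝ] Y)) (w : C(Icc (0 : ℝ) 1, X)) (t : Icc (0 : ℝ) 1) :
    mulOp A w t = A t (w t) := rfl

/-- The Volterra operator `w ↦ ∫ A w`. -/
def volterra (A : C(Icc (0 : ℝ) 1, X →L[ℝ] X)) : C(Icc (0 : ℝ) 1, X) →L[ℝ] C(Icc (0 : ℝ) 1, X) :=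
  prim X ∘L mulOp A

theorem volterra_apply (A : C(Icc (0 : ℝ) 1, X →L[ℝ] X)) (w : C(Icc (0 : ℝ) 1, X))
    (t : Icc (0 : ℝ) 1) : volterra A w t = ∫ s in (0 : ℝ)..t, ext A s (ext w s) := rfl

theorem norm_volterra_pow_apply_le (A : C(Icc (0 : ℝ) 1, X →L[ℝ] X)) (k : ℕ)
    (w : C(Icc (0 : ℝ) 1, X)) (t : Icc (0 : ℝ) 1) :
    ‖(volterra A ^ k) w t‖ ≤ ‖A‖ ^ k * (t : ℝ) ^ k / k.factorial * ‖w‖ := by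
  induction k generalizing t with
  | zero => simpa using w.norm_coe_le_norm t
  | succ k ih =>
    rw [pow_succ']
    change ‖volterra A ((volterra A ^ k) w) t‖ ≤ _
    rw [volterra_apply]
    have hb : ∀ s ∈ Ioc (0 : ℝ) t, ‖ext A s (ext ((volterra A ^ k) w) s)‖ ≤
        ‖A‖ ^ (k + 1) / k.factorial * ‖w‖ * s ^ k := by
      intro s hs
      have hsI : s ∈ Icc (0 : ℝ) 1 := ⟨hs.1.le, hs.2.trans t.2.2⟩
      have h1 := ih ⟨s, hsI⟩
      rw [ext_apply (⇑((volterra A ^ k) w)) hsI]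
      refine ((ext A s).le_opNorm _).trans ((mul_le_mul (norm_ext_le A s) h1 (norm_nonneg _)
        (norm_nonneg _)).trans (le_of_eq ?_))
      rw [pow_succ]
      ring
    refine (intervalIntegral.norm_integral_le_of_norm_le t.2.1
      (ae_of_all _ hb) (Continuous.intervalIntegrable (by fun_prop) _ _)).trans ?_
    rw [intervalIntegral.integral_const_mul, integral_pow, Nat.factorial_succ]
    push_cast
    refine le_of_eq ?_
    have : (k : ℝ) + 1 ≠ 0 := by positivity
    have h2 : (k.factorial : ℝ) ≠ 0 := by positivity
    field_simp
    simp

variable [CompleteSpace X]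

theorem isUnit_one_sub_volterra (A : C(Icc (0 : ℝ) 1, X →L[ℝ] X)) : IsUnit (1 - volterra A) := by
  have htend := FloorSemiring.tendsto_pow_div_factorial_atTop ‖A‖
  obtain ⟨k, hk⟩ := (htend.eventually (gt_mem_nhds (zero_lt_one' ℝ))).exists
  have hnorm : ‖volterra A ^ k‖ < 1 := by
    refine lt_of_le_of_lt (ContinuousLinearMap.opNorm_le_bound _ (by positivity) fun w => ?_) hk
    rw [ContinuousMap.norm_le _ (by positivity)]
    intro t
    refine (norm_volterra_pow_apply_le A k w t).trans ?_
    gcongr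
    exact mul_le_of_le_one_right (by positivity) (pow_le_one₀ t.2.1 t.2.2)
  have hu : IsUnit (1 - volterra A ^ k) := 
    isUnit_one_sub_of_norm_lt_one (R := C(Icc (0 : ℝ) 1, X) →L[ℝ] C(Icc (0 : ℝ) 1, X)) hnorm
  rw [← mul_neg_geom_sum] at hu
  have hcomm : Commute (1 - volterra A) (∑ i ∈ Finset.range k, volterra A ^ i) := by
    refine (Commute.sum_right _ _ _ fun i _ => ?_)
    exact ((Commute.one_left _).sub_left ((Commute.refl _).pow_right i))
  exact (hcomm.isUnit_mul_iff.1 hu).1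

/-- The resolvent `(1 - V_A)⁻¹` of the Volterra operator. -/
def resolv (A : C(Icc (0 : ℝ) 1, X →L[ℝ] X)) : C(Icc (0 : ℝ) 1, X) →L[ℝ] C(Icc (0 : ℝ) 1, X) :=
  Ring.inverse (1 - volterra A)

theorem resolv_eq (A : C(Icc (0 : ℝ) 1, X →L[ℝ] X)) (g : C(Icc (0 : ℝ) 1, X)) :
    resolv A g = g + volterra A (resolv A g) := by
  have h := Ring.mul_inverse_cancel _ (isUnit_one_sub_volterra A)
  have h2 : (1 - volterra A) (resolv A g) = g := congrArg (fun T => T g) h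
  have h3 : resolv A g - volterra A (resolv A g) = g := h2
  rw [← sub_eq_iff_eq_add, h3]

theorem eq_resolv {A : C(Icc (0 : ℝ) 1, X →L[ℝ] X)} {g w : C(Icc (0 : ℝ) 1, X)}
    (h : w = g + volterra A w) : w = resolv A g := by
  have h1 := Ring.inverse_mul_cancel _ (isUnit_one_sub_volterra A)
  have h2 : resolv A ((1 - volterra A) w) = w := congrArg (fun T => T w) h1
  have h3 : (1 - volterra A) w = g := by
    change w - volterra A w = g
    rw [sub_eq_iff_eq_add]
    exact h
  rw [← h2, h3]

/-- The inclusion of the constant maps. -/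
def constL (X : Type*) [NormedAddCommGroup X] [NormedSpace ℝ X] : X →L[ℝ] C(Icc (0 : ℝ) 1, X) :=
  LinearMap.mkContinuous
    { toFun := fun z => ContinuousMap.const _ z
      map_add' := fun z z' => by ext t; rfl
      map_smul' := fun c z => by ext t; rfl } 1 fun z => by
    rw [one_mul, ContinuousMap.norm_le _ (norm_nonneg _)]
    intro t
    exact le_rfl

@[simp] theorem constL_apply (z : X) (t : Icc (0 : ℝ) 1) : constL X z t = z := rfl

/-- The evaluation at the point of `[0,1]` nearest to `t`. -/
def evalL (X : Type*) [NormedAddCommGroup X] [NormedSpace ℝ X] (t : ℝ) :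
    C(Icc (0 : ℝ) 1, X) →L[ℝ] X :=
  LinearMap.mkContinuous
    { toFun := fun w => ext w t
      map_add' := fun _ _ => rfl
      map_smul' := fun _ _ => rfl } 1 fun w => by
    rw [one_mul]
    exact norm_ext_le w t

/-- The fundamental solution at time `t` of the linear differential equation `z' = A z`. -/
def fund (A : C(Icc (0 : ℝ) 1, X →L[ℝ] X)) (t : ℝ) : X →L[ℝ] X :=
  evalL X t ∘L resolv A ∘L constL X

theorem fund_apply (A : C(Icc (0 : ℝ) 1, X →L[ℝ] X)) (t : ℝ) (z : X) :
    fund A t z = ext (resolv A (constL X z)) t := rfl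

theorem continuous_fund_apply (A : C(Icc (0 : ℝ) 1, X →L[ℝ] X)) (z : X) :
    Continuous fun t => fund A t z := continuous_ext _

theorem hasDerivWithinAt_resolv_sub (A : C(Icc (0 : ℝ) 1, X →L[ℝ] X)) (g : C(Icc (0 : ℝ) 1, X))
    {t : ℝ} (ht : t ∈ Icc (0 : ℝ) 1) :
    HasDerivWithinAt (fun s => ext (resolv A g) s - ext g s) (ext A t (ext (resolv A g) t))
      (Icc 0 1) t := by
  have h1 := hasDerivWithinAt_prim (mulOp A (resolv A g)) ht
  have h2 : ∀ s, ext (resolv A g) s - ext g s = ext (prim X (mulOp A (resolv A g))) s := by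
    intro s
    have := resolv_eq A g
    conv_lhs => rw [this]
    exact add_sub_cancel_left _ _
  simp only [h2]
  exact h1

theorem hasDerivWithinAt_fund (A : C(Icc (0 : ℝ) 1, X →L[ℝ] X)) (z : X) {t : ℝ}
    (ht : t ∈ Icc (0 : ℝ) 1) :
    HasDerivWithinAt (fun s => fund A s z) (ext A t (fund A t z)) (Icc 0 1) t := by
  have h := (hasDerivWithinAt_resolv_sub A (constL X z) ht).add_const z
  have h2 : ∀ s, ext (constL X z) s = z := fun s => rfl
  simp only [h2, sub_add_cancel] at h
  exact h

@[simp] theorem fund_zero (A : C(Icc (0 : ℝ) 1, X →L[ℝ] X)) : fund A 0 = 1 := by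
  ext z
  have h0 : (0 : ℝ) ∈ Icc (0 : ℝ) 1 := by simp
  rw [fund_apply, ext_apply _ h0, resolv_eq, ContinuousMap.add_apply, volterra_apply]
  simp

theorem eq_fund_of_integral {A : C(Icc (0 : ℝ) 1, X →L[ℝ] X)} {x : ℝ → X}
    (hx : ContinuousOn x (Icc 0 1))
    (h : ∀ t ∈ Icc (0 : ℝ) 1, x t = x 0 + ∫ s in (0 : ℝ)..t, ext A s (x s)) {t : ℝ}
    (ht : t ∈ Icc (0 : ℝ) 1) : x t = fund A t (x 0) := by
  let w : C(Icc (0 : ℝ) 1, X) := ⟨fun t => x t, continuousOn_iff_continuous_domRestrict.1 hx⟩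
  have hw : w = constL X (x 0) + volterra A w := by
    ext s
    rw [ContinuousMap.add_apply, constL_apply, volterra_apply]
    change x s = _
    rw [h s s.2]
    congr 1
    refine intervalIntegral.integral_congr fun r hr => ?_
    rw [uIcc_of_le s.2.1] at hr
    have hrI : r ∈ Icc (0 : ℝ) 1 := ⟨hr.1, hr.2.trans s.2.2⟩
    rw [ext_apply _ hrI, ext_apply _ hrI]
    rfl
  have := eq_resolv hw
  rw [fund_apply, ← this, ext_apply _ ht]
  rfl

theorem integral_eq_sub_of_hasDerivWithinAt {x y : ℝ → X} {a b : ℝ} (hab : a ≤ b)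
    (h : ∀ t ∈ Icc a b, HasDerivWithinAt x (y t) (Icc a b) t) (hy : ContinuousOn y (Icc a b)) :
    ∫ s in a..b, y s = x b - x a := by
  refine intervalIntegral.integral_eq_sub_of_hasDerivAt_of_le hab
    (fun t ht => (h t ht).continuousWithinAt)
    (fun t ht => (h t (Ioo_subset_Icc_self ht)).hasDerivAt (Icc_mem_nhds ht.1 ht.2)) ?_
  exact (hy.mono (by rw [uIcc_of_le hab])).intervalIntegrable

end Volterra

section Parameters

variable {X : Type*} [NormedAddCommGroup X] [NormedSpace ℝ X] [CompleteSpace X]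

theorem volterra_add_smul (A B : C(Icc (0 : ℝ) 1, X →L[ℝ] X)) (κ : ℝ) :
    volterra (A + κ • B) = volterra A + κ • volterra B := by
  have h : mulOp (A + κ • B) = mulOp A + κ • mulOp B := by
    ext w t
    simp
  rw [volterra, h, ContinuousLinearMap.comp_add, ContinuousLinearMap.comp_smul]
  rfl

theorem resolv_add_smul (A B : C(Icc (0 : ℝ) 1, X →L[ℝ] X)) (κ : ℝ) :
    resolv (A + κ • B) = Ring.inverse (1 - volterra A - κ • volterra B) := by
  rw [resolv, volterra_add_smul, sub_sub]

theorem contDiff_inverse_pencil {R : Type*} [NormedRing R] [NormedAlgebra ℝ R] [CompleteSpace R]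
    {a b : R} (h : ∀ κ : ℝ, IsUnit (a - κ • b)) :
    ContDiff ℝ 1 fun κ : ℝ => Ring.inverse (a - κ • b) := by
  rw [contDiff_iff_contDiffAt]
  intro κ
  obtain ⟨u, hu⟩ := h κ
  have h1 := contDiffAt_ringInverse ℝ (n := 1) u
  rw [hu] at h1
  have h2 : ContDiff ℝ 1 fun κ : ℝ => a - κ • b := by fun_prop
  exact ContDiffAt.comp κ h1 h2.contDiffAt

theorem hasDerivAt_inverse_pencil {R : Type*} [NormedRing R] [NormedAlgebra ℝ R] [CompleteSpace R]
    {a b : R} {κ : ℝ} (h : IsUnit (a - κ • b)) :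
    HasDerivAt (fun κ : ℝ => Ring.inverse (a - κ • b))
      (Ring.inverse (a - κ • b) * b * Ring.inverse (a - κ • b)) κ := by
  obtain ⟨u, hu⟩ := h
  have h1 := hasFDerivAt_ringInverse (𝕜 := ℝ) u
  rw [hu] at h1
  have h2 : HasDerivAt (fun κ : ℝ => a - κ • b) (-b) κ := by
    simpa using ((hasDerivAt_id κ).smul_const b).const_sub a
  have h3 := h1.comp_hasDerivAt κ h2
  convert! h3 using 1
  rw [← hu, Ring.inverse_unit]
  simp

theorem isUnit_volterra_pencil (A B : C(Icc (0 : ℝ) 1, X →L[ℝ] X)) (κ : ℝ) :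
    IsUnit (1 - volterra A - κ • volterra B) := by
  rw [sub_sub, ← volterra_add_smul]
  exact isUnit_one_sub_volterra _

theorem contDiff_resolv (A B : C(Icc (0 : ℝ) 1, X →L[ℝ] X)) :
    ContDiff ℝ 1 fun κ : ℝ => resolv (A + κ • B) := by
  simp only [resolv_add_smul]
  exact contDiff_inverse_pencil (R := C(Icc (0 : ℝ) 1, X) →L[ℝ] C(Icc (0 : ℝ) 1, X))
    (isUnit_volterra_pencil A B)

theorem hasDerivAt_resolv (A B : C(Icc (0 : ℝ) 1, X →L[ℝ] X)) (κ : ℝ) :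
    HasDerivAt (fun κ : ℝ => resolv (A + κ • B))
      (resolv (A + κ • B) * volterra B * resolv (A + κ • B)) κ := by
  simp only [resolv_add_smul]
  exact hasDerivAt_inverse_pencil (R := C(Icc (0 : ℝ) 1, X) →L[ℝ] C(Icc (0 : ℝ) 1, X))
    (isUnit_volterra_pencil A B κ)

theorem contDiff_fund_param (A B : C(Icc (0 : ℝ) 1, X →L[ℝ] X)) (t : ℝ) :
    ContDiff ℝ 1 fun κ : ℝ => fund (A + κ • B) t := by
  unfold fund
  exact contDiff_const.clm_comp ((contDiff_resolv A B).clm_comp contDiff_const)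

/-- The derivative of the solution `fund (A + κ B) · z` with respect to the parameter. -/
def fundVar (A B : C(Icc (0 : ℝ) 1, X →L[ℝ] X)) (z : X) : C(Icc (0 : ℝ) 1, X) :=
  resolv A (volterra B (resolv A (constL X z)))

theorem hasDerivAt_fund_param (A B : C(Icc (0 : ℝ) 1, X →L[ℝ] X)) (κ t : ℝ) (z : X) :
    HasDerivAt (fun κ : ℝ => fund (A + κ • B) t z) (ext (fundVar (A + κ • B) B z) t) κ := by
  have h := (hasDerivAt_resolv A B κ).clm_apply (hasDerivAt_const κ (constL X z))
  have h2 := (evalL X t).hasFDerivAt.comp_hasDerivAt κ h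
  simp only [map_zero, add_zero] at h2
  exact h2

theorem fundVar_zero (A B : C(Icc (0 : ℝ) 1, X →L[ℝ] X)) (z : X) : ext (fundVar A B z) 0 = 0 := by
  have h0 : (0 : ℝ) ∈ Icc (0 : ℝ) 1 := by simp
  rw [ext_apply _ h0, fundVar, resolv_eq, ContinuousMap.add_apply, volterra_apply, volterra_apply]
  simp

theorem hasDerivWithinAt_fundVar (A B : C(Icc (0 : ℝ) 1, X →L[ℝ] X)) (z : X) {t : ℝ}
    (ht : t ∈ Icc (0 : ℝ) 1) : HasDerivWithinAt (ext (fundVar A B z))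
      (ext A t (ext (fundVar A B z) t) + ext B t (fund A t z)) (Icc 0 1) t := by
  have h1 := hasDerivWithinAt_resolv_sub A (volterra B (resolv A (constL X z))) ht
  have h2 : HasDerivWithinAt (ext (volterra B (resolv A (constL X z)))) (ext B t (fund A t z))
      (Icc 0 1) t := hasDerivWithinAt_prim (mulOp B (resolv A (constL X z))) ht
  have h3 := h1.add h2
  refine h3.congr_of_eventuallyEq_of_mem (Eventually.of_forall fun s => ?_) ht
  simp [fundVar]

theorem continuous_fund_param_apply (A B : C(Icc (0 : ℝ) 1, X →L[ℝ] X)) (z : X) :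
    Continuous fun y : ℝ × ℝ => fund (A + y.1 • B) y.2 z := by
  have h1 : Continuous fun κ : ℝ => resolv (A + κ • B) (constL X z) :=
    (contDiff_resolv A B).continuous.clm_apply continuous_const
  have h2 : Continuous fun y : ℝ × ℝ =>
      (resolv (A + y.1 • B) (constL X z)) (projIcc 0 1 zero_le_one y.2) :=
    (h1.comp continuous_fst).eval (continuous_projIcc.comp continuous_snd)
  exact h2

theorem contDiffOn_one_of_hasDerivWithinAt {Y : Type*} [NormedAddCommGroup Y] [NormedSpace ℝ Y]
    {x y : ℝ → Y}
    (h : ∀ t ∈ Icc (0 : ℝ) 1, HasDerivWithinAt x (y t) (Icc 0 1) t)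
    (hy : ContinuousOn y (Icc 0 1)) : ContDiffOn ℝ 1 x (Icc 0 1) := by
  rw [show (1 : WithTop ℕ∞) = 0 + 1 by rfl,
    contDiffOn_succ_iff_derivWithin (uniqueDiffOn_Icc zero_lt_one)]
  refine ⟨fun t ht => (h t ht).differentiableWithinAt, by simp, ?_⟩
  rw [contDiffOn_zero]
  exact hy.congr fun t ht => (h t ht).derivWithin (uniqueDiffOn_Icc zero_lt_one t ht)

theorem contDiffOn_fund [FiniteDimensional ℝ X] (A : C(Icc (0 : ℝ) 1, X →L[ℝ] X)) :
    ContDiffOn ℝ 1 (fund A) (Icc 0 1) := by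
  rw [contDiffOn_clm_apply]
  intro z
  refine contDiffOn_one_of_hasDerivWithinAt (fun t ht => hasDerivWithinAt_fund A z ht) ?_
  exact ((continuous_ext A).clm_apply (continuous_fund_apply A z)).continuousOn

end Parameters

section Flow

variable {X : Type*} [NormedAddCommGroup X] [NormedSpace ℝ X]

theorem partial_fderiv {Y : Type*} [NormedAddCommGroup Y] [NormedSpace ℝ Y] {G : ℝ → X → Y}
    (hG : ContDiffOn ℝ ∞ (fun z : ℝ × X => G z.1 z.2) (Icc (0 : ℝ) 1 ×ˢ univ)) :
    ContDiffOn ℝ ∞ (fun z : ℝ × X => fderiv ℝ (G z.1) z.2) (Icc (0 : ℝ) 1 ×ˢ univ) ∧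
      ∀ t ∈ Icc (0 : ℝ) 1, ContDiff ℝ ∞ (G t) := by
  set S : Set (ℝ × X) := Icc (0 : ℝ) 1 ×ˢ univ
  have hS : UniqueDiffOn ℝ S := (uniqueDiffOn_Icc zero_lt_one).prod uniqueDiffOn_univ
  have hmaps : ∀ t ∈ Icc (0 : ℝ) 1, ∀ x : X, (t, x) ∈ S := fun t ht x => ⟨ht, mem_univ x⟩
  refine ⟨?_, fun t ht => ?_⟩
  · have h1 := hG.fderivWithin (m := ∞) hS (by simp)
    have h2 : ContDiffOn ℝ ∞ (fun z => (fderivWithin ℝ (fun z : ℝ × X => G z.1 z.2) S z).comp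
        (ContinuousLinearMap.inr ℝ ℝ X)) S := h1.clm_comp contDiffOn_const
    refine h2.congr fun z hz => ?_
    have h3 : HasFDerivWithinAt (fun z : ℝ × X => G z.1 z.2)
        (fderivWithin ℝ (fun z : ℝ × X => G z.1 z.2) S z) S (z.1, z.2) :=
      (hG.differentiableOn (by simp) z hz).hasFDerivWithinAt
    have h4 : HasFDerivAt (fun x : X => (z.1, x)) (ContinuousLinearMap.inr ℝ ℝ X) z.2 :=
      hasFDerivAt_prodMk_right z.1 z.2
    have h5 := h3.comp_hasFDerivAt z.2 h4 (Eventually.of_forall fun x => hmaps z.1 hz.1 x)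
    exact h5.fderiv
  · have h1 : ContDiff ℝ ∞ fun x : X => (t, x) := contDiff_const.prodMk contDiff_id
    exact contDiffOn_univ.1 (hG.comp h1.contDiffOn fun x _ => hmaps t ht x)

variable {f : ℝ → X → X} {f' : ℝ → X → X →L[ℝ] X}

/-- The superposition operator `w ↦ f(·, w)` on `C([0,1], X)`. -/
def nemytskii (f : ℝ → X → X)
    (hf : ContinuousOn (fun z : ℝ × X => f z.1 z.2) (Icc (0 : ℝ) 1 ×ˢ univ))
    (w : C(Icc (0 : ℝ) 1, X)) : C(Icc (0 : ℝ) 1, X) where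
  toFun t := f t (w t)
  continuous_toFun := hf.comp_continuous (continuous_subtype_val.prodMk w.continuous)
    fun t => ⟨t.2, mem_univ _⟩

theorem hasStrictFDerivAt_nemytskii
    (hf : ContinuousOn (fun z : ℝ × X => f z.1 z.2) (Icc (0 : ℝ) 1 ×ˢ univ))
    (hf' : ContinuousOn (fun z : ℝ × X => f' z.1 z.2) (Icc (0 : ℝ) 1 ×ˢ univ))
    (hd : ∀ t ∈ Icc (0 : ℝ) 1, ∀ x, HasFDerivAt (f t) (f' t x) x) {x₀ : C(Icc (0 : ℝ) 1, X)}
    {A : C(Icc (0 : ℝ) 1, X →L[ℝ] X)} (hA : ∀ t, A t = f' t (x₀ t)) :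
    HasStrictFDerivAt (nemytskii f hf) (mulOp A) x₀ := by
  rw [hasStrictFDerivAt_iff_isLittleO, Asymptotics.isLittleO_iff]
  intro ε hε
  have hcont : Continuous fun z : Icc (0 : ℝ) 1 × X => ‖f' z.1 (x₀ z.1 + z.2) - A z.1‖ := by
    have h1 : Continuous fun z : Icc (0 : ℝ) 1 × X => f' z.1 (x₀ z.1 + z.2) :=
      hf'.comp_continuous (f := fun z : Icc (0 : ℝ) 1 × X => ((z.1 : ℝ), x₀ z.1 + z.2))
        (by fun_prop) fun z => ⟨z.1.2, mem_univ _⟩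
    exact (h1.sub (A.continuous.comp continuous_fst)).norm
  have hopen : IsOpen {z : Icc (0 : ℝ) 1 × X | ‖f' z.1 (x₀ z.1 + z.2) - A z.1‖ < ε} :=
    isOpen_lt hcont continuous_const
  obtain ⟨U, V, -, hV, hU, h0, hUV⟩ := generalized_tube_lemma (s := (univ : Set (Icc (0 : ℝ) 1)))
    (t := ({0} : Set X)) isCompact_univ isCompact_singleton hopen (by
      rintro ⟨t, x⟩ ⟨-, hx⟩
      rw [mem_singleton_iff] at hx
      subst hx
      simp [hA, hε])
  obtain ⟨δ, hδ, hball⟩ := Metric.isOpen_iff.1 hV 0 (h0 rfl)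
  have hnear : ∀ᶠ p : C(Icc (0 : ℝ) 1, X) × C(Icc (0 : ℝ) 1, X) in 𝓝 (x₀, x₀),
      p.1 ∈ Metric.ball x₀ δ ∧ p.2 ∈ Metric.ball x₀ δ :=
    (continuous_fst.continuousAt.eventually (Metric.ball_mem_nhds _ hδ)).and
      (continuous_snd.continuousAt.eventually (Metric.ball_mem_nhds _ hδ))
  filter_upwards [hnear] with p hp
  rw [ContinuousMap.norm_le _ (by positivity)]
  intro t
  have hmem : ∀ w ∈ Metric.ball x₀ δ, w t ∈ Metric.ball (x₀ t) δ := fun w hw =>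
    lt_of_le_of_lt (ContinuousMap.dist_apply_le_dist t) hw
  have key := (convex_ball (x₀ t) δ).norm_image_sub_le_of_norm_hasFDerivWithin_le'
    (f := f t) (f' := f' t) (φ := A t) (C := ε)
    (fun x _ => (hd t t.2 x).hasFDerivWithinAt) (fun x hx => ?_) (hmem _ hp.2) (hmem _ hp.1)
  · refine key.trans ?_
    gcongr
    exact (p.1 - p.2).norm_coe_le_norm t
  · have h2 : ((t, x - x₀ t) : Icc (0 : ℝ) 1 × X) ∈ U ×ˢ V :=
      ⟨hU (mem_univ _), hball (by rwa [mem_ball_zero_iff, ← dist_eq_norm])⟩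
    have h3 := hUV h2
    simp only [mem_ofPred_eq, add_sub_cancel] at h3
    exact h3.le

theorem ode_unique [FiniteDimensional ℝ X]
    (hf' : ContinuousOn (fun z : ℝ × X => f' z.1 z.2) (Icc (0 : ℝ) 1 ×ˢ univ))
    (hd : ∀ t ∈ Icc (0 : ℝ) 1, ∀ x, HasFDerivAt (f t) (f' t x) x) {T : ℝ} (hT : T ≤ 1)
    {x y : ℝ → X} (hx : ∀ t ∈ Icc (0 : ℝ) T, HasDerivWithinAt x (f t (x t)) (Icc 0 T) t)
    (hy : ∀ t ∈ Icc (0 : ℝ) T, HasDerivWithinAt y (f t (y t)) (Icc 0 T) t) (h0 : x 0 = y 0) :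
    EqOn x y (Icc 0 T) := by
  have hxc : ContinuousOn x (Icc 0 T) := fun t ht => (hx t ht).continuousWithinAt
  have hyc : ContinuousOn y (Icc 0 T) := fun t ht => (hy t ht).continuousWithinAt
  obtain ⟨R₁, hR₁⟩ := isCompact_Icc.exists_bound_of_continuousOn hxc
  obtain ⟨R₂, hR₂⟩ := isCompact_Icc.exists_bound_of_continuousOn hyc
  let R := max R₁ R₂
  have hcomp : IsCompact (Icc (0 : ℝ) 1 ×ˢ Metric.closedBall (0 : X) R) :=
    isCompact_Icc.prod (isCompact_closedBall 0 R)
  obtain ⟨M, hM⟩ := hcomp.exists_bound_of_continuousOn (hf'.mono (prod_mono_right (subset_univ _)))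
  have hlip : ∀ t ∈ Ico (0 : ℝ) T, LipschitzOnWith M.toNNReal (f t) (Metric.closedBall (0 : X) R) := by
    intro t ht
    have htI : t ∈ Icc (0 : ℝ) 1 := ⟨ht.1, ht.2.le.trans hT⟩
    refine (convex_closedBall (0 : X) R).lipschitzOnWith_of_nnnorm_hasFDerivWithin_le
      (f' := f' t) (fun z _ => (hd t htI z).hasFDerivWithinAt) fun z hz => ?_
    rw [← NNReal.coe_le_coe, coe_nnnorm]
    exact (hM (t, z) ⟨htI, hz⟩).trans (Real.le_coe_toNNReal M)
  have hright : ∀ {z : ℝ → X}, (∀ t ∈ Icc (0 : ℝ) T, HasDerivWithinAt z (f t (z t)) (Icc 0 T) t) →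
      ∀ t ∈ Ico (0 : ℝ) T, HasDerivWithinAt z (f t (z t)) (Ici t) t := by
    intro z hz t ht
    have h1 := (hz t (Ico_subset_Icc_self ht)).mono (Icc_subset_Icc_left ht.1)
    exact h1.mono_of_mem_nhdsWithin (Icc_mem_nhdsGE ht.2)
  refine ODE_solution_unique_of_mem_Icc_right (v := f) (s := fun _ => Metric.closedBall (0 : X) R)
    hlip hxc (hright hx) (fun t ht => ?_) hyc (hright hy) (fun t ht => ?_) h0
  · rw [mem_closedBall_zero_iff]
    exact (hR₁ t (Ico_subset_Icc_self ht)).trans (le_max_left _ _)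
  · rw [mem_closedBall_zero_iff]
    exact (hR₂ t (Ico_subset_Icc_self ht)).trans (le_max_right _ _)

/-- Differentiability of the flow at the initial point of an orbit: near the initial point of an
orbit on `[0,1]` there is a differentiable family of orbits on `[0,1]`. -/
theorem exists_orbit_family [CompleteSpace X]
    (hf : ContinuousOn (fun z : ℝ × X => f z.1 z.2) (Icc (0 : ℝ) 1 ×ˢ univ))
    (hf' : ContinuousOn (fun z : ℝ × X => f' z.1 z.2) (Icc (0 : ℝ) 1 ×ˢ univ))
    (hd : ∀ t ∈ Icc (0 : ℝ) 1, ∀ x, HasFDerivAt (f t) (f' t x) x) {x₀ : ℝ → X}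
    (hx₀ : ∀ t ∈ Icc (0 : ℝ) 1, HasDerivWithinAt x₀ (f t (x₀ t)) (Icc 0 1) t)
    {A : C(Icc (0 : ℝ) 1, X →L[ℝ] X)} (hA : ∀ t, A t = f' t (x₀ t)) :
    ∃ g : X → ℝ → X, (∀ᶠ y in 𝓝 (x₀ 0), g y 0 = y ∧
        ∀ t ∈ Icc (0 : ℝ) 1, HasDerivWithinAt (g y) (f t (g y t)) (Icc 0 1) t) ∧
      ∀ t, HasFDerivAt (fun y => g y t) (fund A t) (x₀ 0) := by
  have hx₀c : ContinuousOn x₀ (Icc 0 1) := fun t ht => (hx₀ t ht).continuousWithinAt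
  let w₀ : C(Icc (0 : ℝ) 1, X) := ⟨fun t => x₀ t, continuousOn_iff_continuous_domRestrict.1 hx₀c⟩
  let N := nemytskii f hf
  let F : C(Icc (0 : ℝ) 1, X) → C(Icc (0 : ℝ) 1, X) := fun w => w - prim X (N w)
  have hN : HasStrictFDerivAt N (mulOp A) w₀ := hasStrictFDerivAt_nemytskii hf hf' hd hA
  have hF : HasStrictFDerivAt F (1 - volterra A) w₀ :=
    (hasStrictFDerivAt_id w₀).sub ((prim X).hasStrictFDerivAt.comp w₀ hN)
  obtain ⟨u, hu⟩ := isUnit_one_sub_volterra A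
  let e : C(Icc (0 : ℝ) 1, X) ≃L[ℝ] C(Icc (0 : ℝ) 1, X) := ContinuousLinearEquiv.ofUnit u
  have he : (e : C(Icc (0 : ℝ) 1, X) →L[ℝ] C(Icc (0 : ℝ) 1, X)) = 1 - volterra A := by
    rw [← hu]
    rfl
  rw [← he] at hF
  have hFw₀ : F w₀ = constL X (x₀ 0) := by
    ext t
    change x₀ t - ∫ s in (0 : ℝ)..t, ext (N w₀) s = x₀ 0
    have hsub : Icc (0 : ℝ) t ⊆ Icc 0 1 := Icc_subset_Icc_right t.2.2
    rw [integral_eq_sub_of_hasDerivWithinAt (x := x₀) t.2.1 (fun s hs => ?_)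
      (continuous_ext _).continuousOn]
    · abel
    · have := (hx₀ s (hsub hs)).mono hsub
      rw [ext_apply _ (hsub hs)]
      exact this
  let G := hF.localInverse F e w₀
  have hG : HasStrictFDerivAt G (e.symm : C(Icc (0 : ℝ) 1, X) →L[ℝ] C(Icc (0 : ℝ) 1, X)) (F w₀) :=
    hF.to_localInverse
  have hright : ∀ᶠ v in 𝓝 (F w₀), F (G v) = v := hF.eventually_right_inverse
  rw [hFw₀] at hG hright
  have hsymm : (e.symm : C(Icc (0 : ℝ) 1, X) →L[ℝ] C(Icc (0 : ℝ) 1, X)) = resolv A := by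
    rw [resolv, ← hu, Ring.inverse_unit]
    rfl
  refine ⟨fun y => ext (G (constL X y)), ?_, fun t => ?_⟩
  · filter_upwards [(constL X).continuous.continuousAt.eventually hright] with y hy
    have hy' : G (constL X y) = constL X y + prim X (N (G (constL X y))) := by
      rw [← sub_eq_iff_eq_add]
      exact hy
    have h2 : ∀ s, ext (G (constL X y)) s = y + ext (prim X (N (G (constL X y)))) s := by
      intro s
      conv_lhs => rw [hy']
      rfl
    refine ⟨?_, fun t ht => ?_⟩
    · rw [h2, ext_apply _ (show (0 : ℝ) ∈ Icc (0 : ℝ) 1 by simp), prim_apply]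
      simp
    · have h1 := (hasDerivWithinAt_prim (N (G (constL X y))) ht).const_add y
      rw [ext_apply (N (G (constL X y))) ht] at h1
      rw [ext_apply (G (constL X y)) ht]
      exact h1.congr (fun s _ => h2 s) (h2 t)
  · have h1 := (evalL X t).hasFDerivAt.comp (x₀ 0) (hG.hasFDerivAt.comp (x₀ 0) (constL X).hasFDerivAt)
    rw [hsymm] at h1
    exact h1

end Flow

section SecondDerivative

variable {X Y : Type*} [NormedAddCommGroup X] [NormedSpace ℝ X] [NormedAddCommGroup Y]
  [NormedSpace ℝ Y] {h : X → ℝ}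

theorem hasFDerivAt_fderiv (hh : ContDiff ℝ ∞ h) (x : X) :
    HasFDerivAt (fderiv ℝ h) (fderiv ℝ (fderiv ℝ h) x) x :=
  ((hh.fderiv_right (m := ∞) (by simp)).differentiable (by simp) x).hasFDerivAt

theorem contDiff_clm_fderiv (hh : ContDiff ℝ ∞ h) (L : (X →L[ℝ] ℝ) →L[ℝ] Y) :
    ContDiff ℝ ∞ fun x => L (fderiv ℝ h x) :=
  L.contDiff.comp (hh.fderiv_right (m := ∞) (by simp))

theorem hasFDerivAt_clm_fderiv (hh : ContDiff ℝ ∞ h) (L : (X →L[ℝ] ℝ) →L[ℝ] Y) (x : X) :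
    HasFDerivAt (fun x => L (fderiv ℝ h x)) (L.comp (fderiv ℝ (fderiv ℝ h) x)) x :=
  L.hasFDerivAt.comp x (hasFDerivAt_fderiv hh x)

theorem isSymm_fderiv_fderiv (hh : ContDiff ℝ ∞ h) (x ξ ζ : X) :
    fderiv ℝ (fderiv ℝ h) x ξ ζ = fderiv ℝ (fderiv ℝ h) x ζ ξ := by
  have h1 : IsSymmSndFDerivAt ℝ h x := by
    refine hh.contDiffAt.isSymmSndFDerivAt ?_
    rw [minSmoothness_of_isRCLikeNormedField]
    exact WithTop.coe_le_coe.2 le_top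
  exact h1.eq ξ ζ

theorem fderiv_fderiv_comp_affine (hh : ContDiff ℝ ∞ h) (c : X) (ι : Y →L[ℝ] X) (y η : Y) :
    fderiv ℝ (fderiv ℝ fun y => h (c + ι y)) y η η =
      fderiv ℝ (fderiv ℝ h) (c + ι y) (ι η) (ι η) := by
  have hι : ∀ y, HasFDerivAt (fun y => c + ι y) ι y := fun y => ι.hasFDerivAt.const_add c
  have h1 : (fderiv ℝ fun y => h (c + ι y)) = fun y => (fderiv ℝ h (c + ι y)).comp ι := by
    ext1 y
    exact ((hh.differentiable (by simp) (c + ι y)).hasFDerivAt.comp y (hι y)).fderiv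
  have h2 : HasFDerivAt (fun y => fderiv ℝ h (c + ι y)) _ y :=
    (hasFDerivAt_fderiv hh (c + ι y)).comp y (hι y)
  have h3 := h2.clm_comp (hasFDerivAt_const ι y)
  rw [h1, h3.fderiv]
  simp

theorem hasDerivAt_fderiv_line (hh : ContDiff ℝ ∞ h) (c w : X) (s : ℝ) :
    HasDerivAt (fun s : ℝ => fderiv ℝ h (c + s • w) w)
      (fderiv ℝ (fderiv ℝ h) (c + s • w) w w) s := by
  have h1 : HasDerivAt (fun s : ℝ => c + s • w) w s := by
    simpa using ((hasDerivAt_id s).smul_const w).const_add c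
  have h2 : HasDerivAt (fun s : ℝ => fderiv ℝ h (c + s • w))
      (fderiv ℝ (fderiv ℝ h) (c + s • w) w) s :=
    HasFDerivAt.comp_hasDerivAt (f := fun s : ℝ => c + s • w) s (hasFDerivAt_fderiv hh _) h1
  simpa using h2.clm_apply (hasDerivAt_const s w)

end SecondDerivative

section Legendre

variable {V : Type*} [NormedAddCommGroup V] [NormedSpace ℝ V] [FiniteDimensional ℝ V]

theorem injective_sympB : Function.Injective
    ((LinearMap.toContinuousLinearMap (𝕜 := ℝ) (E := Cot V) (F' := ℝ)).toLinearMap ∘ₗ sympB V) := by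
  rw [injective_iff_map_eq_zero]
  intro ξ hξ
  refine symp_nondegenerate fun η => ?_
  exact congrArg (fun f : Cot V →L[ℝ] ℝ => f η) hξ

/-- The isomorphism of `T*V` with its dual given by the symplectic form. -/
def flatE (V : Type*) [NormedAddCommGroup V] [NormedSpace ℝ V] [FiniteDimensional ℝ V] :
    Cot V ≃L[ℝ] (Cot V →L[ℝ] ℝ) :=
  (LinearEquiv.ofInjectiveOfFinrankEq
    ((LinearMap.toContinuousLinearMap (𝕜 := ℝ) (E := Cot V) (F' := ℝ)).toLinearMap ∘ₗ sympB V)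
    injective_sympB (finrank_dual_eq (V := Cot V)).symm).toContinuousLinearEquiv

theorem flatE_apply (ξ ζ : Cot V) : flatE V ξ ζ = symp ξ ζ := rfl

theorem symp_flatE_symm (α : Cot V →L[ℝ] ℝ) (ζ : Cot V) : symp ((flatE V).symm α) ζ = α ζ := by
  rw [← flatE_apply, ContinuousLinearEquiv.apply_symm_apply]

/-- The Hamiltonian vector field of a function on `T*V`. -/
def hamVec (h : Cot V → ℝ) (x : Cot V) : Cot V := -(flatE V).symm (fderiv ℝ h x)

theorem symp_hamVec (h : Cot V → ℝ) (x ζ : Cot V) : symp (hamVec h x) ζ = -fderiv ℝ h x ζ := by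
  rw [hamVec, symp_neg_left, symp_flatE_symm]

theorem eq_hamVec {h : Cot V → ℝ} {x Z : Cot V} (hZ : ∀ ζ, symp Z ζ = -fderiv ℝ h x ζ) :
    Z = hamVec h x := by
  rw [← sub_eq_zero]
  refine symp_nondegenerate fun ζ => ?_
  rw [symp_sub_left, hZ, symp_hamVec, sub_self]

theorem hamVec_snd (h : Cot V → ℝ) (x : Cot V) (a : V) :
    (hamVec h x).2 a = -fderiv ℝ h x (a, 0) := by
  have := symp_hamVec h x (a, 0)
  simpa [symp] using this

theorem hamVec_fst (h : Cot V → ℝ) (x : Cot V) (η : V →L[ℝ] ℝ) :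
    η (hamVec h x).1 = fderiv ℝ h x (0, η) := by
  have := symp_hamVec h x (0, η)
  simpa [symp] using this

variable {h : Cot V → ℝ}

theorem contDiff_hamVec (hh : ContDiff ℝ ∞ h) : ContDiff ℝ ∞ (hamVec h) :=
  (contDiff_clm_fderiv hh ((flatE V).symm : (Cot V →L[ℝ] ℝ) →L[ℝ] Cot V)).neg

theorem fderiv_hamVec (hh : ContDiff ℝ ∞ h) (x ξ : Cot V) :
    fderiv ℝ (hamVec h) x ξ = -(flatE V).symm (fderiv ℝ (fderiv ℝ h) x ξ) := by
  have h2 := (hasFDerivAt_clm_fderiv hh ((flatE V).symm : (Cot V →L[ℝ] ℝ) →L[ℝ] Cot V) x).neg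
  have h3 : fderiv ℝ (hamVec h) x = _ := h2.fderiv
  rw [h3]
  rfl

theorem symp_fderiv_hamVec (hh : ContDiff ℝ ∞ h) (x ξ ζ : Cot V) :
    symp (fderiv ℝ (hamVec h) x ξ) ζ = -fderiv ℝ (fderiv ℝ h) x ξ ζ := by
  rw [fderiv_hamVec hh, symp_neg_left, symp_flatE_symm]

theorem symp_fderiv_hamVec_symm (hh : ContDiff ℝ ∞ h) (x ξ ζ : Cot V) :
    symp (fderiv ℝ (hamVec h) x ξ) ζ = symp (fderiv ℝ (hamVec h) x ζ) ξ := by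
  rw [symp_fderiv_hamVec hh, symp_fderiv_hamVec hh]
  rw [isSymm_fderiv_fderiv hh]

theorem fderiv_fderiv_fiber (hh : ContDiff ℝ ∞ h) (q : V) (p η : V →L[ℝ] ℝ) :
    fderiv ℝ (fderiv ℝ fun p' : V →L[ℝ] ℝ => h (q, p')) p η η =
      fderiv ℝ (fderiv ℝ h) (q, p) (0, η) (0, η) := by
  have h1 := fderiv_fderiv_comp_affine hh ((q, 0) : Cot V)
    (ContinuousLinearMap.inr ℝ V (V →L[ℝ] ℝ)) p η
  simpa using h1

/-- The Legendre map `(q,p) ↦ (q, D_p h(q,p))`. -/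
def legendre (h : Cot V → ℝ) (x : Cot V) : V × V := (x.1, (hamVec h x).1)

theorem legendre_injective (hh : ContDiff ℝ ∞ h)
    (hc : ∀ q (p η : V →L[ℝ] ℝ), η ≠ 0 → 0 < fderiv ℝ (fderiv ℝ h) (q, p) (0, η) (0, η)) :
    Function.Injective (legendre h) := by
  rintro ⟨q, p⟩ ⟨q', p'⟩ heq
  have hq : q = q' := congrArg Prod.fst heq
  subst hq
  have hv : (hamVec h (q, p)).1 = (hamVec h (q, p')).1 := congrArg Prod.snd heq
  by_contra hne
  let w := p' - p
  have hw : w ≠ 0 := fun h0 => hne (by rw [sub_eq_zero.1 h0])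
  let g : ℝ → ℝ := fun s => fderiv ℝ h ((q, p) + s • ((0, w) : Cot V)) (0, w)
  have hg : ∀ s, HasDerivAt g
      (fderiv ℝ (fderiv ℝ h) ((q, p) + s • ((0, w) : Cot V)) (0, w) (0, w)) s :=
    hasDerivAt_fderiv_line hh (q, p) (0, w)
  have h01 : g 0 = g 1 := by
    simp only [g]
    rw [← hamVec_fst, ← hamVec_fst]
    simp [w, hv]
  obtain ⟨s, -, hs⟩ := exists_hasDerivAt_eq_zero zero_lt_one
    (fun s _ => (hg s).continuousAt.continuousWithinAt) h01 (fun s _ => hg s)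
  have h1 : (q, p) + s • ((0, w) : Cot V) = (q, p + s • w) := by simp
  rw [h1] at hs
  exact (hc q (p + s • w) w hw).ne' hs

theorem exists_isMax (hh : Continuous h) (q v : V)
    (hs : Tendsto (fun p : V →L[ℝ] ℝ => h (q, p) / ‖p‖) (Bornology.cobounded _) atTop) :
    ∃ p : V →L[ℝ] ℝ, ∀ p', p' v - h (q, p') ≤ p v - h (q, p) := by
  refine Continuous.exists_forall_ge (f := fun p : V →L[ℝ] ℝ => p v - h (q, p)) (by fun_prop) ?_
  rw [← Metric.cobounded_eq_cocompact]
  have h1 : Tendsto (fun p : V →L[ℝ] ℝ => -‖p‖) (Bornology.cobounded _) atBot :=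
    tendsto_neg_atTop_atBot.comp tendsto_norm_cobounded_atTop
  refine tendsto_atBot_mono' _ ?_ h1
  filter_upwards [hs.eventually_ge_atTop (‖v‖ + 1),
    tendsto_norm_cobounded_atTop.eventually_gt_atTop 0] with p hp hp0
  rw [le_div_iff₀ hp0] at hp
  have h2 : p v ≤ ‖p‖ * ‖v‖ := (le_abs_self _).trans (p.le_opNorm v)
  nlinarith

theorem legendre_of_isMax (hh : ContDiff ℝ ∞ h) {q v : V} {p : V →L[ℝ] ℝ}
    (hp : ∀ p', p' v - h (q, p') ≤ p v - h (q, p)) : legendre h (q, p) = (q, v) := by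
  refine Prod.ext rfl ?_
  rw [← sub_eq_zero]
  refine SeparatingDual.eq_zero_of_forall_dual_eq_zero (R := ℝ) fun η => ?_
  have h1 : HasFDerivAt (fun p' : V →L[ℝ] ℝ => p' v - h (q, p'))
      (ContinuousLinearMap.apply ℝ ℝ v - (fderiv ℝ h (q, p)).comp (ContinuousLinearMap.inr ℝ V (V →L[ℝ] ℝ))) p :=
    (ContinuousLinearMap.apply ℝ ℝ v).hasFDerivAt.sub
      ((hh.differentiable (by simp) (q, p)).hasFDerivAt.comp p (hasFDerivAt_prodMk_right q p))
  have hmax : IsLocalMax (fun p' : V →L[ℝ] ℝ => p' v - h (q, p')) p := Eventually.of_forall hp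
  have h2 := hmax.hasFDerivAt_eq_zero h1
  have h3 := congrArg (fun L : (V →L[ℝ] ℝ) →L[ℝ] ℝ => L η) h2
  simp only [sub_apply, ContinuousLinearMap.apply_apply, ContinuousLinearMap.comp_apply,
    ContinuousLinearMap.inr_apply, zero_apply] at h3
  change η ((hamVec h (q, p)).1 - v) = 0
  rw [map_sub, hamVec_fst]
  linarith

/-- The properties of the inverse `G` of the Legendre map and of the Fenchel dual of `h`. -/
theorem exists_legendre_inverse (hh : ContDiff ℝ ∞ h)
    (hc : ∀ q (p η : V →L[ℝ] ℝ), η ≠ 0 → 0 < fderiv ℝ (fderiv ℝ h) (q, p) (0, η) (0, η))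
    (hs : ∀ q, Tendsto (fun p : V →L[ℝ] ℝ => h (q, p) / ‖p‖) (Bornology.cobounded _) atTop) :
    ∃ G : V × V → Cot V, (∀ z, legendre h (G z) = z) ∧
      (∀ z, HasFDerivAt (fun z : V × V => ⨆ p : V →L[ℝ] ℝ, (p z.2 - h (z.1, p)))
        ((G z).2.comp (ContinuousLinearMap.snd ℝ V V) +
          (hamVec h (G z)).2.comp (ContinuousLinearMap.fst ℝ V V)) z) ∧
      ∀ z, ∃ G' : V × V →L[ℝ] Cot V, HasFDerivAt G G' z ∧
        ∀ ξ : Cot V, G' (ξ.1, (fderiv ℝ (hamVec h) (G z) ξ).1) = ξ := by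
  have hmax := fun z : V × V => exists_isMax hh.continuous z.1 z.2 (hs z.1)
  choose P hP using hmax
  let G : V × V → Cot V := fun z => (z.1, P z)
  have hG : ∀ z, legendre h (G z) = z := fun z => legendre_of_isMax hh (hP z)
  have hLG : ∀ x, G (legendre h x) = x := fun x =>
    legendre_injective hh hc (by rw [hG])
  have hXd : ∀ x, HasFDerivAt (hamVec h) (fderiv ℝ (hamVec h) x) x := fun x =>
    ((contDiff_hamVec hh).differentiable (by simp) x).hasFDerivAt
  have hΨd : ∀ x, HasFDerivAt (legendre h) ((ContinuousLinearMap.fst ℝ V (V →L[ℝ] ℝ)).prod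
      ((ContinuousLinearMap.fst ℝ V (V →L[ℝ] ℝ)).comp (fderiv ℝ (hamVec h) x))) x := fun x =>
    hasFDerivAt_fst.prodMk (hasFDerivAt_fst.comp x (hXd x))
  have hΨc : ContDiff ℝ ∞ (legendre h) := contDiff_fst.prodMk (contDiff_fst.comp (contDiff_hamVec hh))
  have hder : ∀ z, ∃ G' : V × V →L[ℝ] Cot V, HasFDerivAt G G' z ∧
        ∀ ξ : Cot V, G' (ξ.1, (fderiv ℝ (hamVec h) (G z) ξ).1) = ξ := by
    intro z
    let D : Cot V →L[ℝ] V × V := (ContinuousLinearMap.fst ℝ V (V →L[ℝ] ℝ)).prod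
      ((ContinuousLinearMap.fst ℝ V (V →L[ℝ] ℝ)).comp (fderiv ℝ (hamVec h) (G z)))
    have hinj : Function.Injective (D : Cot V →ₗ[ℝ] V × V) := by
      rw [injective_iff_map_eq_zero]
      rintro ⟨a, α⟩ h0
      have ha : a = 0 := congrArg Prod.fst h0
      subst ha
      have h1 : (fderiv ℝ (hamVec h) (G z) (0, α)).1 = 0 := congrArg Prod.snd h0
      by_contra hne
      have hα : α ≠ 0 := fun h => hne (by rw [h]; rfl)
      have h2 := hc z.1 (P z) α hα
      have h3 := symp_fderiv_hamVec hh (G z) (0, α) (0, α)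
      simp only [symp, h1, map_zero, sub_zero] at h3
      have h4 : fderiv ℝ (fderiv ℝ h) (z.1, P z) (0, α) (0, α) = 0 := by
        have h5 : fderiv ℝ (fderiv ℝ h) (G z) (0, α) (0, α) = 0 := by linarith
        exact h5
      exact h2.ne' h4
    have hfr : Module.finrank ℝ (Cot V) = Module.finrank ℝ (V × V) := by
      rw [finrank_cot, Module.finrank_prod]
    let e : Cot V ≃L[ℝ] V × V :=
      (LinearEquiv.ofInjectiveOfFinrankEq (D : Cot V →ₗ[ℝ] V × V) hinj hfr).toContinuousLinearEquiv
    have he : (e : Cot V →L[ℝ] V × V) = D :=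
      ContinuousLinearMap.ext fun _ => rfl
    have hstrict : HasStrictFDerivAt (legendre h) (e : Cot V →L[ℝ] V × V) (G z) := by
      rw [he]
      exact hΨc.contDiffAt.hasStrictFDerivAt' (hΨd (G z)) (by simp)
    have h1 := hstrict.to_localInverse
    have h2 := hstrict.eventually_right_inverse
    rw [hG z] at h1 h2
    refine ⟨_, h1.hasFDerivAt.congr_of_eventuallyEq ?_, fun ξ => ?_⟩
    · filter_upwards [h2] with y hy
      rw [← hLG (hstrict.localInverse _ _ _ y), hy]
    · have : ((ξ.1, (fderiv ℝ (hamVec h) (G z) ξ).1) : V × V) = e ξ := rfl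
      rw [this]
      exact e.symm_apply_apply ξ
  refine ⟨G, hG, fun z => ?_, hder⟩
  obtain ⟨G', hG', -⟩ := hder z
  have hval : (fun z : V × V => ⨆ p : V →L[ℝ] ℝ, (p z.2 - h (z.1, p))) =
      fun z => (G z).2 z.2 - h (G z) := by
    ext1 z
    exact le_antisymm (ciSup_le fun p => hP z p)
      (le_ciSup (f := fun p : V →L[ℝ] ℝ => p z.2 - h (z.1, p)) ⟨_, by rintro _ ⟨p, rfl⟩; exact hP z p⟩ (P z))
  rw [hval]
  have h1 : HasFDerivAt (fun z => (G z).2) ((ContinuousLinearMap.snd ℝ V (V →L[ℝ] ℝ)).comp G') z :=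
    hasFDerivAt_snd.comp z hG'
  have h2 := (h1.clm_apply (hasFDerivAt_snd (𝕜 := ℝ) (p := z))).sub
    ((hh.differentiable (by simp) (G z)).hasFDerivAt.comp z hG')
  refine h2.congr_fderiv ?_
  refine ContinuousLinearMap.ext fun c => ?_
  have hfst : (G' c).1 = c.1 := by
    have h3 : HasFDerivAt (fun z => (G z).1) ((ContinuousLinearMap.fst ℝ V (V →L[ℝ] ℝ)).comp G') z :=
      hasFDerivAt_fst.comp z hG'
    have h4 := h3.unique (hasFDerivAt_fst (𝕜 := ℝ) (p := z))
    exact congrArg (fun L : V × V →L[ℝ] V => L c) h4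
  have hsplit : fderiv ℝ h (G z) (G' c) =
      fderiv ℝ h (G z) (c.1, 0) + fderiv ℝ h (G z) (0, (G' c).2) := by
    rw [← map_add, ← hfst]
    simp
  have hleg : (hamVec h (G z)).1 = z.2 := congrArg Prod.snd (hG z)
  have h5 : fderiv ℝ h (G z) (0, (G' c).2) = (G' c).2 z.2 := by
    rw [← hamVec_fst, hleg]
  have h6 := hamVec_snd h (G z) c.1
  simp only [add_apply, sub_apply, ContinuousLinearMap.comp_apply, ContinuousLinearMap.flip_apply,
    ContinuousLinearMap.coe_snd', ContinuousLinearMap.coe_fst']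
  rw [hsplit, h5, h6]
  ring

end Legendre

section Linearization

theorem contDiffOn_clm_comp {X Y Z : Type*} [NormedAddCommGroup X] [NormedSpace ℝ X]
    [NormedAddCommGroup Y] [NormedSpace ℝ Y] [NormedAddCommGroup Z] [NormedSpace ℝ Z]
    {g : X → Y} {s : Set X} (hg : ContDiffOn ℝ ∞ g s) (L : Y →L[ℝ] Z) :
    ContDiffOn ℝ ∞ (fun x => L (g x)) s :=
  L.contDiff.comp_contDiffOn hg

theorem fderiv_comp_add_comp {X V₁ V₂ : Type*} [NormedAddCommGroup X] [NormedSpace ℝ X]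
    [NormedAddCommGroup V₁] [NormedSpace ℝ V₁] [NormedAddCommGroup V₂] [NormedSpace ℝ V₂]
    {p : X → V₁ →L[ℝ] ℝ} {r : X → V₂ →L[ℝ] ℝ} {p' : X →L[ℝ] V₁ →L[ℝ] ℝ} {r' : X →L[ℝ] V₂ →L[ℝ] ℝ}
    {z : X} (hp : HasFDerivAt p p' z) (hr : HasFDerivAt r r' z) (S : X →L[ℝ] V₁) (R : X →L[ℝ] V₂)
    (a c : X) : fderiv ℝ (fun z => (p z).comp S + (r z).comp R) z a c = p' a (S c) + r' a (R c) := by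
  have h := (hp.clm_comp (hasFDerivAt_const S z)).add (hr.clm_comp (hasFDerivAt_const R z))
  rw [show (fun z => (p z).comp S + (r z).comp R) =
    (fun z => (p z).comp S) + fun z => (r z).comp R from rfl, h.fderiv]
  simp

variable {n : ℕ} {H : ℝ → Cot (E n) → ℝ}

theorem IsTonelli.contDiff (hH : IsTonelli H) {t : ℝ} (ht : t ∈ Icc (0 : ℝ) 1) :
    ContDiff ℝ ∞ (H t) := (partial_fderiv hH.smooth).2 t ht

theorem IsTonelli.pos (hH : IsTonelli H) {t : ℝ} (ht : t ∈ Icc (0 : ℝ) 1) (q : E n)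
    (p η : E n →L[ℝ] ℝ) (hη : η ≠ 0) :
    0 < fderiv ℝ (fderiv ℝ (H t)) (q, p) (0, η) (0, η) := by
  rw [← fderiv_fderiv_fiber (hH.contDiff ht)]
  exact hH.convex t ht q p η hη

theorem IsTonelli.contDiffOn_hamVec (hH : IsTonelli H) :
    ContDiffOn ℝ ∞ (fun z : ℝ × Cot (E n) => hamVec (H z.1) z.2) (Icc (0 : ℝ) 1 ×ˢ univ) :=
  (contDiffOn_clm_comp (partial_fderiv hH.smooth).1
    ((flatE (E n)).symm : (Cot (E n) →L[ℝ] ℝ) →L[ℝ] Cot (E n))).neg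

theorem isHamiltonianOrbit_iff {T : ℝ} {x : ℝ → Cot (E n)} : IsHamiltonianOrbit H T x ↔
    ∀ t ∈ Icc (0 : ℝ) T, HasDerivWithinAt x (hamVec (H t) (x t)) (Icc 0 T) t := by
  refine forall₂_congr fun t ht => ⟨?_, fun h => ⟨_, symp_hamVec (H t) (x t), h⟩⟩
  rintro ⟨Z, hZ, hd⟩
  rwa [← eq_hamVec hZ]

/-- The differential of the Hamiltonian flow at the initial point of an orbit on `[0,1]` is the
fundamental solution of the linearized equation. -/
theorem hasFDerivAt_hamFlow (hH : IsTonelli H) {x : ℝ → Cot (E n)}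
    (hx : ∀ t ∈ Icc (0 : ℝ) 1, HasDerivWithinAt x (hamVec (H t) (x t)) (Icc 0 1) t)
    {A : C(Icc (0 : ℝ) 1, Cot (E n) →L[ℝ] Cot (E n))}
    (hA : ∀ t, A t = fderiv ℝ (hamVec (H t)) (x t)) {t : ℝ} (ht : t ∈ Icc (0 : ℝ) 1) :
    HasFDerivAt (hamFlow H t) (fund A t) (x 0) := by
  have hf' := (partial_fderiv (G := fun t => hamVec (H t)) hH.contDiffOn_hamVec).1.continuousOn
  have hd : ∀ t ∈ Icc (0 : ℝ) 1, ∀ y,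
      HasFDerivAt (hamVec (H t)) (fderiv ℝ (hamVec (H t)) y) y := fun t ht y =>
    ((contDiff_hamVec (hH.contDiff ht)).differentiable (by simp) y).hasFDerivAt
  obtain ⟨g, hg, hgd⟩ := exists_orbit_family (f := fun t => hamVec (H t))
    (f' := fun t => fderiv ℝ (hamVec (H t))) hH.contDiffOn_hamVec.continuousOn hf' hd hx hA
  refine (hgd t).congr_of_eventuallyEq ?_
  filter_upwards [hg] with y hy
  have hsub : Icc (0 : ℝ) t ⊆ Icc 0 1 := Icc_subset_Icc_right ht.2
  have horb : ∀ s ∈ Icc (0 : ℝ) t, HasDerivWithinAt (g y) (hamVec (H s) (g y s)) (Icc 0 t) s :=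
    fun s hs => (hy.2 s (hsub hs)).mono hsub
  have hex : ∃ x, IsHamiltonianOrbit H t x ∧ x 0 = y :=
    ⟨g y, isHamiltonianOrbit_iff.2 horb, hy.1⟩
  rw [hamFlow, dif_pos hex]
  exact ode_unique (f := fun t => hamVec (H t)) hf' hd ht.2
    (isHamiltonianOrbit_iff.1 hex.choose_spec.1) horb (hex.choose_spec.2.trans hy.1.symm)
    ⟨ht.1, le_rfl⟩

/-- The coefficients of the linearized problem along an extremal. -/
structure IsLinearization (H : ℝ → Cot (E n) → ℝ) (γ : ℝ → E n)
    (A : C(Icc (0 : ℝ) 1, Cot (E n) →L[ℝ] Cot (E n))) : Prop where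
  symm : ∀ t ξ ζ, symp (A t ξ) ζ = symp (A t ζ) ξ
  pos : ∀ t (α : E n →L[ℝ] ℝ), α ≠ 0 → 0 < α (A t (0, α)).1
  flow : ∀ t ∈ Icc (0 : ℝ) 1, HasFDerivAt (hamFlow H t) (fund A t) (hamOrbit H γ 0)
  hess : ∀ (t : Icc (0 : ℝ) 1) (ξ : Cot (E n)) (c d : E n),
    fderiv ℝ (fderiv ℝ (lagr H t)) (γ t, vel γ t) (ξ.1, (A t ξ).1) (c, d) = (A t ξ).2 c + ξ.2 d

theorem exists_isLinearization (hH : IsTonelli H) {Q : Set (E n × E n)} {γ : ℝ → E n}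
    (hγ : IsExtremal H Q γ) : ∃ A, IsLinearization H γ A := by
  have hleg := fun t : Icc (0 : ℝ) 1 => exists_legendre_inverse (hH.contDiff t.2) (hH.pos t.2)
    (hH.superlinear t t.2)
  choose G hG hL hG' using hleg
  have hG1 : ∀ t z, (G t z).1 = z.1 := fun t z => congrArg Prod.fst (hG t z)
  have hG2 : ∀ (t : Icc (0 : ℝ) 1) z, (hamVec (H t) (G t z)).1 = z.2 := fun t z => congrArg Prod.snd (hG t z)
  have hLd : ∀ (t : Icc (0 : ℝ) 1) z, HasFDerivAt (lagr H t) ((G t z).2.comp (ContinuousLinearMap.snd ℝ (E n) (E n)) +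
          (hamVec (H t) (G t z)).2.comp (ContinuousLinearMap.fst ℝ (E n) (E n))) z := hL
  have hV : ∀ (t : Icc (0 : ℝ) 1) q v, lagrV H t q v = (G t (q, v)).2 := by
    intro t q v
    have := (hLd t (q, v)).comp v (hasFDerivAt_prodMk_right q v)
    refine this.fderiv.trans ?_
    ext y
    simp
  have hQ : ∀ (t : Icc (0 : ℝ) 1) q v, lagrQ H t q v = (hamVec (H t) (G t (q, v))).2 := by
    intro t q v
    have := (hLd t (q, v)).comp (f := fun q' => (q', v)) q
      (hasFDerivAt_prodMk_left q v)
    refine this.fderiv.trans ?_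
    ext y
    simp
  have hx : ∀ t : Icc (0 : ℝ) 1, hamOrbit H γ t = G t (γ t, vel γ t) := fun t =>
    Prod.ext (hG1 t (γ t, vel γ t)).symm (hV t _ _)
  have hder : ∀ t ∈ Icc (0 : ℝ) 1, HasDerivWithinAt (hamOrbit H γ)
      (hamVec (H t) (hamOrbit H γ t)) (Icc 0 1) t := by
    intro t ht
    have h1 : HasDerivWithinAt γ (vel γ t) (Icc 0 1) t :=
      (hγ.contDiff.differentiableOn (by simp) t ht).hasDerivWithinAt
    have h2 := h1.prodMk (hγ.euler t ht)
    have h3 : hamVec (H t) (hamOrbit H γ t) = (vel γ t, lagrQ H t (γ t) (vel γ t)) := by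
      rw [hx ⟨t, ht⟩]
      exact Prod.ext (hG2 ⟨t, ht⟩ _) (hQ ⟨t, ht⟩ _ _).symm
    rw [h3]
    exact h2
  have hxc : ContinuousOn (hamOrbit H γ) (Icc 0 1) := fun t ht => (hder t ht).continuousWithinAt
  have hf' := (partial_fderiv (G := fun t => hamVec (H t)) hH.contDiffOn_hamVec).1.continuousOn
  have hAc : Continuous fun t : Icc (0 : ℝ) 1 => fderiv ℝ (hamVec (H t)) (hamOrbit H γ t) := by
    have h1 : Continuous fun t : Icc (0 : ℝ) 1 => ((t : ℝ), hamOrbit H γ t) :=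
      continuous_subtype_val.prodMk (continuousOn_iff_continuous_domRestrict.1 hxc)
    exact hf'.comp_continuous h1 fun t => ⟨t.2, mem_univ _⟩
  refine ⟨⟨_, hAc⟩, fun t ξ ζ => ?_, fun t α hα => ?_, fun t ht => ?_, fun t ξ c d => ?_⟩
  · exact symp_fderiv_hamVec_symm (hH.contDiff t.2) _ _ _
  · have h1 := hH.pos t.2 (hamOrbit H γ t).1 (hamOrbit H γ t).2 α hα
    have h2 := symp_fderiv_hamVec (hH.contDiff t.2) (hamOrbit H γ t) (0, α) (0, α)
    simp only [symp, map_zero, zero_sub, neg_inj] at h2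
    change 0 < α (fderiv ℝ (hamVec (H t)) (hamOrbit H γ t) (0, α)).1
    rw [h2]
    exact h1
  · exact hasFDerivAt_hamFlow hH hder (fun t => rfl) ht
  · obtain ⟨G', hG'd, hG'i⟩ := hG' t (γ t, vel γ t)
    have h1 : fderiv ℝ (lagr H t) = fun z =>
        (G t z).2.comp (ContinuousLinearMap.snd ℝ (E n) (E n)) +
          (hamVec (H t) (G t z)).2.comp (ContinuousLinearMap.fst ℝ (E n) (E n)) :=
      funext fun z => (hLd t z).fderiv
    have h2 : HasFDerivAt (fun z => (G t z).2)
        ((ContinuousLinearMap.snd ℝ (E n) (E n →L[ℝ] ℝ)).comp G') (γ t, vel γ t) :=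
      hasFDerivAt_snd.comp _ hG'd
    have h3 : HasFDerivAt (hamVec (H t)) (fderiv ℝ (hamVec (H t)) (G t (γ t, vel γ t)))
        (G t (γ t, vel γ t)) :=
      ((contDiff_hamVec (hH.contDiff t.2)).differentiable (by simp) _).hasFDerivAt
    have h4 : HasFDerivAt (fun z => (hamVec (H t) (G t z)).2)
        ((ContinuousLinearMap.snd ℝ (E n) (E n →L[ℝ] ℝ)).comp
          ((fderiv ℝ (hamVec (H t)) (G t (γ t, vel γ t))).comp G')) (γ t, vel γ t) :=
      hasFDerivAt_snd.comp _ (h3.comp _ hG'd)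
    rw [h1, fderiv_comp_add_comp h2 h4]
    have h5 : ∀ ξ : Cot (E n), ((⟨_, hAc⟩ : C(Icc (0 : ℝ) 1, Cot (E n) →L[ℝ] Cot (E n))) t) ξ =
        fderiv ℝ (hamVec (H t)) (G t (γ t, vel γ t)) ξ := by
      intro ξ
      rw [← hx t]
      rfl
    simp only [h5, ContinuousLinearMap.comp_apply, hG'i]
    exact add_comm _ _

end Linearization

section AbstractIndex

variable {H : Type*} [NormedAddCommGroup H] [InnerProductSpace ℝ H] [CompleteSpace H]

/-- The quadratic form of a compact self-adjoint operator is bounded by `c` on the orthogonal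
complement of the eigenspaces for eigenvalues larger than `c`. -/
theorem inner_le_of_orthogonal_eigenspaces {R : H →L[ℝ] H} (hR : IsCompactOperator R)
    (hsym : (R : H →ₗ[ℝ] H).IsSymmetric) {c : ℝ} {f : H}
    (hf : ∀ μ, c < μ → ∀ e : H, R e = μ • e → inner ℝ f e = 0) :
    inner ℝ f (R f) ≤ c * ‖f‖ ^ 2 := by
  let eig : ℝ → Submodule ℝ H := fun μ => Module.End.eigenspace (R : Module.End ℝ H) μ
  have heig : ∀ {μ e}, e ∈ eig μ ↔ R e = μ • e := fun {μ e} => Module.End.mem_eigenspace_iff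
  have hort : OrthogonalFamily ℝ (fun μ => eig μ) fun μ => (eig μ).subtypeₗᵢ :=
    hsym.orthogonalFamily_eigenspaces
  let B : Submodule ℝ H := ⨆ μ : {μ : ℝ // μ ≤ c}, eig μ
  have hB : ∀ x ∈ B, inner ℝ x (R x) ≤ c * ‖x‖ ^ 2 := by
    intro x hx
    obtain ⟨g, hg, rfl⟩ := (Submodule.mem_iSup_iff_exists_finsupp _ x).1 hx
    have hort' := hort.comp (f := ((↑) : {μ : ℝ // μ ≤ c} → ℝ)) Subtype.coe_injective
    let l : ∀ μ : {μ : ℝ // μ ≤ c}, eig μ := fun μ => ⟨g μ, hg μ⟩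
    let l' : ∀ μ : {μ : ℝ // μ ≤ c}, eig μ := fun μ => (μ : ℝ) • l μ
    have h1 : (g.sum fun _ y => y) = ∑ μ ∈ g.support, (eig μ).subtypeₗᵢ (l μ) := rfl
    have h2 : R (g.sum fun _ y => y) = ∑ μ ∈ g.support, (eig μ).subtypeₗᵢ (l' μ) := by
      rw [h1, map_sum]
      refine Finset.sum_congr rfl fun μ _ => ?_
      exact heig.1 (hg μ)
    rw [h2, h1, hort'.inner_sum, hort'.norm_sum, Finset.mul_sum]
    refine Finset.sum_le_sum fun μ _ => ?_
    simp only [l']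
    rw [inner_smul_right, real_inner_self_eq_norm_sq]
    exact mul_le_mul_of_nonneg_right μ.2 (sq_nonneg _)
  have hcl : ∀ x ∈ B.topologicalClosure, inner ℝ x (R x) ≤ c * ‖x‖ ^ 2 := by
    intro x hx
    have hclosed : IsClosed {x : H | inner ℝ x (R x) ≤ c * ‖x‖ ^ 2} :=
      isClosed_le (by fun_prop) (by fun_prop)
    have h1 : closure (B : Set H) ⊆ {x : H | inner ℝ x (R x) ≤ c * ‖x‖ ^ 2} :=
      closure_minimal hB hclosed
    exact h1 hx
  refine hcl f ?_
  have hcomp : CompleteSpace B.topologicalClosure := B.isClosed_topologicalClosure.completeSpace_coe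
  let g := f - (B.topologicalClosure.starProjection f : H)
  have hgB : ∀ x ∈ B.topologicalClosure, inner ℝ x g = 0 := fun x hx =>
    (Submodule.mem_orthogonal _ _).1 (Submodule.sub_starProjection_mem_orthogonal f) x hx
  have hlarge : ∀ μ, c < μ → ∀ e : H, R e = μ • e → ∀ x ∈ B.topologicalClosure, inner ℝ e x = 0 := by
    intro μ hμ e he x hx
    have hclosed : IsClosed {x : H | inner ℝ e x = 0} := isClosed_eq (by fun_prop) continuous_const
    have h1 : (B : Set H) ⊆ {x : H | inner ℝ e x = 0} := by
      have h2 : B ≤ (ℝ ∙ e)ᗮ := iSup_le fun μ' x hx => by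
        rw [Submodule.mem_orthogonal_singleton_iff_inner_right]
        have hne : μ ≠ μ' := fun h => absurd μ'.2 (not_le.2 (h ▸ hμ))
        exact hort hne ⟨e, heig.2 he⟩ ⟨x, hx⟩
      exact fun x hx => Submodule.mem_orthogonal_singleton_iff_inner_right.1 (h2 hx)
    exact closure_minimal h1 hclosed hx
  have hg0 : g = 0 := by
    have h1 := ContinuousLinearMap.orthogonalComplement_iSup_eigenspaces_eq_bot hR hsym
    have h2 : g ∈ (⨆ μ, Module.End.eigenspace (R : Module.End ℝ H) μ)ᗮ := by
      rw [← Submodule.iInf_orthogonal, Submodule.mem_iInf]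
      intro μ
      rw [Submodule.mem_orthogonal]
      intro e he
      rcases le_or_gt μ c with hμ | hμ
      · exact hgB e (B.le_topologicalClosure (Submodule.mem_iSup_of_mem ⟨μ, hμ⟩ he))
      · have he' := heig.1 he
        rw [inner_sub_right, real_inner_comm, hf μ hμ e he', hlarge μ hμ e he' _
          (Submodule.starProjection_apply_mem _ _), sub_zero]
    rw [h1] at h2
    exact (Submodule.mem_bot ℝ).1 h2
  rw [sub_eq_zero.1 hg0]
  exact Submodule.starProjection_apply_mem _ _

variable {𝓥 : Type*} [AddCommGroup 𝓥] [Module ℝ 𝓥]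

/-- The kernel of the form `S + κ ⟨j·, j·⟩`. -/
def pencilKer (S : LinearMap.BilinForm ℝ 𝓥) (j : 𝓥 →ₗ[ℝ] H) (κ : ℝ) : Submodule ℝ 𝓥 where
  carrier := {u | ∀ v, S u v + κ * inner ℝ (j u) (j v) = 0}
  add_mem' := fun {u u'} hu hu' v => by
    have h1 := hu v
    have h2 := hu' v
    rw [map_add, map_add, LinearMap.add_apply, inner_add_left]
    linarith
  zero_mem' := fun v => by simp
  smul_mem' := fun c u hu v => by
    have h1 := hu v
    rw [map_smul, map_smul, LinearMap.smul_apply, inner_smul_left, smul_eq_mul]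
    simp only [conj_trivial]
    linear_combination c * h1

theorem mem_pencilKer {S : LinearMap.BilinForm ℝ 𝓥} {j : 𝓥 →ₗ[ℝ] H} {κ : ℝ} {u : 𝓥} :
    u ∈ pencilKer S j κ ↔ ∀ v, S u v + κ * inner ℝ (j u) (j v) = 0 := Iff.rfl

variable {S : LinearMap.BilinForm ℝ 𝓥} {j : 𝓥 →ₗ[ℝ] H} {K : ℝ}

theorem nonneg_of_orthogonal_pencilKer (hS : ∀ u v, S u v = S v u) (hj : Function.Injective j)
    (hK : 0 < K) (hpos : ∀ u, 0 ≤ S u u + K * inner ℝ (j u) (j u)) {G : H → 𝓥} {R : H →L[ℝ] H}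
    (hR : IsCompactOperator R) (hjG : ∀ f, j (G f) = R f)
    (hG : ∀ f v, S (G f) v + K * inner ℝ (j (G f)) (j v) = inner ℝ f (j v)) {u : 𝓥}
    (hu : ∀ κ ∈ Ioo 0 K, ∀ w ∈ pencilKer S j κ, inner ℝ (j u) (j w) = 0) : 0 ≤ S u u := by
  rcases eq_or_ne u 0 with rfl | hu0
  · simp
  have hsym : (R : H →ₗ[ℝ] H).IsSymmetric := by
    intro f g
    have h1 := hG g (G f)
    have h2 := hG f (G g)
    simp only [hjG] at h1 h2
    rw [hS, real_inner_comm (R f) (R g)] at h1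
    change inner ℝ (R f) g = inner ℝ f (R g)
    rw [real_inner_comm (R f) g] at *
    linarith
  have hbound : inner ℝ (j u) (R (j u)) ≤ 1 / K * ‖j u‖ ^ 2 := by
    refine inner_le_of_orthogonal_eigenspaces hR hsym fun μ hμ e he => ?_
    have hμ0 : 0 < μ := lt_trans (by positivity) hμ
    have hmem : G e ∈ pencilKer S j (K - 1 / μ) := by
      intro v
      have h1 := hG e v
      have h2 : inner ℝ (j (G e)) (j v) = μ * inner ℝ e (j v) := by
        rw [hjG, he, inner_smul_left]
        rfl
      rw [h2] at h1 ⊢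
      have h3 : (K - 1 / μ) * (μ * inner ℝ e (j v)) =
          K * (μ * inner ℝ e (j v)) - inner ℝ e (j v) := by
        field_simp
      rw [h3]
      linarith
    have h4 : 1 / μ < K := by
      rw [div_lt_iff₀ hμ0]
      rw [div_lt_iff₀ hK] at hμ
      linarith
    have h4' : 0 < 1 / μ := by positivity
    have h5 := hu (K - 1 / μ) ⟨by linarith, by linarith⟩ _ hmem
    rw [hjG, he, inner_smul_right] at h5
    exact (mul_eq_zero.1 h5).resolve_left hμ0.ne'
  have hju : 0 < ‖j u‖ ^ 2 := by
    have : j u ≠ 0 := fun h => hu0 (hj (by rw [h, map_zero]))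
    positivity
  let SK : LinearMap.BilinForm ℝ 𝓥 := S + K • ((innerₗ H).compl₁₂ j j)
  have hSK : ∀ u v, SK u v = S u v + K * inner ℝ (j u) (j v) := fun u v => rfl
  have hCS := LinearMap.BilinForm.apply_sq_le_of_symm SK (fun u => by rw [hSK]; exact hpos u)
    ⟨fun x y => by simp [hSK, hS x y, real_inner_comm]⟩ (G (j u)) u
  have e1 : SK (G (j u)) u = ‖j u‖ ^ 2 := by
    rw [hSK, hG, real_inner_self_eq_norm_sq]
  have e2 : SK (G (j u)) (G (j u)) = inner ℝ (j u) (R (j u)) := by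
    rw [hSK, hG, hjG]
  rw [e1, e2] at hCS
  have hSKu : 0 ≤ SK u u := by rw [hSK]; exact hpos u
  have h6 : (‖j u‖ ^ 2) ^ 2 ≤ 1 / K * ‖j u‖ ^ 2 * SK u u :=
    hCS.trans (mul_le_mul_of_nonneg_right hbound hSKu)
  have h7 : K * ‖j u‖ ^ 2 ≤ SK u u := by
    have h8 : 1 / K * ‖j u‖ ^ 2 * SK u u = ‖j u‖ ^ 2 * (SK u u / K) := by ring
    rw [h8, sq (‖j u‖ ^ 2)] at h6
    have h9 := le_of_mul_le_mul_left h6 hju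
    rw [le_div_iff₀ hK] at h9
    linarith
  rw [hSK, real_inner_self_eq_norm_sq] at h7
  linarith

theorem pencilKer_form (hS : ∀ u v, S u v = S v u) {Z : Finset ℝ} (w : ∀ κ : Z, pencilKer S j κ) :
    S (∑ κ, (w κ : 𝓥)) (∑ κ, (w κ : 𝓥)) = -∑ κ : Z, (κ : ℝ) * ‖j (w κ)‖ ^ 2 := by
  have hoff : ∀ κ κ' : Z, κ ≠ κ' → S (w κ) (w κ') = 0 := by
    intro κ κ' hne
    have h1 := (w κ).2 (w κ')
    have h2 := (w κ').2 (w κ)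
    rw [hS, real_inner_comm] at h2
    have h3 : ((κ : ℝ) - κ') * inner ℝ (j (w κ)) (j (w κ')) = 0 := by linarith
    rcases mul_eq_zero.1 h3 with h4 | h4
    · exact absurd (Subtype.ext (sub_eq_zero.1 h4)) hne
    · rw [h4] at h1
      linarith
  rw [map_sum, ← Finset.sum_neg_distrib]
  refine Finset.sum_congr rfl fun κ _ => ?_
  rw [map_sum, LinearMap.sum_apply,
    Finset.sum_eq_single κ (fun κ' _ hne => hoff κ' κ hne) (by simp)]
  have h1 := (w κ).2 (w κ)
  rw [real_inner_self_eq_norm_sq] at h1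
  linarith

/-- The Morse index of a form with a compact Green operator is the sum of the dimensions of the
kernels of the forms `S + κ ⟨j·, j·⟩`, `0 < κ < K`. -/
theorem exists_negative_and_bound (hS : ∀ u v, S u v = S v u) (hj : Function.Injective j)
    (hK : 0 < K) (hpos : ∀ u, 0 ≤ S u u + K * inner ℝ (j u) (j u)) {G : H → 𝓥} {R : H →L[ℝ] H}
    (hR : IsCompactOperator R) (hjG : ∀ f, j (G f) = R f)
    (hG : ∀ f v, S (G f) v + K * inner ℝ (j (G f)) (j v) = inner ℝ f (j v)) {Z : Finset ℝ}
    (hZ : ∀ κ ∈ Z, 0 < κ) (hZ' : ∀ κ ∈ Ioo 0 K, κ ∉ Z → pencilKer S j κ = ⊥)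
    (hfin : ∀ κ, Module.Finite ℝ (pencilKer S j κ)) :
    (∃ Y : Submodule ℝ 𝓥, (∀ u ∈ Y, u ≠ 0 → S u u < 0) ∧
      Module.rank ℝ Y = ((∑ κ ∈ Z, Module.finrank ℝ (pencilKer S j κ) : ℕ) : Cardinal)) ∧
    ∀ Y : Submodule ℝ 𝓥, (∀ u ∈ Y, u ≠ 0 → S u u < 0) →
      Module.rank ℝ Y ≤ ((∑ κ ∈ Z, Module.finrank ℝ (pencilKer S j κ) : ℕ) : Cardinal) := by
  have hsum : ∑ κ ∈ Z, Module.finrank ℝ (pencilKer S j κ) =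
      ∑ κ : Z, Module.finrank ℝ (pencilKer S j κ) :=
    (Finset.sum_coe_sort Z fun κ => Module.finrank ℝ (pencilKer S j κ)).symm
  constructor
  · let Φ : (∀ κ : Z, pencilKer S j κ) →ₗ[ℝ] 𝓥 :=
      ∑ κ : Z, (pencilKer S j κ).subtype ∘ₗ LinearMap.proj κ
    have hΦ : ∀ w, Φ w = ∑ κ, (w κ : 𝓥) := fun w => by simp [Φ, LinearMap.sum_apply]
    have hneg : ∀ w, w ≠ 0 → S (Φ w) (Φ w) < 0 := by
      intro w hw
      rw [hΦ, pencilKer_form hS, neg_lt_zero]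
      obtain ⟨κ, hκ⟩ := Function.ne_iff.1 hw
      have hne : j (w κ) ≠ 0 := fun h => hκ (Subtype.ext (hj (by rw [h]; simp)))
      refine Finset.sum_pos' (fun κ' _ => mul_nonneg (hZ κ' κ'.2).le (sq_nonneg _))
        ⟨κ, Finset.mem_univ _, mul_pos (hZ κ κ.2) (by positivity)⟩
    have hinj : Function.Injective Φ := by
      rw [injective_iff_map_eq_zero]
      intro w hw
      by_contra hne
      have := hneg w hne
      rw [hw] at this
      simp at this
    refine ⟨LinearMap.range Φ, ?_, ?_⟩
    · rintro _ ⟨w, rfl⟩ hne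
      exact hneg w fun h => hne (by rw [h, map_zero])
    · rw [rank_range_of_injective Φ hinj, ← Module.finrank_eq_rank, Module.finrank_pi_fintype, hsum]
  · intro Y hY
    let Φ : Y →ₗ[ℝ] (∀ κ : Z, Module.Dual ℝ (pencilKer S j κ)) :=
      LinearMap.pi fun κ => ((innerₗ H).compl₁₂ j (j ∘ₗ (pencilKer S j κ).subtype)) ∘ₗ Y.subtype
    have hΦ : ∀ (u : Y) κ w, Φ u κ w = inner ℝ (j u) (j w) := fun u κ w => rfl
    have hinj : Function.Injective Φ := by
      rw [injective_iff_map_eq_zero]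
      intro u hu
      by_contra hne
      have h1 := hY u u.2 fun h => hne (Subtype.ext h)
      refine absurd (nonneg_of_orthogonal_pencilKer hS hj hK hpos hR hjG hG fun κ hκ w hw => ?_)
        (not_le.2 h1)
      by_cases hκZ : κ ∈ Z
      · rw [← hΦ u ⟨κ, hκZ⟩ ⟨w, hw⟩, hu]
        rfl
      · rw [hZ' κ hκ hκZ, Submodule.mem_bot] at hw
        simp [hw]
    have h1 := LinearMap.rank_le_of_injective Φ hinj
    rw [← Module.finrank_eq_rank ℝ (∀ κ : Z, Module.Dual ℝ (pencilKer S j κ)),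
      Module.finrank_pi_fintype] at h1
    simp only [Subspace.dual_finrank_eq] at h1
    rw [hsum]
    exact h1

end AbstractIndex

section Integration

variable {X : Type*} [NormedAddCommGroup X] [NormedSpace ℝ X]

/-- Lebesgue measure on `[0,1]`. -/
abbrev μI : Measure ℝ := volume.restrict (Icc (0 : ℝ) 1)

theorem ae_eq_of_integral_eq [CompleteSpace X] {g g' : ℝ → X} (hg : IntegrableOn g (Icc (0 : ℝ) 1))
    (hg' : IntegrableOn g' (Icc (0 : ℝ) 1))
    (h : ∀ t ∈ Icc (0 : ℝ) 1, ∫ s in (0 : ℝ)..t, g s = ∫ s in (0 : ℝ)..t, g' s) :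
    g =ᵐ[μI] g' := by
  have h0 : (0 : ℝ) ∈ Icc (0 : ℝ) 1 := by simp
  have h1 : (1 : ℝ) ∈ Icc (0 : ℝ) 1 := by simp
  have e := (intervalIntegrable_of_integrableOn hg h0 h1).ae_hasDerivAt_integral
  have e' := (intervalIntegrable_of_integrableOn hg' h0 h1).ae_hasDerivAt_integral
  have n0 : ∀ᵐ x : ℝ, x ≠ 0 := by simp [ae_iff, measure_singleton]
  have n1 : ∀ᵐ x : ℝ, x ≠ 1 := by simp [ae_iff, measure_singleton]
  rw [EventuallyEq, ae_restrict_iff' measurableSet_Icc]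
  filter_upwards [e, e', n0, n1] with x hx hx' hx0 hx1 hxI
  rw [uIcc_of_le zero_le_one] at hx hx'
  have hlt : x ∈ Ioo (0 : ℝ) 1 := ⟨lt_of_le_of_ne hxI.1 (Ne.symm hx0), lt_of_le_of_ne hxI.2 hx1⟩
  refine (hx hxI 0 h0).unique ((hx' hxI 0 h0).congr_of_eventuallyEq ?_)
  filter_upwards [Icc_mem_nhds hlt.1 hlt.2] with t ht
  exact h t ht

theorem integrableOn_of_memLp {g : ℝ → X} (hg : MemLp g 2 μI) : IntegrableOn g (Icc (0 : ℝ) 1) :=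
  hg.integrable (by norm_num)

theorem memLp_ext (w : C(Icc (0 : ℝ) 1, X)) : MemLp (ext w) 2 μI :=
  MemLp.of_bound (continuous_ext w).aestronglyMeasurable ‖w‖ (ae_of_all _ (norm_ext_le w))

theorem memLp_clm {Y : Type*} [NormedAddCommGroup Y] [NormedSpace ℝ Y]
    (Θ : C(Icc (0 : ℝ) 1, X →L[ℝ] Y)) {g : ℝ → X} (hg : MemLp g 2 μI) :
    MemLp (fun t => ext Θ t (g t)) 2 μI := by
  refine MemLp.of_le_mul (c := ‖Θ‖) hg ?_ (ae_of_all _ fun t => ?_)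
  · exact ContinuousLinearMap.aestronglyMeasurable_comp₂ (ContinuousLinearMap.id ℝ (X →L[ℝ] Y))
      (continuous_ext Θ).aestronglyMeasurable hg.1
  · exact ((ext Θ t).le_opNorm _).trans
      (mul_le_mul_of_nonneg_right (norm_ext_le Θ t) (norm_nonneg _))

theorem integrable_dual {p : ℝ → X →L[ℝ] ℝ} {v : ℝ → X} (hp : MemLp p 2 μI) (hv : MemLp v 2 μI) :
    Integrable (fun t => p t (v t)) μI := by
  have h1 : Integrable (fun t => ‖p t‖ * ‖v t‖) μI := hp.norm.integrable_mul hv.norm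
  refine h1.mono' ?_ (ae_of_all _ fun t => (p t).le_opNorm _)
  exact ContinuousLinearMap.aestronglyMeasurable_comp₂ (ContinuousLinearMap.id ℝ (X →L[ℝ] ℝ))
    hp.1 hv.1

theorem integral_parts_real {f g f' g' : ℝ → ℝ} (hf' : IntegrableOn f' (Icc (0 : ℝ) 1))
    (hg' : IntegrableOn g' (Icc (0 : ℝ) 1))
    (hf : ∀ t ∈ Icc (0 : ℝ) 1, f t = f 0 + ∫ s in (0 : ℝ)..t, f' s)
    (hg : ∀ t ∈ Icc (0 : ℝ) 1, g t = g 0 + ∫ s in (0 : ℝ)..t, g' s) :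
    ∫ t in (0 : ℝ)..1, (f' t * g t + f t * g' t) = f 1 * g 1 - f 0 * g 0 := by
  have h0 : (0 : ℝ) ∈ Icc (0 : ℝ) 1 := by simp
  have h1 : (1 : ℝ) ∈ Icc (0 : ℝ) 1 := by simp
  have key : ∀ {f f' : ℝ → ℝ}, IntegrableOn f' (Icc (0 : ℝ) 1) →
      AbsolutelyContinuousOnInterval (fun t => f 0 + ∫ s in (0 : ℝ)..t, f' s) 0 1 ∧
      ∀ᵐ t, t ∈ Icc (0 : ℝ) 1 → deriv (fun t => f 0 + ∫ s in (0 : ℝ)..t, f' s) t = f' t := by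
    intro f f' hf'
    have hi := intervalIntegrable_of_integrableOn hf' h0 h1
    refine ⟨?_, ?_⟩
    · have hc : AbsolutelyContinuousOnInterval (fun _ : ℝ => f 0) 0 1 :=
        ((LipschitzWith.const (f 0)).lipschitzOnWith (s := uIcc 0 1)).absolutelyContinuousOnInterval
      exact hc.add (hi.absolutelyContinuousOnInterval_intervalIntegral (by simp))
    · filter_upwards [hi.ae_hasDerivAt_integral] with t ht htI
      rw [uIcc_of_le zero_le_one] at ht
      exact ((ht htI 0 h0).const_add (f 0)).deriv
  obtain ⟨hF, hFd⟩ := key (f := f) hf'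
  obtain ⟨hG, hGd⟩ := key (f := g) hg'
  have h2 := hF.integral_deriv_mul_eq_sub hG
  simp only [intervalIntegral.integral_same, add_zero] at h2
  rw [← hf 1 h1, ← hg 1 h1] at h2
  rw [← h2]
  refine intervalIntegral.integral_congr_ae ?_
  filter_upwards [hFd, hGd] with t h3 h4 ht
  rw [uIoc_of_le zero_le_one] at ht
  have htI := Ioc_subset_Icc_self ht
  rw [h3 htI, h4 htI, ← hf t htI, ← hg t htI]

end Integration

section Sobolev

variable {n : ℕ}

theorem dual_apply_eq_sum (p : E n →L[ℝ] ℝ) (v : E n) :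
    p v = ∑ i, p (EuclideanSpace.basisFun (Fin n) ℝ i) * v i := by
  conv_lhs => rw [← (EuclideanSpace.basisFun (Fin n) ℝ).sum_repr v]
  rw [map_sum]
  refine Finset.sum_congr rfl fun i _ => ?_
  rw [map_smul, smul_eq_mul, mul_comm]
  simp

theorem integral_parts {p p' : ℝ → E n →L[ℝ] ℝ} {v v' : ℝ → E n} (hp' : MemLp p' 2 μI)
    (hv' : MemLp v' 2 μI) (hpc : MemLp p 2 μI) (hvc : MemLp v 2 μI)
    (hp : ∀ t ∈ Icc (0 : ℝ) 1, p t = p 0 + ∫ s in (0 : ℝ)..t, p' s)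
    (hv : ∀ t ∈ Icc (0 : ℝ) 1, v t = v 0 + ∫ s in (0 : ℝ)..t, v' s) :
    ∫ t in (0 : ℝ)..1, (p' t (v t) + p t (v' t)) = p 1 (v 1) - p 0 (v 0) := by
  have h0 : (0 : ℝ) ∈ Icc (0 : ℝ) 1 := by simp
  have hbas := dual_apply_eq_sum (n := n)
  set e := EuclideanSpace.basisFun (Fin n) ℝ
  let ev : Fin n → (E n →L[ℝ] ℝ) →L[ℝ] ℝ := fun i => ContinuousLinearMap.apply ℝ ℝ (e i)
  let pr : Fin n → E n →L[ℝ] ℝ := fun i => EuclideanSpace.proj i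
  have hev : ∀ i p, ev i p = p (e i) := fun i p => rfl
  have hpr : ∀ i v, pr i v = v i := fun i v => rfl
  have hev' : ∀ i {p : ℝ → E n →L[ℝ] ℝ}, MemLp p 2 μI → MemLp (fun t => p t (e i)) 2 μI :=
    fun i p hp => (ev i).comp_memLp' hp
  have hpr' : ∀ i {v : ℝ → E n}, MemLp v 2 μI → MemLp (fun t => v t i) 2 μI :=
    fun i v hv => (pr i).comp_memLp' hv
  have hcomp : ∀ i, ∫ t in (0 : ℝ)..1, (p' t (e i) * v t i + p t (e i) * v' t i) =
      p 1 (e i) * v 1 i - p 0 (e i) * v 0 i := by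
    intro i
    refine integral_parts_real (f := fun t => p t (e i)) (g := fun t => v t i)
      (integrableOn_of_memLp (hev' i hp')) (integrableOn_of_memLp (hpr' i hv')) ?_ ?_
    · intro t ht
      have h1 := congrArg (ev i) (hp t ht)
      rw [map_add, ← (ev i).intervalIntegral_comp_comm
        (intervalIntegrable_of_integrableOn (integrableOn_of_memLp hp') h0 ht)] at h1
      exact h1
    · intro t ht
      have h1 := congrArg (pr i) (hv t ht)
      rw [map_add, ← (pr i).intervalIntegral_comp_comm
        (intervalIntegrable_of_integrableOn (integrableOn_of_memLp hv') h0 ht)] at h1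
      exact h1
  have hIntegral : ∀ i ∈ Finset.univ, IntervalIntegrable
      (fun t => p' t (e i) * v t i + p t (e i) * v' t i) volume 0 1 := by
    intro i _
    have h1 : Integrable (fun t => p' t (e i) * v t i + p t (e i) * v' t i) μI :=
      ((hev' i hp').integrable_mul (hpr' i hvc)).add ((hev' i hpc).integrable_mul (hpr' i hv'))
    exact intervalIntegrable_of_integrableOn h1 h0 (by simp)
  have hsum : ∀ t, p' t (v t) + p t (v' t) =
      ∑ i, (p' t (e i) * v t i + p t (e i) * v' t i) := by
    intro t
    rw [hbas (p' t) (v t), hbas (p t) (v' t), Finset.sum_add_distrib]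
  simp only [hsum]
  rw [intervalIntegral.integral_finsetSum hIntegral, Finset.sum_congr rfl fun i _ => hcomp i,
    Finset.sum_sub_distrib, hbas (p 1), hbas (p 0)]

/-- An element of `W^{1,2}` as a continuous map. -/
def w12C (u : W12 n) : C(Icc (0 : ℝ) 1, E n) where
  toFun := (u : Icc (0 : ℝ) 1 → E n)
  continuous_toFun := by
    obtain ⟨g, hg, hu⟩ := u.2
    have h1 : (u : Icc (0 : ℝ) 1 → E n) = fun t => (u : Icc (0 : ℝ) 1 → E n) 0 +
      primOf g (integrableOn_of_memLp hg) t := funext hu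
    rw [h1]
    exact continuous_const.add (ContinuousMap.continuous _)

theorem w12Val_coe (u : W12 n) (t : Icc (0 : ℝ) 1) : w12Val u t = (u : Icc (0 : ℝ) 1 → E n) t :=
  ext_coe (u : Icc (0 : ℝ) 1 → E n) t

theorem w12Val_zero (u : W12 n) : w12Val u 0 = (u : Icc (0 : ℝ) 1 → E n) 0 :=
  w12Val_coe u 0

theorem w12Val_one (u : W12 n) : w12Val u 1 = (u : Icc (0 : ℝ) 1 → E n) 1 :=
  w12Val_coe u 1

theorem memLp_w12Deriv (u : W12 n) : MemLp (w12Deriv u) 2 μI := u.2.choose_spec.1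

theorem memLp_w12Val (u : W12 n) : MemLp (w12Val u) 2 μI := memLp_ext (w12C u)

theorem w12Val_eq (u : W12 n) {t : ℝ} (ht : t ∈ Icc (0 : ℝ) 1) :
    w12Val u t = w12Val u 0 + ∫ s in (0 : ℝ)..t, w12Deriv u s := by
  have h1 := u.2.choose_spec.2 ⟨t, ht⟩
  rw [w12Val_zero, w12Val_coe u ⟨t, ht⟩]
  exact h1

theorem w12Deriv_ae_eq (u : W12 n) {g : ℝ → E n} (hg : MemLp g 2 μI)
    (h : ∀ t : Icc (0 : ℝ) 1, (u : Icc (0 : ℝ) 1 → E n) t =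
      (u : Icc (0 : ℝ) 1 → E n) 0 + ∫ s in (0 : ℝ)..t, g s) : w12Deriv u =ᵐ[μI] g := by
  refine ae_eq_of_integral_eq (integrableOn_of_memLp (memLp_w12Deriv u)) (integrableOn_of_memLp hg) ?_
  intro t ht
  have h1 := w12Val_eq u ht
  have h2 := h ⟨t, ht⟩
  rw [w12Val_zero, w12Val_coe u ⟨t, ht⟩, h2] at h1
  exact (add_left_cancel h1).symm

theorem w12Deriv_add (u v : W12 n) : w12Deriv (u + v) =ᵐ[μI] w12Deriv u + w12Deriv v := by
  refine w12Deriv_ae_eq _ ((memLp_w12Deriv u).add (memLp_w12Deriv v)) fun t => ?_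
  have h0 : (0 : ℝ) ∈ Icc (0 : ℝ) 1 := by simp
  have hi := fun u : W12 n => intervalIntegrable_of_integrableOn
    (integrableOn_of_memLp (memLp_w12Deriv u)) h0 t.2
  simp only [Pi.add_apply]
  rw [intervalIntegral.integral_add (hi u) (hi v)]
  have h1 := w12Val_eq u t.2
  have h2 := w12Val_eq v t.2
  rw [w12Val_zero, w12Val_coe] at h1 h2
  change (u : Icc (0 : ℝ) 1 → E n) t + (v : Icc (0 : ℝ) 1 → E n) t =
    (u : Icc (0 : ℝ) 1 → E n) 0 + (v : Icc (0 : ℝ) 1 → E n) 0 + _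
  rw [h1, h2]
  abel

theorem w12Deriv_smul (c : ℝ) (u : W12 n) : w12Deriv (c • u) =ᵐ[μI] c • w12Deriv u := by
  refine w12Deriv_ae_eq _ ((memLp_w12Deriv u).const_smul c) fun t => ?_
  have h1 := w12Val_eq u t.2
  rw [w12Val_zero, w12Val_coe] at h1
  simp only [Pi.smul_apply]
  rw [intervalIntegral.integral_smul]
  change c • (u : Icc (0 : ℝ) 1 → E n) t = c • (u : Icc (0 : ℝ) 1 → E n) 0 + _
  rw [h1, smul_add]

theorem w12Val_add (u v : W12 n) : w12Val (u + v) = w12Val u + w12Val v := rfl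

theorem w12Val_smul (c : ℝ) (u : W12 n) : w12Val (c • u) = c • w12Val u := rfl

/-- The element of `W^{1,2}` with initial value `q` and derivative `g`. -/
def mkW12 (q : E n) (g : ℝ → E n) (hg : MemLp g 2 μI) : W12 n :=
  ⟨fun t => q + ∫ s in (0 : ℝ)..t, g s, g, hg, fun t => by simp⟩

theorem mkW12_apply (q : E n) (g : ℝ → E n) (hg : MemLp g 2 μI) (t : Icc (0 : ℝ) 1) :
    (mkW12 q g hg : Icc (0 : ℝ) 1 → E n) t = q + ∫ s in (0 : ℝ)..t, g s := rfl

theorem w12Deriv_mkW12 (q : E n) (g : ℝ → E n) (hg : MemLp g 2 μI) :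
    w12Deriv (mkW12 q g hg) =ᵐ[μI] g :=
  w12Deriv_ae_eq _ hg fun t => by simp [mkW12_apply]

end Sobolev

section Pencil

variable {X : Type*} [NormedAddCommGroup X] [NormedSpace ℝ X]

/-- The affine family `A + κ B` of linear systems. -/
def pencil (A B : C(Icc (0 : ℝ) 1, X →L[ℝ] X)) (κ : ℝ) : C(Icc (0 : ℝ) 1, X →L[ℝ] X) := A + κ • B

theorem pencil_apply (A B : C(Icc (0 : ℝ) 1, X →L[ℝ] X)) (κ : ℝ) (t : Icc (0 : ℝ) 1) (ξ : X) :
    pencil A B κ t ξ = A t ξ + κ • B t ξ := rfl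

theorem pencil_zero (A B : C(Icc (0 : ℝ) 1, X →L[ℝ] X)) : pencil A B 0 = A := by
  rw [pencil, zero_smul ℝ B, add_zero]

end Pencil

section ConvexSystem

variable {n : ℕ}

/-- A linear Hamiltonian system `z' = A z` on `T*ℝ^n` with fibrewise positive definite
Hamiltonian. -/
structure IsConvexSystem (A : C(Icc (0 : ℝ) 1, Cot (E n) →L[ℝ] Cot (E n))) : Prop where
  symm : ∀ t ξ ζ, symp (A t ξ) ζ = symp (A t ζ) ξ
  pos : ∀ t (α : E n →L[ℝ] ℝ), α ≠ 0 → 0 < α (A t (0, α)).1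

/-- `Θ t` is the inverse of the linearised Legendre transform `ξ ↦ (ξ.1, (A t ξ).1)`. -/
structure IsLegendreInverse (A : C(Icc (0 : ℝ) 1, Cot (E n) →L[ℝ] Cot (E n)))
    (Θ : C(Icc (0 : ℝ) 1, (E n × E n) →L[ℝ] Cot (E n))) : Prop where
  fst : ∀ t z, (Θ t z).1 = z.1
  fst_map : ∀ t z, (A t (Θ t z)).1 = z.2
  left_inv : ∀ t ξ, Θ t (ξ.1, (A t ξ).1) = ξ

theorem IsLinearization.isConvexSystem {H : ℝ → Cot (E n) → ℝ} {γ : ℝ → E n}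
    {A : C(Icc (0 : ℝ) 1, Cot (E n) →L[ℝ] Cot (E n))} (h : IsLinearization H γ A) :
    IsConvexSystem A := ⟨h.symm, h.pos⟩

theorem continuous_clm_inverse {T X Y : Type*} [TopologicalSpace T] [NormedAddCommGroup X]
    [NormedSpace ℝ X] [NormedAddCommGroup Y] [NormedSpace ℝ Y] [CompleteSpace X]
    {L : T → X →L[ℝ] Y} (hL : Continuous L) (h : ∀ t, (L t).IsInvertible) :
    Continuous fun t => (L t).inverse := by
  refine continuous_iff_continuousAt.2 fun t => ?_
  obtain ⟨e, he⟩ := h t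
  have h1 : ContinuousAt (ContinuousLinearMap.inverse : (X →L[ℝ] Y) → (Y →L[ℝ] X)) (L t) := by
    rw [← he]
    exact (contDiffAt_map_inverse (n := 0) e).continuousAt
  exact h1.comp hL.continuousAt

theorem continuous_clm_prod {T X Y Z : Type*} [TopologicalSpace T] [NormedAddCommGroup X]
    [NormedSpace ℝ X] [NormedAddCommGroup Y] [NormedSpace ℝ Y] [NormedAddCommGroup Z]
    [NormedSpace ℝ Z] {L : T → X →L[ℝ] Y} {M : T → X →L[ℝ] Z} (hL : Continuous L)
    (hM : Continuous M) : Continuous fun t => (L t).prod (M t) :=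
  (ContinuousLinearMap.prodₗᵢ (𝕜 := ℝ) (E := X) (F := Y) (G := Z) ℝ).continuous.comp
    (hL.prodMk hM)

theorem exists_isLegendreInverse {A : C(Icc (0 : ℝ) 1, Cot (E n) →L[ℝ] Cot (E n))}
    (hA : IsConvexSystem A) : ∃ Θ, IsLegendreInverse A Θ := by
  let L : Icc (0 : ℝ) 1 → Cot (E n) →L[ℝ] (E n × E n) := fun t =>
    (ContinuousLinearMap.fst ℝ (E n) (E n →L[ℝ] ℝ)).prod
      ((ContinuousLinearMap.fst ℝ (E n) (E n →L[ℝ] ℝ)).comp (A t))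
  have hLap : ∀ t ξ, L t ξ = (ξ.1, (A t ξ).1) := fun t ξ => rfl
  have hinj : ∀ t, Function.Injective (L t) := by
    intro t
    refine (injective_iff_map_eq_zero (L t)).2 fun ξ hξ => ?_
    rw [hLap, Prod.mk_eq_zero] at hξ
    obtain ⟨q, α⟩ := ξ
    obtain ⟨h1, h2⟩ := hξ
    simp only at h1
    subst h1
    by_contra hne
    have h3 : α ≠ 0 := fun h => hne (by rw [h]; rfl)
    have h4 := hA.pos t α h3
    rw [h2, map_zero] at h4
    exact lt_irrefl _ h4
  have hdim : Module.finrank ℝ (Cot (E n)) = Module.finrank ℝ (E n × E n) := by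
    rw [finrank_cot, Module.finrank_prod]
  have hinv : ∀ t, (L t).IsInvertible := by
    intro t
    let e := LinearEquiv.ofInjectiveOfFinrankEq (L t : Cot (E n) →ₗ[ℝ] (E n × E n)) (hinj t) hdim
    exact ⟨e.toContinuousLinearEquiv, ContinuousLinearMap.ext fun ξ => rfl⟩
  have hLc : Continuous L := by
    have h2 : Continuous fun t => (ContinuousLinearMap.fst ℝ (E n) (E n →L[ℝ] ℝ)).comp (A t) :=
      continuous_const.clm_comp A.continuous
    exact continuous_clm_prod continuous_const h2
  refine ⟨⟨fun t => (L t).inverse, continuous_clm_inverse hLc hinv⟩, ?_⟩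
  have hright : ∀ t z, L t ((L t).inverse z) = z := fun t z => by
    have := (hinv t).self_apply_inverse z
    exact this
  have hleft : ∀ t ξ, (L t).inverse (L t ξ) = ξ := fun t ξ => (hinv t).inverse_apply_self ξ
  exact ⟨fun t z => congrArg Prod.fst (hright t z), fun t z => congrArg Prod.snd (hright t z),
    hleft⟩

/-- The shift `(q, p) ↦ (0, ⟨q, ·⟩)`. -/
def shiftB (n : ℕ) : C(Icc (0 : ℝ) 1, Cot (E n) →L[ℝ] Cot (E n)) :=
  ContinuousMap.const _ ((ContinuousLinearMap.inr ℝ (E n) (E n →L[ℝ] ℝ)).comp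
    ((innerSL ℝ).comp (ContinuousLinearMap.fst ℝ (E n) (E n →L[ℝ] ℝ))))

theorem shiftB_apply (t : Icc (0 : ℝ) 1) (ξ : Cot (E n)) :
    shiftB n t ξ = (0, innerSL ℝ ξ.1) := rfl

theorem ext_shiftB (t : ℝ) (ξ : Cot (E n)) : ext (shiftB n) t ξ = (0, innerSL ℝ ξ.1) := rfl

variable {A : C(Icc (0 : ℝ) 1, Cot (E n) →L[ℝ] Cot (E n))}
  {Θ : C(Icc (0 : ℝ) 1, (E n × E n) →L[ℝ] Cot (E n))}

theorem pencil_shiftB_apply (κ : ℝ) (t : Icc (0 : ℝ) 1) (ξ : Cot (E n)) :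
    pencil A (shiftB n) κ t ξ = ((A t ξ).1, (A t ξ).2 + κ • innerSL ℝ ξ.1) := by
  rw [pencil_apply, shiftB_apply]
  refine Prod.ext ?_ rfl
  simp

theorem IsConvexSystem.shift (hA : IsConvexSystem A) (κ : ℝ) :
    IsConvexSystem (pencil A (shiftB n) κ) := by
  refine ⟨fun t ξ ζ => ?_, fun t α hα => ?_⟩
  · have h1 := hA.symm t ξ ζ
    simp only [pencil_shiftB_apply, symp, add_apply, smul_apply, innerSL_apply_apply,
      smul_eq_mul] at h1 ⊢
    rw [real_inner_comm ξ.1 ζ.1]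
    linarith
  · rw [pencil_shiftB_apply]
    exact hA.pos t α hα

theorem IsLegendreInverse.shift (hΘ : IsLegendreInverse A Θ) (κ : ℝ) :
    IsLegendreInverse (pencil A (shiftB n) κ) Θ := by
  refine ⟨hΘ.fst, fun t z => ?_, fun t ξ => ?_⟩
  · rw [pencil_shiftB_apply]
    exact hΘ.fst_map t z
  · rw [pencil_shiftB_apply]
    exact hΘ.left_inv t ξ

/-- The bilinear form `D²L` of the quadratic Lagrangian dual to `a`, in the coordinates of the
phase space. -/
def hessForm (a : Cot (E n) →L[ℝ] Cot (E n)) (ξ η : Cot (E n)) : ℝ := (a ξ).2 η.1 + ξ.2 (a η).1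

theorem hessForm_add_left (a : Cot (E n) →L[ℝ] Cot (E n)) (ξ ξ' η : Cot (E n)) :
    hessForm a (ξ + ξ') η = hessForm a ξ η + hessForm a ξ' η := by
  simp only [hessForm, map_add, Prod.snd_add, add_apply]
  ring

theorem hessForm_smul_left (a : Cot (E n) →L[ℝ] Cot (E n)) (c : ℝ) (ξ η : Cot (E n)) :
    hessForm a (c • ξ) η = c * hessForm a ξ η := by
  simp only [hessForm, map_smul, Prod.smul_snd, smul_apply, smul_eq_mul]
  ring

theorem hessForm_add_right (a : Cot (E n) →L[ℝ] Cot (E n)) (ξ η η' : Cot (E n)) :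
    hessForm a ξ (η + η') = hessForm a ξ η + hessForm a ξ η' := by
  simp only [hessForm, map_add, Prod.fst_add]
  ring

theorem hessForm_smul_right (a : Cot (E n) →L[ℝ] Cot (E n)) (c : ℝ) (ξ η : Cot (E n)) :
    hessForm a ξ (c • η) = c * hessForm a ξ η := by
  simp only [hessForm, map_smul, Prod.smul_fst, smul_eq_mul]
  ring

theorem IsConvexSystem.hessForm_symm (hA : IsConvexSystem A) (t : ℝ) (ξ η : Cot (E n)) :
    hessForm (ext A t) ξ η = hessForm (ext A t) η ξ := by
  have h1 : symp (ext A t ξ) η = symp (ext A t η) ξ := hA.symm _ ξ η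
  simp only [symp, hessForm] at h1 ⊢
  linarith

theorem integrable_hessForm (A : C(Icc (0 : ℝ) 1, Cot (E n) →L[ℝ] Cot (E n)))
    {z w : ℝ → Cot (E n)} (hz : MemLp z 2 μI) (hw : MemLp w 2 μI) :
    Integrable (fun t => hessForm (ext A t) (z t) (w t)) μI := by
  have h1 := memLp_clm A hz
  have h2 := memLp_clm A hw
  exact (integrable_dual h1.snd hw.fst).add (integrable_dual hz.snd h2.fst)

theorem memLp_clm_const {X Y : Type*} [NormedAddCommGroup X] [NormedSpace ℝ X]
    [NormedAddCommGroup Y] [NormedSpace ℝ Y] (L : X →L[ℝ] Y) {g : ℝ → X} (hg : MemLp g 2 μI) :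
    MemLp (fun t => L (g t)) 2 μI := L.comp_memLp' hg

/-- The phase-space lift of `u ∈ W^{1,2}`. -/
def w12Lift (Θ : C(Icc (0 : ℝ) 1, (E n × E n) →L[ℝ] Cot (E n))) (u : W12 n) (t : ℝ) : Cot (E n) :=
  ext Θ t (w12Val u t, w12Deriv u t)

theorem memLp_w12Lift (Θ : C(Icc (0 : ℝ) 1, (E n × E n) →L[ℝ] Cot (E n))) (u : W12 n) :
    MemLp (w12Lift Θ u) 2 μI :=
  memLp_clm Θ (MemLp.of_fst_snd ⟨memLp_w12Val u, memLp_w12Deriv u⟩)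

theorem w12Lift_add (Θ : C(Icc (0 : ℝ) 1, (E n × E n) →L[ℝ] Cot (E n))) (u v : W12 n) :
    w12Lift Θ (u + v) =ᵐ[μI] w12Lift Θ u + w12Lift Θ v := by
  filter_upwards [w12Deriv_add u v] with t ht
  simp only [w12Lift, Pi.add_apply, ← map_add, ht, w12Val_add, Prod.mk_add_mk]

theorem w12Lift_smul (Θ : C(Icc (0 : ℝ) 1, (E n × E n) →L[ℝ] Cot (E n))) (c : ℝ) (u : W12 n) :
    w12Lift Θ (c • u) =ᵐ[μI] c • w12Lift Θ u := by
  filter_upwards [w12Deriv_smul c u] with t ht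
  simp only [w12Lift, Pi.smul_apply, ← map_smul, ht, w12Val_smul, Prod.smul_mk]

theorem IsLegendreInverse.w12Lift_fst (hΘ : IsLegendreInverse A Θ) (u : W12 n) (t : ℝ) :
    (w12Lift Θ u t).1 = w12Val u t := hΘ.fst _ _

theorem IsLegendreInverse.map_w12Lift_fst (hΘ : IsLegendreInverse A Θ) (u : W12 n) (t : ℝ) :
    (ext A t (w12Lift Θ u t)).1 = w12Deriv u t := hΘ.fst_map _ _

/-- The second variation as a bilinear form on `W^{1,2}`. -/
def secBilin (A : C(Icc (0 : ℝ) 1, Cot (E n) →L[ℝ] Cot (E n)))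
    (Θ : C(Icc (0 : ℝ) 1, (E n × E n) →L[ℝ] Cot (E n))) : LinearMap.BilinForm ℝ (W12 n) :=
  LinearMap.mk₂ ℝ (fun u v => ∫ t, hessForm (ext A t) (w12Lift Θ u t) (w12Lift Θ v t) ∂μI)
    (by
      intro u u' v
      rw [← integral_add (integrable_hessForm A (memLp_w12Lift Θ u) (memLp_w12Lift Θ v))
        (integrable_hessForm A (memLp_w12Lift Θ u') (memLp_w12Lift Θ v))]
      refine integral_congr_ae ?_
      filter_upwards [w12Lift_add Θ u u'] with t ht
      rw [ht, Pi.add_apply, hessForm_add_left])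
    (by
      intro c u v
      rw [smul_eq_mul, ← integral_const_mul]
      refine integral_congr_ae ?_
      filter_upwards [w12Lift_smul Θ c u] with t ht
      rw [ht, Pi.smul_apply, hessForm_smul_left])
    (by
      intro u v v'
      rw [← integral_add (integrable_hessForm A (memLp_w12Lift Θ u) (memLp_w12Lift Θ v))
        (integrable_hessForm A (memLp_w12Lift Θ u) (memLp_w12Lift Θ v'))]
      refine integral_congr_ae ?_
      filter_upwards [w12Lift_add Θ v v'] with t ht
      rw [ht, Pi.add_apply, hessForm_add_right])
    (by
      intro c u v
      rw [smul_eq_mul, ← integral_const_mul]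
      refine integral_congr_ae ?_
      filter_upwards [w12Lift_smul Θ c v] with t ht
      rw [ht, Pi.smul_apply, hessForm_smul_right])

theorem secBilin_apply (u v : W12 n) : secBilin A Θ u v =
    ∫ t, hessForm (ext A t) (w12Lift Θ u t) (w12Lift Θ v t) ∂μI := rfl

theorem IsConvexSystem.secBilin_symm (hA : IsConvexSystem A) (u v : W12 n) :
    secBilin A Θ u v = secBilin A Θ v u :=
  integral_congr_ae (ae_of_all _ fun t => hA.hessForm_symm t _ _)

theorem intervalIntegral_eq_μI {X : Type*} [NormedAddCommGroup X] [NormedSpace ℝ X] (f : ℝ → X) :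
    ∫ t in (0 : ℝ)..1, f t = ∫ t, f t ∂μI := by
  rw [intervalIntegral.integral_of_le zero_le_one, integral_Icc_eq_integral_Ioc]

theorem IsLinearization.secondVar_eq {H : ℝ → Cot (E n) → ℝ} {γ : ℝ → E n}
    (h : IsLinearization H γ A) (hΘ : IsLegendreInverse A Θ) (u v : W12 n) :
    secondVar H γ u v = secBilin A Θ u v := by
  rw [secondVar, intervalIntegral_eq_μI, secBilin_apply]
  refine setIntegral_congr_fun measurableSet_Icc fun t ht => ?_
  have h1 := h.hess ⟨t, ht⟩ (w12Lift Θ u t) (w12Val v t) (w12Deriv v t)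
  have h2 : ext A t = A ⟨t, ht⟩ := ext_apply A ht
  rw [← h2, hΘ.w12Lift_fst, hΘ.map_w12Lift_fst] at h1
  simp only [hessForm, hΘ.w12Lift_fst, hΘ.map_w12Lift_fst]
  exact h1

theorem IsLegendreInverse.secBilin_pencil (hΘ : IsLegendreInverse A Θ) (κ : ℝ) (u v : W12 n) :
    secBilin (pencil A (shiftB n) κ) Θ u v =
      secBilin A Θ u v + κ * ∫ t, inner ℝ (w12Val u t) (w12Val v t) ∂μI := by
  have hi : Integrable (fun t => inner ℝ (w12Val u t) (w12Val v t)) μI :=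
    integrable_dual (memLp_clm_const (innerSL ℝ) (memLp_w12Val u)) (memLp_w12Val v)
  rw [secBilin_apply, secBilin_apply, ← integral_const_mul,
    ← integral_add (integrable_hessForm A (memLp_w12Lift Θ u) (memLp_w12Lift Θ v))
      (hi.const_mul κ)]
  refine integral_congr_ae (ae_of_all _ fun t => ?_)
  have h1 : ∀ ξ, ext (pencil A (shiftB n) κ) t ξ =
    ((ext A t ξ).1, (ext A t ξ).2 + κ • innerSL ℝ ξ.1) := fun ξ => pencil_shiftB_apply κ _ ξ
  simp only [hessForm, h1, hΘ.w12Lift_fst, hΘ.map_w12Lift_fst, add_apply, smul_apply, smul_eq_mul,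
    innerSL_apply_apply]
  ring

theorem IsLegendreInverse.secBilin_of_solution (hΘ : IsLegendreInverse A Θ)
    {z : C(Icc (0 : ℝ) 1, Cot (E n))} {f : ℝ → E n} (hf : MemLp f 2 μI)
    (hz : ∀ t ∈ Icc (0 : ℝ) 1, ext z t = ext z 0 +
      ∫ s in (0 : ℝ)..t, (ext A s (ext z s) - ((0 : E n), innerSL ℝ (f s))))
    {u : W12 n} (hu : ∀ t : Icc (0 : ℝ) 1, (u : Icc (0 : ℝ) 1 → E n) t = (z t).1) (v : W12 n) :
    secBilin A Θ u v = (ext z 1).2 (w12Val v 1) - (ext z 0).2 (w12Val v 0) +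
      ∫ t, inner ℝ (f t) (w12Val v t) ∂μI := by
  have h0 : (0 : ℝ) ∈ Icc (0 : ℝ) 1 := by simp
  have hzL := memLp_ext z
  have hAz := memLp_clm A hzL
  have hfd := memLp_clm_const (innerSL (E := E n) ℝ) hf
  have hG : MemLp (fun s => ext A s (ext z s) - ((0 : E n), innerSL ℝ (f s))) 2 μI :=
    hAz.sub (memLp_clm_const (ContinuousLinearMap.inr ℝ (E n) (E n →L[ℝ] ℝ)) hfd)
  have hGi : ∀ t ∈ Icc (0 : ℝ) 1, IntervalIntegrable
      (fun s => ext A s (ext z s) - ((0 : E n), innerSL ℝ (f s))) volume 0 t := fun t ht =>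
    intervalIntegrable_of_integrableOn (integrableOn_of_memLp hG) h0 ht
  have hz1 : ∀ t ∈ Icc (0 : ℝ) 1, (ext z t).1 = (ext z 0).1 +
      ∫ s in (0 : ℝ)..t, (ext A s (ext z s)).1 := by
    intro t ht
    have h1 := congrArg (ContinuousLinearMap.fst ℝ (E n) (E n →L[ℝ] ℝ)) (hz t ht)
    rw [map_add, ← ContinuousLinearMap.intervalIntegral_comp_comm _ (hGi t ht)] at h1
    simpa using h1
  have hz2 : ∀ t ∈ Icc (0 : ℝ) 1, (ext z t).2 = (ext z 0).2 +
      ∫ s in (0 : ℝ)..t, ((ext A s (ext z s)).2 - innerSL ℝ (f s)) := by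
    intro t ht
    have h1 := congrArg (ContinuousLinearMap.snd ℝ (E n) (E n →L[ℝ] ℝ)) (hz t ht)
    rw [map_add, ← ContinuousLinearMap.intervalIntegral_comp_comm _ (hGi t ht)] at h1
    simpa using h1
  have hud : w12Deriv u =ᵐ[μI] fun t => (ext A t (ext z t)).1 := by
    refine w12Deriv_ae_eq u hAz.fst fun t => ?_
    have h1 := hz1 t t.2
    have h2 : ext z (0 : ℝ) = z 0 := ext_apply z h0
    rw [hu, hu, ← ext_coe z t, h1, h2]
  have hlift : w12Lift Θ u =ᵐ[μI] ext z := by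
    filter_upwards [hud, ae_restrict_mem measurableSet_Icc] with t ht htI
    have h2 : w12Val u t = (ext z t).1 := by
      rw [ext_apply z htI, ← hu, ← w12Val_coe]
    rw [w12Lift, h2, ht]
    exact hΘ.left_inv _ _
  have hparts := integral_parts (p := fun t => (ext z t).2)
    (p' := fun t => (ext A t (ext z t)).2 - innerSL ℝ (f t)) (hAz.snd.sub hfd)
    (memLp_w12Deriv v) hzL.snd (memLp_w12Val v) hz2 (fun t ht => w12Val_eq v ht)
  have hi : Integrable (fun t => inner ℝ (f t) (w12Val v t)) μI :=
    integrable_dual hfd (memLp_w12Val v)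
  rw [← hparts, intervalIntegral_eq_μI, ← integral_add _ hi]
  · rw [secBilin_apply]
    refine integral_congr_ae ?_
    filter_upwards [hlift] with t ht
    simp only [hessForm, ht, hΘ.w12Lift_fst, hΘ.map_w12Lift_fst, sub_apply, innerSL_apply_apply]
    ring
  · exact (integrable_dual (hAz.snd.sub hfd) (memLp_w12Val v)).add
      (integrable_dual hzL.snd (memLp_w12Deriv v))

end ConvexSystem

section Kernel

variable {n : ℕ}

theorem exists_ae_eq_add_integral {p a : ℝ → E n →L[ℝ] ℝ} (hp : MemLp p 2 μI) (ha : MemLp a 2 μI)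
    (h : ∀ v : W12 n, w12Val v 0 = 0 → w12Val v 1 = 0 →
      ∫ t, (a t (w12Val v t) + p t (w12Deriv v t)) ∂μI = 0) :
    ∃ c : E n →L[ℝ] ℝ, p =ᵐ[μI] fun t => c + ∫ s in (0 : ℝ)..t, a s := by
  have h0 : (0 : ℝ) ∈ Icc (0 : ℝ) 1 := by simp
  set P := primOf a (integrableOn_of_memLp ha) with hPdef
  have hP : ∀ t ∈ Icc (0 : ℝ) 1, ext P t = ∫ s in (0 : ℝ)..t, a s := fun t ht => by
    rw [ext_apply P ht, hPdef, primOf_apply]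
  have hPL := memLp_ext P
  let J : (E n →L[ℝ] ℝ) →L[ℝ] E n := LinearMap.toContinuousLinearMap
    { toFun := (InnerProductSpace.toDual ℝ (E n)).symm
      map_add' := fun α β => map_add _ α β
      map_smul' := fun c α => map_smulₛₗ _ c α }
  have hJ : ∀ (α : E n →L[ℝ] ℝ) (v : E n), inner ℝ (J α) v = α v := fun α v =>
    InnerProductSpace.toDual_symm_apply
  set g : ℝ → E n := fun t => J (p t - ext P t) with hg
  have hgL : MemLp g 2 μI := memLp_clm_const J (hp.sub hPL)
  set c : E n := ∫ t, g t ∂μI with hc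
  have hgc : MemLp (fun t => g t - c) 2 μI := hgL.sub (memLp_const c)
  have hgi : Integrable g μI := integrableOn_of_memLp hgL
  have hgci : Integrable (fun t => g t - c) μI := integrableOn_of_memLp hgc
  have hmean : ∫ t, (g t - c) ∂μI = 0 := by
    rw [integral_sub hgi (integrable_const c), integral_const]
    simp [hc, μI]
  let v := mkW12 0 (fun t => g t - c) hgc
  have hv0 : w12Val v 0 = 0 := by
    rw [w12Val_zero, mkW12_apply]
    simp
  have hv1 : w12Val v 1 = 0 := by
    rw [w12Val_one, mkW12_apply]
    change (0 : E n) + ∫ s in (0 : ℝ)..1, (g s - c) = 0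
    rw [intervalIntegral_eq_μI, hmean, add_zero]
  have hvd := w12Deriv_mkW12 0 (fun t => g t - c) hgc
  have h1 := h v hv0 hv1
  have h2 := integral_parts (p := ext P) (p' := a) ha (memLp_w12Deriv v) hPL (memLp_w12Val v)
    (fun t ht => by
      rw [hP t ht, hP 0 h0]
      simp) (fun t ht => w12Val_eq v ht)
  rw [hv0, hv1, map_zero, map_zero, sub_zero, intervalIntegral_eq_μI] at h2
  have h3 : ∫ t, inner ℝ (g t) (g t - c) ∂μI = 0 := by
    have h4 := integral_sub
      ((integrable_dual ha (memLp_w12Val v)).add (integrable_dual hp (memLp_w12Deriv v)))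
      ((integrable_dual ha (memLp_w12Val v)).add (integrable_dual hPL (memLp_w12Deriv v)))
    simp only [Pi.add_apply] at h4
    rw [h1, h2, sub_zero] at h4
    rw [← h4]
    refine integral_congr_ae ?_
    filter_upwards [hvd] with t ht
    rw [hg]
    simp only [hJ]
    rw [ht]
    simp only [sub_apply, hg]
    ring
  have h4 : ∫ t, inner ℝ c (g t - c) ∂μI = 0 := by
    have := (innerSL ℝ c).integral_comp_comm hgci
    simp only [innerSL_apply_apply] at this
    rw [this, hmean, inner_zero_right]
  have hgd : Integrable (fun t => inner ℝ (g t) (g t - c)) μI :=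
    integrable_dual (memLp_clm_const (innerSL ℝ) hgL) hgc
  have hcd : Integrable (fun t => inner ℝ c (g t - c)) μI :=
    integrable_dual (memLp_clm_const (innerSL ℝ) (memLp_const c)) hgc
  have h5 : ∫ t, ‖g t - c‖ ^ 2 ∂μI = 0 := by
    have h6 := integral_sub hgd hcd
    rw [h3, h4, sub_zero] at h6
    rw [← h6]
    refine integral_congr_ae (ae_of_all _ fun t => ?_)
    simp only
    rw [← inner_sub_left, real_inner_self_eq_norm_sq]
  have h6 : (fun t => ‖g t - c‖ ^ 2) =ᵐ[μI] 0 :=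
    (integral_eq_zero_iff_of_nonneg (fun t => by positivity) (hgc.integrable_norm_pow (by norm_num))).1
      h5
  refine ⟨innerSL ℝ c, ?_⟩
  filter_upwards [h6, ae_restrict_mem measurableSet_Icc] with t ht htI
  have h7 : g t = c := by
    have : ‖g t - c‖ = 0 := by simpa using ht
    exact sub_eq_zero.1 (norm_eq_zero.1 this)
  rw [← hP t htI, ← sub_eq_iff_eq_add]
  refine ContinuousLinearMap.ext fun w => ?_
  rw [innerSL_apply_apply, ← h7, hg]
  simp only [hJ]

/-- The initial conditions `z` for which `(z, Φ z)` satisfies the boundary condition and the natural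
boundary condition associated to `W`. -/
def bdrySpace (W : Submodule ℝ (E n × E n)) (Φ : Cot (E n) →L[ℝ] Cot (E n)) :
    Submodule ℝ (Cot (E n)) where
  carrier := {z | (z.1, (Φ z).1) ∈ W ∧ ∀ ξ ∈ W, z.2 ξ.1 = (Φ z).2 ξ.2}
  add_mem' := by
    rintro z w ⟨h1, h2⟩ ⟨h3, h4⟩
    refine ⟨?_, fun ξ hξ => ?_⟩
    · rw [map_add]
      exact W.add_mem h1 h3
    · rw [map_add]
      simp only [Prod.snd_add, add_apply, h2 ξ hξ, h4 ξ hξ]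
  zero_mem' := by
    refine ⟨?_, fun ξ hξ => ?_⟩
    · rw [map_zero]
      exact W.zero_mem
    · rw [map_zero]
      simp
  smul_mem' := by
    rintro c z ⟨h1, h2⟩
    refine ⟨?_, fun ξ hξ => ?_⟩
    · rw [map_smul]
      exact W.smul_mem c h1
    · rw [map_smul]
      simp only [Prod.smul_snd, smul_apply, h2 ξ hξ]

theorem mem_bdrySpace {W : Submodule ℝ (E n × E n)} {Φ : Cot (E n) →L[ℝ] Cot (E n)}
    {z : Cot (E n)} :
    z ∈ bdrySpace W Φ ↔ (z.1, (Φ z).1) ∈ W ∧ ∀ ξ ∈ W, z.2 ξ.1 = (Φ z).2 ξ.2 := Iff.rfl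

variable {A : C(Icc (0 : ℝ) 1, Cot (E n) →L[ℝ] Cot (E n))}
  {Θ : C(Icc (0 : ℝ) 1, (E n × E n) →L[ℝ] Cot (E n))}

theorem fund_eq_integral {X : Type*} [NormedAddCommGroup X] [NormedSpace ℝ X] [CompleteSpace X]
    (A : C(Icc (0 : ℝ) 1, X →L[ℝ] X)) (z : X) {t : ℝ} (ht : t ∈ Icc (0 : ℝ) 1) :
    fund A t z = z + ∫ s in (0 : ℝ)..t, ext A s (fund A s z) := by
  have h := resolv_eq A (constL X z)
  have h1 := congrArg (fun w : C(Icc (0 : ℝ) 1, X) => w ⟨t, ht⟩) h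
  simp only [ContinuousMap.add_apply, volterra_apply] at h1
  rw [fund_apply, ext_apply _ ht, h1]
  rfl

theorem memLp_map_fund {X : Type*} [NormedAddCommGroup X] [NormedSpace ℝ X] [CompleteSpace X]
    (A : C(Icc (0 : ℝ) 1, X →L[ℝ] X)) (z : X) : MemLp (fun t => ext A t (fund A t z)) 2 μI :=
  memLp_clm A (memLp_ext (resolv A (constL X z)))

/-- The configuration-space component of the solution of `z' = A z` with initial condition `z`. -/
def solW12 (A : C(Icc (0 : ℝ) 1, Cot (E n) →L[ℝ] Cot (E n))) : Cot (E n) →ₗ[ℝ] W12 n where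
  toFun z := ⟨fun t => (fund A t z).1, fun s => (ext A s (fund A s z)).1,
    (memLp_map_fund A z).fst, fun t => by
      have h0 : (0 : ℝ) ∈ Icc (0 : ℝ) 1 := by simp
      have h1 := congrArg (ContinuousLinearMap.fst ℝ (E n) (E n →L[ℝ] ℝ)) (fund_eq_integral A z t.2)
      rw [map_add, ← ContinuousLinearMap.intervalIntegral_comp_comm _
        (intervalIntegrable_of_integrableOn (integrableOn_of_memLp (memLp_map_fund A z)) h0 t.2)] at h1
      have h2 : fund A ((0 : Icc (0 : ℝ) 1) : ℝ) z = z := by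
        change fund A 0 z = z
        rw [fund_zero]
        rfl
      beta_reduce
      rw [h2]
      exact h1⟩
  map_add' z w := by
    refine Subtype.ext (funext fun t => ?_)
    change (fund A t (z + w)).1 = (fund A t z).1 + (fund A t w).1
    rw [map_add, Prod.fst_add]
  map_smul' c z := by
    refine Subtype.ext (funext fun t => ?_)
    change (fund A t (c • z)).1 = c • (fund A t z).1
    rw [map_smul, Prod.smul_fst]

theorem solW12_apply (z : Cot (E n)) (t : Icc (0 : ℝ) 1) :
    (solW12 A z : Icc (0 : ℝ) 1 → E n) t = (fund A t z).1 := rfl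

theorem IsLegendreInverse.secBilin_solW12 (hΘ : IsLegendreInverse A Θ) (z : Cot (E n))
    (v : W12 n) : secBilin A Θ (solW12 A z) v =
      (fund A 1 z).2 (w12Val v 1) - z.2 (w12Val v 0) := by
  have h0 : ext (resolv A (constL _ z)) 0 = z := by
    rw [← fund_apply, fund_zero]
    rfl
  have h := hΘ.secBilin_of_solution (z := resolv A (constL _ z)) (f := 0) MemLp.zero (by
    intro t ht
    rw [h0, ← fund_apply, fund_eq_integral A z ht]
    congr 1
    refine intervalIntegral.integral_congr fun s _ => ?_
    simp only [Pi.zero_apply, map_zero, ← fund_apply]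
    rw [← Prod.zero_eq_mk, sub_zero]) (u := solW12 A z) (fun t => by
      rw [solW12_apply, fund_apply, ext_coe]) v
  rw [h, h0, ← fund_apply]
  simp

theorem IsConvexSystem.solW12_injective (hA : IsConvexSystem A) :
    Function.Injective (solW12 A) := by
  have h0 : (0 : ℝ) ∈ Icc (0 : ℝ) 1 := by simp
  refine (injective_iff_map_eq_zero _).2 fun z hz => ?_
  have hq : ∀ t ∈ Icc (0 : ℝ) 1, (fund A t z).1 = 0 := fun t ht => by
    rw [← solW12_apply z ⟨t, ht⟩, hz]
    rfl
  have h1 := (hasDerivWithinAt_fund A z h0).fst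
  have h2 : HasDerivWithinAt (fun t => (fund A t z).1) 0 (Icc (0 : ℝ) 1) 0 :=
    (hasDerivWithinAt_const (0 : ℝ) (Icc (0 : ℝ) 1) (0 : E n)).congr (fun t ht => hq t ht) (hq 0 h0)
  have h3 := (uniqueDiffOn_Icc zero_lt_one 0 h0).eq_deriv _ h1 h2
  have h4 : fund A 0 z = z := by
    rw [fund_zero]
    rfl
  have h5 := hq 0 h0
  rw [h4] at h3 h5
  obtain ⟨q, α⟩ := z
  simp only at h5
  subst h5
  by_contra hne
  have h6 : α ≠ 0 := fun h => hne (by rw [h]; rfl)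
  have h7 := hA.pos ⟨0, h0⟩ α h6
  rw [ext_apply A h0] at h3
  rw [h3, map_zero] at h7
  exact lt_irrefl _ h7

theorem exists_w12_boundary (ξ : E n × E n) :
    ∃ v : W12 n, w12Val v 0 = ξ.1 ∧ w12Val v 1 = ξ.2 := by
  refine ⟨mkW12 ξ.1 (fun _ => ξ.2 - ξ.1) (memLp_const _), ?_, ?_⟩
  · rw [w12Val_zero, mkW12_apply]
    simp
  · rw [w12Val_one, mkW12_apply]
    simp

theorem mem_W12W {W : Submodule ℝ (E n × E n)} {u : W12 n} :
    u ∈ W12W W ↔ (w12Val u 0, w12Val u 1) ∈ W := by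
  rw [w12Val_zero, w12Val_one]
  rfl

theorem IsLegendreInverse.mem_kernel_iff (hΘ : IsLegendreInverse A Θ)
    (W : Submodule ℝ (E n × E n)) (u : W12 n) :
    (u ∈ W12W W ∧ ∀ v ∈ W12W W, secBilin A Θ u v = 0) ↔
      ∃ z ∈ bdrySpace W (fund A 1), solW12 A z = u := by
  have h0 : (0 : ℝ) ∈ Icc (0 : ℝ) 1 := by simp
  have hval0 : ∀ z, w12Val (solW12 A z) 0 = z.1 := fun z => by
    rw [w12Val_zero, solW12_apply]
    change (fund A 0 z).1 = _
    rw [fund_zero]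
    rfl
  have hval1 : ∀ z, w12Val (solW12 A z) 1 = (fund A 1 z).1 := fun z => by
    rw [w12Val_one, solW12_apply]
    rfl
  constructor
  · rintro ⟨huW, hker⟩
    have hzL := memLp_w12Lift Θ u
    have hAz := memLp_clm A hzL
    obtain ⟨c, hc⟩ := exists_ae_eq_add_integral hzL.snd hAz.snd (fun v hv0 hv1 => by
      have h1 := hker v (mem_W12W.2 (by rw [hv0, hv1]; exact W.zero_mem))
      rw [secBilin_apply] at h1
      simpa only [hessForm, hΘ.w12Lift_fst, hΘ.map_w12Lift_fst] using h1)
    set P := primOf _ (integrableOn_of_memLp hAz.snd) with hPdef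
    have hP : ∀ t ∈ Icc (0 : ℝ) 1, ext P t = ∫ s in (0 : ℝ)..t, (ext A s (w12Lift Θ u s)).2 :=
      fun t ht => by rw [ext_apply P ht, hPdef, primOf_apply]
    let x : ℝ → Cot (E n) := fun t => (w12Val u t, c + ext P t)
    have hx : Continuous x :=
      (continuous_ext (w12C u)).prodMk (continuous_const.add (continuous_ext P))
    have hxae : w12Lift Θ u =ᵐ[μI] x := by
      filter_upwards [hc, ae_restrict_mem measurableSet_Icc] with t ht htI
      refine Prod.ext (hΘ.w12Lift_fst u t) ?_
      change (w12Lift Θ u t).2 = c + ext P t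
      rw [ht, hP t htI]
    have hP0 : ext P 0 = 0 := by
      rw [hP 0 h0]
      simp
    have hIntegral : ∀ t ∈ Icc (0 : ℝ) 1, x t = x 0 + ∫ s in (0 : ℝ)..t, ext A s (x s) := by
      intro t ht
      have h1 : ∫ s in (0 : ℝ)..t, ext A s (x s) = ∫ s in (0 : ℝ)..t, ext A s (w12Lift Θ u s) := by
        refine intervalIntegral.integral_congr_ae ?_
        rw [EventuallyEq, ae_restrict_iff' measurableSet_Icc] at hxae
        filter_upwards [hxae] with s hs hst
        rw [uIoc_of_le ht.1] at hst
        rw [hs ⟨hst.1.le, hst.2.trans ht.2⟩]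
      have hi := intervalIntegrable_of_integrableOn (integrableOn_of_memLp hAz) h0 ht
      rw [h1]
      refine Prod.ext ?_ ?_
      · change w12Val u t = w12Val u 0 +
          ContinuousLinearMap.fst ℝ (E n) (E n →L[ℝ] ℝ) (∫ s in (0 : ℝ)..t, _)
        rw [← ContinuousLinearMap.intervalIntegral_comp_comm _ hi, w12Val_eq u ht]
        congr 1
        refine intervalIntegral.integral_congr fun s _ => ?_
        exact (hΘ.map_w12Lift_fst u s).symm
      · change c + ext P t = c + ext P 0 +
          ContinuousLinearMap.snd ℝ (E n) (E n →L[ℝ] ℝ) (∫ s in (0 : ℝ)..t, _)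
        rw [← ContinuousLinearMap.intervalIntegral_comp_comm _ hi, hP0, hP t ht, add_zero]
        rfl
    have hxf : ∀ t ∈ Icc (0 : ℝ) 1, x t = fund A t (x 0) := fun t ht =>
      eq_fund_of_integral hx.continuousOn hIntegral ht
    have hu : solW12 A (x 0) = u := by
      refine Subtype.ext (funext fun t => ?_)
      rw [solW12_apply, ← hxf t t.2, ← w12Val_coe]
    refine ⟨x 0, ⟨?_, fun ξ hξ => ?_⟩, hu⟩
    · have := mem_W12W.1 huW
      rw [← hu, hval0, hval1] at this
      exact this
    · obtain ⟨v, hv0, hv1⟩ := exists_w12_boundary ξ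
      have h1 := hker v (mem_W12W.2 (by rw [hv0, hv1]; exact hξ))
      rw [← hu, hΘ.secBilin_solW12, hv0, hv1] at h1
      linarith
  · rintro ⟨z, ⟨hz1, hz2⟩, rfl⟩
    refine ⟨mem_W12W.2 (by rw [hval0, hval1]; exact hz1), fun v hv => ?_⟩
    rw [hΘ.secBilin_solW12, hz2 _ (mem_W12W.1 hv), sub_self]

end Kernel

section CompactPrimitive

variable {V : Type*} [NormedAddCommGroup V] [InnerProductSpace ℝ V] [FiniteDimensional ℝ V]

/-- The space `L²([0,1], V)`. -/
abbrev L2I (V : Type*) [NormedAddCommGroup V] : Type _ := Lp V 2 μI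

theorem norm_toLp_ext_le (w : C(Icc (0 : ℝ) 1, V)) : ‖(memLp_ext w).toLp‖ ≤ 1 * ‖w‖ := by
  have h1 : ∀ᵐ t ∂μI, ‖(memLp_ext w).toLp (ext w) t‖ ≤ ‖w‖ := by
    filter_upwards [(memLp_ext w).coeFn_toLp] with t ht
    rw [ht]
    exact norm_ext_le w t
  have h2 := Lp.norm_le_of_ae_bound (norm_nonneg w) h1
  refine h2.trans (mul_le_mul_of_nonneg_right ?_ (norm_nonneg w))
  have h3 : measureUnivNNReal μI = 1 := by
    simp [measureUnivNNReal, μI]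
  rw [h3]
  simp

/-- The inclusion `C([0,1], V) → L²([0,1], V)`. -/
def cToLp (V : Type*) [NormedAddCommGroup V] [InnerProductSpace ℝ V] [FiniteDimensional ℝ V] :
    C(Icc (0 : ℝ) 1, V) →L[ℝ] L2I V :=
  LinearMap.mkContinuous
    { toFun := fun w => (memLp_ext w).toLp
      map_add' := fun w w' => (memLp_ext w).toLp_add (memLp_ext w')
      map_smul' := fun c w => (memLp_ext w).toLp_const_smul c } 1 norm_toLp_ext_le

theorem coeFn_cToLp (w : C(Icc (0 : ℝ) 1, V)) : cToLp V w =ᵐ[μI] ext w := (memLp_ext w).coeFn_toLp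

theorem cToLp_injective : Function.Injective (cToLp V) := by
  intro w w' h
  have h1 : ext w =ᵐ[μI] ext w' := by
    filter_upwards [coeFn_cToLp w, coeFn_cToLp w'] with t h1 h2
    rw [← h1, ← h2, h]
  have h2 := Measure.eqOn_Icc_of_ae_eq volume zero_ne_one h1 (continuous_ext w).continuousOn
    (continuous_ext w').continuousOn
  refine ContinuousMap.ext fun t => ?_
  have := h2 t.2
  rwa [ext_coe, ext_coe] at this

theorem norm_sq_eq_integral (f : L2I V) : ‖f‖ ^ 2 = ∫ t, ‖f t‖ ^ 2 ∂μI := by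
  rw [← real_inner_self_eq_norm_sq, L2.inner_def]
  simp only [real_inner_self_eq_norm_sq]

theorem integrableOn_Lp (f : L2I V) : IntegrableOn f (Icc (0 : ℝ) 1) :=
  integrableOn_of_memLp (Lp.memLp f)

theorem norm_integral_le (f : L2I V) {a s t : ℝ} (ha : 0 < a) (hst : s ≤ t) (hs : 0 ≤ s)
    (ht : t ≤ 1) : ‖∫ r in s..t, f r‖ ≤ a * (t - s) / 2 + ‖f‖ ^ 2 / (2 * a) := by
  have hsI : s ∈ Icc (0 : ℝ) 1 := ⟨hs, hst.trans ht⟩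
  have htI : t ∈ Icc (0 : ℝ) 1 := ⟨hs.trans hst, ht⟩
  have h2 : Integrable (fun r => ‖f r‖ ^ 2) μI := (Lp.memLp f).integrable_norm_pow (by norm_num)
  have h3 := intervalIntegrable_of_integrableOn h2 hsI htI
  have h4 := (intervalIntegrable_of_integrableOn (integrableOn_Lp f) hsI htI).norm
  have h5 : ∫ r in s..t, ‖f r‖ ^ 2 ≤ ‖f‖ ^ 2 := by
    rw [norm_sq_eq_integral, intervalIntegral.integral_of_le hst]
    exact setIntegral_mono_set h2 (ae_of_all _ fun r => by positivity)
      (Ioc_subset_Icc_self.trans (Icc_subset_Icc hs ht)).eventuallyLE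
  calc ‖∫ r in s..t, f r‖ ≤ ∫ r in s..t, ‖f r‖ := intervalIntegral.norm_integral_le_integral_norm hst
    _ ≤ ∫ r in s..t, (a / 2 + ‖f r‖ ^ 2 / (2 * a)) := by
        refine intervalIntegral.integral_mono_on hst h4
          (intervalIntegrable_const.add (h3.div_const _)) fun r _ => ?_
        have : a / 2 + ‖f r‖ ^ 2 / (2 * a) - ‖f r‖ = (a - ‖f r‖) ^ 2 / (2 * a) := by
          field_simp
          ring
        have h6 : 0 ≤ (a - ‖f r‖) ^ 2 / (2 * a) := by positivity
        linarith
    _ = a * (t - s) / 2 + (∫ r in s..t, ‖f r‖ ^ 2) / (2 * a) := by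
        rw [intervalIntegral.integral_add intervalIntegrable_const (h3.div_const _),
          intervalIntegral.integral_const, intervalIntegral.integral_div, smul_eq_mul]
        ring
    _ ≤ _ := by gcongr

theorem primOf_apply_sub (f : L2I V) (s t : Icc (0 : ℝ) 1) :
    primOf f (integrableOn_Lp f) t - primOf f (integrableOn_Lp f) s = ∫ r in (s : ℝ)..t, f r := by
  have h0 : (0 : ℝ) ∈ Icc (0 : ℝ) 1 := by simp
  rw [primOf_apply, primOf_apply]
  exact intervalIntegral.integral_interval_sub_left
    (intervalIntegrable_of_integrableOn (integrableOn_Lp f) h0 t.2)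
    (intervalIntegrable_of_integrableOn (integrableOn_Lp f) h0 s.2)

theorem dist_primOf_le (f : L2I V) {a : ℝ} (ha : 0 < a) (s t : Icc (0 : ℝ) 1) :
    dist (primOf f (integrableOn_Lp f) s) (primOf f (integrableOn_Lp f) t) ≤
      a * dist s t / 2 + ‖f‖ ^ 2 / (2 * a) := by
  wlog hst : s ≤ t generalizing s t
  · rw [dist_comm, dist_comm s t]
    exact this t s (le_of_not_ge hst)
  rw [dist_comm, dist_eq_norm, primOf_apply_sub, dist_comm s t, Subtype.dist_eq, Real.dist_eq,
    abs_of_nonneg (sub_nonneg.2 (Subtype.coe_le_coe.2 hst))]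
  exact norm_integral_le f ha hst s.2.1 t.2.2

theorem norm_primOf_le (f : L2I V) : ‖primOf f (integrableOn_Lp f)‖ ≤ ‖f‖ := by
  refine (ContinuousMap.norm_le _ (norm_nonneg f)).2 fun t => ?_
  rw [primOf_apply]
  rcases (norm_nonneg f).eq_or_lt with h | h
  · have h1 : f = 0 := norm_eq_zero.1 h.symm
    have h2 : ∀ a : ℝ, 0 < a → ‖∫ r in (0 : ℝ)..t, f r‖ ≤ a := by
      intro a ha
      have h3 := norm_integral_le f ha t.2.1 le_rfl t.2.2
      rw [← h] at h3
      have h4 := t.2.2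
      have h5 := mul_le_mul_of_nonneg_left h4 ha.le
      norm_num at h3
      linarith
    rw [← h]
    exact le_of_forall_gt_imp_ge_of_dense fun a ha => h2 a ha
  · have h3 := norm_integral_le f h t.2.1 le_rfl t.2.2
    have h4 : ‖f‖ ^ 2 / (2 * ‖f‖) = ‖f‖ / 2 := by
      field_simp
    have h5 := mul_le_mul_of_nonneg_left t.2.2 h.le
    rw [h4] at h3
    linarith

/-- The primitive of a square-integrable map. -/
def primLp (V : Type*) [NormedAddCommGroup V] [InnerProductSpace ℝ V] [FiniteDimensional ℝ V] :
    L2I V →L[ℝ] C(Icc (0 : ℝ) 1, V) :=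
  LinearMap.mkContinuous
    { toFun := fun f => primOf f (integrableOn_Lp f)
      map_add' := fun f g => by
        refine ContinuousMap.ext fun t => ?_
        have h0 : (0 : ℝ) ∈ Icc (0 : ℝ) 1 := by simp
        rw [ContinuousMap.add_apply, primOf_apply, primOf_apply, primOf_apply,
          ← intervalIntegral.integral_add
            (intervalIntegrable_of_integrableOn (integrableOn_Lp f) h0 t.2)
            (intervalIntegrable_of_integrableOn (integrableOn_Lp g) h0 t.2)]
        refine intervalIntegral.integral_congr_ae ?_
        have h1 := Lp.coeFn_add f g
        rw [EventuallyEq, ae_restrict_iff' measurableSet_Icc] at h1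
        filter_upwards [h1] with s hs hst
        rw [uIoc_of_le t.2.1] at hst
        exact hs ⟨hst.1.le, hst.2.trans t.2.2⟩
      map_smul' := fun c f => by
        refine ContinuousMap.ext fun t => ?_
        rw [RingHom.id_apply, ContinuousMap.smul_apply, primOf_apply, primOf_apply,
          ← intervalIntegral.integral_smul]
        refine intervalIntegral.integral_congr_ae ?_
        have h1 := Lp.coeFn_smul c f
        rw [EventuallyEq, ae_restrict_iff' measurableSet_Icc] at h1
        filter_upwards [h1] with s hs hst
        rw [uIoc_of_le t.2.1] at hst
        exact hs ⟨hst.1.le, hst.2.trans t.2.2⟩ } 1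
    (fun f => by
      rw [one_mul]
      exact norm_primOf_le f)

theorem primLp_apply (f : L2I V) (t : Icc (0 : ℝ) 1) :
    primLp V f t = ∫ s in (0 : ℝ)..t, f s := primOf_apply _ (integrableOn_Lp f) t

theorem isCompactOperator_primLp : IsCompactOperator (primLp V) := by
  refine (isCompactOperator_iff_isCompact_closure_image_closedBall
    (primLp V : L2I V →ₗ[ℝ] C(Icc (0 : ℝ) 1, V)) (r := 1) one_pos).2 ?_
  let e := ContinuousMap.isometryEquivBoundedOfCompact (Icc (0 : ℝ) 1) V
  set S := (primLp V : L2I V →ₗ[ℝ] C(Icc (0 : ℝ) 1, V)) '' Metric.closedBall 0 1 with hS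
  have key : IsCompact (closure (e '' S)) := by
    refine BoundedContinuousFunction.arzela_ascoli (Metric.closedBall 0 1)
      (isCompact_closedBall 0 1) _ ?_ ?_
    · rintro _ t ⟨_, ⟨f, hf, rfl⟩, rfl⟩
      rw [mem_closedBall_zero_iff] at hf ⊢
      exact ((ContinuousMap.norm_coe_le_norm (primLp V f) t).trans (norm_primOf_le f)).trans hf
    · intro t
      rw [Metric.equicontinuousAt_iff]
      intro ε hε
      refine ⟨ε ^ 2 / 4, by positivity, ?_⟩
      rintro s hs ⟨_, _, ⟨f, hf, rfl⟩, rfl⟩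
      rw [mem_closedBall_zero_iff] at hf
      have h1 := dist_primOf_le f (a := 2 / ε) (by positivity) t s
      have h2 : ‖f‖ ^ 2 ≤ 1 := pow_le_one₀ (norm_nonneg f) hf
      have h3 : ‖f‖ ^ 2 / (2 * (2 / ε)) ≤ ε / 4 := by
        have : ‖f‖ ^ 2 / (2 * (2 / ε)) = ‖f‖ ^ 2 * (ε / 4) := by
          field_simp
          ring
        rw [this]
        have := mul_le_mul_of_nonneg_right h2 (by positivity : 0 ≤ ε / 4)
        linarith
      have h4 : 2 / ε * dist t s / 2 ≤ ε / 4 := by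
        rw [dist_comm] at hs
        have h5 : 2 / ε * dist t s / 2 = dist t s / ε := by ring
        rw [h5, div_le_iff₀ hε]
        nlinarith
      refine lt_of_le_of_lt (h1.trans (add_le_add h4 h3)) (by linarith)
  have h2 : closure S = e ⁻¹' closure (e '' S) := by
    have h3 := e.toHomeomorph.preimage_closure (e '' S)
    rw [show e.toHomeomorph ⁻¹' (e '' S) = S from e.injective.preimage_image S] at h3
    exact h3.symm
  rw [h2]
  exact e.toHomeomorph.isCompact_preimage.2 key

end CompactPrimitive

section Hilbert

variable {n : ℕ}

/-- The inclusion of `W^{1,2}_W` into `L²`. -/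
def jW (W : Submodule ℝ (E n × E n)) : W12W W →ₗ[ℝ] L2I (E n) where
  toFun u := cToLp (E n) (w12C u)
  map_add' u v := (cToLp (E n)).map_add (w12C u) (w12C v)
  map_smul' c u := (cToLp (E n)).map_smul c (w12C u)

variable {W : Submodule ℝ (E n × E n)}

theorem jW_apply (u : W12W W) : jW W u = cToLp (E n) (w12C u) := rfl

theorem jW_injective : Function.Injective (jW W) := by
  intro u v h
  have h1 := cToLp_injective h
  refine Subtype.ext (Subtype.ext (funext fun t => ?_))
  exact congrArg (fun w : C(Icc (0 : ℝ) 1, E n) => w t) h1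

theorem inner_jW (f : L2I (E n)) (v : W12W W) :
    inner ℝ f (jW W v) = ∫ t, inner ℝ (f t) (w12Val (v : W12 n) t) ∂μI := by
  rw [L2.inner_def]
  refine integral_congr_ae ?_
  filter_upwards [coeFn_cToLp (w12C (v : W12 n))] with t ht
  rw [jW_apply, ht]
  rfl

theorem inner_jW_jW (u v : W12W W) :
    inner ℝ (jW W u) (jW W v) = ∫ t, inner ℝ (w12Val (u : W12 n) t) (w12Val (v : W12 n) t) ∂μI := by
  rw [inner_jW]
  refine integral_congr_ae ?_
  filter_upwards [coeFn_cToLp (w12C (u : W12 n))] with t ht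
  rw [jW_apply, ht]
  rfl

end Hilbert

section Green

variable {X : Type*} [NormedAddCommGroup X] [NormedSpace ℝ X] [CompleteSpace X]

/-- Solution operator of `w' = A w - g'` with boundary condition `w(0) = ζ(y)`, where `y` is
the final value of the solution with zero initial condition. -/
def greenOp (A : C(Icc (0 : ℝ) 1, X →L[ℝ] X)) (ζ : X →L[ℝ] X) :
    C(Icc (0 : ℝ) 1, X) →L[ℝ] C(Icc (0 : ℝ) 1, X) :=
  resolv A ∘L constL X ∘L ζ ∘L evalL X 1 ∘L resolv A - resolv A

theorem ext_greenOp (A : C(Icc (0 : ℝ) 1, X →L[ℝ] X)) (ζ : X →L[ℝ] X) (g : C(Icc (0 : ℝ) 1, X))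
    (t : ℝ) : ext (greenOp A ζ g) t = fund A t (ζ (ext (resolv A g) 1)) - ext (resolv A g) t := rfl

theorem ext_resolv_eq (A : C(Icc (0 : ℝ) 1, X →L[ℝ] X)) (g : C(Icc (0 : ℝ) 1, X)) {t : ℝ}
    (ht : t ∈ Icc (0 : ℝ) 1) :
    ext (resolv A g) t = ext g t + ∫ s in (0 : ℝ)..t, ext A s (ext (resolv A g) s) := by
  have h1 := congrArg (fun w : C(Icc (0 : ℝ) 1, X) => w ⟨t, ht⟩) (resolv_eq A g)
  simp only [ContinuousMap.add_apply, volterra_apply] at h1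
  rw [ext_apply _ ht, h1, ext_apply _ ht]

theorem ext_greenOp_zero (A : C(Icc (0 : ℝ) 1, X →L[ℝ] X)) (ζ : X →L[ℝ] X)
    {g : C(Icc (0 : ℝ) 1, X)} (hg : ext g 0 = 0) :
    ext (greenOp A ζ g) 0 = ζ (ext (resolv A g) 1) := by
  have h1 := ext_resolv_eq A g (t := 0) (by simp)
  rw [hg, intervalIntegral.integral_same, add_zero] at h1
  rw [ext_greenOp, fund_zero, h1, sub_zero]
  rfl

theorem ext_greenOp_eq (A : C(Icc (0 : ℝ) 1, X →L[ℝ] X)) (ζ : X →L[ℝ] X)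
    {g : C(Icc (0 : ℝ) 1, X)} (hg : ext g 0 = 0) {t : ℝ} (ht : t ∈ Icc (0 : ℝ) 1) :
    ext (greenOp A ζ g) t = ext (greenOp A ζ g) 0 +
      (∫ s in (0 : ℝ)..t, ext A s (ext (greenOp A ζ g) s)) - ext g t := by
  have h0 : (0 : ℝ) ∈ Icc (0 : ℝ) 1 := by simp
  have hi : ∀ w : C(Icc (0 : ℝ) 1, X),
      IntervalIntegrable (fun s => ext A s (ext w s)) volume 0 t := fun w =>
    intervalIntegrable_of_integrableOn (integrableOn_of_memLp (memLp_clm A (memLp_ext w))) h0 ht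
  rw [ext_greenOp_zero A ζ hg, ext_greenOp, fund_eq_integral A _ ht, ext_resolv_eq A g ht]
  have h1 : ∫ s in (0 : ℝ)..t, ext A s (ext (greenOp A ζ g) s) =
      (∫ s in (0 : ℝ)..t, ext A s (fund A s (ζ (ext (resolv A g) 1)))) -
      ∫ s in (0 : ℝ)..t, ext A s (ext (resolv A g) s) := by
    refine Eq.trans ?_ (intervalIntegral.integral_sub
      (hi (resolv A (constL X (ζ (ext (resolv A g) 1))))) (hi (resolv A g)))
    refine intervalIntegral.integral_congr fun s _ => ?_
    simp only [ext_greenOp, map_sub]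
  rw [h1]
  abel

end Green

section Positivity

theorem exists_pos_add_mul {Z : Type*} [TopologicalSpace Z] [CompactSpace Z] {f g : Z → ℝ}
    (hf : Continuous f) (hg : Continuous g) (hg0 : ∀ z, 0 ≤ g z) (h : ∀ z, g z = 0 → 0 < f z) :
    ∃ K : ℝ, 0 < K ∧ ∀ z, 0 < f z + K * g z := by
  obtain ⟨k, hk⟩ := isCompact_univ.elim_directed_cover (fun k : ℕ => {z | 0 < f z + k * g z})
    (fun k => isOpen_lt continuous_const (hf.add (continuous_const.mul hg))) (by
      intro z _
      rw [mem_iUnion]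
      rcases (hg0 z).eq_or_lt with h0 | h0
      · refine ⟨0, ?_⟩
        change 0 < f z + ((0 : ℕ) : ℝ) * g z
        have := h z h0.symm
        simpa using this
      · obtain ⟨k, hk⟩ := exists_nat_gt (-f z / g z)
        rw [div_lt_iff₀ h0] at hk
        refine ⟨k, ?_⟩
        change 0 < f z + (k : ℝ) * g z
        linarith) (by
      refine directed_of_isDirected_le fun k l hkl z hz => ?_
      change 0 < f z + (k : ℝ) * g z at hz
      change 0 < f z + (l : ℝ) * g z
      have h1 : (k : ℝ) ≤ l := by exact_mod_cast hkl
      have := mul_le_mul_of_nonneg_right h1 (hg0 z)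
      linarith)
  refine ⟨k + 1, by positivity, fun z => ?_⟩
  have h1 : 0 < f z + (k : ℝ) * g z := hk (mem_univ z)
  have := hg0 z
  linarith

variable {n : ℕ} {A : C(Icc (0 : ℝ) 1, Cot (E n) →L[ℝ] Cot (E n))}

theorem hessForm_pencil (A : C(Icc (0 : ℝ) 1, Cot (E n) →L[ℝ] Cot (E n))) (κ t : ℝ)
    (ξ : Cot (E n)) : hessForm (ext (pencil A (shiftB n) κ) t) ξ ξ =
      hessForm (ext A t) ξ ξ + κ * ‖ξ.1‖ ^ 2 := by
  have h1 : ext (pencil A (shiftB n) κ) t ξ =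
    ((ext A t ξ).1, (ext A t ξ).2 + κ • innerSL ℝ ξ.1) := pencil_shiftB_apply κ _ ξ
  simp only [hessForm, h1, add_apply, smul_apply, smul_eq_mul, innerSL_apply_apply,
    real_inner_self_eq_norm_sq]
  ring

/-- The quadratic Lagrangian dual to the system `A` is positive definite. -/
def IsPosSystem (A : C(Icc (0 : ℝ) 1, Cot (E n) →L[ℝ] Cot (E n))) : Prop :=
  ∀ t ξ, ξ ≠ 0 → 0 < hessForm (ext A t) ξ ξ

theorem IsConvexSystem.exists_isPosSystem (hA : IsConvexSystem A) :
    ∃ K : ℝ, 0 < K ∧ IsPosSystem (pencil A (shiftB n) K) := by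
  have : CompactSpace (Metric.sphere (0 : Cot (E n)) 1) :=
    isCompact_iff_compactSpace.1 (isCompact_sphere _ _)
  have hc : Continuous fun z : Icc (0 : ℝ) 1 × Metric.sphere (0 : Cot (E n)) 1 =>
      A z.1 (z.2 : Cot (E n)) :=
    (A.continuous.comp continuous_fst).clm_apply (continuous_subtype_val.comp continuous_snd)
  have hs : Continuous fun z : Icc (0 : ℝ) 1 × Metric.sphere (0 : Cot (E n)) 1 =>
      (z.2 : Cot (E n)) := continuous_subtype_val.comp continuous_snd
  obtain ⟨K, hK, hpos⟩ := exists_pos_add_mul (Z := Icc (0 : ℝ) 1 × Metric.sphere (0 : Cot (E n)) 1)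
    (f := fun z => hessForm (A z.1) z.2 z.2) (g := fun z => ‖(z.2 : Cot (E n)).1‖ ^ 2)
    ((hc.snd.clm_apply hs.fst).add (hs.snd.clm_apply hc.fst)) (hs.fst.norm.pow 2)
    (fun z => by positivity) (by
      rintro ⟨t, ⟨⟨q, α⟩, hz⟩⟩ h
      have hq : q = 0 := by simpa using h
      subst hq
      have hα : α ≠ 0 := by
        rintro rfl
        rw [mem_sphere_zero_iff_norm] at hz
        simp at hz
      have h2 := hA.pos t α hα
      simpa [hessForm] using h2)
  refine ⟨K, hK, fun t ξ hξ => ?_⟩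
  have hn : 0 < ‖ξ‖ := norm_pos_iff.2 hξ
  have h1 := hpos (projIcc 0 1 zero_le_one t, ⟨‖ξ‖⁻¹ • ξ, by
    rw [mem_sphere_zero_iff_norm, norm_smul, norm_inv, norm_norm, inv_mul_cancel₀ hn.ne']⟩)
  simp only [hessForm_smul_left, hessForm_smul_right, Prod.smul_fst, norm_smul, norm_inv,
    norm_norm] at h1
  rw [hessForm_pencil]
  have h2 : hessForm (ext A t) ξ ξ + K * ‖ξ.1‖ ^ 2 = ‖ξ‖ ^ 2 *
      (‖ξ‖⁻¹ * (‖ξ‖⁻¹ * hessForm (A (projIcc 0 1 zero_le_one t)) ξ ξ) +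
        K * (‖ξ‖⁻¹ * ‖ξ.1‖) ^ 2) := by
    field_simp
    rfl
  rw [h2]
  exact mul_pos (by positivity) h1

theorem hasDerivWithinAt_fst {V W : Type*} [NormedAddCommGroup V] [NormedSpace ℝ V]
    [NormedAddCommGroup W] [NormedSpace ℝ W] {z : ℝ → V × W} {z' : V × W} {s : Set ℝ} {t : ℝ}
    (hz : HasDerivWithinAt z z' s t) : HasDerivWithinAt (fun r => (z r).1) z'.1 s t :=
  (ContinuousLinearMap.fst ℝ V W).hasFDerivAt.comp_hasDerivWithinAt t hz

theorem hasDerivWithinAt_snd {V W : Type*} [NormedAddCommGroup V] [NormedSpace ℝ V]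
    [NormedAddCommGroup W] [NormedSpace ℝ W] {z : ℝ → V × W} {z' : V × W} {s : Set ℝ} {t : ℝ}
    (hz : HasDerivWithinAt z z' s t) : HasDerivWithinAt (fun r => (z r).2) z'.2 s t :=
  (ContinuousLinearMap.snd ℝ V W).hasFDerivAt.comp_hasDerivWithinAt t hz

theorem hasDerivWithinAt_symp {V : Type*} [NormedAddCommGroup V] [NormedSpace ℝ V]
    {z w : ℝ → Cot V} {z' w' : Cot V} {s : Set ℝ} {t : ℝ} (hz : HasDerivWithinAt z z' s t)
    (hw : HasDerivWithinAt w w' s t) :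
    HasDerivWithinAt (fun r => symp (z r) (w r)) (symp z' (w t) + symp (z t) w') s t := by
  have h1 := ((hasDerivWithinAt_snd hz).clm_apply (hasDerivWithinAt_fst hw)).sub
    ((hasDerivWithinAt_snd hw).clm_apply (hasDerivWithinAt_fst hz))
  refine h1.congr_deriv ?_
  simp only [symp]
  ring

theorem IsConvexSystem.symp_fund (hA : IsConvexSystem A) {t : ℝ} (ht : t ∈ Icc (0 : ℝ) 1)
    (z w : Cot (E n)) : symp (fund A t z) (fund A t w) = symp z w := by
  have h1 : ∀ s ∈ Icc (0 : ℝ) 1, HasDerivWithinAt (fun r => symp (fund A r z) (fund A r w)) 0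
      (Icc (0 : ℝ) 1) s := by
    intro s hs
    refine (hasDerivWithinAt_symp (hasDerivWithinAt_fund A z hs)
      (hasDerivWithinAt_fund A w hs)).congr_deriv ?_
    have h2 := hA.symm ⟨s, hs⟩ (fund A s z) (fund A s w)
    rw [← ext_apply A hs] at h2
    rw [h2, symp_swap (fund A s z)]
    ring
  have h2 := (convex_Icc (0 : ℝ) 1).is_const_of_fderivWithin_eq_zero (𝕜 := ℝ)
    (fun s hs => (h1 s hs).differentiableWithinAt) (fun s hs => by
      have h3 := (h1 s hs).hasFDerivWithinAt.fderivWithin (uniqueDiffOn_Icc zero_lt_one s hs)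
      rw [h3]
      ext
      simp) ht (left_mem_Icc.2 zero_le_one)
  simp only [fund_zero] at h2
  exact h2

theorem IsConvexSystem.fund_eq_zero (hA : IsConvexSystem A) {t : ℝ} (ht : t ∈ Icc (0 : ℝ) 1)
    {z : Cot (E n)} (h : fund A t z = 0) : z = 0 :=
  symp_nondegenerate fun w => by rw [← hA.symp_fund ht, h, symp_zero_left]

theorem IsConvexSystem.bdrySpace_eq_bot (hA : IsConvexSystem A) (hpos : IsPosSystem A)
    (W : Submodule ℝ (E n × E n)) {b : ℝ} (hb0 : 0 < b) (hb1 : b ≤ 1) :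
    bdrySpace W (fund A b) = ⊥ := by
  refine (Submodule.eq_bot_iff _).2 fun z hz => ?_
  by_contra hne
  have hd : ∀ s ∈ Icc (0 : ℝ) 1, HasDerivWithinAt (fun r => (fund A r z).2 (fund A r z).1)
      (hessForm (ext A s) (fund A s z) (fund A s z)) (Icc (0 : ℝ) 1) s := fun s hs =>
    (hasDerivWithinAt_snd (hasDerivWithinAt_fund A z hs)).clm_apply
      (hasDerivWithinAt_fst (hasDerivWithinAt_fund A z hs))
  have hmono : StrictMonoOn (fun r => (fund A r z).2 (fund A r z).1) (Icc (0 : ℝ) 1) := by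
    refine strictMonoOn_of_deriv_pos (convex_Icc 0 1)
      (fun s hs => (hd s hs).continuousWithinAt) fun s hs => ?_
    rw [interior_Icc] at hs
    have hsI := Ioo_subset_Icc_self hs
    rw [((hd s hsI).hasDerivAt (Icc_mem_nhds hs.1 hs.2)).deriv]
    exact hpos s _ fun h => hne (hA.fund_eq_zero hsI h)
  have h1 := hmono (left_mem_Icc.2 zero_le_one) ⟨hb0.le, hb1⟩ hb0
  have h2 := hz.2 _ hz.1
  simp only [fund_zero] at h1
  simp only at h2
  exact absurd h2 h1.ne

end Positivity

section BoundaryProblem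

variable {n : ℕ}

/-- The boundary operator whose kernel consists of the pairs satisfying the boundary condition and
the natural boundary condition associated to `W`. -/
def bdryMap (W : Submodule ℝ (E n × E n)) :
    (Cot (E n) × Cot (E n)) →ₗ[ℝ] ((E n × E n) ⧸ W) × Module.Dual ℝ W where
  toFun z := (W.mkQ (z.1.1, z.2.1),
    ((z.1.2.coprod (-z.2.2) : E n × E n →L[ℝ] ℝ) : E n × E n →ₗ[ℝ] ℝ) ∘ₗ W.subtype)
  map_add' z w := by
    refine Prod.ext (W.mkQ.map_add (z.1.1, z.2.1) (w.1.1, w.2.1)) (LinearMap.ext fun ξ => ?_)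
    simp
    ring
  map_smul' c z := by
    refine Prod.ext (W.mkQ.map_smul c (z.1.1, z.2.1)) (LinearMap.ext fun ξ => ?_)
    simp
    ring

theorem bdryMap_eq_zero {W : Submodule ℝ (E n × E n)} {a b : Cot (E n)} :
    bdryMap W (a, b) = 0 ↔ (a.1, b.1) ∈ W ∧ ∀ ξ ∈ W, a.2 ξ.1 = b.2 ξ.2 := by
  rw [Prod.ext_iff]
  refine and_congr (Submodule.Quotient.mk_eq_zero W) ⟨fun h ξ hξ => ?_, fun h => ?_⟩
  · have h1 : a.2 ξ.1 + (-b.2) ξ.2 = 0 := congrArg (fun f : Module.Dual ℝ W => f ⟨ξ, hξ⟩) h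
    rw [neg_apply] at h1
    linarith
  · refine LinearMap.ext fun ξ => ?_
    change a.2 (ξ : E n × E n).1 + (-b.2) (ξ : E n × E n).2 = 0
    rw [neg_apply, h ξ ξ.2]
    ring

theorem exists_boundary_solution {W : Submodule ℝ (E n × E n)} {Φ : Cot (E n) →L[ℝ] Cot (E n)}
    (h : bdrySpace W Φ = ⊥) : ∃ ζ : Cot (E n) →L[ℝ] Cot (E n),
      ∀ y, bdryMap W (ζ y, Φ (ζ y) - y) = 0 := by
  let T : Cot (E n) →ₗ[ℝ] ((E n × E n) ⧸ W) × Module.Dual ℝ W :=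
    bdryMap W ∘ₗ (LinearMap.id.prod (Φ : Cot (E n) →ₗ[ℝ] Cot (E n)))
  have hT : ∀ z, T z = bdryMap W (z, Φ z) := fun z => rfl
  have hinj : Function.Injective T := by
    refine (injective_iff_map_eq_zero T).2 fun z hz => ?_
    rw [hT, bdryMap_eq_zero] at hz
    have : z ∈ bdrySpace W Φ := hz
    rwa [h, Submodule.mem_bot] at this
  have hdim : Module.finrank ℝ (Cot (E n)) =
      Module.finrank ℝ (((E n × E n) ⧸ W) × Module.Dual ℝ W) := by
    rw [finrank_cot, Module.finrank_prod, Subspace.dual_finrank_eq,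
      Submodule.finrank_quotient_add_finrank, Module.finrank_prod]
  let e := LinearEquiv.ofInjectiveOfFinrankEq T hinj hdim
  have he : ∀ z, e z = bdryMap W (z, Φ z) := fun z => rfl
  let ζ : Cot (E n) →ₗ[ℝ] Cot (E n) :=
    (e.symm : _ →ₗ[ℝ] Cot (E n)) ∘ₗ bdryMap W ∘ₗ LinearMap.inr ℝ (Cot (E n)) (Cot (E n))
  refine ⟨LinearMap.toContinuousLinearMap ζ, fun y => ?_⟩
  have h1 : e (ζ y) = bdryMap W (0, y) := e.apply_symm_apply _
  rw [he] at h1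
  change bdryMap W (ζ y, Φ (ζ y) - y) = 0
  have h2 : ((ζ y, Φ (ζ y) - y) : Cot (E n) × Cot (E n)) = (ζ y, Φ (ζ y)) - (0, y) := by
    refine Prod.ext (sub_zero _).symm rfl
  rw [h2, map_sub, h1, sub_self]

end BoundaryProblem

section IndexFormula

variable {n : ℕ} {A : C(Icc (0 : ℝ) 1, Cot (E n) →L[ℝ] Cot (E n))}
  {Θ : C(Icc (0 : ℝ) 1, (E n × E n) →L[ℝ] Cot (E n))} {W : Submodule ℝ (E n × E n)}

/-- The second variation on `W^{1,2}_W`. -/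
def secBilinW (A : C(Icc (0 : ℝ) 1, Cot (E n) →L[ℝ] Cot (E n)))
    (Θ : C(Icc (0 : ℝ) 1, (E n × E n) →L[ℝ] Cot (E n))) (W : Submodule ℝ (E n × E n)) :
    LinearMap.BilinForm ℝ (W12W W) := (secBilin A Θ).restrict (W12W W)

theorem secBilinW_apply (u v : W12W W) :
    secBilinW A Θ W u v = secBilin A Θ (u : W12 n) (v : W12 n) := rfl

theorem IsLegendreInverse.secBilinW_add (hΘ : IsLegendreInverse A Θ) (κ : ℝ) (u v : W12W W) :
    secBilinW A Θ W u v + κ * inner ℝ (jW W u) (jW W v) =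
      secBilin (pencil A (shiftB n) κ) Θ (u : W12 n) (v : W12 n) := by
  rw [hΘ.secBilin_pencil, inner_jW_jW, secBilinW_apply]

/-- The primitive of a square-integrable force. -/
def forceL (n : ℕ) : L2I (E n) →L[ℝ] C(Icc (0 : ℝ) 1, Cot (E n)) :=
  (((ContinuousLinearMap.inr ℝ (E n) (E n →L[ℝ] ℝ)).comp (innerSL ℝ)).compLeftContinuous ℝ
    (Icc (0 : ℝ) 1)).comp (primLp (E n))

theorem forceL_apply (f : L2I (E n)) (t : Icc (0 : ℝ) 1) :
    forceL n f t = ((0 : E n), innerSL ℝ (∫ s in (0 : ℝ)..t, f s)) := by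
  rw [← primLp_apply]
  rfl

theorem isCompactOperator_forceL : IsCompactOperator (forceL n) :=
  (isCompactOperator_primLp (V := E n)).clm_comp
    (((ContinuousLinearMap.inr ℝ (E n) (E n →L[ℝ] ℝ)).comp (innerSL ℝ)).compLeftContinuous ℝ
      (Icc (0 : ℝ) 1))

theorem forceL_eq_integral (f : L2I (E n)) {t : ℝ} (ht : t ∈ Icc (0 : ℝ) 1) :
    ext (forceL n f) t = ∫ s in (0 : ℝ)..t, ((0 : E n), innerSL ℝ (f s)) := by
  have h0 : (0 : ℝ) ∈ Icc (0 : ℝ) 1 := by simp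
  have h1 := ContinuousLinearMap.intervalIntegral_comp_comm
    ((ContinuousLinearMap.inr ℝ (E n) (E n →L[ℝ] ℝ)).comp (innerSL ℝ))
    (intervalIntegrable_of_integrableOn (integrableOn_Lp f) h0 ht)
  rw [ext_apply _ ht, forceL_apply]
  exact h1.symm

theorem exists_green (hΘ : IsLegendreInverse A Θ) (hbot : bdrySpace W (fund A 1) = ⊥) :
    ∃ (R : L2I (E n) →L[ℝ] L2I (E n)) (G : L2I (E n) → W12W W), IsCompactOperator R ∧
      (∀ f, jW W (G f) = R f) ∧
      ∀ f (v : W12W W), secBilin A Θ (G f : W12 n) (v : W12 n) = inner ℝ f (jW W v) := by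
  have h0 : (0 : ℝ) ∈ Icc (0 : ℝ) 1 := by simp
  obtain ⟨ζ, hζ⟩ := exists_boundary_solution hbot
  let w : L2I (E n) → C(Icc (0 : ℝ) 1, Cot (E n)) := fun f => greenOp A ζ (forceL n f)
  have hf0 : ∀ f, ext (forceL n f) 0 = 0 := fun f => by
    rw [forceL_eq_integral f h0, intervalIntegral.integral_same]
  have hwL : ∀ f, MemLp (fun s => ext A s (ext (w f) s)) 2 μI := fun f =>
    memLp_clm A (memLp_ext (w f))
  have hfL : ∀ f : L2I (E n), MemLp (fun s => ((0 : E n), innerSL ℝ (f s))) 2 μI := fun f =>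
    memLp_clm_const ((ContinuousLinearMap.inr ℝ (E n) (E n →L[ℝ] ℝ)).comp (innerSL ℝ)) (Lp.memLp f)
  have hwi : ∀ f, ∀ t ∈ Icc (0 : ℝ) 1,
      IntervalIntegrable (fun s => ext A s (ext (w f) s)) volume 0 t := fun f t ht =>
    intervalIntegrable_of_integrableOn (integrableOn_of_memLp (hwL f)) h0 ht
  have hfi : ∀ f : L2I (E n), ∀ t ∈ Icc (0 : ℝ) 1,
      IntervalIntegrable (fun s => ((0 : E n), innerSL ℝ (f s))) volume 0 t := fun f t ht =>
    intervalIntegrable_of_integrableOn (integrableOn_of_memLp (hfL f)) h0 ht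
  have hweq : ∀ f, ∀ t ∈ Icc (0 : ℝ) 1, ext (w f) t = ext (w f) 0 +
      ∫ s in (0 : ℝ)..t, (ext A s (ext (w f) s) - ((0 : E n), innerSL ℝ (f s))) := by
    intro f t ht
    rw [intervalIntegral.integral_sub (hwi f t ht) (hfi f t ht), ← forceL_eq_integral f ht,
      ext_greenOp_eq A ζ (hf0 f) ht]
    exact add_sub_assoc _ _ _
  have hw0 : ∀ f, ext (w f) 0 = ζ (ext (resolv A (forceL n f)) 1) := fun f =>
    ext_greenOp_zero A ζ (hf0 f)
  have hw1 : ∀ f, ext (w f) 1 = fund A 1 (ζ (ext (resolv A (forceL n f)) 1)) -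
      ext (resolv A (forceL n f)) 1 := fun f => rfl
  have hbd : ∀ f, ((ext (w f) 0).1, (ext (w f) 1).1) ∈ W ∧
      ∀ ξ ∈ W, (ext (w f) 0).2 ξ.1 = (ext (w f) 1).2 ξ.2 := fun f => by
    rw [hw0, hw1]
    exact bdryMap_eq_zero.1 (hζ _)
  have hw12 : ∀ f, (fun t : Icc (0 : ℝ) 1 => (w f t).1) ∈ W12 n := fun f => by
    refine ⟨fun s => (ext A s (ext (w f) s)).1, (hwL f).fst, fun t => ?_⟩
    have h1 := congrArg (ContinuousLinearMap.fst ℝ (E n) (E n →L[ℝ] ℝ)) (hweq f t t.2)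
    rw [map_add, ← ContinuousLinearMap.intervalIntegral_comp_comm _
      ((hwi f t t.2).sub (hfi f t t.2)), ext_coe, ext_apply _ h0] at h1
    refine h1.trans ?_
    congr 1
    refine intervalIntegral.integral_congr fun s _ => ?_
    exact sub_zero _
  let G : L2I (E n) → W12W W := fun f => ⟨⟨fun t => (w f t).1, hw12 f⟩, by
    have h1 := (hbd f).1
    rw [ext_apply _ h0, ext_apply _ (right_mem_Icc.2 zero_le_one)] at h1
    exact h1⟩
  refine ⟨(cToLp (E n)).comp (((ContinuousLinearMap.fst ℝ (E n) (E n →L[ℝ] ℝ)).compLeftContinuous ℝ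
    (Icc (0 : ℝ) 1)).comp ((greenOp A ζ).comp (forceL n))), G, ?_, fun f => ?_, fun f v => ?_⟩
  · exact ((isCompactOperator_forceL.clm_comp (greenOp A ζ)).clm_comp
      ((ContinuousLinearMap.fst ℝ (E n) (E n →L[ℝ] ℝ)).compLeftContinuous ℝ
        (Icc (0 : ℝ) 1))).clm_comp (cToLp (E n))
  · rw [jW_apply]
    rfl
  · rw [hΘ.secBilin_of_solution (Lp.memLp f) (hweq f) (u := (G f : W12 n)) (fun t => rfl) v,
      (hbd f).2 _ (mem_W12W.1 v.2), sub_self, zero_add, inner_jW]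

/-- The kernel of the second variation, shifted by `κ`, on `W^{1,2}_W`. -/
abbrev secKer (A : C(Icc (0 : ℝ) 1, Cot (E n) →L[ℝ] Cot (E n)))
    (Θ : C(Icc (0 : ℝ) 1, (E n × E n) →L[ℝ] Cot (E n))) (W : Submodule ℝ (E n × E n)) (κ : ℝ) :
    Submodule ℝ (W12W W) :=
  pencilKer (𝓥 := W12W W) (H := L2I (E n)) (secBilinW A Θ W) (jW W) κ

theorem IsLegendreInverse.mem_secKer_iff (hΘ : IsLegendreInverse A Θ) (κ : ℝ) (u : W12W W) :
    u ∈ secKer A Θ W κ ↔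
      ∃ z ∈ bdrySpace W (fund (pencil A (shiftB n) κ) 1),
        solW12 (pencil A (shiftB n) κ) z = (u : W12 n) := by
  rw [← (hΘ.shift κ).mem_kernel_iff, mem_pencilKer]
  simp only [hΘ.secBilinW_add]
  exact ⟨fun h => ⟨u.2, fun v hv => h ⟨v, hv⟩⟩, fun h v => h.2 v v.2⟩

/-- Solutions of the boundary value problem are determined by their initial conditions. -/
def secKerEquiv (hA : IsConvexSystem A) (hΘ : IsLegendreInverse A Θ)
    (W : Submodule ℝ (E n × E n)) (κ : ℝ) :
    bdrySpace W (fund (pencil A (shiftB n) κ) 1) ≃ₗ[ℝ] secKer A Θ W κ :=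
  LinearEquiv.ofBijective
    ((((solW12 (pencil A (shiftB n) κ)).domRestrict _).codRestrict (W12W W) fun z =>
      (((hΘ.shift κ).mem_kernel_iff W _).2 ⟨z, z.2, rfl⟩).1).codRestrict
      (secKer A Θ W κ) fun z => (hΘ.mem_secKer_iff κ _).2 ⟨z, z.2, rfl⟩)
    ⟨fun z w h => Subtype.ext ((hA.shift κ).solW12_injective
        (congrArg (fun x : secKer A Θ W κ => ((x : W12W W) : W12 n)) h)),
      fun u => by
        obtain ⟨z, hz, hzu⟩ := (hΘ.mem_secKer_iff κ u.1).1 u.2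
        exact ⟨⟨z, hz⟩, Subtype.ext (Subtype.ext hzu)⟩⟩

theorem IsPosSystem.secBilin_nonneg (hpos : IsPosSystem A) (u : W12 n) :
    0 ≤ secBilin A Θ u u := by
  rw [secBilin_apply]
  refine integral_nonneg fun t => ?_
  by_cases h : w12Lift Θ u t = 0
  · simp [h, hessForm]
  · exact (hpos t _ h).le

theorem exists_negative_and_bound_secBilin (hA : IsConvexSystem A) (hΘ : IsLegendreInverse A Θ)
    {K : ℝ} (hK : 0 < K) (hpos : IsPosSystem (pencil A (shiftB n) K)) {Z : Finset ℝ}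
    (hZ : ∀ κ ∈ Z, 0 < κ)
    (hZ' : ∀ κ ∈ Ioo 0 K, κ ∉ Z → bdrySpace W (fund (pencil A (shiftB n) κ) 1) = ⊥) :
    (∃ Y : Submodule ℝ (W12W W), (∀ u ∈ Y, u ≠ 0 → secBilinW A Θ W u u < 0) ∧
      Module.rank ℝ Y = ((∑ κ ∈ Z,
        Module.finrank ℝ (bdrySpace W (fund (pencil A (shiftB n) κ) 1)) : ℕ) : Cardinal)) ∧
    ∀ Y : Submodule ℝ (W12W W), (∀ u ∈ Y, u ≠ 0 → secBilinW A Θ W u u < 0) →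
      Module.rank ℝ Y ≤ ((∑ κ ∈ Z,
        Module.finrank ℝ (bdrySpace W (fund (pencil A (shiftB n) κ) 1)) : ℕ) : Cardinal) := by
  obtain ⟨R, G, hR, hjG, hG⟩ := exists_green (hΘ.shift K)
    ((hA.shift K).bdrySpace_eq_bot hpos W one_pos le_rfl)
  have hfin : ∀ κ, Module.Finite ℝ (secKer A Θ W κ) := fun κ =>
    Module.Finite.equiv (secKerEquiv hA hΘ W κ)
  have hdim : ∀ κ, Module.finrank ℝ (secKer A Θ W κ) =
      Module.finrank ℝ (bdrySpace W (fund (pencil A (shiftB n) κ) 1)) := fun κ =>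
    (secKerEquiv hA hΘ W κ).finrank_eq.symm
  have := exists_negative_and_bound (𝓥 := W12W W) (H := L2I (E n)) (S := secBilinW A Θ W) (j := jW W)
    (fun u v => hA.secBilin_symm _ _) jW_injective hK (fun u => by
      rw [hΘ.secBilinW_add]
      exact hpos.secBilin_nonneg _) hR hjG (fun f v => by
      rw [hΘ.secBilinW_add]
      exact hG f v) hZ (fun κ hκ hκZ => by
      have h1 := hZ' κ hκ hκZ
      have : Subsingleton (secKer A Θ W κ) := by
        have : Subsingleton (bdrySpace W (fund (pencil A (shiftB n) κ) 1)) := by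
          rw [h1]
          infer_instance
        exact (secKerEquiv hA hΘ W κ).symm.injective.subsingleton
      exact (Submodule.subsingleton_iff_eq_bot).1 this) hfin
  simpa only [hdim] using this

end IndexFormula

section MovingForm

variable {X : Type*} [NormedAddCommGroup X] [NormedSpace ℝ X] [FiniteDimensional ℝ X]
  {Z : Type*} [NormedAddCommGroup Z] [NormedSpace ℝ Z]

/-- The quadratic form `ξ ↦ Ω(ξ, Tξ)` on a subspace. -/
def movingForm (Ω : LinearMap.BilinForm ℝ X) (T : X →L[ℝ] X) (U : Submodule ℝ X) :
    QuadraticForm ℝ U :=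
  (LinearMap.BilinMap.toQuadraticMap (Ω.compl₂ (T : X →ₗ[ℝ] X))).restrict U

theorem isMovedBy_graph {Ω : LinearMap.BilinForm ℝ X} {Λ : ℝ → Submodule ℝ X} {t : ℝ}
    (ht : t ∈ Icc (0 : ℝ) 1) {M : ℝ → Z →L[ℝ] Z} {D : Z →L[ℝ] Z}
    (hM : HasDerivWithinAt M D (Icc 0 1) t) (ι : Z →L[ℝ] X) (P : X →L[ℝ] Z) (e : Z →ₗ[ℝ] X)
    (he : ∀ z, P (e z) = z) (hΛ : ∀ s ∈ Icc (0 : ℝ) 1, IsLag Ω (Λ s) ∧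
      Λ s = LinearMap.range (e + (ι : Z →ₗ[ℝ] X) ∘ₗ (M s : Z →ₗ[ℝ] Z)))
    (hι : ∀ z, P (ι z) = 0) :
    IsMovedBy Ω Λ t (fun s => 1 + ι.comp ((M s - M t).comp P)) (ι.comp (D.comp P)) := by
  refine ⟨?_, ?_, ?_⟩
  · have h1 : HasDerivWithinAt (fun s => ι.comp ((M s - M t).comp P)) (ι.comp (D.comp P))
        (Icc 0 1) t := by
      have h2 := (((ContinuousLinearMap.compL ℝ X Z X ι).comp
        ((ContinuousLinearMap.compL ℝ X Z Z).flip P)).hasFDerivAt.comp_hasDerivWithinAt t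
        (hM.sub_const (M t)))
      exact h2
    exact h1.const_add _
  · simp
  · filter_upwards [self_mem_nhdsWithin] with s hs
    refine ⟨(hΛ s hs).1, ?_⟩
    rw [(hΛ s hs).2, (hΛ t ht).2, ← LinearMap.range_comp]
    congr 1
    refine LinearMap.ext fun z => ?_
    change (e z + ι (M t z)) + ι ((M s - M t) (P (e z + ι (M t z)))) = e z + ι (M s z)
    rw [map_add P, he, hι, add_zero, sub_apply, map_sub]
    abel

theorem finite_crossings {Ω : LinearMap.BilinForm ℝ X} (hΩ : IsSymplecticForm Ω)
    {Λ : ℝ → Submodule ℝ X} {Λ₀ : Submodule ℝ X} (hΛ₀ : IsLag Ω Λ₀) {T : ℝ → ℝ → X →L[ℝ] X}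
    {T' : ℝ → X →L[ℝ] X} (hT : ∀ t ∈ Icc (0 : ℝ) 1, IsMovedBy Ω Λ t (T t) (T' t))
    (hnd : ∀ t ∈ Icc (0 : ℝ) 1, ∀ ξ, (∀ ζ, QuadraticMap.polar (movingForm Ω (T' t) (Λ t ⊓ Λ₀)) ξ ζ =
      0) → ξ = 0) :
    {t ∈ Icc (0 : ℝ) 1 | Λ t ⊓ Λ₀ ≠ ⊥}.Finite := by
  have key : (Icc (0 : ℝ) 1 ∩ {t | Λ t ⊓ Λ₀ ≠ ⊥}).Finite := by
    refine isCompact_Icc.induction_on (p := fun A => (A ∩ {t | Λ t ⊓ Λ₀ ≠ ⊥}).Finite) (by simp)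
      (fun A B hAB hB => hB.subset (inter_subset_inter_left _ hAB))
      (fun A B hA hB => by rw [union_inter_distrib_right]; exact hA.union hB) ?_
    intro t ht
    obtain ⟨ν, hν, hc, hct⟩ := exists_common_complement hΩ ((hT t ht).isLag ht) hΛ₀
    refine ⟨_, (hT t ht).eventually_chartSig hΩ hΛ₀ ht (fun ξ => rfl)
      ((radical_eq_bot_iff_polar _).2 (hnd t ht)) hν hc hct,
      (finite_singleton t).subset ?_⟩
    rintro s ⟨h1, h2⟩
    by_contra hne
    exact h2 (h1.2 hne)
  exact key

theorem signature_of_posDef {M : Type*} [AddCommGroup M] [Module ℝ M] [FiniteDimensional ℝ M]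
    {Q : QuadraticForm ℝ M} {P N : Submodule ℝ M} (hP : ∀ x ∈ P, x ≠ 0 → 0 < Q x)
    (hN : ∀ x ∈ N, x ≠ 0 → Q x < 0)
    (hdim : Module.finrank ℝ P + Module.finrank ℝ N = Module.finrank ℝ M) :
    Q.radical = ⊥ ∧ signature Q = (Module.finrank ℝ P : ℤ) - Module.finrank ℝ N := by
  have h1 : Module.finrank ℝ P ≤ sigPos Q := le_sigPos_of_posDef Q fun x hx =>
    hP x x.2 fun h => hx (Subtype.ext h)
  have h2 : Module.finrank ℝ N ≤ sigNeg Q := le_sigPos_of_posDef (-Q) fun x hx => by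
    have h3 := hN x x.2 fun h => hx (Subtype.ext h)
    change 0 < -Q x
    linarith
  have h3 := Q.sigPos_add_sigNeg_add_radical
  refine ⟨Submodule.finrank_eq_zero.1 (by omega), ?_⟩
  rw [signature]
  omega

theorem signature_congr_submodule {Y : Type*} [NormedAddCommGroup Y] [NormedSpace ℝ Y]
    {U : Submodule ℝ X} {U' : Submodule ℝ Y} {Q : QuadraticForm ℝ U} {Q' : QuadraticForm ℝ U'}
    (e : U ≃ₗ[ℝ] U') (h : ∀ x, Q' (e x) = Q x) : signature Q' = signature Q :=
  (signature_congr e h).symm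

theorem nondegenerate_congr {Y : Type*} [NormedAddCommGroup Y] [NormedSpace ℝ Y]
    {U : Submodule ℝ X} {U' : Submodule ℝ Y} {Q : QuadraticForm ℝ U} {Q' : QuadraticForm ℝ U'}
    (e : U ≃ₗ[ℝ] U') (h : ∀ x, Q' (e x) = Q x)
    (hQ : ∀ x, (∀ y, QuadraticMap.polar Q x y = 0) → x = 0) (x : U')
    (hx : ∀ y, QuadraticMap.polar Q' x y = 0) : x = 0 := by
  have h1 := hQ (e.symm x) fun y => by
    have h2 := hx (e y)
    simp only [QuadraticMap.polar] at h2 ⊢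
    rw [← h, ← h, ← h, map_add, e.apply_symm_apply, h2]
  have h3 := congrArg e h1
  rwa [e.apply_symm_apply, map_zero] at h3

end MovingForm

section GraphPath

variable {V : Type*} [NormedAddCommGroup V] [NormedSpace ℝ V]

/-- The subspace `graph(ΦC)` of `T*(V × V)`. -/
def graphC (Φ : Cot V →L[ℝ] Cot V) : Submodule ℝ (Cot (V × V)) :=
  graphCot ((Φ : Cot V →ₗ[ℝ] Cot V) ∘ₗ involC V)

theorem symp_cotProd (a b c d : Cot V) :
    symp (cotProd V (a, b)) (cotProd V (c, d)) = symp a c + symp b d := by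
  simp only [symp, cotProd, LinearMap.coe_mk, AddHom.coe_mk, ContinuousLinearMap.coprod_apply]
  ring

theorem symp_involC (a b : Cot V) : symp (involC V a) (involC V b) = -symp a b := by
  simp only [symp, involC, LinearMap.prodMap_apply, LinearMap.id_apply, LinearMap.neg_apply,
    neg_apply]
  ring

theorem involC_involC (a : Cot V) : involC V (involC V a) = a := by
  refine Prod.ext rfl ?_
  simp [involC]

/-- The embedding `z ↦ (Cz, 0)`. -/
def embFst (V : Type*) [NormedAddCommGroup V] [NormedSpace ℝ V] : Cot V →ₗ[ℝ] Cot (V × V) :=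
  cotProd V ∘ₗ LinearMap.inl ℝ (Cot V) (Cot V) ∘ₗ involC V

/-- The embedding of the second factor. -/
def embSnd (V : Type*) [NormedAddCommGroup V] [NormedSpace ℝ V] : Cot V →ₗ[ℝ] Cot (V × V) :=
  cotProd V ∘ₗ LinearMap.inr ℝ (Cot V) (Cot V)

/-- The parametrization `z ↦ (Cz, Φz)` of `graph(ΦC)`. -/
def embGraph (Φ : Cot V →L[ℝ] Cot V) : Cot V →ₗ[ℝ] Cot (V × V) :=
  embFst V + embSnd V ∘ₗ (Φ : Cot V →ₗ[ℝ] Cot V)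

theorem embGraph_apply (Φ : Cot V →L[ℝ] Cot V) (z : Cot V) :
    embGraph Φ z = cotProd V (involC V z, Φ z) := by
  change cotProd V (involC V z, 0) + cotProd V (0, Φ z) = _
  rw [← map_add, Prod.mk_add_mk, add_zero, zero_add]

theorem range_embGraph (Φ : Cot V →L[ℝ] Cot V) : LinearMap.range (embGraph Φ) = graphC Φ := by
  refine Submodule.ext fun ξ => ?_
  rw [graphC, graphCot, Submodule.mem_map, LinearMap.mem_range]
  constructor
  · rintro ⟨z, rfl⟩
    refine ⟨(involC V z, Φ z), ?_, (embGraph_apply Φ z).symm⟩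
    rw [LinearMap.mem_graph_iff]
    change Φ z = Φ (involC V (involC V z))
    rw [involC_involC]
  · rintro ⟨⟨a, b⟩, h, rfl⟩
    rw [LinearMap.mem_graph_iff] at h
    refine ⟨involC V a, ?_⟩
    rw [embGraph_apply, involC_involC]
    exact congrArg (fun y => cotProd V (a, y)) h.symm

/-- The projection of `T*(V × V)` onto the first factor, followed by `C`. -/
def projFst (V : Type*) [NormedAddCommGroup V] [NormedSpace ℝ V] : Cot (V × V) →ₗ[ℝ] Cot V where
  toFun ξ := (ξ.1.1, -ξ.2.comp (ContinuousLinearMap.inl ℝ V V))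
  map_add' ξ η := by
    refine Prod.ext rfl (ContinuousLinearMap.ext fun v => ?_)
    simp
    ring
  map_smul' c ξ := by
    refine Prod.ext rfl (ContinuousLinearMap.ext fun v => ?_)
    simp

theorem projFst_cotProd (a b : Cot V) : projFst V (cotProd V (a, b)) = involC V a := by
  refine Prod.ext rfl (ContinuousLinearMap.ext fun v => ?_)
  simp [projFst, cotProd, involC]

theorem projFst_embFst (z : Cot V) : projFst V (embFst V z) = z := by
  change projFst V (cotProd V (involC V z, 0)) = z
  rw [projFst_cotProd, involC_involC]

theorem projFst_embSnd (z : Cot V) : projFst V (embSnd V z) = 0 := by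
  change projFst V (cotProd V (0, z)) = 0
  rw [projFst_cotProd, map_zero]

theorem projFst_embGraph (Φ : Cot V →L[ℝ] Cot V) (z : Cot V) :
    projFst V (embGraph Φ z) = z := by
  rw [embGraph_apply, projFst_cotProd, involC_involC]

theorem embGraph_injective (Φ : Cot V →L[ℝ] Cot V) : Function.Injective (embGraph Φ) :=
  Function.LeftInverse.injective (projFst_embGraph Φ)

variable [FiniteDimensional ℝ V]

theorem isLagrangian_graphC {Φ : Cot V →L[ℝ] Cot V}
    (hΦ : ∀ z w, symp (Φ z) (Φ w) = symp z w) : IsLagrangian (graphC Φ) := by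
  rw [← range_embGraph]
  refine ⟨?_, ?_⟩
  · rw [LinearMap.finrank_range_of_inj (embGraph_injective Φ), finrank_cot, Module.finrank_prod]
  · rintro _ ⟨z, rfl⟩ _ ⟨w, rfl⟩
    rw [embGraph_apply, embGraph_apply, symp_cotProd, symp_involC, hΦ]
    ring

theorem isLagrangianFamilyOn_graphC {Y : Type*} [NormedAddCommGroup Y] [NormedSpace ℝ Y] {k : ℕ}
    {M : Y → Cot V →L[ℝ] Cot V} {s : Set Y} (hM : ∀ z, ContDiffOn ℝ k (fun y => M y z) s)
    (hs : ∀ y ∈ s, ∀ z w, symp (M y z) (M y w) = symp z w) :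
    IsLagrangianFamilyOn k (fun y => graphC (M y)) s := by
  refine ⟨fun y hy => isLagrangian_graphC (hs y hy), fun y _ => ?_⟩
  have hdim : Module.finrank ℝ (Cot V) = Module.finrank ℝ (V × V) := by
    rw [finrank_cot, Module.finrank_prod]
  let b : Module.Basis (Fin (Module.finrank ℝ (V × V))) ℝ (Cot V) :=
    (Module.finBasis ℝ (Cot V)).reindex (finCongr hdim)
  refine ⟨univ, univ_mem, fun y i => embGraph (M y) (b i), ?_, fun z _ => ⟨?_, ?_⟩⟩
  · rw [inter_univ]
    refine contDiffOn_pi.2 fun i => ?_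
    have h1 : ContDiffOn ℝ k (fun y => LinearMap.toContinuousLinearMap (embSnd V) (M y (b i))) s :=
      (ContinuousLinearMap.contDiff _).comp_contDiffOn (hM (b i))
    exact contDiffOn_const.add h1
  · exact b.linearIndependent.map' _ (LinearMap.ker_eq_bot.2 (embGraph_injective (M z)))
  · rw [show (range fun i => embGraph (M z) (b i)) = embGraph (M z) '' range b from
      range_comp (embGraph (M z)) b, Submodule.span_image, b.span_eq, ← LinearMap.range_eq_map,
      range_embGraph]

theorem isLagrangian_conormal (W : Submodule ℝ V) : IsLagrangian (conormal W) := by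
  let r : (V →L[ℝ] ℝ) →ₗ[ℝ] Module.Dual ℝ W :=
    { toFun := fun α => (α : V →ₗ[ℝ] ℝ) ∘ₗ W.subtype
      map_add' := fun α β => rfl
      map_smul' := fun c α => rfl }
  have hr : Function.Surjective r := by
    intro β
    obtain ⟨β', hβ'⟩ := LinearMap.exists_extend β
    exact ⟨LinearMap.toContinuousLinearMap β', hβ'⟩
  let f : Cot V →ₗ[ℝ] (V ⧸ W) × Module.Dual ℝ W := W.mkQ.prodMap r
  have hf : Function.Surjective f := Function.Surjective.prodMap W.mkQ_surjective hr
  have hker : LinearMap.ker f = conormal W := by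
    refine Submodule.ext fun ξ => ?_
    rw [LinearMap.mem_ker, Prod.ext_iff]
    refine and_congr (Submodule.Quotient.mk_eq_zero W) ⟨fun h u hu => ?_, fun h => ?_⟩
    · exact congrArg (fun g : Module.Dual ℝ W => g ⟨u, hu⟩) h
    · exact LinearMap.ext fun u => h u u.2
  have h1 := LinearMap.finrank_range_add_finrank_ker f
  rw [LinearMap.range_eq_top.2 hf, finrank_top, hker, Module.finrank_prod, Subspace.dual_finrank_eq,
    Submodule.finrank_quotient_add_finrank, finrank_cot] at h1
  refine ⟨by omega, ?_⟩
  rintro ξ ⟨h2, h3⟩ η ⟨h4, h5⟩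
  rw [symp, h3 _ h4, h5 _ h2, sub_zero]

end GraphPath

section BoundaryForm

variable {n : ℕ}

theorem embGraph_mem_conormal {W : Submodule ℝ (E n × E n)} {Φ : Cot (E n) →L[ℝ] Cot (E n)}
    {z : Cot (E n)} : embGraph Φ z ∈ conormal W ↔ z ∈ bdrySpace W Φ := by
  rw [embGraph_apply, mem_bdrySpace]
  refine and_congr Iff.rfl (forall₂_congr fun ξ _ => ?_)
  change (-z.2) ξ.1 + (Φ z).2 ξ.2 = 0 ↔ _
  rw [neg_apply]
  constructor <;> intro h <;> linarith

/-- The intersection of `graph(ΦC)` with the conormal space, in terms of initial conditions. -/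
def bdryEquiv (W : Submodule ℝ (E n × E n)) (Φ : Cot (E n) →L[ℝ] Cot (E n)) :
    bdrySpace W Φ ≃ₗ[ℝ] ↥(graphC Φ ⊓ conormal W) :=
  LinearEquiv.ofBijective
    (((embGraph Φ).domRestrict (bdrySpace W Φ)).codRestrict (graphC Φ ⊓ conormal W) fun z =>
      ⟨range_embGraph Φ ▸ LinearMap.mem_range_self _ _, embGraph_mem_conormal.2 z.2⟩)
    ⟨fun z w h => Subtype.ext (embGraph_injective Φ
      (congrArg (fun x : ↥(graphC Φ ⊓ conormal W) => (x : Cot (E n × E n))) h)), by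
      rintro ⟨ξ, h1, h2⟩
      rw [← range_embGraph] at h1
      obtain ⟨z, rfl⟩ := h1
      exact ⟨⟨z, embGraph_mem_conormal.1 h2⟩, rfl⟩⟩

theorem coe_bdryEquiv (W : Submodule ℝ (E n × E n)) (Φ : Cot (E n) →L[ℝ] Cot (E n))
    (z : bdrySpace W Φ) : (bdryEquiv W Φ z : Cot (E n × E n)) = embGraph Φ z := rfl

/-- The crossing form of a path of graphs, in terms of initial conditions. -/
def bdryForm (W : Submodule ℝ (E n × E n)) (Φ D : Cot (E n) →L[ℝ] Cot (E n)) :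
    QuadraticForm ℝ (bdrySpace W Φ) :=
  (LinearMap.BilinMap.toQuadraticMap ((sympB (E n)).compl₁₂ (Φ : Cot (E n) →ₗ[ℝ] Cot (E n))
    (D : Cot (E n) →ₗ[ℝ] Cot (E n)))).restrict (bdrySpace W Φ)

theorem bdryForm_apply (W : Submodule ℝ (E n × E n)) (Φ D : Cot (E n) →L[ℝ] Cot (E n))
    (z : bdrySpace W Φ) : bdryForm W Φ D z = symp (Φ z) (D z) := rfl

/-- The endomorphism of `T*(ℝ^n × ℝ^n)` which generates the motion of the graphs. -/
def graphMotion (D : Cot (E n) →L[ℝ] Cot (E n)) : Cot (E n × E n) →L[ℝ] Cot (E n × E n) :=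
  (LinearMap.toContinuousLinearMap (embSnd (E n))).comp
    (D.comp (LinearMap.toContinuousLinearMap (projFst (E n))))

/-- The crossing form of a path of graphs. -/
def graphCrossing (W : Submodule ℝ (E n × E n)) (Φ D : Cot (E n) →L[ℝ] Cot (E n)) :
    QuadraticForm ℝ ↥(graphC Φ ⊓ conormal W) :=
  movingForm (X := Cot (E n × E n)) (sympB (E n × E n)) (graphMotion D) (graphC Φ ⊓ conormal W)

theorem graphCrossing_bdryEquiv (W : Submodule ℝ (E n × E n)) (Φ D : Cot (E n) →L[ℝ] Cot (E n))
    (z : bdrySpace W Φ) :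
    graphCrossing W Φ D (bdryEquiv W Φ z) = bdryForm W Φ D z := by
  change symp (embGraph Φ z) (embSnd (E n) (D (projFst (E n) (embGraph Φ z)))) = _
  rw [projFst_embGraph, embGraph_apply]
  change symp _ (cotProd (E n) (0, D z)) = _
  rw [symp_cotProd, symp_zero_right, zero_add, bdryForm_apply]

theorem sgn_graphCrossing (W : Submodule ℝ (E n × E n)) (Φ D : Cot (E n) →L[ℝ] Cot (E n)) :
    sgn (graphCrossing W Φ D) = sgn (bdryForm W Φ D) :=
  signature_congr_submodule (X := Cot (E n)) (Y := Cot (E n × E n)) (bdryEquiv W Φ)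
    (graphCrossing_bdryEquiv W Φ D)

theorem isNondeg_graphCrossing {W : Submodule ℝ (E n × E n)} {Φ D : Cot (E n) →L[ℝ] Cot (E n)}
    (h : IsNondeg (bdryForm W Φ D)) : IsNondeg (graphCrossing W Φ D) :=
  nondegenerate_congr (X := Cot (E n)) (Y := Cot (E n × E n)) (bdryEquiv W Φ)
    (graphCrossing_bdryEquiv W Φ D) h

variable {M D : ℝ → Cot (E n) →L[ℝ] Cot (E n)}

theorem isMovedBy_graphC (hD : ∀ t ∈ Icc (0 : ℝ) 1, HasDerivWithinAt M (D t) (Icc 0 1) t)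
    (hs : ∀ t ∈ Icc (0 : ℝ) 1, ∀ z w, symp (M t z) (M t w) = symp z w) {t : ℝ}
    (ht : t ∈ Icc (0 : ℝ) 1) : ∃ T, IsMovedBy (sympB (E n × E n)) (fun s => graphC (M s)) t T
      (graphMotion (D t)) :=
  ⟨_, isMovedBy_graph ht (hD t ht) (LinearMap.toContinuousLinearMap (embSnd (E n)))
    (LinearMap.toContinuousLinearMap (projFst (E n))) (embFst (E n)) projFst_embFst
    (fun s hsI => ⟨isLagrangian_iff.1 (isLagrangian_graphC (hs s hsI)), (range_embGraph _).symm⟩)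
    projFst_embSnd⟩

theorem isRegularMaslovIndex_graphC (W : Submodule ℝ (E n × E n))
    (hM : ∀ z, ContDiffOn ℝ 1 (fun t => M t z) (Icc 0 1))
    (hD : ∀ t ∈ Icc (0 : ℝ) 1, HasDerivWithinAt M (D t) (Icc 0 1) t)
    (hs : ∀ t ∈ Icc (0 : ℝ) 1, ∀ z w, symp (M t z) (M t w) = symp z w)
    (hnd : ∀ t ∈ Icc (0 : ℝ) 1, IsNondeg (bdryForm W (M t) (D t))) :
    IsRegularMaslovIndex (fun t => graphC (M t)) (conormal W)
      ((sgn (bdryForm W (M 0) (D 0)) : ℝ) / 2 +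
        ∑ᶠ t ∈ Ioo (0 : ℝ) 1, (sgn (bdryForm W (M t) (D t)) : ℝ) +
        (sgn (bdryForm W (M 1) (D 1)) : ℝ) / 2) := by
  refine ⟨isLagrangianFamilyOn_graphC (k := 1) hM hs, fun t => graphCrossing W (M t) (D t),
    fun t ht => ⟨?_, isNondeg_graphCrossing (hnd t ht)⟩, ?_⟩
  · obtain ⟨T, hT⟩ := isMovedBy_graphC hD hs ht
    exact hT.isCrossingForm ht fun ξ => rfl
  · simp only [sgn_graphCrossing]

theorem finite_bdrySpace_ne_bot (W : Submodule ℝ (E n × E n))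
    (hD : ∀ t ∈ Icc (0 : ℝ) 1, HasDerivWithinAt M (D t) (Icc 0 1) t)
    (hs : ∀ t ∈ Icc (0 : ℝ) 1, ∀ z w, symp (M t z) (M t w) = symp z w)
    (hnd : ∀ t ∈ Icc (0 : ℝ) 1, IsNondeg (bdryForm W (M t) (D t))) :
    {t ∈ Icc (0 : ℝ) 1 | bdrySpace W (M t) ≠ ⊥}.Finite := by
  have h := fun t (ht : t ∈ Icc (0 : ℝ) 1) => isMovedBy_graphC hD hs ht
  choose! T hT using h
  refine (finite_crossings (X := Cot (E n × E n)) isSymplecticForm_sympB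
    (isLagrangian_iff.1 (isLagrangian_conormal W)) hT
    fun t ht => isNondeg_graphCrossing (hnd t ht)).subset ?_
  rintro t ⟨ht, hne⟩
  refine ⟨ht, fun h => hne ?_⟩
  refine (Submodule.eq_bot_iff _).2 fun z hz => ?_
  have h1 := (bdryEquiv W (M t) ⟨z, hz⟩).2
  have h2 : (bdryEquiv W (M t) ⟨z, hz⟩ : Cot (E n × E n)) = 0 :=
    (Submodule.eq_bot_iff _).1 h _ h1
  rw [coe_bdryEquiv] at h2
  exact embGraph_injective (M t) (h2.trans (map_zero _).symm)

end BoundaryForm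

section Reparametrization

theorem hasDerivAt_max_zero_sq (x : ℝ) :
    HasDerivAt (fun y : ℝ => max y 0 ^ 2) (2 * max x 0) x := by
  have h1 : ∀ y ∈ Ici (0 : ℝ), max y 0 ^ 2 = y ^ 2 := fun y hy => by rw [max_eq_left hy]
  have h2 : ∀ y ∈ Iic (0 : ℝ), max y 0 ^ 2 = 0 := fun y hy => by rw [max_eq_right hy]; norm_num
  have hsq : HasDerivAt (fun y : ℝ => y ^ 2) (2 * x) x := by simpa using hasDerivAt_pow 2 x
  rcases lt_trichotomy x 0 with h | h | h
  · rw [max_eq_right h.le, mul_zero]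
    refine (hasDerivAt_const x (0 : ℝ)).congr_of_eventuallyEq ?_
    filter_upwards [Iio_mem_nhds h] with y hy
    exact h2 y (mem_Iic.2 (le_of_lt (mem_Iio.1 hy)))
  · subst h
    have h3 : HasDerivWithinAt (fun y : ℝ => max y 0 ^ 2) (2 * max 0 0) (Ici 0) 0 := by
      have := hsq.hasDerivWithinAt.congr (s := Ici (0 : ℝ)) h1 (h1 0 (mem_Ici.2 le_rfl))
      simpa using this
    have h4 : HasDerivWithinAt (fun y : ℝ => max y 0 ^ 2) (2 * max 0 0) (Iic 0) 0 := by
      have := (hasDerivWithinAt_const (0 : ℝ) (Iic (0 : ℝ)) (0 : ℝ)).congr h2 (h2 0 (mem_Iic.2 le_rfl))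
      simpa using this
    have h5 := h3.union h4
    rwa [union_comm, Iic_union_Ici, hasDerivWithinAt_univ] at h5
  · rw [max_eq_left h.le]
    refine hsq.congr_of_eventuallyEq ?_
    filter_upwards [Ioi_mem_nhds h] with y hy
    exact h1 y (mem_Ici.2 (le_of_lt (mem_Ioi.1 hy)))

/-- A `C^1` time change, increasing from `0` to `1` on `[0,1/2]` and then constant. -/
def timeChange (τ : ℝ) : ℝ := 1 - max (1 - 2 * τ) 0 ^ 2

/-- A `C^1` parameter change, constant on `[0,1/2]` and then decreasing from `1` to `0`. -/
def paramChange (τ : ℝ) : ℝ := 1 - max (2 * τ - 1) 0 ^ 2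

theorem hasDerivAt_timeChange (τ : ℝ) : HasDerivAt timeChange (4 * max (1 - 2 * τ) 0) τ := by
  have h1 : HasDerivAt (fun τ : ℝ => 1 - 2 * τ) (-(2 * 1)) τ :=
    ((hasDerivAt_id τ).const_mul 2).const_sub 1
  have h2 := ((hasDerivAt_max_zero_sq (1 - 2 * τ)).comp τ h1).const_sub 1
  refine h2.congr_deriv ?_
  ring

theorem hasDerivAt_paramChange (τ : ℝ) : HasDerivAt paramChange (-(4 * max (2 * τ - 1) 0)) τ := by
  have h1 : HasDerivAt (fun τ : ℝ => 2 * τ - 1) (2 * 1) τ :=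
    ((hasDerivAt_id τ).const_mul 2).sub_const 1
  have h2 := ((hasDerivAt_max_zero_sq (2 * τ - 1)).comp τ h1).const_sub 1
  refine h2.congr_deriv ?_
  ring

theorem contDiff_one_of_hasDerivAt {f f' : ℝ → ℝ} (h : ∀ x, HasDerivAt f (f' x) x)
    (hf' : Continuous f') : ContDiff ℝ 1 f := by
  refine contDiff_one_iff_deriv.2 ⟨fun x => (h x).differentiableAt, ?_⟩
  rwa [funext fun x => (h x).deriv]

theorem contDiff_timeChange : ContDiff ℝ 1 timeChange :=
  contDiff_one_of_hasDerivAt hasDerivAt_timeChange (by fun_prop)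

theorem contDiff_paramChange : ContDiff ℝ 1 paramChange :=
  contDiff_one_of_hasDerivAt hasDerivAt_paramChange (by fun_prop)

theorem timeChange_of_le {τ : ℝ} (h : τ ≤ 1 / 2) : timeChange τ = 1 - (1 - 2 * τ) ^ 2 := by
  rw [timeChange, max_eq_left (by linarith)]

theorem timeChange_of_ge {τ : ℝ} (h : 1 / 2 ≤ τ) : timeChange τ = 1 := by
  rw [timeChange, max_eq_right (by linarith)]
  norm_num

theorem paramChange_of_le {τ : ℝ} (h : τ ≤ 1 / 2) : paramChange τ = 1 := by
  rw [paramChange, max_eq_right (by linarith)]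
  norm_num

theorem paramChange_of_ge {τ : ℝ} (h : 1 / 2 ≤ τ) : paramChange τ = 1 - (2 * τ - 1) ^ 2 := by
  rw [paramChange, max_eq_left (by linarith)]

theorem timeChange_mem {τ : ℝ} (h : τ ∈ Icc (0 : ℝ) 1) : timeChange τ ∈ Icc (0 : ℝ) 1 := by
  rcases le_total τ (1 / 2) with h1 | h1
  · rw [timeChange_of_le h1]
    have := h.1
    exact ⟨by nlinarith, by nlinarith [sq_nonneg (1 - 2 * τ)]⟩
  · rw [timeChange_of_ge h1]
    simp

end Reparametrization

section RegularPath

variable {X : Type*} [NormedAddCommGroup X] [NormedSpace ℝ X] [FiniteDimensional ℝ X]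
  (A B : C(Icc (0 : ℝ) 1, X →L[ℝ] X)) (K : ℝ)

theorem contDiff_fund_pencil (t : ℝ) : ContDiff ℝ 1 fun κ => fund (pencil A B κ) t :=
  contDiff_fund_param A B t

theorem hasDerivWithinAt_fund_clm {t : ℝ} (ht : t ∈ Icc (0 : ℝ) 1) :
    HasDerivWithinAt (fund A) ((ext A t).comp (fund A t)) (Icc (0 : ℝ) 1) t := by
  have h := ((contDiffOn_fund A).differentiableOn one_ne_zero t ht).hasDerivWithinAt
  refine h.congr_deriv (ContinuousLinearMap.ext fun z => ?_)
  have h1 := h.clm_apply (hasDerivWithinAt_const t (Icc (0 : ℝ) 1) z)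
  rw [map_zero, add_zero] at h1
  exact (uniqueDiffOn_Icc zero_lt_one t ht).eq_deriv _ h1 (hasDerivWithinAt_fund A z ht)

/-- A path of solution operators which first moves in time for the system `A + K B`, and then
moves the parameter from `K` to `0`. -/
def regPath (τ : ℝ) : X →L[ℝ] X :=
  fund (pencil A B K) (timeChange τ) + fund (pencil A B (K * paramChange τ)) 1 -
    fund (pencil A B K) 1

/-- The derivative of `regPath`. -/
def regPathDeriv (τ : ℝ) : X →L[ℝ] X :=
  (4 * max (1 - 2 * τ) 0) • (ext (pencil A B K) (timeChange τ)).comp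
      (fund (pencil A B K) (timeChange τ)) +
    (K * -(4 * max (2 * τ - 1) 0)) •
      deriv (fun κ => fund (pencil A B κ) 1) (K * paramChange τ)

theorem hasDerivWithinAt_regPath {τ : ℝ} (hτ : τ ∈ Icc (0 : ℝ) 1) :
    HasDerivWithinAt (regPath A B K) (regPathDeriv A B K τ) (Icc (0 : ℝ) 1) τ := by
  have h1 := (hasDerivWithinAt_fund_clm (pencil A B K) (timeChange_mem hτ)).scomp τ
    (hasDerivAt_timeChange τ).hasDerivWithinAt (fun s hs => timeChange_mem hs)
  have h2 := ((contDiff_fund_pencil A B 1).differentiable one_ne_zero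
    (K * paramChange τ)).hasDerivAt.scomp τ ((hasDerivAt_paramChange τ).const_mul K)
  exact (h1.add h2.hasDerivWithinAt).sub_const _

theorem contDiffOn_regPath : ContDiffOn ℝ 1 (regPath A B K) (Icc (0 : ℝ) 1) := by
  have h1 : ContDiffOn ℝ 1 (fun τ => fund (pencil A B K) (timeChange τ)) (Icc (0 : ℝ) 1) :=
    (contDiffOn_fund (pencil A B K)).comp contDiff_timeChange.contDiffOn
      fun s hs => timeChange_mem hs
  have h2 : ContDiff ℝ 1 fun τ => fund (pencil A B (K * paramChange τ)) 1 :=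
    (contDiff_fund_pencil A B 1).comp (contDiff_const.mul contDiff_paramChange)
  exact (h1.add h2.contDiffOn).sub contDiffOn_const

variable {A B K}

theorem regPath_eq (τ : ℝ) : regPath A B K τ = fund (pencil A B (K * paramChange τ)) (timeChange τ) := by
  rcases le_total τ (1 / 2) with h | h
  · rw [regPath, paramChange_of_le h, mul_one, add_sub_cancel_right]
  · rw [regPath, timeChange_of_ge h, add_sub_cancel_left]

theorem regPath_of_le {τ : ℝ} (h : τ ≤ 1 / 2) :
    regPath A B K τ = fund (pencil A B K) (timeChange τ) := by
  rw [regPath_eq, paramChange_of_le h, mul_one]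

theorem regPath_of_ge {τ : ℝ} (h : 1 / 2 ≤ τ) :
    regPath A B K τ = fund (pencil A B (K * paramChange τ)) 1 := by
  rw [regPath_eq, timeChange_of_ge h]

theorem regPath_zero : regPath A B K 0 = 1 := by
  rw [regPath_of_le (by norm_num), timeChange_of_le (by norm_num)]
  norm_num

theorem regPathDeriv_zero_apply (z : X) :
    regPathDeriv A B K 0 z = (4 : ℝ) • ext (pencil A B K) 0 z := by
  have h : timeChange 0 = 0 := by
    rw [timeChange_of_le (by norm_num)]
    norm_num
  simp [regPathDeriv, h, fund_zero]

theorem regPathDeriv_apply_of_ge {τ : ℝ} (h : 1 / 2 ≤ τ) (z : X) :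
    regPathDeriv A B K τ z = (-(4 * K * (2 * τ - 1))) •
      ext (fundVar (pencil A B (K * paramChange τ)) B z) 1 := by
  have h1 := ((contDiff_fund_pencil A B 1).differentiable one_ne_zero
    (K * paramChange τ)).hasDerivAt.clm_apply (hasDerivAt_const (K * paramChange τ) z)
  have h2 := h1.unique (hasDerivAt_fund_param A B (K * paramChange τ) 1 z)
  rw [map_zero, add_zero] at h2
  change (4 * max (1 - 2 * τ) 0) • _ + (K * -(4 * max (2 * τ - 1) 0)) •
    deriv (fun κ => fund (pencil A B κ) 1) (K * paramChange τ) z = _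
  rw [h2, max_eq_right (by linarith : 1 - 2 * τ ≤ 0), max_eq_left (by linarith), mul_zero, zero_smul,
    zero_add]
  congr 1
  ring

end RegularPath

section Submodules

variable {X : Type*} [NormedAddCommGroup X] [NormedSpace ℝ X] [FiniteDimensional ℝ X]

theorem signature_of_le_submodule {U P N : Submodule ℝ X} {Q : QuadraticForm ℝ U} (hPU : P ≤ U)
    (hNU : N ≤ U) (hP : ∀ x : U, (x : X) ∈ P → x ≠ 0 → 0 < Q x)
    (hN : ∀ x : U, (x : X) ∈ N → x ≠ 0 → Q x < 0)
    (hdim : Module.finrank ℝ P + Module.finrank ℝ N = Module.finrank ℝ U) :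
    (∀ x, (∀ y, QuadraticMap.polar Q x y = 0) → x = 0) ∧
      signature Q = (Module.finrank ℝ P : ℤ) - Module.finrank ℝ N := by
  have h1 := (Submodule.comapSubtypeEquivOfLe hPU).finrank_eq
  have h2 := (Submodule.comapSubtypeEquivOfLe hNU).finrank_eq
  have h3 := signature_of_posDef (Q := Q) (P := P.comap U.subtype) (N := N.comap U.subtype)
    (fun x hx => hP x hx) (fun x hx => hN x hx) (by rw [h1, h2, hdim])
  rw [h1, h2] at h3
  exact ⟨(radical_eq_bot_iff_polar Q).1 h3.1, h3.2⟩

theorem signature_of_posDef_submodule {U : Submodule ℝ X} {Q : QuadraticForm ℝ U}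
    (hP : ∀ x : U, x ≠ 0 → 0 < Q x) :
    (∀ x, (∀ y, QuadraticMap.polar Q x y = 0) → x = 0) ∧
      signature Q = (Module.finrank ℝ U : ℤ) := by
  have := signature_of_le_submodule (Q := Q) le_rfl bot_le (fun x _ => hP x)
    (fun x hx hne => absurd (Subtype.ext ((Submodule.mem_bot ℝ).1 hx)) hne) (by simp)
  simpa using this

end Submodules

section Crossings

variable {n : ℕ} {A : C(Icc (0 : ℝ) 1, Cot (E n) →L[ℝ] Cot (E n))} {W : Submodule ℝ (E n × E n)}

theorem sgn_eq_of_posDef {W : Submodule ℝ (E n × E n)} {Φ D : Cot (E n) →L[ℝ] Cot (E n)}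
    (h : ∀ z ∈ bdrySpace W Φ, z ≠ 0 → 0 < symp (Φ z) (D z)) :
    IsNondeg (bdryForm W Φ D) ∧ sgn (bdryForm W Φ D) = Module.finrank ℝ (bdrySpace W Φ) :=
  signature_of_posDef_submodule (X := Cot (E n)) (Q := bdryForm W Φ D) fun z hz =>
    h z z.2 fun h0 => hz (Subtype.ext h0)

theorem sgn_eq_zero_of_eq_bot {W : Submodule ℝ (E n × E n)} {Φ D : Cot (E n) →L[ℝ] Cot (E n)}
    (h : bdrySpace W Φ = ⊥) :
    IsNondeg (bdryForm W Φ D) ∧ sgn (bdryForm W Φ D) = 0 := by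
  have h1 := sgn_eq_of_posDef (W := W) (Φ := Φ) (D := D) fun z hz hne =>
    absurd ((Submodule.eq_bot_iff _).1 h z hz) hne
  refine ⟨h1.1, h1.2.trans ?_⟩
  rw [h, finrank_bot]
  rfl

theorem symp_shiftB (t : ℝ) (ξ : Cot (E n)) : symp ξ (ext (shiftB n) t ξ) = -‖ξ.1‖ ^ 2 := by
  rw [ext_shiftB, symp]
  simp

theorem IsConvexSystem.symp_fundVar_neg (hA : IsConvexSystem A) {z : Cot (E n)} (hz : z ≠ 0) :
    symp (fund A 1 z) (ext (fundVar A (shiftB n) z) 1) < 0 := by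
  have h0 : (0 : ℝ) ∈ Icc (0 : ℝ) 1 := by simp
  set φ : ℝ → ℝ := fun t => symp (fund A t z) (ext (fundVar A (shiftB n) z) t) with hφ
  have hd : ∀ s ∈ Icc (0 : ℝ) 1, HasDerivWithinAt φ (-‖(fund A s z).1‖ ^ 2) (Icc (0 : ℝ) 1) s := by
    intro s hs
    refine (hasDerivWithinAt_symp (hasDerivWithinAt_fund A z hs)
      (hasDerivWithinAt_fundVar A (shiftB n) z hs)).congr_deriv ?_
    have h2 := hA.symm ⟨s, hs⟩ (fund A s z) (ext (fundVar A (shiftB n) z) s)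
    rw [← ext_apply A hs] at h2
    rw [h2, symp_add_right, symp_shiftB, symp_swap (fund A s z)]
    ring
  have hcont : ContinuousOn φ (Icc (0 : ℝ) 1) := fun s hs => (hd s hs).continuousWithinAt
  have hφ0 : φ 0 = 0 := by
    rw [hφ]
    simp only [fundVar_zero, symp_zero_right]
  have hanti : AntitoneOn φ (Icc (0 : ℝ) 1) := by
    refine antitoneOn_of_deriv_nonpos (convex_Icc 0 1) hcont (fun s hs => ?_) fun s hs => ?_
    · rw [interior_Icc] at hs
      exact ((hd s (Ioo_subset_Icc_self hs)).hasDerivAt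
        (Icc_mem_nhds hs.1 hs.2)).differentiableAt.differentiableWithinAt
    · rw [interior_Icc] at hs
      rw [((hd s (Ioo_subset_Icc_self hs)).hasDerivAt (Icc_mem_nhds hs.1 hs.2)).deriv]
      have := sq_nonneg ‖(fund A s z).1‖
      linarith
  have h1 : (1 : ℝ) ∈ Icc (0 : ℝ) 1 := by simp
  have hle := hanti h0 h1 zero_le_one
  rw [hφ0] at hle
  refine lt_of_le_of_ne hle fun heq => hz ?_
  have hconst : ∀ s ∈ Icc (0 : ℝ) 1, φ s = 0 := fun s hs => by
    have h2 := hanti h0 hs hs.1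
    have h3 := hanti hs h1 hs.2
    change φ 1 = 0 at heq
    linarith
  refine hA.solW12_injective ?_
  rw [map_zero]
  refine Subtype.ext (funext fun t => ?_)
  rw [solW12_apply]
  have h3 : HasDerivWithinAt φ 0 (Icc (0 : ℝ) 1) t :=
    (hasDerivWithinAt_const (t : ℝ) (Icc (0 : ℝ) 1) (0 : ℝ)).congr hconst (hconst t t.2)
  have h4 := (uniqueDiffOn_Icc zero_lt_one t t.2).eq_deriv _ (hd t t.2) h3
  have h5 : ‖(fund A t z).1‖ = 0 := by
    have := neg_eq_zero.1 h4
    exact pow_eq_zero_iff (two_ne_zero) |>.1 this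
  exact norm_eq_zero.1 h5

/-- The crossing form at the initial time. -/
theorem IsConvexSystem.initial_crossing (hA : IsConvexSystem A) (hpos : IsPosSystem A)
    {D : Cot (E n) →L[ℝ] Cot (E n)} (hD : ∀ z, D z = (4 : ℝ) • ext A 0 z) :
    IsNondeg (bdryForm W 1 D) ∧
      sgn (bdryForm W 1 D) = (n : ℤ) - Module.finrank ℝ W := by
  let δ : E n × E n →ₗ[ℝ] E n := LinearMap.snd ℝ (E n) (E n) - LinearMap.fst ℝ (E n) (E n)
  have hδ : ∀ ξ, δ ξ = ξ.2 - ξ.1 := fun ξ => rfl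
  let kerW := LinearMap.ker (δ.domRestrict W)
  have hmem1 : ∀ z : Cot (E n), z ∈ bdrySpace W 1 ↔
      (z.1, z.1) ∈ W ∧ ∀ ξ ∈ W, z.2 ξ.1 = z.2 ξ.2 := fun z => Iff.rfl
  let f : kerW →ₗ[ℝ] Cot (E n) := LinearMap.inl ℝ (E n) (E n →L[ℝ] ℝ) ∘ₗ
    LinearMap.fst ℝ (E n) (E n) ∘ₗ W.subtype ∘ₗ kerW.subtype
  have hf : ∀ x : kerW, f x = ((x : W).1.1, 0) := fun x => rfl
  have hker : ∀ x : kerW, (x : W).1.2 = (x : W).1.1 := fun x => sub_eq_zero.1 x.2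
  have hfinj : Function.Injective f := by
    intro x y hxy
    have h1 : (x : W).1.1 = (y : W).1.1 := congrArg (fun w : Cot (E n) => w.1) hxy
    refine Subtype.ext (Subtype.ext (Prod.ext h1 ?_))
    rw [hker, hker, h1]
  let Wd : Submodule ℝ (E n) := LinearMap.range (δ.domRestrict W)
  let g : Wd.dualAnnihilator →ₗ[ℝ] Cot (E n) := LinearMap.inr ℝ (E n) (E n →L[ℝ] ℝ) ∘ₗ
    (LinearMap.toContinuousLinearMap : (E n →ₗ[ℝ] ℝ) ≃ₗ[ℝ] (E n →L[ℝ] ℝ)).toLinearMap ∘ₗ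
      Wd.dualAnnihilator.subtype
  have hg : ∀ α : Wd.dualAnnihilator, g α = (0, LinearMap.toContinuousLinearMap (α : E n →ₗ[ℝ] ℝ)) :=
    fun α => rfl
  have hginj : Function.Injective g := by
    intro α β h
    have h1 := congrArg Prod.snd h
    exact Subtype.ext (LinearMap.toContinuousLinearMap.injective h1)
  let N := LinearMap.range f
  let P := LinearMap.range g
  have hNmem : ∀ z : Cot (E n), z ∈ N ↔ z ∈ bdrySpace W 1 ∧ z.2 = 0 := by
    intro z
    constructor
    · rintro ⟨x, rfl⟩
      rw [hf]
      refine ⟨(hmem1 _).2 ⟨?_, fun ξ _ => by simp⟩, rfl⟩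
      have h1 := (x : W).2
      have h2 := hker x
      have h3 : (((x : W).1.1, (x : W).1.1) : E n × E n) = (x : W).1 := Prod.ext rfl h2.symm
      rw [h3]
      exact h1
    · rintro ⟨h1, h2⟩
      refine ⟨⟨⟨(z.1, z.1), h1.1⟩, sub_self _⟩, ?_⟩
      rw [hf]
      exact Prod.ext rfl h2.symm
  have hPmem : ∀ z : Cot (E n), z ∈ P ↔ z ∈ bdrySpace W 1 ∧ z.1 = 0 := by
    intro z
    constructor
    · rintro ⟨α, rfl⟩
      rw [hg]
      refine ⟨(hmem1 _).2 ⟨W.zero_mem, fun ξ hξ => ?_⟩, rfl⟩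
      have h1 := (Submodule.mem_dualAnnihilator _).1 α.2 (δ ξ) ⟨⟨ξ, hξ⟩, rfl⟩
      rw [hδ, map_sub] at h1
      change (α : E n →ₗ[ℝ] ℝ) ξ.1 = (α : E n →ₗ[ℝ] ℝ) ξ.2
      linarith
    · rintro ⟨h1, h2⟩
      refine ⟨⟨(z.2 : E n →ₗ[ℝ] ℝ), (Submodule.mem_dualAnnihilator _).2 ?_⟩, ?_⟩
      · rintro _ ⟨ξ, rfl⟩
        have h3 := ((hmem1 z).1 h1).2 ξ ξ.2
        change z.2 (δ ξ) = 0
        rw [hδ, map_sub, h3, sub_self]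
      · rw [hg]
        exact Prod.ext h2.symm rfl
  have hNd : Module.finrank ℝ N = Module.finrank ℝ kerW := LinearMap.finrank_range_of_inj hfinj
  have hPd : Module.finrank ℝ P = Module.finrank ℝ Wd.dualAnnihilator :=
    LinearMap.finrank_range_of_inj hginj
  have hrn : Module.finrank ℝ Wd + Module.finrank ℝ kerW = Module.finrank ℝ W :=
    LinearMap.finrank_range_add_finrank_ker (δ.domRestrict W)
  have hann := Subspace.finrank_add_finrank_dualAnnihilator_eq Wd
  rw [finrank_euclideanSpace, Fintype.card_fin] at hann
  have hsup : P ⊔ N = bdrySpace W 1 := by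
    refine le_antisymm (sup_le (fun z hz => ((hPmem z).1 hz).1) fun z hz => ((hNmem z).1 hz).1) ?_
    intro z hz
    have h1 := (hmem1 z).1 hz
    have h2 : z = (0, z.2) + (z.1, 0) := Prod.ext (zero_add _).symm (add_zero _).symm
    rw [h2]
    refine Submodule.add_mem_sup ((hPmem _).2 ⟨(hmem1 _).2 ⟨W.zero_mem, h1.2⟩, rfl⟩)
      ((hNmem _).2 ⟨(hmem1 _).2 ⟨h1.1, fun ξ _ => by simp⟩, rfl⟩)
  have hinf : P ⊓ N = ⊥ := by
    refine (Submodule.eq_bot_iff _).2 fun z hz => ?_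
    exact Prod.ext ((hPmem z).1 hz.1).2 ((hNmem z).1 hz.2).2
  have hdim := Submodule.finrank_sup_add_finrank_inf_eq P N
  rw [hsup, hinf, finrank_bot, add_zero] at hdim
  have h0 : (0 : ℝ) ∈ Icc (0 : ℝ) 1 := by simp
  have hval : ∀ z : bdrySpace W (1 : Cot (E n) →L[ℝ] Cot (E n)),
      bdryForm W 1 D z = 4 * symp (z : Cot (E n)) (ext A 0 z) := by
    intro z
    rw [bdryForm_apply, hD, symp_smul_right]
    rfl
  have key := signature_of_le_submodule (X := Cot (E n)) (Q := bdryForm W 1 D) (P := P) (N := N)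
    (hsup ▸ le_sup_left) (hsup ▸ le_sup_right) (fun z hz hne => by
      rw [hval]
      obtain ⟨⟨q, α⟩, hz'⟩ := z
      have hq : q = 0 := ((hPmem _).1 hz).2
      subst hq
      have hα : α ≠ 0 := by
        rintro rfl
        exact hne rfl
      have h1 := hA.pos ⟨0, h0⟩ α hα
      rw [← ext_apply A h0] at h1
      have h2 : symp ((0 : E n), α) (ext A 0 (0, α)) = α (ext A 0 (0, α)).1 := by
        simp [symp]
      change 0 < 4 * symp ((0 : E n), α) (ext A 0 (0, α))
      rw [h2]
      linarith) (fun z hz hne => by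
      rw [hval]
      obtain ⟨⟨q, α⟩, hz'⟩ := z
      have hα : α = 0 := ((hNmem _).1 hz).2
      subst hα
      have h1 := hpos 0 (q, 0) fun h => hne (Subtype.ext h)
      have h2 : symp (q, (0 : E n →L[ℝ] ℝ)) (ext A 0 (q, 0)) =
          -hessForm (ext A 0) (q, 0) (q, 0) := by
        simp [symp, hessForm]
      change 4 * symp (q, (0 : E n →L[ℝ] ℝ)) (ext A 0 (q, 0)) < 0
      rw [h2]
      linarith) hdim.symm
  refine ⟨key.1, key.2.trans ?_⟩
  rw [hPd, hNd]
  omega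

end Crossings

section MaslovComputation

variable {n : ℕ} {A : C(Icc (0 : ℝ) 1, Cot (E n) →L[ℝ] Cot (E n))} {W : Submodule ℝ (E n × E n)}

theorem continuous_fund_pencil_apply {X : Type*} [NormedAddCommGroup X] [NormedSpace ℝ X]
    [CompleteSpace X] (A B : C(Icc (0 : ℝ) 1, X →L[ℝ] X)) (z : X) :
    Continuous fun y : ℝ × ℝ => fund (pencil A B y.1) y.2 z :=
  continuous_fund_param_apply A B z

theorem IsConvexSystem.lagrangianHomotopic_regPath (hA : IsConvexSystem A) (K : ℝ)
    {Λ : ℝ → Submodule ℝ (Cot (E n × E n))}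
    (hΛ : ∀ t ∈ Icc (0 : ℝ) 1, Λ t = graphC (fund A t)) :
    LagrangianHomotopic Λ fun τ => graphC (regPath A (shiftB n) K τ) := by
  let c : ℝ × ℝ → ℝ × ℝ := fun y =>
    (K * (y.1 * paramChange y.2), (1 - y.1) * y.2 + y.1 * timeChange y.2)
  have hc : Continuous c := by
    have h1 := contDiff_paramChange.continuous
    have h2 := contDiff_timeChange.continuous
    fun_prop
  have hmem : ∀ y ∈ Icc (0 : ℝ) 1 ×ˢ Icc (0 : ℝ) 1, (c y).2 ∈ Icc (0 : ℝ) 1 := by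
    rintro ⟨s, τ⟩ ⟨hs, hτ⟩
    exact convex_Icc (0 : ℝ) 1 hτ (timeChange_mem hτ) (sub_nonneg.2 hs.2) hs.1 (by simp)
  have h0 : (0 : ℝ) ∈ Icc (0 : ℝ) 1 := by simp
  have h1 : (1 : ℝ) ∈ Icc (0 : ℝ) 1 := by simp
  refine ⟨fun y => graphC (fund (pencil A (shiftB n) (c y).1) (c y).2), ?_, fun t ht => ⟨?_, ?_⟩,
    fun s hs => ⟨?_, ?_⟩⟩
  · refine isLagrangianFamilyOn_graphC (k := 0) (fun z => ?_)
      fun y hy => (hA.shift (c y).1).symp_fund (hmem y hy)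
    exact contDiffOn_zero.2 ((continuous_fund_pencil_apply A (shiftB n) z).comp hc).continuousOn
  · have h2 : c (0, t) = (0, t) := by simp [c]
    beta_reduce
    rw [h2, hΛ t ht, pencil_zero]
  · have h2 : c (1, t) = (K * paramChange t, timeChange t) := by simp [c]
    beta_reduce
    rw [h2, regPath_eq]
  · have h2 : (c (s, 0)).2 = 0 := by
      simp [c, timeChange]
    beta_reduce
    rw [h2, hΛ 0 h0, fund_zero, fund_zero]
  · have h2 : c (s, 1) = (0, 1) := by
      have h3 : paramChange 1 = 0 := by
        rw [paramChange_of_ge (by norm_num)]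
        norm_num
      have h4 : timeChange 1 = 1 := timeChange_of_ge (by norm_num)
      simp [c, h3, h4]
    beta_reduce
    rw [h2, hΛ 1 h1, pencil_zero]

theorem IsConvexSystem.symp_regPath (hA : IsConvexSystem A) (K : ℝ) {τ : ℝ}
    (hτ : τ ∈ Icc (0 : ℝ) 1) (z w : Cot (E n)) :
    symp (regPath A (shiftB n) K τ z) (regPath A (shiftB n) K τ w) = symp z w := by
  rw [regPath_eq]
  exact (hA.shift _).symp_fund (timeChange_mem hτ) z w

theorem timeChange_pos {τ : ℝ} (h0 : 0 < τ) (h : τ ≤ 1 / 2) : 0 < timeChange τ := by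
  rw [timeChange_of_le h]
  nlinarith

theorem IsConvexSystem.bdrySpace_regPath_eq_bot (hA : IsConvexSystem A) {K : ℝ}
    (hpos : IsPosSystem (pencil A (shiftB n) K)) {τ : ℝ} (h0 : 0 < τ) (h : τ ≤ 1 / 2) :
    bdrySpace W (regPath A (shiftB n) K τ) = ⊥ := by
  rw [regPath_of_le h]
  exact (hA.shift K).bdrySpace_eq_bot hpos W (timeChange_pos h0 h)
    (timeChange_mem ⟨h0.le, by linarith⟩).2

theorem IsConvexSystem.crossing_regPath (hA : IsConvexSystem A) {K : ℝ} (hK : 0 < K) {τ : ℝ}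
    (h : 1 / 2 < τ) :
    IsNondeg (bdryForm W (regPath A (shiftB n) K τ) (regPathDeriv A (shiftB n) K τ)) ∧
      sgn (bdryForm W (regPath A (shiftB n) K τ) (regPathDeriv A (shiftB n) K τ)) =
        Module.finrank ℝ (bdrySpace W (regPath A (shiftB n) K τ)) := by
  refine sgn_eq_of_posDef fun z _ hz => ?_
  rw [regPathDeriv_apply_of_ge h.le, regPath_of_ge h.le, symp_smul_right]
  have h1 := (hA.shift (K * paramChange τ)).symp_fundVar_neg hz
  have h2 : 0 < 4 * K * (2 * τ - 1) := by
    have : 0 < 2 * τ - 1 := by linarith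
    positivity
  nlinarith

theorem IsConvexSystem.isNondeg_regPath (hA : IsConvexSystem A) {K : ℝ} (hK : 0 < K)
    (hpos : IsPosSystem (pencil A (shiftB n) K)) {τ : ℝ} (hτ : τ ∈ Icc (0 : ℝ) 1) :
    IsNondeg (bdryForm W (regPath A (shiftB n) K τ) (regPathDeriv A (shiftB n) K τ)) := by
  rcases hτ.1.eq_or_lt with h0 | h0
  · subst h0
    rw [regPath_zero]
    exact ((hA.shift K).initial_crossing hpos regPathDeriv_zero_apply).1
  · rcases le_or_gt τ (1 / 2) with h | h
    · exact (sgn_eq_zero_of_eq_bot (hA.bdrySpace_regPath_eq_bot hpos h0 h)).1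
    · exact (hA.crossing_regPath hK h).1

theorem exists_paramChange_eq {K κ : ℝ} (hκ : κ ∈ Ioo 0 K) :
    ∃ τ ∈ Ioo (1 / 2 : ℝ) 1, K * paramChange τ = κ := by
  have hK : 0 < K := hκ.1.trans hκ.2
  have h1 : 0 < 1 - κ / K := by
    rw [sub_pos, div_lt_one hK]
    exact hκ.2
  have h2 : 1 - κ / K < 1 := by
    have := div_pos hκ.1 hK
    linarith
  have h3 : 0 < √(1 - κ / K) := Real.sqrt_pos.2 h1
  have h4 : √(1 - κ / K) < 1 := by
    rw [Real.sqrt_lt' one_pos]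
    linarith
  refine ⟨(1 + √(1 - κ / K)) / 2, ⟨by linarith, by linarith⟩, ?_⟩
  rw [paramChange_of_ge (by linarith)]
  have h5 := Real.sq_sqrt h1.le
  have h6 : 2 * ((1 + √(1 - κ / K)) / 2) - 1 = √(1 - κ / K) := by ring
  rw [h6, h5]
  field_simp
  ring

theorem IsConvexSystem.exists_isMaslovIndex (hA : IsConvexSystem A) {K : ℝ} (hK : 0 < K)
    (hpos : IsPosSystem (pencil A (shiftB n) K)) {Λ : ℝ → Submodule ℝ (Cot (E n × E n))}
    (hΛ : ∀ t ∈ Icc (0 : ℝ) 1, Λ t = graphC (fund A t)) (W : Submodule ℝ (E n × E n)) :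
    ∃ Z : Finset ℝ, (∀ κ ∈ Z, 0 < κ) ∧
      (∀ κ ∈ Ioo 0 K, κ ∉ Z → bdrySpace W (fund (pencil A (shiftB n) κ) 1) = ⊥) ∧
      IsMaslovIndex Λ (conormal W) (((n : ℝ) - Module.finrank ℝ W) / 2 +
        ((∑ κ ∈ Z, Module.finrank ℝ (bdrySpace W (fund (pencil A (shiftB n) κ) 1)) : ℕ) : ℝ) +
        (Module.finrank ℝ (bdrySpace W (fund A 1)) : ℝ) / 2) := by
  have hD := fun τ (hτ : τ ∈ Icc (0 : ℝ) 1) => hasDerivWithinAt_regPath A (shiftB n) K hτ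
  have hs := fun τ (hτ : τ ∈ Icc (0 : ℝ) 1) => hA.symp_regPath K hτ
  have hnd := fun τ (hτ : τ ∈ Icc (0 : ℝ) 1) => hA.isNondeg_regPath (W := W) hK hpos hτ
  have hfin := finite_bdrySpace_ne_bot W hD hs hnd
  have hreg := isRegularMaslovIndex_graphC W
    (fun z => (contDiffOn_regPath A (shiftB n) K).clm_apply contDiffOn_const) hD hs hnd
  let Zτ : Finset ℝ := hfin.toFinset.filter fun τ => τ ∈ Ioo (1 / 2 : ℝ) 1
  have hZτ : ∀ τ, τ ∈ Zτ ↔ τ ∈ Ioo (1 / 2 : ℝ) 1 ∧ bdrySpace W (regPath A (shiftB n) K τ) ≠ ⊥ := by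
    intro τ
    rw [Finset.mem_filter, Set.Finite.mem_toFinset]
    constructor
    · rintro ⟨⟨-, h1⟩, h2⟩
      exact ⟨h2, h1⟩
    · rintro ⟨h1, h2⟩
      exact ⟨⟨⟨by linarith [h1.1], h1.2.le⟩, h2⟩, h1⟩
  refine ⟨Zτ.image fun τ => K * paramChange τ, ?_, ?_, _, hA.lagrangianHomotopic_regPath K hΛ, ?_⟩
  · intro κ hκ
    obtain ⟨τ, hτ, rfl⟩ := Finset.mem_image.1 hκ
    obtain ⟨⟨h1, h2⟩, -⟩ := (hZτ τ).1 hτ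
    rw [paramChange_of_ge h1.le]
    refine mul_pos hK ?_
    nlinarith
  · intro κ hκ hκZ
    obtain ⟨τ, hτ, rfl⟩ := exists_paramChange_eq hκ
    by_contra hne
    rw [← regPath_of_ge hτ.1.le] at hne
    exact hκZ (Finset.mem_image.2 ⟨τ, (hZτ τ).2 ⟨hτ, hne⟩, rfl⟩)
  · convert! hreg using 1
    have e0 : sgn (bdryForm W (regPath A (shiftB n) K 0) (regPathDeriv A (shiftB n) K 0)) =
        (n : ℤ) - Module.finrank ℝ W := by
      rw [regPath_zero]
      exact ((hA.shift K).initial_crossing hpos regPathDeriv_zero_apply).2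
    have e1 : sgn (bdryForm W (regPath A (shiftB n) K 1) (regPathDeriv A (shiftB n) K 1)) =
        Module.finrank ℝ (bdrySpace W (fund A 1)) := by
      have h1 : K * paramChange 1 = 0 := by
        rw [paramChange_of_ge (by norm_num)]
        norm_num
      rw [(hA.crossing_regPath hK (by norm_num)).2, regPath_of_ge (by norm_num), h1, pencil_zero]
    have es : ∑ᶠ τ ∈ Ioo (0 : ℝ) 1, (sgn (bdryForm W (regPath A (shiftB n) K τ)
        (regPathDeriv A (shiftB n) K τ)) : ℝ) = ∑ τ ∈ Zτ, (sgn (bdryForm W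
          (regPath A (shiftB n) K τ) (regPathDeriv A (shiftB n) K τ)) : ℝ) := by
      refine finsum_mem_eq_sum_of_inter_support_eq _ ?_
      ext τ
      simp only [mem_inter_iff, Function.mem_support, Finset.mem_coe]
      refine and_congr_left fun hne => ?_
      have hne' : bdrySpace W (regPath A (shiftB n) K τ) ≠ ⊥ := by
        intro h
        rw [(sgn_eq_zero_of_eq_bot h).2] at hne
        simp at hne
      rw [hZτ]
      constructor
      · intro h
        refine ⟨⟨?_, h.2⟩, hne'⟩
        by_contra h2
        exact hne' (hA.bdrySpace_regPath_eq_bot hpos h.1 (not_lt.1 h2))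
      · rintro ⟨h, -⟩
        exact ⟨by linarith [h.1], h.2⟩
    have es' : ∑ τ ∈ Zτ, (sgn (bdryForm W
        (regPath A (shiftB n) K τ) (regPathDeriv A (shiftB n) K τ)) : ℝ) =
        ((∑ κ ∈ Zτ.image fun τ => K * paramChange τ,
          Module.finrank ℝ (bdrySpace W (fund (pencil A (shiftB n) κ) 1)) : ℕ) : ℝ) := by
      rw [Finset.sum_image, Nat.cast_sum]
      · refine Finset.sum_congr rfl fun τ hτ => ?_
        have h1 := ((hZτ τ).1 hτ).1.1
        rw [(hA.crossing_regPath hK h1).2, regPath_of_ge h1.le]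
        simp
      · intro τ hτ τ' hτ' heq
        have h1 := ((hZτ τ).1 hτ).1.1
        have h2 := ((hZτ τ').1 hτ').1.1
        simp only [paramChange_of_ge h1.le, paramChange_of_ge h2.le] at heq
        have h3 := mul_left_cancel₀ hK.ne' heq
        nlinarith
    rw [e0, e1, es, es']
    push_cast
    ring

end MaslovComputation

section TangentSpace

variable {X : Type*} [NormedAddCommGroup X] [NormedSpace ℝ X] [FiniteDimensional ℝ X]

theorem IsSubmanifold.finrank_tangentAt {d : ℕ} {Q : Set X} (hQ : IsSubmanifold d Q) {z : X}
    (hz : z ∈ Q) : Module.finrank ℝ (tangentAt Q z) = d := by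
  obtain ⟨Φ, S, hzs, hΦ, hΨ, hd, himg⟩ := hQ z hz
  have hzt : Φ z ∈ Φ.target := Φ.map_source hzs
  have hΦz : ContDiffAt ℝ ∞ Φ z := hΦ.contDiffAt (Φ.open_source.mem_nhds hzs)
  have hΨz : ContDiffAt ℝ ∞ Φ.symm (Φ z) := hΨ.contDiffAt (Φ.open_target.mem_nhds hzt)
  have hΦd := (hΦz.differentiableAt (by simp)).hasFDerivAt
  have hΨd := (hΨz.differentiableAt (by simp)).hasFDerivAt
  set D := fderiv ℝ Φ z
  set D' := fderiv ℝ Φ.symm (Φ z)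
  have hleft : ∀ v, D' (D v) = v := by
    intro v
    have h1 : HasFDerivAt (Φ.symm ∘ Φ) (D'.comp D) z := hΨd.comp z hΦd
    have h2 : HasFDerivAt (Φ.symm ∘ Φ) (ContinuousLinearMap.id ℝ X) z := by
      refine (hasFDerivAt_id z).congr_of_eventuallyEq ?_
      filter_upwards [Φ.open_source.mem_nhds hzs] with y hy
      exact Φ.left_inv hy
    exact congrArg (fun L : X →L[ℝ] X => L v) (h1.unique h2)
  have hright : ∀ v, D (D' v) = v := by
    intro v
    have h0 : Φ.symm (Φ z) = z := Φ.left_inv hzs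
    have hΦd' : HasFDerivAt Φ D (Φ.symm (Φ z)) := by rwa [h0]
    have h1 : HasFDerivAt (Φ ∘ Φ.symm) (D.comp D') (Φ z) := hΦd'.comp (Φ z) hΨd
    have h2 : HasFDerivAt (Φ ∘ Φ.symm) (ContinuousLinearMap.id ℝ X) (Φ z) := by
      refine (hasFDerivAt_id (Φ z)).congr_of_eventuallyEq ?_
      filter_upwards [Φ.open_target.mem_nhds hzt] with y hy
      exact Φ.right_inv hy
    exact congrArg (fun L : X →L[ℝ] X => L v) (h1.unique h2)
  have hchart : ∀ y ∈ Q ∩ Φ.source, Φ y ∈ S := fun y hy =>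
    (himg.subset (mem_image_of_mem Φ hy)).1
  have heq : tangentAt Q z = S.map (D' : X →ₗ[ℝ] X) := by
    refine le_antisymm (Submodule.span_le.2 ?_) ?_
    · rintro v ⟨c, -, hc0, hcQ, hcv⟩
      obtain ⟨T, hT⟩ := Submodule.exists_isCompl S
      let p : X →L[ℝ] X := LinearMap.toContinuousLinearMap (T.projection S hT.symm)
      have hp : ∀ x, p x = 0 ↔ x ∈ S := fun x => Submodule.projection_apply_eq_zero_iff hT.symm
      subst hc0
      have h1 : HasDerivAt (fun s => p (Φ (c s))) (p (D v)) 0 :=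
        p.hasFDerivAt.comp_hasDerivAt 0 (hΦd.comp_hasDerivAt 0 hcv)
      have h2 : HasDerivAt (fun s => p (Φ (c s))) 0 0 := by
        refine (hasDerivAt_const (0 : ℝ) (0 : X)).congr_of_eventuallyEq ?_
        filter_upwards [hcQ, hcv.continuousAt.preimage_mem_nhds (Φ.open_source.mem_nhds hzs)]
          with s hs hs'
        exact (hp _).2 (hchart _ ⟨hs, hs'⟩)
      exact ⟨D v, (hp _).1 (h1.unique h2), hleft v⟩
    · rintro _ ⟨w, hw, rfl⟩
      refine Submodule.subset_span ⟨fun s => Φ.symm (Φ z + s • w), ?_, ?_, ?_, ?_⟩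
      · have h1 : ContDiffAt ℝ ∞ (fun s : ℝ => Φ z + s • w) 0 := by fun_prop
        refine ContDiffAt.comp (0 : ℝ) ?_ h1
        simpa using hΨz
      · simp [Φ.left_inv hzs]
      · have hcont : ContinuousAt (fun s : ℝ => Φ z + s • w) 0 := by fun_prop
        have hmem : Φ.target ∈ 𝓝 (Φ z + (0 : ℝ) • w) := by
          rw [zero_smul, add_zero]
          exact Φ.open_target.mem_nhds hzt
        filter_upwards [hcont.preimage_mem_nhds hmem] with s hs
        have h1 : Φ z + s • w ∈ (S : Set X) ∩ Φ.target :=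
          ⟨S.add_mem (hchart z ⟨hz, hzs⟩) (S.smul_mem s hw), hs⟩
        rw [← himg] at h1
        obtain ⟨y, hy, hyeq⟩ := h1
        rw [← hyeq, Φ.left_inv hy.2]
        exact hy.1
      · have h1 : HasDerivAt (fun s : ℝ => Φ z + s • w) w 0 := by
          simpa using ((hasDerivAt_id (0 : ℝ)).smul_const w).const_add (Φ z)
        have h2 : HasFDerivAt Φ.symm D' (Φ z + (0 : ℝ) • w) := by
          rwa [zero_smul, add_zero]
        exact h2.comp_hasDerivAt (0 : ℝ) h1
  rw [heq, ← hd]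
  refine (LinearEquiv.finrank_eq (Submodule.equivMapOfInjective _ ?_ S)).symm
  exact Function.LeftInverse.injective hright

end TangentSpace

section Conclusion

variable {n : ℕ} {H : ℝ → Cot (E n) → ℝ} {Q : Set (E n × E n)} {γ : ℝ → E n}
  {A : C(Icc (0 : ℝ) 1, Cot (E n) →L[ℝ] Cot (E n))}
  {Θ : C(Icc (0 : ℝ) 1, (E n × E n) →L[ℝ] Cot (E n))}

theorem IsLagrangianFamilyOn.congr {V : Type*} [NormedAddCommGroup V] [NormedSpace ℝ V] {Y : Type*}
    [NormedAddCommGroup Y] [NormedSpace ℝ Y] {k : ℕ} {Λ Λ' : Y → Submodule ℝ (Cot V)} {s : Set Y}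
    (h : IsLagrangianFamilyOn k Λ s) (heq : ∀ y ∈ s, Λ' y = Λ y) : IsLagrangianFamilyOn k Λ' s := by
  refine ⟨fun y hy => heq y hy ▸ h.1 y hy, fun y hy => ?_⟩
  obtain ⟨u, hu, F, hF, hspan⟩ := h.2 y hy
  exact ⟨u, hu, F, hF, fun z hz => by rw [heq z hz.1]; exact hspan z hz⟩

theorem IsLinearization.lamPath_eq (h : IsLinearization H γ A) {t : ℝ} (ht : t ∈ Icc (0 : ℝ) 1) :
    lamPath H γ t = graphC (fund A t) := by
  rw [lamPath, (h.flow t ht).fderiv]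
  rfl

theorem IsLinearization.isLagrangianFamilyOn_lamPath (h : IsLinearization H γ A) :
    IsLagrangianFamilyOn 1 (lamPath H γ) (Icc (0 : ℝ) 1) :=
  (isLagrangianFamilyOn_graphC (k := 1)
    (fun _ => (contDiffOn_fund A).clm_apply contDiffOn_const)
    fun _ ht => h.isConvexSystem.symp_fund ht).congr fun _ ht => h.lamPath_eq ht

theorem IsLinearization.finrank_inf_conormal (h : IsLinearization H γ A)
    (W : Submodule ℝ (E n × E n)) : Module.finrank ℝ ↥(lamPath H γ 1 ⊓ conormal W) =
      Module.finrank ℝ (bdrySpace W (fund A 1)) := by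
  rw [h.lamPath_eq (right_mem_Icc.2 zero_le_one)]
  exact (bdryEquiv W (fund A 1)).finrank_eq.symm

theorem IsLinearization.nullity_eq (h : IsLinearization H γ A) (hΘ : IsLegendreInverse A Θ) :
    nullity H Q γ =
      (Module.finrank ℝ (bdrySpace (tangentAt Q (γ 0, γ 1)) (fund A 1)) : ℕ∞) := by
  have h1 : {u : W12 n | u ∈ W12W (tangentAt Q (γ 0, γ 1)) ∧
      ∀ v ∈ W12W (tangentAt Q (γ 0, γ 1)), secondVar H γ u v = 0} =
      ((bdrySpace (tangentAt Q (γ 0, γ 1)) (fund A 1)).map (solW12 A) : Set (W12 n)) := by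
    ext u
    simp only [h.secondVar_eq hΘ]
    exact hΘ.mem_kernel_iff _ u
  rw [nullity, h1, Submodule.span_eq, ← (Submodule.equivMapOfInjective (solW12 A)
    h.isConvexSystem.solW12_injective _).rank_eq, ← Module.finrank_eq_rank, Cardinal.toENat_nat]

theorem IsLinearization.morseIndex_eq (h : IsLinearization H γ A) (hΘ : IsLegendreInverse A Θ)
    {i : ℕ}
    (hneg : ∃ Y : Submodule ℝ (W12W (tangentAt Q (γ 0, γ 1))),
      (∀ u ∈ Y, u ≠ 0 → secBilinW A Θ (tangentAt Q (γ 0, γ 1)) u u < 0) ∧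
      Module.rank ℝ Y = (i : Cardinal))
    (hle : ∀ Y : Submodule ℝ (W12W (tangentAt Q (γ 0, γ 1))),
      (∀ u ∈ Y, u ≠ 0 → secBilinW A Θ (tangentAt Q (γ 0, γ 1)) u u < 0) →
      Module.rank ℝ Y ≤ (i : Cardinal)) :
    morseIndex H Q γ = (i : ℕ∞) := by
  set 𝒲 := W12W (tangentAt Q (γ 0, γ 1)) with h𝒲
  refine le_antisymm (iSup₂_le fun S hS => ?_) ?_
  · have h1 := hle (S.comap 𝒲.subtype) fun u hu hne => by
      rw [secBilinW_apply, ← h.secondVar_eq hΘ]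
      exact hS.2 u hu fun h0 => hne (Subtype.ext h0)
    rw [(Submodule.comapSubtypeEquivOfLe hS.1).rank_eq] at h1
    have h2 := OrderHomClass.mono Cardinal.toENat h1
    rwa [Cardinal.toENat_nat] at h2
  · obtain ⟨Y, hY, hr⟩ := hneg
    refine le_iSup₂_of_le (Y.map 𝒲.subtype) ⟨?_, ?_⟩ ?_
    · rintro _ ⟨u, -, rfl⟩
      exact u.2
    · rintro _ ⟨u, hu, rfl⟩ hne
      rw [h.secondVar_eq hΘ]
      exact hY u hu fun h0 => hne (by rw [h0, map_zero])
    · rw [← (Submodule.equivMapOfInjective 𝒲.subtype 𝒲.injective_subtype Y).rank_eq, hr,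
        Cardinal.toENat_nat]

end Conclusion

end ConormalIndex

end

theorem mainTheorem3 (n d : ℕ)
    (H : ℝ → ConormalIndex.Cot (ConormalIndex.E n) → ℝ) (hH : ConormalIndex.IsTonelli H)
    (Q : Set (ConormalIndex.E n × ConormalIndex.E n)) (hQ : ConormalIndex.IsSubmanifold d Q)
    (γ : ℝ → ConormalIndex.E n) (hγ : ConormalIndex.IsExtremal H Q γ) :
    ConormalIndex.IsLagrangianFamilyOn 1 (ConormalIndex.lamPath H γ) (Set.Icc (0 : ℝ) 1) ∧
    ConormalIndex.nullity H Q γ =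
      (Module.finrank ℝ
        ↥(ConormalIndex.lamPath H γ 1 ⊓
          ConormalIndex.conormal (ConormalIndex.tangentAt Q (γ 0, γ 1))) : ℕ∞) ∧
    ∃ i ν : ℕ, ConormalIndex.morseIndex H Q γ = (i : ℕ∞) ∧
      ConormalIndex.nullity H Q γ = (ν : ℕ∞) ∧
      (i : ℝ) =
        ConormalIndex.maslovIndex (ConormalIndex.lamPath H γ)
            (ConormalIndex.conormal (ConormalIndex.tangentAt Q (γ 0, γ 1)))
          + (1 / 2 : ℝ) * ((d : ℝ) - (n : ℝ)) - (1 / 2 : ℝ) * (ν : ℝ) := by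
  obtain ⟨A, hlin⟩ := ConormalIndex.exists_isLinearization hH hγ
  have hA := hlin.isConvexSystem
  obtain ⟨Θ, hΘ⟩ := ConormalIndex.exists_isLegendreInverse hA
  obtain ⟨K, hK, hpos⟩ := hA.exists_isPosSystem
  obtain ⟨Z, hZ, hZ', hmaslov⟩ := hA.exists_isMaslovIndex hK hpos
    (fun _ ht => hlin.lamPath_eq ht) (ConormalIndex.tangentAt Q (γ 0, γ 1))
  obtain ⟨hneg, hle⟩ := ConormalIndex.exists_negative_and_bound_secBilin hA hΘ hK hpos hZ hZ'
  refine ⟨hlin.isLagrangianFamilyOn_lamPath, ?_, _, _, hlin.morseIndex_eq hΘ hneg hle,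
    hlin.nullity_eq hΘ, ?_⟩
  · rw [hlin.nullity_eq hΘ, hlin.finrank_inf_conormal]
  · rw [hmaslov.maslovIndex_eq (ConormalIndex.isLagrangian_conormal _),
      hQ.finrank_tangentAt hγ.mem]
    ring
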